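/- Let $|\rho|<1$, $a_1,a_2\in\mathbb R$, $c,\lambda>0$, $N_0\in\{0,1,2,\dots\}$ and $\theta>\max\{\tfrac14,\tfrac{1+|\rho|}6\}$ be fixed. **Model problem.** Let $$u(x,y,t)=\frac1{4\pi t\sqrt{1-\rho^2}}\exp\Big(-\frac{(x+a_1t)^2+(y+a_2t)^2-2\rho(x+a_1t)(y+a_2t)}{4t(1-\rho^2)}\Big).$$ Then $u$ is smooth for $t>0$, satisfies $u_t=u_{xx}+2\rho u_{xy}+u_{yy}+a_1u_x+a_2u_y$ for $t>0$, is integrable in $(x,y)$ for each $t>0$, and $u(\cdot,\cdot,t)\to\delta(x)\delta(y)$ as $t\to0^+$ (tested against bounded continuous functions). **Scheme.** For $N\ge1$ put $\Delta t=1/N$, $h=h_1=\Delta t/\lambda$, $h_2=ch$, $x_j=jh_1$, $y_k=kh_2$ ($j,k\in\mathbb Z$). Put $A=A_0+A_1+A_2$ with the central differences $A_0=\frac{\rho}{2h_1h_2}\delta_{2x}\delta_{2y}$, $A_1=\frac1{h_1^2}\delta_x^2+\frac{a_1}{2h_1}\delta_{2x}$, $A_2=\frac1{h_2^2}\delta_y^2+\frac{a_2}{2h_2}\delta_{2y}$,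 where $\delta_{2x}V_{j,k}=V_{j+1,k}-V_{j-1,k}$, $\delta_x^2V_{j,k}=V_{j-1,k}-2V_{j,k}+V_{j+1,k}$ and likewise in $y$. Put $Z_i=\Delta tA_i$, $Z=\Delta tA$. Start from $U_{0,j,k}=\frac1{h_1h_2}$ if $j=k=0$ and $0$ otherwise. For $n=1,\dots,\min\{N_0,N\}$ use two implicit Euler half-steps, $(I-\frac12Z)U_{n-1/2}=U_{n-1}$, $(I-\frac12Z)U_n=U_{n-1/2}$. For $N_0<n\le N$ use the MCS step $$\begin{aligned}&Y_0=(I+Z)U_{n-1},\quad (I-\theta Z_i)Y_i=Y_{i-1}-\theta Z_iU_{n-1}\ (i=1,2),\\&\widehat Y_0=Y_0+\theta Z_0(Y_2-U_{n-1}),\quad \widetilde Y_0=\widehat Y_0+(\tfrac12-\theta)Z(Y_2-U_{n-1}),\\&(I-\theta Z_i)\widetilde Y_i=\widetilde Y_{i-1}-\theta Z_iU_{n-1}\ (i=1,2),\quad U_n=\widetilde Y_2.\end{aligned}$$ All implicit equations are solved in the square-summable grid functions. For every $N\ge1$ the result $U_N$ exists and is unique. **Coefficients.** Let $\phi$ be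 the standard normal density, $\phi_\rho(x,y)=\frac1{2\pi\sqrt{1-\rho^2}}\exp\big(-\frac{x^2-2\rho xy+y^2}{2(1-\rho^2)}\big)$, and let $X=\frac12\partial_x^2+\frac{a_1}{\sqrt2}\partial_x$, $Y=\frac12\partial_y^2+\frac{a_2}{\sqrt2}\partial_y$, $L=X+Y+\rho\,\partial_x\partial_y$, $G=\frac\rho2\partial_x\partial_y+(\frac12-\theta)(X+Y)$, $$S=\tfrac1{48}\partial_x^4+\tfrac\rho{12}(\partial_x^3\partial_y+c^2\partial_x\partial_y^3)+\tfrac{c^2}{48}\partial_y^4+\tfrac{a_1}{12\sqrt2}\partial_x^3+\tfrac{a_2c^2}{12\sqrt2}\partial_y^3 .$$ Define $$C^{low}_{x,y}=\tfrac12\Big[\big(S-\lambda^2\theta^2XYL+\tfrac{\lambda^2}{12}L^3-\lambda^2LG^2+\tfrac{N_0\lambda^2}4L^2\big)\phi_\rho\Big]\Big(\tfrac{x+a_1}{\sqrt2},\tfrac{y+a_2}{\sqrt2}\Big),$$ where the derivatives of $\phi_\rho$ are taken first and then evaluated at the indicated point. With $$\iota(\vartheta_1,\vartheta_2)=c^2\sin^2\tfrac{\vartheta_1}2+2\rho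 c\cos\tfrac{\vartheta_1}2\sin\tfrac{\vartheta_1}2\cos\tfrac{\vartheta_2}2\sin\tfrac{\vartheta_2}2+\sin^2\tfrac{\vartheta_2}2,$$ $$C^{high}_{j,k}=\frac{c^{4N_0-1}}{2\pi^2}\int_{-\pi}^{\pi}\int_0^\pi\frac{\cos(j\vartheta_1+k\vartheta_2)}{[2\lambda\,\iota(\vartheta_1,\vartheta_2)]^{2N_0}}\exp\Big(-\frac{\iota(\vartheta_1,\vartheta_2)}{4\lambda^2\theta^2\sin^2\frac{\vartheta_1}2\sin^2\frac{\vartheta_2}2}\Big)d\vartheta_1d\vartheta_2,$$ $$C^{CS}_{j,y}=\frac{\phi\big(\frac{y+a_2}{\sqrt2}\big)}{2\sqrt2\,\pi}\int_{-\pi}^\pi\frac{\cos(j\vartheta)}{(2\lambda\sin^2\frac\vartheta2)^{2N_0}}e^{-1/(\lambda^2\sin^2\frac\vartheta2)}d\vartheta,$$ $$C^{CS}_{x,k}=\frac{\phi\big(\frac{x+a_1}{\sqrt2}\big)}{2\sqrt2\,c\,\pi}\int_{-\pi}^\pi\frac{\cos(k\vartheta)}{(2\frac\lambda{c^2}\sin^2\frac\vartheta2)^{2N_0}}e^{-c^2/(\lambda^2\sin^2\frac\vartheta2)}d\vartheta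 .$$ **Claim.** Define the remainder $r_{j,k}$, for $\theta\ne\frac12$, by $$U_{N,j,k}-u(x_j,y_k,1)=h^2C^{low}_{x_j,y_k}+h^{2N_0-2}C^{high}_{j,k}+r_{j,k},$$ and for $\theta=\frac12$ (the CS scheme) by $$U_{N,j,k}-u(x_j,y_k,1)=h^2C^{low}_{x_j,y_k}+h^{2N_0-2}C^{high}_{j,k}+h^{2N_0-1}(-1)^{N-N_0}\big(C^{CS}_{j,y_k}+C^{CS}_{x_j,k}\big)+r_{j,k}.$$ In the following, $h=1/(\lambda N)$ with $N\to\infty$, and constants do not depend on $h$, $j$, $k$, $\vartheta_1$, $\vartheta_2$. 1. There is $\delta>0$ such that for every $w\in\mathbb N$ there is $K$ with the following property for all sufficiently small $h$: there is a measurable $E$ with $$r_{j,k}=\frac1{4\pi^2h_1h_2}\int_{-\pi}^\pi\int_{-\pi}^\pi E(\vartheta_1,\vartheta_2)e^{ij\vartheta_1}e^{ik\vartheta_2}\,d\vartheta_1d\vartheta_2\quad(j,k\in\mathbb Z)$$ and, for $0<|\vartheta_1|,|\vartheta_2|\le\pi$, with $\kappa=\vartheta_1/h_1$, $\eta=\vartheta_2/h_2$: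 for $\theta\ne\frac12$, $$|E|\le K\Big(h^3e^{-\delta(\kappa^2+\eta^2)}+h^{2N_0+1}e^{-\delta(\vartheta_1^{-2}+\vartheta_2^{-2})}+h^w\Big),$$ and for $\theta=\frac12$ the same bound with $h^{2N_0+1}\big(e^{-\delta(\vartheta_1^{-2}+\eta^2)}+e^{-\delta(\kappa^2+\vartheta_2^{-2})}\big)$ added inside the large parentheses. 2. There is $K$ such that $|r_{j,k}|\le K\,(h^3+h^{2N_0-1})$ for all $j,k\in\mathbb Z$ and all sufficiently small $h$. 3. There is $K$ such that $|U_{N,j,k}-u(x_j,y_k,1)|\le K\,h^{\min\{2,\,2N_0-2\}}$ for all $j,k\in\mathbb Z$ and all sufficiently small $h$, for $\theta\neq\frac12$ as well as for $\theta=\frac12$. -/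

import Mathlib

open MeasureTheory Filter Topology
open scoped ContDiff

namespace RannacherMCS

noncomputable section

/-! ### The model problem and its exact solution -/

/-- `u x y t` solves `u_t = u_xx + 2ρ u_xy + u_yy + a₁ u_x + a₂ u_y` for `t > 0` with initial
data the Dirac delta at the origin (attained as a weak limit against bounded continuous
functions). -/
structure IsModelSolution (ρ a₁ a₂ : ℝ) (u : ℝ → ℝ → ℝ → ℝ) : Prop where
  smooth : ContDiffOn ℝ ∞ (fun q : ℝ × ℝ × ℝ => u q.1 q.2.1 q.2.2) {q | 0 < q.2.2}
  pde : ∀ x y t : ℝ, 0 < t →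
    deriv (fun s => u x y s) t =
      iteratedDeriv 2 (fun s => u s y t) x
        + 2 * ρ * deriv (fun s => deriv (fun r => u r s t) x) y
        + iteratedDeriv 2 (fun s => u x s t) y
        + a₁ * deriv (fun s => u s y t) x + a₂ * deriv (fun s => u x s t) y
  integrable : ∀ t : ℝ, 0 < t → Integrable (fun p : ℝ × ℝ => u p.1 p.2 t)
  initial : ∀ f : ℝ × ℝ → ℝ, Continuous f → (∃ M : ℝ, ∀ p, |f p| ≤ M) →
    Tendsto (fun t => ∫ p : ℝ × ℝ, u p.1 p.2 t * f p) (𝓝[>] 0) (𝓝 (f (0, 0)))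

/-- The closed-form solution: the density at `(x, y)` of the bivariate normal distribution with
mean `(-a₁ t, -a₂ t)`, variances `2t` and correlation `ρ`. -/
def exactSolution (ρ a₁ a₂ x y t : ℝ) : ℝ :=
  1 / (4 * Real.pi * t * √(1 - ρ ^ 2)) *
    Real.exp (-(1 / (4 * t)) * (1 / (1 - ρ ^ 2)) *
      ((x + a₁ * t) ^ 2 + (y + a₂ * t) ^ 2 - 2 * ρ * (x + a₁ * t) * (y + a₂ * t)))

/-! ### Spatial discretization on the grid `(j h₁, k h₂)` -/

/-- Real grid functions on `ℤ²`. -/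
abbrev Grid : Type := ℤ → ℤ → ℝ

/-- Square-summability; it singles out the solution of the implicit equations on the
infinite grid. -/
def SquareSummable (V : Grid) : Prop := Summable fun p : ℤ × ℤ => V p.1 p.2 ^ 2

def delta2x (V : Grid) : Grid := fun j k => V (j + 1) k - V (j - 1) k

def delta2y (V : Grid) : Grid := fun j k => V j (k + 1) - V j (k - 1)

def deltaSqx (V : Grid) : Grid := fun j k => V (j - 1) k - 2 * V j k + V (j + 1) k

def deltaSqy (V : Grid) : Grid := fun j k => V j (k - 1) - 2 * V j k + V j (k + 1)

/-- Discretization of the mixed derivative term `2ρ u_xy`. -/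
def opA0 (ρ h₁ h₂ : ℝ) (V : Grid) : Grid := (ρ / (2 * h₁ * h₂)) • delta2x (delta2y V)

/-- Discretization of `u_xx + a₁ u_x`. -/
def opA1 (a₁ h₁ : ℝ) (V : Grid) : Grid := (1 / h₁ ^ 2) • deltaSqx V + (a₁ / (2 * h₁)) • delta2x V

/-- Discretization of `u_yy + a₂ u_y`. -/
def opA2 (a₂ h₂ : ℝ) (V : Grid) : Grid := (1 / h₂ ^ 2) • deltaSqy V + (a₂ / (2 * h₂)) • delta2y V

/-- Discrete Dirac delta. -/
def diracGrid (h₁ h₂ : ℝ) : Grid := fun j k => if j = 0 ∧ k = 0 then 1 / (h₁ * h₂) else 0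

/-! ### Time stepping -/

/-- One MCS step from `U` to `V` for the operators `Zᵢ = Δt Aᵢ`. -/
def IsMCSStep (θ : ℝ) (Z₀ Z₁ Z₂ : Grid → Grid) (U V : Grid) : Prop :=
  ∃ Y₀ Y₁ Y₂ Yhat Ytil₀ Ytil₁ : Grid,
    SquareSummable Y₁ ∧ SquareSummable Y₂ ∧ SquareSummable Ytil₁ ∧ SquareSummable V ∧
    Y₀ = U + (Z₀ U + Z₁ U + Z₂ U) ∧
    Y₁ - θ • Z₁ Y₁ = Y₀ - θ • Z₁ U ∧
    Y₂ - θ • Z₂ Y₂ = Y₁ - θ • Z₂ U ∧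
    Yhat = Y₀ + θ • Z₀ Y₂ - θ • Z₀ U ∧
    Ytil₀ = Yhat + (1 / 2 - θ) • (Z₀ Y₂ + Z₁ Y₂ + Z₂ Y₂)
      - (1 / 2 - θ) • (Z₀ U + Z₁ U + Z₂ U) ∧
    Ytil₁ - θ • Z₁ Ytil₁ = Ytil₀ - θ • Z₁ U ∧
    V - θ • Z₂ V = Ytil₁ - θ • Z₂ U

/-- Two implicit Euler half-steps from `U` to `V`. -/
def IsEulerPair (Z₀ Z₁ Z₂ : Grid → Grid) (U V : Grid) : Prop :=
  ∃ W : Grid, SquareSummable W ∧ SquareSummable V ∧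
    W - (1 / 2 : ℝ) • (Z₀ W + Z₁ W + Z₂ W) = U ∧
    V - (1 / 2 : ℝ) • (Z₀ V + Z₁ V + Z₂ V) = W

/-- `W` is the numerical approximation at time `1` produced with `N` time steps of size `dt`, of
which the first `min N₀ N` are pairs of implicit Euler half-steps and the others are MCS steps. -/
def IsNumericalSolution (ρ a₁ a₂ θ h₁ h₂ dt : ℝ) (N₀ N : ℕ) (W : Grid) : Prop :=
  ∃ U : ℕ → Grid, U 0 = diracGrid h₁ h₂ ∧
    (∀ n < N,
      (n < N₀ → IsEulerPair (fun V => dt • opA0 ρ h₁ h₂ V) (fun V => dt • opA1 a₁ h₁ V)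
        (fun V => dt • opA2 a₂ h₂ V) (U n) (U (n + 1))) ∧
      (N₀ ≤ n → IsMCSStep θ (fun V => dt • opA0 ρ h₁ h₂ V) (fun V => dt • opA1 a₁ h₁ V)
        (fun V => dt • opA2 a₂ h₂ V) (U n) (U (n + 1)))) ∧
    U N = W

/-- The mesh width `h` for which `N` steps of size `Δt = lam * h` reach time `1`. -/
def meshWidth (lam : ℝ) (N : ℕ) : ℝ := 1 / (lam * N)

/-! ### The low-wavenumber coefficient -/

def Dx (f : ℝ → ℝ → ℝ) : ℝ → ℝ → ℝ := fun x y => deriv (fun s => f s y) x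

def Dy (f : ℝ → ℝ → ℝ) : ℝ → ℝ → ℝ := fun x y => deriv (fun s => f x s) y

/-- Bivariate standard normal density with correlation `ρ`. -/
def phiRho (ρ x y : ℝ) : ℝ :=
  1 / √(4 * Real.pi ^ 2 * (1 - ρ ^ 2)) *
    Real.exp (-((x ^ 2 - 2 * ρ * x * y + y ^ 2) / (2 * (1 - ρ ^ 2))))

/-- `½ ∂ₓ² + (a₁/√2) ∂ₓ`. -/
def opX (a₁ : ℝ) (f : ℝ → ℝ → ℝ) : ℝ → ℝ → ℝ := (1 / 2 : ℝ) • Dx (Dx f) + (a₁ / √2) • Dx f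

/-- `½ ∂ᵧ² + (a₂/√2) ∂ᵧ`. -/
def opY (a₂ : ℝ) (f : ℝ → ℝ → ℝ) : ℝ → ℝ → ℝ := (1 / 2 : ℝ) • Dy (Dy f) + (a₂ / √2) • Dy f

/-- `½ ∂ₓ² + ρ ∂ₓ∂ᵧ + ½ ∂ᵧ² + (a₁/√2) ∂ₓ + (a₂/√2) ∂ᵧ`. -/
def opL (ρ a₁ a₂ : ℝ) (f : ℝ → ℝ → ℝ) : ℝ → ℝ → ℝ := opX a₁ f + ρ • Dx (Dy f) + opY a₂ f

/-- `(ρ/2) ∂ₓ∂ᵧ + (½ - θ)(½ ∂ₓ² + ½ ∂ᵧ² + (a₁/√2) ∂ₓ + (a₂/√2) ∂ᵧ)`. -/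
def opG (ρ a₁ a₂ θ : ℝ) (f : ℝ → ℝ → ℝ) : ℝ → ℝ → ℝ :=
  (ρ / 2) • Dx (Dy f) + (1 / 2 - θ) • (opX a₁ f + opY a₂ f)

/-- The part of the leading error operator that comes from the spatial discretization. -/
def opS (ρ a₁ a₂ c : ℝ) (f : ℝ → ℝ → ℝ) : ℝ → ℝ → ℝ :=
  (1 / 48 : ℝ) • Dx (Dx (Dx (Dx f)))
    + (ρ / 12) • (Dx (Dx (Dx (Dy f))) + c ^ 2 • Dx (Dy (Dy (Dy f))))
    + (c ^ 2 / 48) • Dy (Dy (Dy (Dy f)))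
    + (a₁ / (12 * √2)) • Dx (Dx (Dx f)) + (a₂ * c ^ 2 / (12 * √2)) • Dy (Dy (Dy f))

/-- `C^low_{x,y}`: the operators act on `phiRho`, and the result is evaluated at
`((x + a₁)/√2, (y + a₂)/√2)`. -/
def Clow (ρ a₁ a₂ c lam θ : ℝ) (N₀ : ℕ) (x y : ℝ) : ℝ :=
  ((1 / 2 : ℝ) •
    (opS ρ a₁ a₂ c (phiRho ρ)
      - (lam ^ 2 * θ ^ 2) • opX a₁ (opY a₂ (opL ρ a₁ a₂ (phiRho ρ)))
      + (lam ^ 2 / 12) • opL ρ a₁ a₂ (opL ρ a₁ a₂ (opL ρ a₁ a₂ (phiRho ρ)))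
      - (lam ^ 2) • opL ρ a₁ a₂ (opG ρ a₁ a₂ θ (opG ρ a₁ a₂ θ (phiRho ρ)))
      + ((N₀ : ℝ) * lam ^ 2 / 4) • opL ρ a₁ a₂ (opL ρ a₁ a₂ (phiRho ρ))))
    ((x + a₁) / √2) ((y + a₂) / √2)

/-! ### The high-wavenumber coefficient -/

def iota (ρ c s t : ℝ) : ℝ :=
  c ^ 2 * Real.sin (s / 2) ^ 2
    + 2 * ρ * c * Real.cos (s / 2) * Real.sin (s / 2) * Real.cos (t / 2) * Real.sin (t / 2)
    + Real.sin (t / 2) ^ 2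

def highIntegrand (ρ c lam θ : ℝ) (N₀ : ℕ) (j k : ℤ) (s t : ℝ) : ℝ :=
  Real.cos (j * s + k * t) / (2 * lam * iota ρ c s t) ^ (2 * N₀) *
    Real.exp (-(1 / (4 * lam ^ 2 * θ ^ 2)) *
      (iota ρ c s t / (Real.sin (s / 2) ^ 2 * Real.sin (t / 2) ^ 2)))

def Chigh (ρ c lam θ : ℝ) (N₀ : ℕ) (j k : ℤ) : ℝ :=
  c ^ (4 * (N₀ : ℤ) - 1) / (2 * Real.pi ^ 2) *
      (∫ t in (0 : ℝ)..Real.pi, ∫ s in (0 : ℝ)..Real.pi, highIntegrand ρ c lam θ N₀ j k s t)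
    + c ^ (4 * (N₀ : ℤ) - 1) / (2 * Real.pi ^ 2) *
      (∫ t in (-Real.pi)..(0 : ℝ), ∫ s in (0 : ℝ)..Real.pi, highIntegrand ρ c lam θ N₀ j k s t)

/-! ### The Craig--Sneyd coefficients (`θ = 1/2`) -/

/-- Standard normal density. -/
def phi (x : ℝ) : ℝ := ProbabilityTheory.gaussianPDFReal 0 1 x

/-- `C^CS_{j,y}`. -/
def CcsX (a₂ lam : ℝ) (N₀ : ℕ) (j : ℤ) (y : ℝ) : ℝ :=
  1 / (2 * √2 * Real.pi) * phi ((y + a₂) / √2) *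
    ∫ s in (-Real.pi)..Real.pi,
      Real.cos (j * s) / (2 * lam * Real.sin (s / 2) ^ 2) ^ (2 * N₀) *
        Real.exp (-(1 / (lam ^ 2 * Real.sin (s / 2) ^ 2)))

/-- `C^CS_{x,k}`. -/
def CcsY (a₁ c lam : ℝ) (N₀ : ℕ) (x : ℝ) (k : ℤ) : ℝ :=
  1 / (2 * √2 * c * Real.pi) * phi ((x + a₁) / √2) *
    ∫ t in (-Real.pi)..Real.pi,
      Real.cos (k * t) / (2 * (lam / c ^ 2) * Real.sin (t / 2) ^ 2) ^ (2 * N₀) *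
        Real.exp (-(c ^ 2 / (lam ^ 2 * Real.sin (t / 2) ^ 2)))

/-! ### Total error, its approximations, and remainder bounds -/

/-- `U_{j,k} - u(x_j, y_k, 1)` with `x_j = j h`, `y_k = k c h`. -/
def totalError (ρ a₁ a₂ c h : ℝ) (U : Grid) : Grid := fun j k =>
  U j k - exactSolution ρ a₁ a₂ (j * h) (k * (c * h)) 1

/-- `h² C^low_{x_j,y_k} + h^{2N₀-2} C^high_{j,k}`. -/
def approxMCS (ρ a₁ a₂ c lam θ : ℝ) (N₀ : ℕ) (h : ℝ) : Grid := fun j k =>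
  h ^ 2 * Clow ρ a₁ a₂ c lam θ N₀ (j * h) (k * (c * h))
    + h ^ (2 * (N₀ : ℤ) - 2) * Chigh ρ c lam θ N₀ j k

/-- `h^{2N₀-1} (-1)^{N-N₀} (C^CS_{j,y_k} + C^CS_{x_j,k})`. -/
def extraCS (a₁ a₂ c lam : ℝ) (N₀ N : ℕ) (h : ℝ) : Grid := fun j k =>
  h ^ (2 * (N₀ : ℤ) - 1) * (-1 : ℝ) ^ ((N : ℤ) - (N₀ : ℤ)) *
    (CcsX a₂ lam N₀ j (k * (c * h)) + CcsY a₁ c lam N₀ (j * h) k)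

/-- Inverse mixed discrete/continuous Fourier transform. -/
def invMixedFourier (h₁ h₂ : ℝ) (E : ℝ → ℝ → ℂ) (j k : ℤ) : ℂ :=
  1 / (4 * (Real.pi : ℂ) ^ 2 * h₁ * h₂) *
    ∫ t in (-Real.pi)..Real.pi, ∫ s in (-Real.pi)..Real.pi,
      E s t * Complex.exp (Complex.I * j * s) * Complex.exp (Complex.I * k * t)

/-- Gaussian concentration at low wavenumbers. -/
def envLow (δ c h s t : ℝ) : ℝ := Real.exp (-δ * ((s / h) ^ 2 + (t / (c * h)) ^ 2))

/-- Concentration where both angles are away from zero. -/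
def envHigh (δ s t : ℝ) : ℝ := Real.exp (-δ * (1 / s ^ 2 + 1 / t ^ 2))

/-- Concentration where one angle is away from zero and the other wavenumber is bounded. -/
def envCS (δ c h s t : ℝ) : ℝ :=
  Real.exp (-δ * (1 / s ^ 2 + (t / (c * h)) ^ 2)) + Real.exp (-δ * ((s / h) ^ 2 + 1 / t ^ 2))

/-- The grid function `r` is the inverse transform of a function of size at most `B` on the
Fourier domain (the axes, a null set, being left out). -/
def HasFourierBound (h₁ h₂ : ℝ) (r : Grid) (B : ℝ → ℝ → ℝ) : Prop :=
  ∃ E : ℝ → ℝ → ℂ, Measurable (Function.uncurry E) ∧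
    (∀ j k : ℤ, ((r j k : ℝ) : ℂ) = invMixedFourier h₁ h₂ E j k) ∧
    ∀ s t : ℝ, 0 < |s| → |s| ≤ Real.pi → 0 < |t| → |t| ≤ Real.pi → ‖E s t‖ ≤ B s t

end

end RannacherMCS

open RannacherMCS

/-!
The scheme has constant coefficients on an infinite grid, so the mixed Fourier transform turns every
difference operator into multiplication by a function of the two angles. Each implicit equation has
a symbol of modulus at least one, hence is solvable by division, and uniquely so by pairing with the
solution of the adjoint equation (`IsMultiplier.eq_zero`). The numerical solution is therefore the
grid function of the symbol `mainSym = (1 / (1 - z / 2)) ^ (2 N₀) * R ^ (N - N₀)`, where `z` is the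
symbol of `Δt A` and `R` the amplification factor of one MCS step (`isNumericalSolution_gridOf`).

Up to every power of `h`, this symbol lives in a few regions of the angles `(ϑ₁, ϑ₂)`, each described
by a phase that must not exceed `h ^ (-1/4)`.

* At low wavenumbers (phase `κ² + η²`) the logarithm of `R` is expanded to third order. The result
  is the symbol of the exact solution times `1 + h² * lowPoly` (`mainSym_sub_lowSym_le`).
* With both angles away from zero, `1 - R` is of order `h`, the powers of `R` tend to an exponential,
  and the `2 N₀` Euler factors contribute `h ^ (2 N₀)` (`mainSym_sub_highSym_le`).
* For `θ = 1/2` only, with one angle away from zero and the other wavenumber bounded, `R` is within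
  order `h` of `-1`, which produces the alternating terms (`mainSym_sub_csSym_le`, and `mainSym_swap`
  for the exchanged roles of the two directions).
* Everywhere else `mainSym` is smaller than any power of `h` (`mainSym_intermediate_le`). Without
  convection the symbols are real, and the lower bound on `θ` is what makes `1 - R` and
  `1 + R` positive with a quantitative bound (`exists_le_one_sub_realFactor`). Convection perturbs `R`
  by a small multiple of that bound (`norm_mcsFactor_sub_realFactor_le`).

The product of two different phases is at least of order `h⁻²`, so the regions are disjoint, and in
each region the approximations belonging to the other ones are negligible (`far_of_near`). Adding
them up gives the error of the symbol at all angles (`exists_symbol_error_mcs`,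
`exists_symbol_error_cs`).

It remains to identify the approximations on the grid. The transform of `lowSym` over the whole plane
is the exact solution plus `h² Clow`, because `phiRho` is a Fourier integral of a Gaussian under which
differential operators act as polynomials (`HasGaussSymbol`, `exactSolution_add_Clow`). Passing from
the plane to the square of angles means summing over all periods, which changes the symbol by less
than any power of `h` (`exists_fold`, `exists_low_fold`). The symbol of the term with `Chigh` is used
as it stands (`gridOf_highSym`), and the Craig--Sneyd terms are made periodic in one variable
(`exists_cs_fold`, `exists_cs_fold_swap`). Finally the symbol of the remainder is made Hermitian
without enlarging its bound, since the grid functions are real (`hasFourierBound_gridOf`).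
Integrating that bound gives the uniform bound on the remainder (`abs_le_of_hasFourierBound`), and
with the boundedness of all coefficients the order of convergence (`exists_abs_totalError_le`). That
the Gaussian solves the model problem is checked by differentiation and parabolic scaling
(`isModelSolution_exactSolution`).
-/

namespace RannacherMCS

noncomputable section

/-! ### Inverse Fourier transforms of bounded symbols -/

/-- The square `(-π, π]²` with Lebesgue measure. -/
def boxMeasure : Measure (ℝ × ℝ) :=
  (volume.restrict (Set.Ioc (-Real.pi) Real.pi)).prod
    (volume.restrict (Set.Ioc (-Real.pi) Real.pi))

instance : IsFiniteMeasure boxMeasure := by unfold boxMeasure; infer_instance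

/-- Measurable functions on the Fourier domain that are bounded off the axes. -/
structure IsSymbol (E : ℝ → ℝ → ℂ) : Prop where
  measurable : Measurable (Function.uncurry E)
  bounded : ∃ C : ℝ, ∀ s t : ℝ, s ≠ 0 → t ≠ 0 → |s| ≤ Real.pi → |t| ≤ Real.pi → ‖E s t‖ ≤ C

/-- The axes are null sets, so that symbols need only be controlled off them. -/
theorem ae_boxMeasure : ∀ᵐ p : ℝ × ℝ ∂boxMeasure,
    p.1 ≠ 0 ∧ p.2 ≠ 0 ∧ |p.1| ≤ Real.pi ∧ |p.2| ≤ Real.pi := by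
  have h1 : ∀ᵐ s : ℝ ∂(volume.restrict (Set.Ioc (-Real.pi) Real.pi)), s ≠ 0 ∧ |s| ≤ Real.pi := by
    filter_upwards [ae_restrict_mem measurableSet_Ioc,
      ae_restrict_of_ae (Measure.ae_ne volume (0 : ℝ))] with s hs h0
    exact ⟨h0, abs_le.2 ⟨hs.1.le, hs.2⟩⟩
  have hx := Measure.quasiMeasurePreserving_fst (μ := volume.restrict (Set.Ioc (-Real.pi) Real.pi))
    (ν := volume.restrict (Set.Ioc (-Real.pi) Real.pi)) |>.ae h1
  have hy := Measure.quasiMeasurePreserving_snd (μ := volume.restrict (Set.Ioc (-Real.pi) Real.pi))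
    (ν := volume.restrict (Set.Ioc (-Real.pi) Real.pi)) |>.ae h1
  filter_upwards [hx, hy] with p h h'
  exact ⟨h.1, h'.1, h.2, h'.2⟩

namespace IsSymbol

variable {E F : ℝ → ℝ → ℂ}

theorem ae_bounded (hE : IsSymbol E) : ∃ C : ℝ, ∀ᵐ p ∂boxMeasure, ‖Function.uncurry E p‖ ≤ C := by
  obtain ⟨C, hC⟩ := hE.bounded
  refine ⟨C, ?_⟩
  filter_upwards [ae_boxMeasure] with p hp
  exact hC p.1 p.2 hp.1 hp.2.1 hp.2.2.1 hp.2.2.2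

theorem memLp (hE : IsSymbol E) (q : ENNReal) : MemLp (Function.uncurry E) q boxMeasure := by
  obtain ⟨C, hC⟩ := hE.ae_bounded
  exact MemLp.of_bound hE.measurable.aestronglyMeasurable C hC

theorem integrable (hE : IsSymbol E) : Integrable (Function.uncurry E) boxMeasure :=
  memLp_one_iff_integrable.1 (hE.memLp 1)

theorem add (hE : IsSymbol E) (hF : IsSymbol F) : IsSymbol (fun s t => E s t + F s t) := by
  obtain ⟨C, hC⟩ := hE.bounded
  obtain ⟨D, hD⟩ := hF.bounded
  exact ⟨hE.measurable.add hF.measurable, C + D, fun s t h1 h2 h3 h4 =>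
    (norm_add_le _ _).trans (add_le_add (hC s t h1 h2 h3 h4) (hD s t h1 h2 h3 h4))⟩

theorem mul (hE : IsSymbol E) (hF : IsSymbol F) : IsSymbol (fun s t => E s t * F s t) := by
  obtain ⟨C, hC⟩ := hE.bounded
  obtain ⟨D, hD⟩ := hF.bounded
  refine ⟨hE.measurable.mul hF.measurable, C * D, fun s t h1 h2 h3 h4 => ?_⟩
  rw [norm_mul]
  exact mul_le_mul (hC s t h1 h2 h3 h4) (hD s t h1 h2 h3 h4) (norm_nonneg _)
    ((norm_nonneg _).trans (hC s t h1 h2 h3 h4))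

theorem const (c : ℂ) : IsSymbol (fun _ _ => c) :=
  ⟨measurable_const, ‖c‖, fun _ _ _ _ _ _ => le_rfl⟩

theorem sub (hE : IsSymbol E) (hF : IsSymbol F) : IsSymbol (fun s t => E s t - F s t) := by
  simpa [sub_eq_add_neg] using hE.add ((const (-1)).mul hF)

theorem pow (hE : IsSymbol E) (n : ℕ) : IsSymbol (fun s t => E s t ^ n) := by
  induction n with
  | zero => simpa using const 1
  | succ n ih => simpa only [pow_succ] using ih.mul hE

theorem of_continuous (hE : Continuous (Function.uncurry E)) : IsSymbol E := by
  obtain ⟨C, hC⟩ := (isCompact_Icc (a := -Real.pi) (b := Real.pi)).prod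
    (isCompact_Icc (a := -Real.pi) (b := Real.pi)) |>.exists_bound_of_continuousOn hE.continuousOn
  exact ⟨hE.measurable, C, fun s t _ _ h3 h4 => hC (s, t) ⟨abs_le.1 h3, abs_le.1 h4⟩⟩

theorem expX (a : ℤ) : IsSymbol (fun s _ => Complex.exp (Complex.I * a * s)) :=
  of_continuous (by simp only [Function.uncurry_def]; fun_prop)

theorem expY (a : ℤ) : IsSymbol (fun _ t => Complex.exp (Complex.I * a * t)) :=
  of_continuous (by simp only [Function.uncurry_def]; fun_prop)

/-- Division by a symbol that is bounded away from zero. -/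
theorem div (hE : IsSymbol E) (hF : IsSymbol F) {b : ℝ} (hb : 0 < b)
    (h : ∀ s t, b ≤ ‖F s t‖) : IsSymbol (fun s t => E s t / F s t) := by
  obtain ⟨C, hC⟩ := hE.bounded
  refine ⟨hE.measurable.div hF.measurable, C / b, fun s t h1 h2 h3 h4 => ?_⟩
  rw [norm_div]
  have h5 := hC s t h1 h2 h3 h4
  exact div_le_div₀ ((norm_nonneg _).trans h5) h5 hb (h s t)

end IsSymbol

theorem norm_exp_I_int (j : ℤ) (s : ℝ) : ‖Complex.exp (Complex.I * j * s)‖ = 1 := by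
  have : Complex.I * j * s = ((j * s : ℝ) : ℂ) * Complex.I := by push_cast; ring
  rw [this, Complex.norm_exp_ofReal_mul_I]

theorem invMixedFourier_eq {E : ℝ → ℝ → ℂ} (hE : IsSymbol E) (h₁ h₂ : ℝ) (j k : ℤ) :
    invMixedFourier h₁ h₂ E j k = 1 / (4 * (Real.pi : ℂ) ^ 2 * h₁ * h₂) *
      ∫ p : ℝ × ℝ, E p.1 p.2 * Complex.exp (Complex.I * j * p.1) *
        Complex.exp (Complex.I * k * p.2) ∂boxMeasure := by
  have hpi : -Real.pi ≤ Real.pi := by linarith [Real.pi_pos]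
  have hI := ((hE.mul (IsSymbol.expX j)).mul (IsSymbol.expY k)).integrable
  unfold invMixedFourier
  congr 1
  unfold boxMeasure at hI ⊢
  refine Eq.trans ?_ (integral_prod_symm _ hI).symm
  rw [intervalIntegral.integral_of_le hpi]
  refine integral_congr_ae (Eventually.of_forall fun t => ?_)
  simp only
  rw [intervalIntegral.integral_of_le hpi]
  rfl

theorem invMixedFourier_add {E F : ℝ → ℝ → ℂ} (hE : IsSymbol E) (hF : IsSymbol F)
    (h₁ h₂ : ℝ) (j k : ℤ) :
    invMixedFourier h₁ h₂ (fun s t => E s t + F s t) j k =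
      invMixedFourier h₁ h₂ E j k + invMixedFourier h₁ h₂ F j k := by
  rw [invMixedFourier_eq hE, invMixedFourier_eq hF, invMixedFourier_eq (hE.add hF), ← mul_add]
  congr 1
  refine Eq.trans ?_ (integral_add ((hE.mul (IsSymbol.expX j)).mul (IsSymbol.expY k)).integrable
      ((hF.mul (IsSymbol.expX j)).mul (IsSymbol.expY k)).integrable)
  congr 1
  ext p
  ring

theorem invMixedFourier_const_mul (c : ℂ) (E : ℝ → ℝ → ℂ) (h₁ h₂ : ℝ) (j k : ℤ) :
    invMixedFourier h₁ h₂ (fun s t => c * E s t) j k = c * invMixedFourier h₁ h₂ E j k := by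
  unfold invMixedFourier
  simp only [mul_assoc c, intervalIntegral.integral_const_mul]
  ring

theorem invMixedFourier_shift (a b : ℤ) (E : ℝ → ℝ → ℂ) (h₁ h₂ : ℝ) (j k : ℤ) :
    invMixedFourier h₁ h₂ (fun s t => Complex.exp (Complex.I * a * s) *
      Complex.exp (Complex.I * b * t) * E s t) j k = invMixedFourier h₁ h₂ E (j + a) (k + b) := by
  unfold invMixedFourier
  congr 2
  ext t
  congr 1
  ext s
  have e1 : Complex.I * ((j + a : ℤ) : ℂ) * s = Complex.I * j * s + Complex.I * a * s := by
    push_cast; ring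
  have e2 : Complex.I * ((k + b : ℤ) : ℂ) * t = Complex.I * k * t + Complex.I * b * t := by
    push_cast; ring
  rw [e1, e2, Complex.exp_add, Complex.exp_add]
  ring

theorem integral_exp_int (n : ℤ) :
    ∫ s in Set.Ioc (-Real.pi) Real.pi, Complex.exp (Complex.I * n * s) =
      if n = 0 then 2 * (Real.pi : ℂ) else 0 := by
  have hpi : -Real.pi ≤ Real.pi := by linarith [Real.pi_pos]
  rw [← intervalIntegral.integral_of_le hpi]
  split_ifs with h
  · subst h
    simp
    ring
  · rw [integral_exp_mul_complex (by simp [h])]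
    have : Complex.exp (Complex.I * n * (Real.pi : ℂ)) =
        Complex.exp (Complex.I * n * ((-Real.pi : ℝ) : ℂ)) := by
      rw [Complex.exp_eq_exp_iff_exists_int]
      exact ⟨n, by push_cast; ring⟩
    rw [this, sub_self, zero_div]

theorem integral_boxMeasure_exp (m n : ℤ) :
    ∫ p : ℝ × ℝ, Complex.exp (Complex.I * m * p.1) * Complex.exp (Complex.I * n * p.2) ∂boxMeasure
      = if m = 0 ∧ n = 0 then 4 * (Real.pi : ℂ) ^ 2 else 0 := by
  unfold boxMeasure
  rw [integral_prod_mul (fun s : ℝ => Complex.exp (Complex.I * m * s))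
    (fun t : ℝ => Complex.exp (Complex.I * n * t)), integral_exp_int, integral_exp_int]
  by_cases hm : m = 0 <;> by_cases hn : n = 0 <;> simp [hm, hn]
  ring

/-- The real grid function with symbol `E`. -/
def gridOf (h₁ h₂ : ℝ) (E : ℝ → ℝ → ℂ) : Grid := fun j k => (invMixedFourier h₁ h₂ E j k).re

theorem gridOf_add {E F : ℝ → ℝ → ℂ} (hE : IsSymbol E) (hF : IsSymbol F) (h₁ h₂ : ℝ) :
    gridOf h₁ h₂ (fun s t => E s t + F s t) = gridOf h₁ h₂ E + gridOf h₁ h₂ F := by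
  ext j k
  simp [gridOf, invMixedFourier_add hE hF]

theorem gridOf_const_mul (c : ℝ) (E : ℝ → ℝ → ℂ) (h₁ h₂ : ℝ) :
    gridOf h₁ h₂ (fun s t => c * E s t) = c • gridOf h₁ h₂ E := by
  ext j k
  simp [gridOf, invMixedFourier_const_mul]

theorem gridOf_sub {E F : ℝ → ℝ → ℂ} (hE : IsSymbol E) (hF : IsSymbol F) (h₁ h₂ : ℝ) :
    gridOf h₁ h₂ (fun s t => E s t - F s t) = gridOf h₁ h₂ E - gridOf h₁ h₂ F := by
  have h := gridOf_add hE ((IsSymbol.const ((-1 : ℝ) : ℂ)).mul hF) h₁ h₂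
  rw [gridOf_const_mul] at h
  convert h using 1
  · congr 1; ext s t; push_cast; ring
  · simp [sub_eq_add_neg]

theorem gridOf_shift (a b : ℤ) (E : ℝ → ℝ → ℂ) (h₁ h₂ : ℝ) (j k : ℤ) :
    gridOf h₁ h₂ (fun s t => Complex.exp (Complex.I * a * s) *
      Complex.exp (Complex.I * b * t) * E s t) j k = gridOf h₁ h₂ E (j + a) (k + b) := by
  simp [gridOf, invMixedFourier_shift]

theorem gridOf_exp (a b : ℤ) (h₁ h₂ : ℝ) (j k : ℤ) :
    gridOf h₁ h₂ (fun s t => Complex.exp (Complex.I * a * s) *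
      Complex.exp (Complex.I * b * t)) j k = if j = -a ∧ k = -b then 1 / (h₁ * h₂) else 0 := by
  have hs := gridOf_shift a b (fun _ _ => 1) h₁ h₂ j k
  simp only [mul_one] at hs
  rw [hs, gridOf, invMixedFourier_eq (IsSymbol.const 1)]
  simp only [one_mul]
  rw [integral_boxMeasure_exp]
  have e : (j + a = 0 ∧ k + b = 0) ↔ (j = -a ∧ k = -b) := by
    constructor <;> rintro ⟨h1, h2⟩ <;> constructor <;> linarith
  simp only [e]
  split_ifs
  · have hpi : (Real.pi : ℂ) ≠ 0 := by exact_mod_cast Real.pi_ne_zero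
    have : 1 / (4 * (Real.pi : ℂ) ^ 2 * h₁ * h₂) * (4 * (Real.pi : ℂ) ^ 2) =
        ((1 / (h₁ * h₂) : ℝ) : ℂ) := by
      push_cast
      rw [show 4 * (Real.pi : ℂ) ^ 2 * h₁ * h₂ = (4 * (Real.pi : ℂ) ^ 2) * (h₁ * h₂) by ring]
      rw [one_div, mul_inv, one_div]
      field_simp
    rw [this, Complex.ofReal_re]
  · simp

theorem gridOf_one (h₁ h₂ : ℝ) : gridOf h₁ h₂ (fun _ _ => 1) = diracGrid h₁ h₂ := by
  ext j k
  have := gridOf_exp 0 0 h₁ h₂ j k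
  simpa [diracGrid] using this

/-- Bessel's inequality for the trigonometric system: bounded symbols have square-summable
grid functions. -/
theorem squareSummable_gridOf {E : ℝ → ℝ → ℂ} (hE : IsSymbol E) (h₁ h₂ : ℝ) :
    SquareSummable (gridOf h₁ h₂ E) := by
  let e : ℤ × ℤ → ℝ → ℝ → ℂ := fun n s t => ((1 / (2 * Real.pi) : ℝ) : ℂ) *
    (Complex.exp (Complex.I * (-n.1 : ℤ) * s) * Complex.exp (Complex.I * (-n.2 : ℤ) * t))
  have he : ∀ n, IsSymbol (e n) := fun n =>
    (IsSymbol.const _).mul ((IsSymbol.expX _).mul (IsSymbol.expY _))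
  let v : ℤ × ℤ → Lp ℂ 2 boxMeasure := fun n => ((he n).memLp 2).toLp _
  have hconj : ∀ (n : ℤ × ℤ) (s t : ℝ), (starRingEnd ℂ) (e n s t) =
      ((1 / (2 * Real.pi) : ℝ) : ℂ) *
    (Complex.exp (Complex.I * n.1 * s) * Complex.exp (Complex.I * n.2 * t)) := by
    intro n s t
    simp only [e, map_mul, Complex.conj_ofReal, ← Complex.exp_conj, Complex.conj_I, map_intCast]
    push_cast
    simp
  have hinner : ∀ (n : ℤ × ℤ) (F : ℝ → ℝ → ℂ) (hF : IsSymbol F),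
      inner ℂ (v n) ((hF.memLp 2).toLp _) = ((1 / (2 * Real.pi) : ℝ) : ℂ) *
      ∫ p : ℝ × ℝ, F p.1 p.2 * Complex.exp (Complex.I * n.1 * p.1) *
        Complex.exp (Complex.I * n.2 * p.2) ∂boxMeasure := by
    intro n F hF
    rw [L2.inner_def, ← integral_const_mul]
    refine integral_congr_ae ?_
    filter_upwards [((he n).memLp 2).coeFn_toLp, (hF.memLp 2).coeFn_toLp] with p h1 h2
    simp only [v]
    rw [h1, h2]
    simp only [Function.uncurry_def, RCLike.inner_apply, hconj]
    ring
  have hpi : (Real.pi : ℂ) ≠ 0 := by exact_mod_cast Real.pi_ne_zero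
  have hv : Orthonormal ℂ v := by
    rw [orthonormal_iff_ite]
    intro m n
    rw [hinner m (e n) (he n)]
    have : ∀ p : ℝ × ℝ, e n p.1 p.2 * Complex.exp (Complex.I * m.1 * p.1) *
        Complex.exp (Complex.I * m.2 * p.2) = ((1 / (2 * Real.pi) : ℝ) : ℂ) *
        (Complex.exp (Complex.I * (m.1 - n.1 : ℤ) * p.1) *
          Complex.exp (Complex.I * (m.2 - n.2 : ℤ) * p.2)) := by
      intro p
      have e1 : Complex.I * ((m.1 - n.1 : ℤ) : ℂ) * p.1 =
          Complex.I * m.1 * p.1 + Complex.I * (-n.1 : ℤ) * p.1 := by push_cast; ring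
      have e2 : Complex.I * ((m.2 - n.2 : ℤ) : ℂ) * p.2 =
          Complex.I * m.2 * p.2 + Complex.I * (-n.2 : ℤ) * p.2 := by push_cast; ring
      rw [e1, e2, Complex.exp_add, Complex.exp_add]
      simp only [e]
      ring
    simp only [this]
    rw [integral_const_mul, integral_boxMeasure_exp]
    have e : (m.1 - n.1 = 0 ∧ m.2 - n.2 = 0) ↔ m = n := by
      rw [sub_eq_zero, sub_eq_zero, Prod.ext_iff]
    simp only [e]
    split_ifs
    · push_cast
      field_simp
      norm_num
    · simp
  have hs := hv.inner_products_summable (((hE.memLp 2).toLp _))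
  have hs' := hs.mul_left ((1 / (2 * Real.pi * h₁ * h₂)) ^ 2)
  refine Summable.of_nonneg_of_le (fun _ => sq_nonneg _) (fun n => ?_) hs'
  rw [hinner n E hE, ← mul_pow]
  rw [sq_le_sq, abs_mul, abs_norm]
  refine (Complex.abs_re_le_norm _).trans (le_of_eq ?_)
  rw [invMixedFourier_eq hE, ← Real.norm_eq_abs, ← Complex.norm_real (1 / (2 * Real.pi * h₁ * h₂)),
    ← norm_mul, ← mul_assoc]
  congr 2
  push_cast
  rw [show 4 * (Real.pi : ℂ) ^ 2 * h₁ * h₂ = (2 * (Real.pi : ℂ) * h₁ * h₂) * (2 * Real.pi)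
    by ring]
  rw [one_div_mul_one_div]

/-! ### Difference operators as Fourier multipliers on square-summable grid functions -/

theorem SquareSummable.add {V W : Grid} (hV : SquareSummable V) (hW : SquareSummable W) :
    SquareSummable (V + W) := by
  refine Summable.of_nonneg_of_le (fun _ => sq_nonneg _) (fun p => ?_)
    ((Summable.add hV hW).mul_left 2)
  simp only [Pi.add_apply]
  nlinarith [sq_nonneg (V p.1 p.2 - W p.1 p.2)]

theorem SquareSummable.smul {V : Grid} (c : ℝ) (hV : SquareSummable V) :
    SquareSummable (c • V) := by
  refine (Summable.mul_left (c ^ 2) hV).congr fun p => ?_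
  simp [mul_pow]

theorem SquareSummable.sub {V W : Grid} (hV : SquareSummable V) (hW : SquareSummable W) :
    SquareSummable (V - W) := by
  have : V - W = V + (-1 : ℝ) • W := by ext; simp [sub_eq_add_neg]
  rw [this]
  exact hV.add (hW.smul _)

theorem SquareSummable.summable_mul {V W : Grid} (hV : SquareSummable V)
    (hW : SquareSummable W) : Summable fun p : ℤ × ℤ => V p.1 p.2 * W p.1 p.2 := by
  refine Summable.of_norm_bounded (Summable.add hV hW) fun p => ?_
  rw [Real.norm_eq_abs, abs_le]
  constructor <;> nlinarith [sq_nonneg (V p.1 p.2 - W p.1 p.2), sq_nonneg (V p.1 p.2 + W p.1 p.2)]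

/-- The inner product of two grid functions. -/
def gridInner (V W : Grid) : ℝ := ∑' p : ℤ × ℤ, V p.1 p.2 * W p.1 p.2

/-- `T` is a linear operator on grid functions that acts on Fourier transforms as multiplication
by `σ`, and `T'` is an adjoint of `T`, with multiplier `σ'`. -/
structure IsMultiplier (T T' : Grid → Grid) (σ σ' : ℝ → ℝ → ℂ) : Prop where
  symbol : IsSymbol σ
  symbol' : IsSymbol σ'
  act : ∀ h₁ h₂ E, IsSymbol E → T (gridOf h₁ h₂ E) = gridOf h₁ h₂ fun s t => σ s t * E s t
  act' : ∀ h₁ h₂ E, IsSymbol E → T' (gridOf h₁ h₂ E) = gridOf h₁ h₂ fun s t => σ' s t * E s t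
  sub : ∀ V W, T (V - W) = T V - T W
  sq : ∀ V, SquareSummable V → SquareSummable (T V)
  sq' : ∀ V, SquareSummable V → SquareSummable (T' V)
  adj : ∀ V W, SquareSummable V → SquareSummable W → gridInner (T V) W = gridInner V (T' W)

/-- Translation of a grid function. -/
def shiftGrid (a b : ℤ) (V : Grid) : Grid := fun j k => V (j + a) (k + b)

theorem SquareSummable.shift {V : Grid} (hV : SquareSummable V) (a b : ℤ) :
    SquareSummable (shiftGrid a b V) :=
  ((Equiv.addRight a).prodCongr (Equiv.addRight b)).summable_iff.2 hV

namespace IsMultiplier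

theorem shift (a b : ℤ) : IsMultiplier (shiftGrid a b) (shiftGrid (-a) (-b))
    (fun s t => Complex.exp (Complex.I * a * s) * Complex.exp (Complex.I * b * t))
    (fun s t => Complex.exp (Complex.I * (-a : ℤ) * s) * Complex.exp (Complex.I * (-b : ℤ) * t)) where
  symbol := (IsSymbol.expX _).mul (IsSymbol.expY _)
  symbol' := (IsSymbol.expX _).mul (IsSymbol.expY _)
  act h₁ h₂ E _ := by ext j k; exact (gridOf_shift a b E h₁ h₂ j k).symm
  act' h₁ h₂ E _ := by ext j k; exact (gridOf_shift (-a) (-b) E h₁ h₂ j k).symm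
  sub V W := rfl
  sq V hV := hV.shift a b
  sq' V hV := hV.shift _ _
  adj V W _ _ := by
    unfold gridInner
    rw [← ((Equiv.addRight a).prodCongr (Equiv.addRight b)).tsum_eq
      (fun p : ℤ × ℤ => V p.1 p.2 * shiftGrid (-a) (-b) W p.1 p.2)]
    simp [shiftGrid]

variable {T T' S S' : Grid → Grid} {σ σ' τ τ' : ℝ → ℝ → ℂ}

theorem add (hT : IsMultiplier T T' σ σ') (hS : IsMultiplier S S' τ τ') :
    IsMultiplier (fun V => T V + S V) (fun V => T' V + S' V)
      (fun s t => σ s t + τ s t) (fun s t => σ' s t + τ' s t) where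
  symbol := hT.symbol.add hS.symbol
  symbol' := hT.symbol'.add hS.symbol'
  act h₁ h₂ E hE := by
    rw [hT.act _ _ _ hE, hS.act _ _ _ hE, ← gridOf_add (hT.symbol.mul hE) (hS.symbol.mul hE)]
    simp only [add_mul]
  act' h₁ h₂ E hE := by
    rw [hT.act' _ _ _ hE, hS.act' _ _ _ hE,
      ← gridOf_add (hT.symbol'.mul hE) (hS.symbol'.mul hE)]
    simp only [add_mul]
  sub V W := by rw [hT.sub, hS.sub]; abel
  sq V hV := (hT.sq V hV).add (hS.sq V hV)
  sq' V hV := (hT.sq' V hV).add (hS.sq' V hV)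
  adj V W hV hW := by
    have h1 := hT.adj V W hV hW
    have h2 := hS.adj V W hV hW
    unfold gridInner at *
    simp only [Pi.add_apply, add_mul, mul_add]
    rw [Summable.tsum_add ((hT.sq V hV).summable_mul hW) ((hS.sq V hV).summable_mul hW),
      Summable.tsum_add (hV.summable_mul (hT.sq' W hW)) (hV.summable_mul (hS.sq' W hW)), h1, h2]

theorem smul (c : ℝ) (hT : IsMultiplier T T' σ σ') :
    IsMultiplier (fun V => c • T V) (fun V => c • T' V)
      (fun s t => c * σ s t) (fun s t => c * σ' s t) where
  symbol := (IsSymbol.const c).mul hT.symbol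
  symbol' := (IsSymbol.const c).mul hT.symbol'
  act h₁ h₂ E hE := by
    rw [hT.act _ _ _ hE, ← gridOf_const_mul]
    simp only [mul_assoc]
  act' h₁ h₂ E hE := by
    rw [hT.act' _ _ _ hE, ← gridOf_const_mul]
    simp only [mul_assoc]
  sub V W := by rw [hT.sub, smul_sub]
  sq V hV := (hT.sq V hV).smul c
  sq' V hV := (hT.sq' V hV).smul c
  adj V W hV hW := by
    have h1 := hT.adj V W hV hW
    unfold gridInner at *
    simp only [Pi.smul_apply, smul_eq_mul, mul_assoc, mul_left_comm _ c]
    rw [tsum_mul_left, tsum_mul_left, h1]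

/-- A multiplier operator whose adjoint stays away from `1` has no nonzero square-summable
fixed point: pair a fixed point with the solution of the adjoint equation for a unit vector. -/
theorem eq_zero (hT : IsMultiplier T T' σ σ') (h : ∀ s t, 1 ≤ ‖1 - σ' s t‖) {V : Grid}
    (hV : SquareSummable V) (hfix : T V = V) : V = 0 := by
  ext a b
  let e : ℝ → ℝ → ℂ := fun s t =>
    Complex.exp (Complex.I * (-a : ℤ) * s) * Complex.exp (Complex.I * (-b : ℤ) * t)
  have he : IsSymbol e := (IsSymbol.expX _).mul (IsSymbol.expY _)
  have hd : IsSymbol (fun s t => 1 - σ' s t) := (IsSymbol.const 1).sub hT.symbol'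
  let F : ℝ → ℝ → ℂ := fun s t => e s t / (1 - σ' s t)
  have hF : IsSymbol F := he.div hd one_pos h
  let W := gridOf 1 1 F
  have hW : SquareSummable W := squareSummable_gridOf hF 1 1
  have hWe : W - T' W = gridOf 1 1 e := by
    rw [hT.act' _ _ _ hF, ← gridOf_sub hF (hT.symbol'.mul hF)]
    congr 1
    ext s t
    have : 1 - σ' s t ≠ 0 := fun h0 => by
      have := h s t
      rw [h0, norm_zero] at this
      linarith
    simp only [F]
    field_simp
  have hadj := hT.adj V W hV hW
  rw [hfix] at hadj
  have h0 : ∑' p : ℤ × ℤ, V p.1 p.2 * (W - T' W) p.1 p.2 = 0 := by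
    simp only [Pi.sub_apply, mul_sub]
    rw [Summable.tsum_sub (hV.summable_mul hW) (hV.summable_mul (hT.sq' W hW))]
    exact sub_eq_zero.2 hadj
  have hg : ∀ j k, gridOf 1 1 e j k = if j = a ∧ k = b then 1 else 0 := by
    intro j k
    simpa only [neg_neg, mul_one, div_one] using gridOf_exp (-a) (-b) 1 1 j k
  rw [hWe, tsum_eq_single (a, b)] at h0
  · simpa [hg] using h0
  · rintro ⟨j, k⟩ hjk
    have : ¬ (j = a ∧ k = b) := by rintro ⟨rfl, rfl⟩; exact hjk rfl
    simp only [hg, if_neg this, mul_zero]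

/-- Uniqueness of square-summable solutions of `V - T V = G`. -/
theorem injective (hT : IsMultiplier T T' σ σ') (h : ∀ s t, 1 ≤ ‖1 - σ' s t‖) {V W : Grid}
    (hV : SquareSummable V) (hW : SquareSummable W) (hVW : V - T V = W - T W) : V = W := by
  have : T (V - W) = V - W := by
    rw [hT.sub]

    ext j k
    have h2 := congrFun (congrFun hVW j) k
    simp only [Pi.sub_apply] at h2 ⊢
    linarith
  exact sub_eq_zero.1 (hT.eq_zero h (hV.sub hW) this)

end IsMultiplier

/-! ### The symbols of the scheme -/

/-- Minus the real part of the symbol of a one-dimensional scaled difference operator. -/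
def xSym (l h s : ℝ) : ℝ := 4 * l / h * Real.sin (s / 2) ^ 2

/-- The symbol of `Δt A₁` for `l = λ`, `a = a₁`, and of `Δt A₂` for `l = λ / c²`, `a = c a₂`. -/
def zSym (l a h s : ℝ) : ℂ := -(xSym l h s : ℂ) + ((l * a * Real.sin s : ℝ) : ℂ) * Complex.I

/-- The symbol of `Δt A₀`, which is real. -/
def xMix (ρ c lam h s t : ℝ) : ℝ := -(2 * lam * ρ / (c * h)) * (Real.sin s * Real.sin t)

theorem exp_I_one (s : ℝ) : Complex.exp (Complex.I * (1 : ℤ) * s) =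
    (Real.cos s : ℂ) + (Real.sin s : ℂ) * Complex.I := by
  rw [Int.cast_one, mul_one, mul_comm, Complex.exp_mul_I, Complex.ofReal_cos, Complex.ofReal_sin]

theorem exp_I_neg_one (s : ℝ) : Complex.exp (Complex.I * (-1 : ℤ) * s) =
    (Real.cos s : ℂ) - (Real.sin s : ℂ) * Complex.I := by
  have : Complex.I * ((-1 : ℤ) : ℂ) * s = Complex.I * (1 : ℤ) * ((-s : ℝ) : ℂ) := by
    push_cast; ring
  rw [this, exp_I_one]
  simp [sub_eq_add_neg]

theorem cos_eq_one_sub_sin_half (s : ℝ) : Real.cos s = 1 - 2 * Real.sin (s / 2) ^ 2 := by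
  have := Real.cos_two_mul (s / 2)
  rw [Real.cos_sq'] at this
  rw [mul_div_cancel₀ s two_ne_zero] at this
  linarith

section symbols

variable {ρ a₁ a₂ c lam h : ℝ}

theorem isMultiplier_X (hh : h ≠ 0) : IsMultiplier (fun V => (lam * h) • opA1 a₁ h V)
    (fun V => (lam * h) • opA1 (-a₁) h V) (fun s _ => zSym lam a₁ h s)
    (fun s _ => zSym lam (-a₁) h s) := by
  have base : ∀ d e m : ℝ, IsMultiplier
      (fun V => d • shiftGrid (-1) 0 V + m • shiftGrid 0 0 V + e • shiftGrid 1 0 V) _ _ _ :=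
    fun d e m => (((IsMultiplier.shift (-1) 0).smul d).add ((IsMultiplier.shift 0 0).smul m)).add
      ((IsMultiplier.shift 1 0).smul e)
  convert base (lam * h * (1 / h ^ 2 - a₁ / (2 * h))) (lam * h * (1 / h ^ 2 + a₁ / (2 * h)))
    (lam * h * (-2 / h ^ 2)) using 1
  · ext V j k
    simp [opA1, deltaSqx, delta2x, shiftGrid, ← sub_eq_add_neg]
    ring
  · ext V j k
    simp [opA1, deltaSqx, delta2x, shiftGrid, ← sub_eq_add_neg]
    ring
  all_goals
    ext s t
    simp only [exp_I_one, exp_I_neg_one, neg_neg, neg_zero, zSym, xSym]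
    simp only [cos_eq_one_sub_sin_half s]
    push_cast
    have hh' : (h : ℂ) ≠ 0 := by exact_mod_cast hh
    simp
    field_simp
    ring

theorem isMultiplier_Y (hc : c ≠ 0) (hh : h ≠ 0) :
    IsMultiplier (fun V => (lam * h) • opA2 a₂ (c * h) V)
    (fun V => (lam * h) • opA2 (-a₂) (c * h) V) (fun _ t => zSym (lam / c ^ 2) (c * a₂) h t)
    (fun _ t => zSym (lam / c ^ 2) (c * -a₂) h t) := by
  have base : ∀ d e m : ℝ, IsMultiplier
      (fun V => d • shiftGrid 0 (-1) V + m • shiftGrid 0 0 V + e • shiftGrid 0 1 V) _ _ _ :=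
    fun d e m => (((IsMultiplier.shift 0 (-1)).smul d).add ((IsMultiplier.shift 0 0).smul m)).add
      ((IsMultiplier.shift 0 1).smul e)
  convert base (lam * h * (1 / (c * h) ^ 2 - a₂ / (2 * (c * h))))
    (lam * h * (1 / (c * h) ^ 2 + a₂ / (2 * (c * h)))) (lam * h * (-2 / (c * h) ^ 2)) using 1
  · ext V j k
    simp [opA2, deltaSqy, delta2y, shiftGrid, ← sub_eq_add_neg]
    ring
  · ext V j k
    simp [opA2, deltaSqy, delta2y, shiftGrid, ← sub_eq_add_neg]
    ring
  all_goals
    ext s t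
    simp only [exp_I_one, exp_I_neg_one, neg_neg, neg_zero, zSym, xSym]
    simp only [cos_eq_one_sub_sin_half t]
    push_cast
    have hh' : (h : ℂ) ≠ 0 := by exact_mod_cast hh
    have hc' : (c : ℂ) ≠ 0 := by exact_mod_cast hc
    simp
    field_simp
    ring

theorem isMultiplier_mix (hc : c ≠ 0) (hh : h ≠ 0) :
    IsMultiplier (fun V => (lam * h) • opA0 ρ h (c * h) V)
    (fun V => (lam * h) • opA0 ρ h (c * h) V) (fun s t => (xMix ρ c lam h s t : ℂ))
    (fun s t => (xMix ρ c lam h s t : ℂ)) := by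
  have base : ∀ d : ℝ, IsMultiplier (fun V => d • ((shiftGrid 1 1 V + (-1 : ℝ) • shiftGrid (-1) 1 V)
      + ((-1 : ℝ) • shiftGrid 1 (-1) V + shiftGrid (-1) (-1) V))) _ _ _ :=
    fun d => ((((IsMultiplier.shift 1 1)).add ((IsMultiplier.shift (-1) 1).smul (-1))).add
      (((IsMultiplier.shift 1 (-1)).smul (-1)).add ((IsMultiplier.shift (-1) (-1))))).smul d
  convert base (lam * h * (ρ / (2 * h * (c * h)))) using 1
  · ext V j k
    simp [opA0, delta2x, delta2y, shiftGrid, ← sub_eq_add_neg]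
    ring
  · ext V j k
    simp [opA0, delta2x, delta2y, shiftGrid, ← sub_eq_add_neg]
    ring
  all_goals
    ext s t
    simp only [exp_I_one, exp_I_neg_one, neg_neg, xMix]
    push_cast
    have hh' : (h : ℂ) ≠ 0 := by exact_mod_cast hh
    have hc' : (c : ℂ) ≠ 0 := by exact_mod_cast hc
    field_simp
    ring_nf
    simp only [Complex.I_sq]
    ring

end symbols

theorem xSym_nonneg {l h : ℝ} (hl : 0 < l) (hh : 0 < h) (s : ℝ) : 0 ≤ xSym l h s := by
  unfold xSym; positivity

theorem zSym_re (l a h s : ℝ) : (zSym l a h s).re = -xSym l h s := by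
  rw [zSym, Complex.add_re, Complex.re_ofReal_mul, Complex.I_re, Complex.neg_re, Complex.ofReal_re]
  ring

/-- The mixed term is dominated by the two pure second differences. -/
theorem xMix_sq_le {ρ c lam h : ℝ} (hc : 0 < c) (hh : 0 < h) (s t : ℝ) :
    xMix ρ c lam h s t ^ 2 ≤ 4 * ρ ^ 2 * (xSym lam h s * xSym (lam / c ^ 2) h t) := by
  have hs : Real.sin s = 2 * Real.sin (s / 2) * Real.cos (s / 2) := by
    rw [← Real.sin_two_mul]; ring_nf
  have ht : Real.sin t = 2 * Real.sin (t / 2) * Real.cos (t / 2) := by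
    rw [← Real.sin_two_mul]; ring_nf
  have e : xMix ρ c lam h s t ^ 2 = 4 * ρ ^ 2 * (xSym lam h s * xSym (lam / c ^ 2) h t) *
      (Real.cos (s / 2) ^ 2 * Real.cos (t / 2) ^ 2) := by
    unfold xMix xSym
    rw [hs, ht]
    field_simp
    ring
  rw [e]
  have h1 := Real.cos_sq_le_one (s / 2)
  have h2 := Real.cos_sq_le_one (t / 2)
  have h3 : Real.cos (s / 2) ^ 2 * Real.cos (t / 2) ^ 2 ≤ 1 :=
    mul_le_one₀ h1 (sq_nonneg _) h2
  have h4 : 0 ≤ xSym lam h s * xSym (lam / c ^ 2) h t := by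
    have : xSym lam h s * xSym (lam / c ^ 2) h t = (4 * lam / (c * h) *
      (Real.sin (s / 2) * Real.sin (t / 2))) ^ 2 := by
      unfold xSym; field_simp
    rw [this]; positivity
  exact mul_le_of_le_one_right (by positivity) h3

/-- The symbol of `Δt A` has real part at most `-(1 - |ρ|) (x₁ + x₂)`. -/
theorem xMix_le {ρ c lam h : ℝ} (hc : 0 < c) (hlam : 0 < lam) (hh : 0 < h) (s t : ℝ) :
    |xMix ρ c lam h s t| ≤ |ρ| * (xSym lam h s + xSym (lam / c ^ 2) h t) := by
  have h1 := xSym_nonneg hlam hh s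
  have h2 := xSym_nonneg (div_pos hlam (pow_pos hc 2)) hh t
  apply abs_le_of_sq_le_sq _ (by positivity)
  refine (xMix_sq_le hc hh s t).trans ?_
  rw [mul_pow, sq_abs]
  nlinarith [mul_nonneg (sq_nonneg ρ) (sq_nonneg (xSym lam h s - xSym (lam / c ^ 2) h t))]

theorem one_le_norm_one_sub {z : ℂ} (hz : z.re ≤ 0) : 1 ≤ ‖1 - z‖ := by
  refine le_trans ?_ (Complex.re_le_norm _)
  simp; linarith

/-- The amplification factor of one MCS step. -/
def mcsFactor (θ : ℝ) (z₀ z₁ z₂ : ℂ) : ℂ :=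
  1 + (z₀ + z₁ + z₂) / ((1 - θ * z₁) * (1 - θ * z₂)) +
    (θ * z₀ * (z₀ + z₁ + z₂) + (1 / 2 - θ) * (z₀ + z₁ + z₂) ^ 2) /
      ((1 - θ * z₁) * (1 - θ * z₂)) ^ 2

section steps

variable {Z₀ Z₁ Z₂ Z₀' Z₁' Z₂' : Grid → Grid} {σ₀ σ₁ σ₂ σ₀' σ₁' σ₂' : ℝ → ℝ → ℂ} {θ : ℝ}

theorem IsMultiplier.sum (h₀ : IsMultiplier Z₀ Z₀' σ₀ σ₀') (h₁ : IsMultiplier Z₁ Z₁' σ₁ σ₁')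
    (h₂ : IsMultiplier Z₂ Z₂' σ₂ σ₂') : IsMultiplier (fun V => (1 / 2 : ℝ) • (Z₀ V + Z₁ V + Z₂ V))
      (fun V => (1 / 2 : ℝ) • (Z₀' V + Z₁' V + Z₂' V))
      (fun s t => ((1 / 2 : ℝ) : ℂ) * (σ₀ s t + σ₁ s t + σ₂ s t))
      (fun s t => ((1 / 2 : ℝ) : ℂ) * (σ₀' s t + σ₁' s t + σ₂' s t)) :=
  ((h₀.add h₁).add h₂).smul _

/-- Only the adjoint symbols enter, through `IsMultiplier.eq_zero`. -/
theorem isEulerPair_unique (h₀ : IsMultiplier Z₀ Z₀' σ₀ σ₀') (h₁ : IsMultiplier Z₁ Z₁' σ₁ σ₁')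
    (h₂ : IsMultiplier Z₂ Z₂' σ₂ σ₂') (hre : ∀ s t, (σ₀' s t + σ₁' s t + σ₂' s t).re ≤ 0)
    {U V V' : Grid} (hV : IsEulerPair Z₀ Z₁ Z₂ U V) (hV' : IsEulerPair Z₀ Z₁ Z₂ U V') :
    V = V' := by
  have hZ := h₀.sum h₁ h₂
  have hn : ∀ s t, 1 ≤ ‖1 - ((1 / 2 : ℝ) : ℂ) * (σ₀' s t + σ₁' s t + σ₂' s t)‖ := fun s t => by
    apply one_le_norm_one_sub
    rw [Complex.re_ofReal_mul]
    linarith [hre s t]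
  obtain ⟨W, hW, hVs, e1, e2⟩ := hV
  obtain ⟨W', hW', hVs', e1', e2'⟩ := hV'
  have : W = W' := hZ.injective hn hW hW' (e1.trans e1'.symm)
  subst this
  exact hZ.injective hn hVs hVs' (e2.trans e2'.symm)

theorem isMCSStep_unique (hθ : 0 ≤ θ) (h₁ : IsMultiplier Z₁ Z₁' σ₁ σ₁')
    (h₂ : IsMultiplier Z₂ Z₂' σ₂ σ₂') (hre₁ : ∀ s t, (σ₁' s t).re ≤ 0)
    (hre₂ : ∀ s t, (σ₂' s t).re ≤ 0)
    {U V V' : Grid} (hV : IsMCSStep θ Z₀ Z₁ Z₂ U V) (hV' : IsMCSStep θ Z₀ Z₁ Z₂ U V') :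
    V = V' := by
  have hn₁ : ∀ s t, 1 ≤ ‖1 - (θ : ℂ) * σ₁' s t‖ := fun s t => by
    apply one_le_norm_one_sub
    rw [Complex.re_ofReal_mul]
    exact mul_nonpos_of_nonneg_of_nonpos hθ (hre₁ s t)
  have hn₂ : ∀ s t, 1 ≤ ‖1 - (θ : ℂ) * σ₂' s t‖ := fun s t => by
    apply one_le_norm_one_sub
    rw [Complex.re_ofReal_mul]
    exact mul_nonpos_of_nonneg_of_nonpos hθ (hre₂ s t)
  obtain ⟨Y₀, Y₁, Y₂, Yh, Yt₀, Yt₁, q₁, q₂, q₃, q₄, e₁, e₂, e₃, e₄, e₅, e₆, e₇⟩ := hV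
  obtain ⟨Y₀', Y₁', Y₂', Yh', Yt₀', Yt₁', q₁', q₂', q₃', q₄', e₁', e₂', e₃', e₄', e₅', e₆', e₇'⟩ := hV'
  obtain rfl : Y₀ = Y₀' := e₁.trans e₁'.symm
  obtain rfl : Y₁ = Y₁' := (h₁.smul θ).injective hn₁ q₁ q₁' (e₂.trans e₂'.symm)
  obtain rfl : Y₂ = Y₂' := (h₂.smul θ).injective hn₂ q₂ q₂' (e₃.trans e₃'.symm)
  obtain rfl : Yh = Yh' := e₄.trans e₄'.symm
  obtain rfl : Yt₀ = Yt₀' := e₅.trans e₅'.symm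
  obtain rfl : Yt₁ = Yt₁' := (h₁.smul θ).injective hn₁ q₃ q₃' (e₆.trans e₆'.symm)
  exact (h₂.smul θ).injective hn₂ q₄ q₄' (e₇.trans e₇'.symm)

/-- Two implicit Euler half-steps divide the symbol by `(1 - z / 2) ^ 2`. -/
theorem isEulerPair_gridOf (h₀ : IsMultiplier Z₀ Z₀' σ₀ σ₀') (h₁ : IsMultiplier Z₁ Z₁' σ₁ σ₁')
    (h₂ : IsMultiplier Z₂ Z₂' σ₂ σ₂') (hre : ∀ s t, (σ₀ s t + σ₁ s t + σ₂ s t).re ≤ 0)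
    (k₁ k₂ : ℝ) {E : ℝ → ℝ → ℂ} (hE : IsSymbol E) :
    IsEulerPair Z₀ Z₁ Z₂ (gridOf k₁ k₂ E) (gridOf k₁ k₂ fun s t =>
      E s t / (1 - 1 / 2 * (σ₀ s t + σ₁ s t + σ₂ s t)) ^ 2) := by
  have hZ := h₀.sum h₁ h₂
  have hn : ∀ s t, 1 ≤ ‖1 - ((1 / 2 : ℝ) : ℂ) * (σ₀ s t + σ₁ s t + σ₂ s t)‖ := fun s t => by
    apply one_le_norm_one_sub
    rw [Complex.re_ofReal_mul]
    linarith [hre s t]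
  have key : ∀ F : ℝ → ℝ → ℂ, IsSymbol F →
      IsSymbol (fun s t => F s t / (1 - ((1 / 2 : ℝ) : ℂ) * (σ₀ s t + σ₁ s t + σ₂ s t))) ∧
      gridOf k₁ k₂ (fun s t => F s t / (1 - ((1 / 2 : ℝ) : ℂ) * (σ₀ s t + σ₁ s t + σ₂ s t))) -
      (1 / 2 : ℝ) • (Z₀ (gridOf k₁ k₂ (fun s t => F s t / (1 - ((1 / 2 : ℝ) : ℂ) *
        (σ₀ s t + σ₁ s t + σ₂ s t)))) + Z₁ (gridOf k₁ k₂ (fun s t => F s t / (1 - ((1 / 2 : ℝ) : ℂ) *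
        (σ₀ s t + σ₁ s t + σ₂ s t)))) + Z₂ (gridOf k₁ k₂ (fun s t => F s t / (1 - ((1 / 2 : ℝ) : ℂ) *
        (σ₀ s t + σ₁ s t + σ₂ s t))))) = gridOf k₁ k₂ F := by
    intro F hF
    have hG := hF.div ((IsSymbol.const 1).sub hZ.symbol) one_pos hn
    refine ⟨hG, ?_⟩
    have := hZ.act k₁ k₂ _ hG
    rw [this, ← gridOf_sub hG (hZ.symbol.mul hG)]
    congr 1
    ext s t
    have : 1 - ((1 / 2 : ℝ) : ℂ) * (σ₀ s t + σ₁ s t + σ₂ s t) ≠ 0 := fun h0 => by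
      have := hn s t
      rw [h0, norm_zero] at this
      linarith
    field_simp
  obtain ⟨k1, k2⟩ := key E hE
  obtain ⟨k3, k4⟩ := key _ k1
  have e : (fun s t => E s t / (1 - 1 / 2 * (σ₀ s t + σ₁ s t + σ₂ s t)) ^ 2) =
    fun s t => E s t / (1 - ((1 / 2 : ℝ) : ℂ) * (σ₀ s t + σ₁ s t + σ₂ s t)) /
      (1 - ((1 / 2 : ℝ) : ℂ) * (σ₀ s t + σ₁ s t + σ₂ s t)) := by
    ext s t
    push_cast
    rw [div_div, sq]
  rw [e]
  exact ⟨_, squareSummable_gridOf k1 _ _, squareSummable_gridOf k3 _ _, k2, k4⟩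

/-- `V` is the grid function of the symbol `E`. -/
structure IsGridOf (k₁ k₂ : ℝ) (V : Grid) (E : ℝ → ℝ → ℂ) : Prop where
  symbol : IsSymbol E
  eq : V = gridOf k₁ k₂ E

namespace IsGridOf

variable {k₁ k₂ : ℝ} {V W : Grid} {E F : ℝ → ℝ → ℂ}

theorem add (hV : IsGridOf k₁ k₂ V E) (hW : IsGridOf k₁ k₂ W F) :
    IsGridOf k₁ k₂ (V + W) (fun s t => E s t + F s t) :=
  ⟨hV.symbol.add hW.symbol, by rw [gridOf_add hV.symbol hW.symbol, hV.eq, hW.eq]⟩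

theorem sub (hV : IsGridOf k₁ k₂ V E) (hW : IsGridOf k₁ k₂ W F) :
    IsGridOf k₁ k₂ (V - W) (fun s t => E s t - F s t) :=
  ⟨hV.symbol.sub hW.symbol, by rw [gridOf_sub hV.symbol hW.symbol, hV.eq, hW.eq]⟩

theorem smul (c : ℝ) (hV : IsGridOf k₁ k₂ V E) :
    IsGridOf k₁ k₂ (c • V) (fun s t => c * E s t) :=
  ⟨(IsSymbol.const _).mul hV.symbol, by rw [gridOf_const_mul, hV.eq]⟩

theorem op {T T' : Grid → Grid} {σ σ' : ℝ → ℝ → ℂ} (hV : IsGridOf k₁ k₂ V E)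
    (hT : IsMultiplier T T' σ σ') : IsGridOf k₁ k₂ (T V) (fun s t => σ s t * E s t) :=
  ⟨hT.symbol.mul hV.symbol, by rw [hV.eq, hT.act _ _ _ hV.symbol]⟩

theorem ext (hV : IsGridOf k₁ k₂ V E) (hW : IsGridOf k₁ k₂ W F) (h : ∀ s t, E s t = F s t) :
    V = W := by
  rw [hV.eq, hW.eq]
  congr 1
  ext s t
  exact h s t

end IsGridOf

/-- One MCS step multiplies the symbol by `mcsFactor`: eliminating the six intermediate stages, whose
symbols are rational in those of `Z₀`, `Z₁`, `Z₂`, leaves the closed form of the amplification factor. -/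
theorem isMCSStep_gridOf (hθ : 0 ≤ θ) (h₀ : IsMultiplier Z₀ Z₀' σ₀ σ₀')
    (h₁ : IsMultiplier Z₁ Z₁' σ₁ σ₁') (h₂ : IsMultiplier Z₂ Z₂' σ₂ σ₂')
    (hre₁ : ∀ s t, (σ₁ s t).re ≤ 0) (hre₂ : ∀ s t, (σ₂ s t).re ≤ 0)
    (k₁ k₂ : ℝ) {E : ℝ → ℝ → ℂ} (hE : IsSymbol E) :
    IsMCSStep θ Z₀ Z₁ Z₂ (gridOf k₁ k₂ E) (gridOf k₁ k₂ fun s t =>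
      mcsFactor θ (σ₀ s t) (σ₁ s t) (σ₂ s t) * E s t) := by
  have hn₁ : ∀ s t, 1 ≤ ‖1 - (θ : ℂ) * σ₁ s t‖ := fun s t => by
    apply one_le_norm_one_sub
    rw [Complex.re_ofReal_mul]
    exact mul_nonpos_of_nonneg_of_nonpos hθ (hre₁ s t)
  have hn₂ : ∀ s t, 1 ≤ ‖1 - (θ : ℂ) * σ₂ s t‖ := fun s t => by
    apply one_le_norm_one_sub
    rw [Complex.re_ofReal_mul]
    exact mul_nonpos_of_nonneg_of_nonpos hθ (hre₂ s t)
  have hne₁ : ∀ s t, 1 - (θ : ℂ) * σ₁ s t ≠ 0 := fun s t h0 => by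
    have := hn₁ s t; rw [h0, norm_zero] at this; linarith
  have hne₂ : ∀ s t, 1 - (θ : ℂ) * σ₂ s t ≠ 0 := fun s t h0 => by
    have := hn₂ s t; rw [h0, norm_zero] at this; linarith
  have d₁ := (IsSymbol.const 1).sub ((IsSymbol.const (θ : ℂ)).mul h₁.symbol)
  have d₂ := (IsSymbol.const 1).sub ((IsSymbol.const (θ : ℂ)).mul h₂.symbol)
  have sZ := (h₀.symbol.add h₁.symbol).add h₂.symbol
  have rU : IsGridOf k₁ k₂ (gridOf k₁ k₂ E) E := ⟨hE, rfl⟩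
  -- `y` is the multiplier of `Y₂ - U` and `w` the increment entering the second pair of solves
  obtain ⟨y, hy⟩ : ∃ y : ℝ → ℝ → ℂ, y = fun s t =>
    (σ₀ s t + σ₁ s t + σ₂ s t) * E s t / (1 - θ * σ₁ s t) / (1 - θ * σ₂ s t) := ⟨_, rfl⟩
  obtain ⟨w, hw⟩ : ∃ w : ℝ → ℝ → ℂ, w = fun s t => (σ₀ s t + σ₁ s t + σ₂ s t) * E s t +
    ((θ : ℂ) * σ₀ s t + ((1 / 2 - θ : ℝ) : ℂ) * (σ₀ s t + σ₁ s t + σ₂ s t)) * y s t := ⟨_, rfl⟩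
  have sy : IsSymbol y := hy ▸ ((sZ.mul hE).div d₁ one_pos hn₁).div d₂ one_pos hn₂
  have sw : IsSymbol w := hw ▸ (sZ.mul hE).add
    ((((IsSymbol.const _).mul h₀.symbol).add ((IsSymbol.const _).mul sZ)).mul sy)
  have r0 : IsGridOf k₁ k₂ _ _ := ⟨hE.add (sZ.mul hE), rfl⟩
  have r1 : IsGridOf k₁ k₂ _ _ := ⟨hE.add ((sZ.mul hE).div d₁ one_pos hn₁), rfl⟩
  have r2 : IsGridOf k₁ k₂ _ _ := ⟨hE.add sy, rfl⟩
  have rh : IsGridOf k₁ k₂ _ _ :=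
    ⟨(hE.add (sZ.mul hE)).add ((IsSymbol.const (θ : ℂ)).mul (h₀.symbol.mul sy)), rfl⟩
  have t0 : IsGridOf k₁ k₂ _ _ := ⟨hE.add sw, rfl⟩
  have t1 : IsGridOf k₁ k₂ _ _ := ⟨hE.add (sw.div d₁ one_pos hn₁), rfl⟩
  have t2 : IsGridOf k₁ k₂ _ _ := ⟨hE.add ((sw.div d₁ one_pos hn₁).div d₂ one_pos hn₂), rfl⟩
  have ea : (fun s t => mcsFactor θ (σ₀ s t) (σ₁ s t) (σ₂ s t) * E s t) =
      fun s t => E s t + w s t / (1 - θ * σ₁ s t) / (1 - θ * σ₂ s t) := by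
    ext s t
    simp only [mcsFactor, hw, hy, div_eq_mul_inv, mul_inv, mul_pow, ← inv_pow]
    generalize (1 - θ * σ₁ s t)⁻¹ = i₁
    generalize (1 - θ * σ₂ s t)⁻¹ = i₂
    push_cast
    ring
  rw [ea]
  refine ⟨_, _, _, _, _, _, squareSummable_gridOf r1.symbol _ _,
    squareSummable_gridOf r2.symbol _ _, squareSummable_gridOf t1.symbol _ _,
    squareSummable_gridOf t2.symbol _ _,
    r0.ext (rU.add (((rU.op h₀).add (rU.op h₁)).add (rU.op h₂))) ?_,
    (r1.sub ((r1.op h₁).smul θ)).ext (r0.sub ((rU.op h₁).smul θ)) ?_,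
    (r2.sub ((r2.op h₂).smul θ)).ext (r1.sub ((rU.op h₂).smul θ)) ?_,
    rh.ext ((r0.add ((r2.op h₀).smul θ)).sub ((rU.op h₀).smul θ)) ?_,
    t0.ext ((rh.add ((((r2.op h₀).add (r2.op h₁)).add (r2.op h₂)).smul _)).sub
      ((((rU.op h₀).add (rU.op h₁)).add (rU.op h₂)).smul _)) ?_,
    (t1.sub ((t1.op h₁).smul θ)).ext (t0.sub ((rU.op h₁).smul θ)) ?_,
    (t2.sub ((t2.op h₂).smul θ)).ext (t1.sub ((rU.op h₂).smul θ)) ?_⟩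
  · intro s t; ring
  · intro s t
    linear_combination (σ₀ s t + σ₁ s t + σ₂ s t) * E s t * mul_inv_cancel₀ (hne₁ s t)
  · intro s t
    simp only [hy]
    linear_combination (σ₀ s t + σ₁ s t + σ₂ s t) * E s t * (1 - θ * σ₁ s t)⁻¹ *
      mul_inv_cancel₀ (hne₂ s t)
  · intro s t; ring
  · intro s t; simp only [hw]; ring
  · intro s t
    linear_combination w s t * mul_inv_cancel₀ (hne₁ s t)
  · intro s t
    linear_combination w s t * (1 - θ * σ₁ s t)⁻¹ * mul_inv_cancel₀ (hne₂ s t)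

end steps

/-! ### The numerical solution and its symbol -/

/-- The symbol of `Δt A`. -/
def zTot (ρ a₁ a₂ c lam h s t : ℝ) : ℂ :=
  xMix ρ c lam h s t + zSym lam a₁ h s + zSym (lam / c ^ 2) (c * a₂) h t

/-- The amplification factor of one MCS step, as a function of the angles. -/
def ampl (ρ a₁ a₂ c lam θ h s t : ℝ) : ℂ :=
  mcsFactor θ (xMix ρ c lam h s t) (zSym lam a₁ h s) (zSym (lam / c ^ 2) (c * a₂) h t)

/-- The symbol of the numerical solution after `n` steps. -/
def mainSym (ρ a₁ a₂ c lam θ h : ℝ) (N₀ n : ℕ) (s t : ℝ) : ℂ :=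
  (1 / (1 - 1 / 2 * zTot ρ a₁ a₂ c lam h s t)) ^ (2 * min n N₀) *
    ampl ρ a₁ a₂ c lam θ h s t ^ (n - N₀)

section numerical

variable {ρ c lam θ h : ℝ}

theorem zTot_re (ρ a₁ a₂ c lam h s t : ℝ) : (zTot ρ a₁ a₂ c lam h s t).re =
    xMix ρ c lam h s t - (xSym lam h s + xSym (lam / c ^ 2) h t) := by
  simp only [zTot, Complex.add_re, Complex.ofReal_re, zSym_re]
  ring

/-- Ellipticity of the spatial discretization. With `|ρ| < 1` it makes the implicit Euler steps solvable. -/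
theorem zTot_re_le (hc : 0 < c) (hlam : 0 < lam) (hh : 0 < h) (a₁ a₂ s t : ℝ) :
    (zTot ρ a₁ a₂ c lam h s t).re ≤
      -((1 - |ρ|) * (xSym lam h s + xSym (lam / c ^ 2) h t)) := by
  rw [zTot_re]
  have := (le_abs_self _).trans (xMix_le (ρ := ρ) hc hlam hh s t)
  linarith

theorem zTot_re_nonpos (hρ : |ρ| < 1) (hc : 0 < c) (hlam : 0 < lam) (hh : 0 < h)
    (a₁ a₂ s t : ℝ) : (zTot ρ a₁ a₂ c lam h s t).re ≤ 0 := by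
  have h1 := xSym_nonneg hlam hh s
  have h2 := xSym_nonneg (div_pos hlam (pow_pos hc 2)) hh t
  have := zTot_re_le (ρ := ρ) hc hlam hh a₁ a₂ s t
  nlinarith

theorem isSymbol_mainSym {a₁ a₂ : ℝ} (hρ : |ρ| < 1) (hc : 0 < c) (hlam : 0 < lam)
    (hθ : 0 ≤ θ) (hh : 0 < h) (N₀ n : ℕ) : IsSymbol (mainSym ρ a₁ a₂ c lam θ h N₀ n) := by
  have m0 := (isMultiplier_mix (ρ := ρ) (lam := lam) hc.ne' hh.ne').symbol
  have m1 := (isMultiplier_X (a₁ := a₁) (lam := lam) hh.ne').symbol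
  have m2 := (isMultiplier_Y (a₂ := a₂) (lam := lam) hc.ne' hh.ne').symbol
  have mz := (m0.add m1).add m2
  have hz : ∀ s t, 1 ≤ ‖1 - 1 / 2 * zTot ρ a₁ a₂ c lam h s t‖ := fun s t => by
    apply one_le_norm_one_sub
    have := zTot_re_nonpos hρ hc hlam hh a₁ a₂ s t
    have e : (1 / 2 * zTot ρ a₁ a₂ c lam h s t).re = 1 / 2 * (zTot ρ a₁ a₂ c lam h s t).re := by
      rw [show (1 / 2 : ℂ) = ((1 / 2 : ℝ) : ℂ) by push_cast; rfl, Complex.re_ofReal_mul]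
    rw [e]; linarith
  have hp1 : ∀ s t : ℝ, 1 ≤ ‖1 - (θ : ℂ) * zSym lam a₁ h s‖ := fun s _ => by
    apply one_le_norm_one_sub
    rw [Complex.re_ofReal_mul, zSym_re]
    nlinarith [xSym_nonneg hlam hh s]
  have hp2 : ∀ s t : ℝ, 1 ≤ ‖1 - (θ : ℂ) * zSym (lam / c ^ 2) (c * a₂) h t‖ := fun _ t => by
    apply one_le_norm_one_sub
    rw [Complex.re_ofReal_mul, zSym_re]
    nlinarith [xSym_nonneg (div_pos hlam (pow_pos hc 2)) hh t]
  have hp : ∀ s t : ℝ, 1 ≤ ‖(1 - (θ : ℂ) * zSym lam a₁ h s) *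
      (1 - (θ : ℂ) * zSym (lam / c ^ 2) (c * a₂) h t)‖ := fun s t => by
    rw [norm_mul]; exact one_le_mul_of_one_le_of_one_le (hp1 s t) (hp2 s t)
  have sp := ((IsSymbol.const 1).sub ((IsSymbol.const (θ : ℂ)).mul m1)).mul
    ((IsSymbol.const 1).sub ((IsSymbol.const (θ : ℂ)).mul m2))
  have s1 := (IsSymbol.const 1).div ((IsSymbol.const 1).sub ((IsSymbol.const (1 / 2)).mul mz))
    one_pos hz
  refine (s1.pow _).mul (IsSymbol.pow ?_ _)
  refine ((IsSymbol.const 1).add (mz.div sp one_pos hp)).add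
    (((((IsSymbol.const _).mul m0).mul mz).add ((IsSymbol.const _).mul (mz.pow 2))).div
    (sp.pow 2) one_pos fun s t => ?_)
  rw [norm_pow]
  exact one_le_pow₀ (hp s t)

/-- The scheme has exactly one square-summable solution, the grid function of `mainSym`. -/
theorem isNumericalSolution_gridOf {a₁ a₂ : ℝ} (hρ : |ρ| < 1) (hc : 0 < c) (hlam : 0 < lam)
    (hθ : 0 ≤ θ) (hh : 0 < h) (N₀ N : ℕ) :
    IsNumericalSolution ρ a₁ a₂ θ h (c * h) (lam * h) N₀ N
      (gridOf h (c * h) (mainSym ρ a₁ a₂ c lam θ h N₀ N)) ∧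
    ∀ W : Grid, IsNumericalSolution ρ a₁ a₂ θ h (c * h) (lam * h) N₀ N W →
      W = gridOf h (c * h) (mainSym ρ a₁ a₂ c lam θ h N₀ N) := by
  have m0 := isMultiplier_mix (ρ := ρ) (lam := lam) hc.ne' hh.ne'
  have m1 := isMultiplier_X (a₁ := a₁) (lam := lam) hh.ne'
  have m2 := isMultiplier_Y (a₂ := a₂) (lam := lam) hc.ne' hh.ne'
  have hre1 : ∀ a s : ℝ, (zSym lam a h s).re ≤ 0 := fun a s => by
    rw [zSym_re]; linarith [xSym_nonneg hlam hh s]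
  have hre2 : ∀ a t : ℝ, (zSym (lam / c ^ 2) a h t).re ≤ 0 := fun a t => by
    rw [zSym_re]; linarith [xSym_nonneg (div_pos hlam (pow_pos hc 2)) hh t]
  have hstart : gridOf h (c * h) (mainSym ρ a₁ a₂ c lam θ h N₀ 0) = diracGrid h (c * h) := by
    rw [← gridOf_one]
    congr 1
    ext s t
    simp [mainSym]
  have hE : ∀ n, n < N₀ → IsEulerPair (fun V => (lam * h) • opA0 ρ h (c * h) V)
      (fun V => (lam * h) • opA1 a₁ h V) (fun V => (lam * h) • opA2 a₂ (c * h) V)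
      (gridOf h (c * h) (mainSym ρ a₁ a₂ c lam θ h N₀ n))
      (gridOf h (c * h) (mainSym ρ a₁ a₂ c lam θ h N₀ (n + 1))) := by
    intro n hn
    have := isEulerPair_gridOf m0 m1 m2 (fun s t => zTot_re_nonpos hρ hc hlam hh a₁ a₂ s t)
      h (c * h) (isSymbol_mainSym (a₁ := a₁) (a₂ := a₂) hρ hc hlam hθ hh N₀ n)
    convert this using 2
    ext s t
    rw [mainSym, mainSym, min_eq_left hn.le, min_eq_left (Nat.succ_le_of_lt hn),
      Nat.sub_eq_zero_of_le hn.le, Nat.sub_eq_zero_of_le (Nat.succ_le_of_lt hn)]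
    rw [pow_zero, mul_one, mul_one, one_div_pow, one_div_pow, div_div, ← zTot, ← pow_add]
    rfl
  have hM : ∀ n, N₀ ≤ n → IsMCSStep θ (fun V => (lam * h) • opA0 ρ h (c * h) V)
      (fun V => (lam * h) • opA1 a₁ h V) (fun V => (lam * h) • opA2 a₂ (c * h) V)
      (gridOf h (c * h) (mainSym ρ a₁ a₂ c lam θ h N₀ n))
      (gridOf h (c * h) (mainSym ρ a₁ a₂ c lam θ h N₀ (n + 1))) := by
    intro n hn
    have := isMCSStep_gridOf hθ m0 m1 m2 (fun s t => hre1 _ s) (fun s t => hre2 _ t)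
      h (c * h) (isSymbol_mainSym (a₁ := a₁) (a₂ := a₂) hρ hc hlam hθ hh N₀ n)
    convert this using 2
    ext s t
    rw [mainSym, mainSym, min_eq_right hn, min_eq_right (hn.trans n.le_succ), Nat.succ_sub hn,
      pow_succ]
    simp only [ampl]
    ring
  refine ⟨⟨fun n => gridOf h (c * h) (mainSym ρ a₁ a₂ c lam θ h N₀ n), hstart,
    fun n _ => ⟨hE n, hM n⟩, rfl⟩, ?_⟩
  rintro W ⟨U, hU0, hU, rfl⟩
  have : ∀ n ≤ N, U n = gridOf h (c * h) (mainSym ρ a₁ a₂ c lam θ h N₀ n) := by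
    intro n
    induction n with
    | zero => intro _; rw [hU0, hstart]
    | succ n ih =>
      intro hn
      have hn' := ih (Nat.le_of_succ_le hn)
      obtain ⟨u1, u2⟩ := hU n hn
      rw [hn'] at u1 u2
      rcases lt_or_ge n N₀ with hlt | hge
      · refine isEulerPair_unique m0 m1 m2 (fun s t => ?_) (u1 hlt) (hE n hlt)
        exact zTot_re_nonpos hρ hc hlam hh (-a₁) (-a₂) s t
      · exact isMCSStep_unique hθ m1 m2 (fun s t => hre1 _ s) (fun s t => hre2 _ t)
          (u2 hge) (hM n hge)
  exact this N le_rfl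

end numerical

/-! ### Uniform order estimates -/

/-- A set of parameters with a small scale `h` and a large scale `y`, such that `h y⁸` stays
bounded. The large scale is a wavenumber or a reciprocal angle; the exponent `8` is the largest one
that occurs in the local error of a time step. -/
structure Scale (α : Type) where
  dom : Set α
  h : α → ℝ
  y : α → ℝ
  h_pos : ∀ x ∈ dom, 0 < h x
  h_le : ∀ x ∈ dom, h x ≤ 1
  one_le : ∀ x ∈ dom, 1 ≤ y x
  bound : ∃ C : ℝ, ∀ x ∈ dom, h x * y x ^ 8 ≤ C

namespace Scale

variable {α : Type} {S : Scale α} {f g : α → ℂ} {n m : ℤ} {k l : ℕ}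

/-- `f = O(hⁿ yᵏ)` uniformly on the parameter set. -/
def Big (S : Scale α) (n : ℤ) (k : ℕ) (f : α → ℂ) : Prop :=
  ∃ C : ℝ, 0 ≤ C ∧ ∀ x ∈ S.dom, ‖f x‖ ≤ C * (S.h x ^ n * S.y x ^ k)

theorem pos (n : ℤ) (k : ℕ) {x : α} (hx : x ∈ S.dom) : 0 < S.h x ^ n * S.y x ^ k :=
  mul_pos (zpow_pos (S.h_pos x hx) n) (pow_pos (lt_of_lt_of_le one_pos (S.one_le x hx)) k)

theorem Big.of_le {C : ℝ} (h : ∀ x ∈ S.dom, ‖f x‖ ≤ C * (S.h x ^ n * S.y x ^ k)) :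
    S.Big n k f :=
  ⟨|C|, abs_nonneg C, fun x hx => (h x hx).trans
    (mul_le_mul_of_nonneg_right (le_abs_self C) (S.pos n k hx).le)⟩

theorem Big.congr (hf : S.Big n k f) (h : ∀ x ∈ S.dom, g x = f x) : S.Big n k g := by
  obtain ⟨C, hC, hf⟩ := hf
  exact ⟨C, hC, fun x hx => by rw [h x hx]; exact hf x hx⟩

theorem Big.of_norm_le (hf : S.Big n k f) (h : ∀ x ∈ S.dom, ‖g x‖ ≤ ‖f x‖) : S.Big n k g := by
  obtain ⟨C, hC, hf⟩ := hf
  exact ⟨C, hC, fun x hx => (h x hx).trans (hf x hx)⟩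

theorem Big.mono (hf : S.Big n k f) (hmn : m ≤ n) (hkl : k ≤ l) : S.Big m l f := by
  obtain ⟨C, hC, hf⟩ := hf
  refine ⟨C, hC, fun x hx => (hf x hx).trans (mul_le_mul_of_nonneg_left ?_ hC)⟩
  exact mul_le_mul (zpow_le_zpow_right_of_le_one₀ (S.h_pos x hx) (S.h_le x hx) hmn)
    (pow_le_pow_right₀ (S.one_le x hx) hkl) (pow_nonneg (zero_le_one.trans (S.one_le x hx)) k)
    (zpow_pos (S.h_pos x hx) m).le

theorem Big.add (hf : S.Big n k f) (hg : S.Big n k g) : S.Big n k (fun x => f x + g x) := by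
  obtain ⟨C, hC, hf⟩ := hf
  obtain ⟨D, hD, hg⟩ := hg
  refine ⟨C + D, add_nonneg hC hD, fun x hx => (norm_add_le _ _).trans ?_⟩
  rw [add_mul]
  exact add_le_add (hf x hx) (hg x hx)

theorem Big.mul (hf : S.Big n k f) (hg : S.Big m l g) :
    S.Big (n + m) (k + l) (fun x => f x * g x) := by
  obtain ⟨C, hC, hf⟩ := hf
  obtain ⟨D, hD, hg⟩ := hg
  refine ⟨C * D, mul_nonneg hC hD, fun x hx => ?_⟩
  rw [norm_mul, zpow_add₀ (S.h_pos x hx).ne', pow_add]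
  calc ‖f x‖ * ‖g x‖ ≤ (C * (S.h x ^ n * S.y x ^ k)) * (D * (S.h x ^ m * S.y x ^ l)) :=
        mul_le_mul (hf x hx) (hg x hx) (norm_nonneg _) (mul_nonneg hC (S.pos n k hx).le)
    _ = _ := by ring

theorem Big.const (c : ℂ) : S.Big 0 0 (fun _ => c) :=
  .of_le (C := ‖c‖) fun x _ => by simp

theorem Big.const_mul (c : ℂ) (hf : S.Big n k f) : S.Big n k (fun x => c * f x) := by
  simpa using (Big.const c).mul hf

theorem Big.neg (hf : S.Big n k f) : S.Big n k (fun x => -f x) :=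
  hf.of_norm_le fun x _ => by rw [norm_neg]

theorem Big.sub (hf : S.Big n k f) (hg : S.Big n k g) : S.Big n k (fun x => f x - g x) := by
  simpa [sub_eq_add_neg] using hf.add hg.neg

theorem Big.pow (hf : S.Big n k f) (m : ℕ) : S.Big (m * n) (m * k) (fun x => f x ^ m) := by
  induction m with
  | zero => simpa using Big.const (S := S) 1
  | succ m ih =>
    have := ih.mul hf
    simp only [← pow_succ] at this
    convert this using 1
    · push_cast; ring
    · ring

theorem Big.h_zpow (n : ℤ) : S.Big n 0 (fun x => ((S.h x ^ n : ℝ) : ℂ)) :=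
  .of_le (C := 1) fun x hx => by
    rw [Complex.norm_real, Real.norm_of_nonneg (zpow_pos (S.h_pos x hx) n).le]; simp

/-- One power of `h` pays for eight powers of `y`. -/
theorem Big.trade (hf : S.Big (n + 1) (k + 8) f) : S.Big n k f := by
  obtain ⟨C, hC, hf⟩ := hf
  obtain ⟨B, hB⟩ := S.bound
  refine .of_le (C := C * B) fun x hx => (hf x hx).trans ?_
  rw [zpow_add_one₀ (S.h_pos x hx).ne', pow_add]
  calc C * (S.h x ^ n * S.h x * (S.y x ^ k * S.y x ^ 8))
      = C * (S.h x ^ n * S.y x ^ k) * (S.h x * S.y x ^ 8) := by ring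
    _ ≤ C * (S.h x ^ n * S.y x ^ k) * B :=
        mul_le_mul_of_nonneg_left (hB x hx) (mul_nonneg hC (S.pos n k hx).le)
    _ = _ := by ring

theorem Big.bounded (hf : S.Big 1 8 f) : S.Big 0 0 f := Big.trade (by simpa using hf)

/-- Taylor expansion of the exponential. -/
theorem Big.exp_sub_sum (hf : S.Big n k f) (h0 : S.Big 0 0 f) (m : ℕ) :
    S.Big (m * n) (m * k) (fun x => Complex.exp (f x) -
      ∑ i ∈ Finset.range m, f x ^ i / (i.factorial : ℂ)) := by
  obtain ⟨C, hC, h0⟩ := h0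
  refine Big.of_norm_le ((hf.pow m).const_mul (Real.exp C : ℂ)) fun x hx => ?_
  rw [norm_mul, norm_pow, Complex.norm_real, Real.norm_of_nonneg (Real.exp_pos _).le, mul_comm]
  refine (Complex.norm_exp_sub_sum_le_norm_mul_exp _ _).trans ?_
  have := h0 x hx
  simp only [zpow_zero, pow_zero, mul_one] at this
  exact mul_le_mul_of_nonneg_left (Real.exp_le_exp.2 this) (pow_nonneg (norm_nonneg _) m)

theorem Big.exp (h0 : S.Big 0 0 f) : S.Big 0 0 (fun x => Complex.exp (f x)) := by
  simpa using h0.exp_sub_sum h0 0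

theorem Big.pow_sub_one (hf : S.Big n k f) (h0 : S.Big 0 0 f) (m : ℕ) :
    S.Big n k (fun x => (1 + f x) ^ m - 1) := by
  induction m with
  | zero => simpa using (Big.const (S := S) 0).mul hf
  | succ m ih =>
    have h1 : S.Big 0 0 (fun x => 1 + f x) := (Big.const 1).add h0
    have h2 : S.Big n k (fun x => ((1 + f x) ^ m - 1) * (1 + f x)) := by simpa using ih.mul h1
    exact (h2.add hf).congr fun x _ => by ring

/-- The elementary bound `(1 + x) ^ m - 1 ≤ m x exp (m x)`, which turns a local error per step into a
global one. -/
theorem norm_one_add_pow_sub_one_le (a : ℂ) (m : ℕ) :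
    ‖(1 + a) ^ m - 1‖ ≤ m * ‖a‖ * Real.exp (m * ‖a‖) := by
  have h1 : ‖(1 + a) ^ m - 1‖ ≤ (1 + ‖a‖) ^ m - 1 := by
    induction m with
    | zero => simp
    | succ m ih =>
      have e : (1 + a) ^ (m + 1) - 1 = ((1 + a) ^ m - 1) * (1 + a) + a := by ring
      rw [e]
      refine (norm_add_le _ _).trans ?_
      rw [norm_mul]
      have h2 : ‖1 + a‖ ≤ 1 + ‖a‖ := (norm_add_le _ _).trans (by simp)
      have h3 : (0 : ℝ) ≤ (1 + ‖a‖) ^ m - 1 := (norm_nonneg _).trans ih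
      have h4 := mul_le_mul ih h2 (norm_nonneg _) h3
      calc _ ≤ ((1 + ‖a‖) ^ m - 1) * (1 + ‖a‖) + ‖a‖ := by linarith
        _ = _ := by ring
  refine h1.trans ?_
  have h2 : (1 + ‖a‖) ^ m ≤ Real.exp (m * ‖a‖) := by
    rw [Real.exp_nat_mul]
    refine pow_le_pow_left₀ (by positivity) ?_ m
    linarith [Real.add_one_le_exp ‖a‖]
  have h3 := Real.add_one_le_exp (-(m * ‖a‖))
  have h4 := Real.exp_pos (m * ‖a‖)
  have h5 : Real.exp (m * ‖a‖) * Real.exp (-(m * ‖a‖)) = 1 := by rw [← Real.exp_add]; simp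
  nlinarith [mul_le_mul_of_nonneg_left h3 h4.le]

/-- Compound growth: if `f = O(hⁿ⁺¹ yᵏ)`, then `(1 + f)ᴹ = 1 + O(hⁿ yᵏ)` for `M = O(1/h)`. -/
theorem Big.pow_nat (hf : S.Big (n + 1) k f) (hn : 1 ≤ n) (hk : k ≤ 8) {M : α → ℕ} {K : ℝ}
    (hM : ∀ x ∈ S.dom, M x * S.h x ≤ K) : S.Big n k (fun x => (1 + f x) ^ M x - 1) := by
  obtain ⟨C, hC, hf⟩ := hf
  obtain ⟨B, hB⟩ := S.bound
  refine .of_le (C := |K| * C * Real.exp (|K| * C * |B|)) fun x hx =>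
    (norm_one_add_pow_sub_one_le _ _).trans ?_
  have h1 : M x * ‖f x‖ ≤ |K| * C * (S.h x ^ n * S.y x ^ k) := by
    calc M x * ‖f x‖ ≤ M x * (C * (S.h x ^ (n + 1) * S.y x ^ k)) :=
          mul_le_mul_of_nonneg_left (hf x hx) (Nat.cast_nonneg _)
      _ = (M x * S.h x) * (C * (S.h x ^ n * S.y x ^ k)) := by
          rw [zpow_add_one₀ (S.h_pos x hx).ne']; ring
      _ ≤ |K| * (C * (S.h x ^ n * S.y x ^ k)) :=
          mul_le_mul_of_nonneg_right ((hM x hx).trans (le_abs_self K))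
            (mul_nonneg hC (S.pos n k hx).le)
      _ = _ := by ring
  have h2 : S.h x ^ n * S.y x ^ k ≤ |B| := by
    refine le_trans ?_ ((hB x hx).trans (le_abs_self B))
    have := zpow_le_zpow_right_of_le_one₀ (S.h_pos x hx) (S.h_le x hx) hn
    rw [zpow_one] at this
    exact mul_le_mul this (pow_le_pow_right₀ (S.one_le x hx) hk)
      (pow_nonneg (zero_le_one.trans (S.one_le x hx)) k) (S.h_pos x hx).le
  have h3 : M x * ‖f x‖ ≤ |K| * C * |B| :=
    h1.trans (mul_le_mul_of_nonneg_left h2 (by positivity))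
  calc M x * ‖f x‖ * Real.exp (M x * ‖f x‖)
      ≤ |K| * C * (S.h x ^ n * S.y x ^ k) * Real.exp (|K| * C * |B|) :=
        mul_le_mul h1 (Real.exp_le_exp.2 h3) (Real.exp_pos _).le
          ((by positivity : (0:ℝ) ≤ M x * ‖f x‖).trans h1)
    _ = _ := by ring

theorem Big.inv_of_le {b : ℝ} (hb : 0 < b) (h : ∀ x ∈ S.dom, b ≤ ‖f x‖ * (S.h x ^ n * S.y x ^ k)) :
    S.Big n k (fun x => 1 / f x) :=
  .of_le (C := 1 / b) fun x hx => by
    have h1 := h x hx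
    have h2 : 0 < ‖f x‖ := by
      rcases (norm_nonneg (f x)).eq_or_lt with h0 | h0
      · rw [← h0, zero_mul] at h1; linarith
      · exact h0
    rw [norm_div, norm_one, div_le_iff₀ h2]
    calc (1 : ℝ) = 1 / b * b := by field_simp
      _ ≤ 1 / b * (‖f x‖ * (S.h x ^ n * S.y x ^ k)) :=
          mul_le_mul_of_nonneg_left h1 (by positivity)
      _ = _ := by ring

theorem Big.pow_sub_pow (hf : S.Big n k f) (hg : S.Big n k g)
    (hfg : S.Big (n + 1) l (fun x => f x - g x)) (hkl : k ≤ l) (m : ℕ) :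
    S.Big (m * n + 1) (m * l) (fun x => f x ^ m - g x ^ m) := by
  induction m with
  | zero => simpa using (Big.const (S := S) 0).mul (Big.h_zpow 1)
  | succ m ih =>
    have h1 := ih.mul hf
    have h2 := (hg.pow m).mul hfg
    have h1' : S.Big ((m + 1 : ℕ) * n + 1) ((m + 1) * l)
        (fun x => (f x ^ m - g x ^ m) * f x) :=
      h1.mono (by push_cast; linarith) (by nlinarith)
    have h2' : S.Big ((m + 1 : ℕ) * n + 1) ((m + 1) * l)
        (fun x => g x ^ m * (f x - g x)) :=
      h2.mono (by push_cast; linarith) (by nlinarith [Nat.mul_le_mul_left m hkl])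
    exact (h1'.add h2').congr fun x _ => by ring

/-- Third-order expansion of the sine. -/
theorem Big.sin {r : α → ℝ} (hr : S.Big n k (fun x => (r x : ℂ)))
    (h0 : S.Big 0 0 (fun x => (r x : ℂ))) :
    S.Big (5 * n) (5 * k) (fun x => ((Real.sin (r x) - (r x - r x ^ 3 / 6) : ℝ) : ℂ)) := by
  have h1 := (hr.const_mul Complex.I).exp_sub_sum (h0.const_mul Complex.I) 5
  refine h1.of_norm_le fun x _ => ?_
  rw [Complex.norm_real]
  refine le_trans (le_of_eq ?_) (Complex.abs_im_le_norm _)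
  rw [Real.norm_eq_abs]
  congr 1
  have e : Complex.exp (Complex.I * r x) - ∑ i ∈ Finset.range 5,
      (Complex.I * (r x : ℂ)) ^ i / (i.factorial : ℂ) =
      ((Real.cos (r x) - (1 - r x ^ 2 / 2 + r x ^ 4 / 24) : ℝ) : ℂ) +
      ((Real.sin (r x) - (r x - r x ^ 3 / 6) : ℝ) : ℂ) * Complex.I := by
    rw [mul_comm Complex.I, Complex.exp_mul_I]
    simp only [Finset.sum_range_succ, Finset.sum_range_zero, mul_pow, Complex.I_sq,
      Complex.I_pow_three, Complex.I_pow_four, Nat.factorial]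
    push_cast
    ring
  simp only [e]
  rw [Complex.add_im, Complex.im_ofReal_mul, Complex.I_im, Complex.ofReal_im]
  ring

/-- Fifth-order expansion of the cosine. -/
theorem Big.cos {r : α → ℝ} (hr : S.Big n k (fun x => (r x : ℂ)))
    (h0 : S.Big 0 0 (fun x => (r x : ℂ))) :
    S.Big (6 * n) (6 * k) (fun x => ((Real.cos (r x) - (1 - r x ^ 2 / 2 + r x ^ 4 / 24) : ℝ) : ℂ)) := by
  have h1 := (hr.const_mul Complex.I).exp_sub_sum (h0.const_mul Complex.I) 6
  refine h1.of_norm_le fun x _ => ?_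
  rw [Complex.norm_real]
  refine le_trans (le_of_eq ?_) (Complex.abs_re_le_norm _)
  rw [Real.norm_eq_abs]
  congr 1
  have e : Complex.exp (Complex.I * r x) - ∑ i ∈ Finset.range 6,
      (Complex.I * (r x : ℂ)) ^ i / (i.factorial : ℂ) =
      ((Real.cos (r x) - (1 - r x ^ 2 / 2 + r x ^ 4 / 24) : ℝ) : ℂ) +
      ((Real.sin (r x) - (r x - r x ^ 3 / 6 + r x ^ 5 / 120) : ℝ) : ℂ) * Complex.I := by
    have hI : Complex.I ^ 5 = Complex.I := by rw [pow_succ, Complex.I_pow_four, one_mul]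
    rw [mul_comm Complex.I, Complex.exp_mul_I]
    simp only [Finset.sum_range_succ, Finset.sum_range_zero, mul_pow, Complex.I_sq,
      Complex.I_pow_three, Complex.I_pow_four, hI, Nat.factorial]
    push_cast
    ring
  simp only [e]
  rw [Complex.add_re, Complex.re_ofReal_mul, Complex.I_re, Complex.ofReal_re]
  ring

end Scale

/-! ### Low wavenumbers -/

/-- The phase at low wavenumbers, `κ² + η²`. -/
def phaseLow (c h s t : ℝ) : ℝ := (s / h) ^ 2 + (t / (c * h)) ^ 2

/-- The symbol of `∂ₓ² + a ∂ₓ`. -/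
def psi (a κ : ℝ) : ℂ := -(κ : ℂ) ^ 2 + Complex.I * a * κ

/-- The symbol of the differential operator of the model problem. -/
def psiL (ρ a₁ a₂ κ η : ℝ) : ℂ := psi a₁ κ + psi a₂ η - 2 * ρ * κ * η

/-- The `h²`-coefficient of the symbol of the difference operator `A`. -/
def psiS (ρ a₁ a₂ c κ η : ℝ) : ℂ :=
  (κ : ℂ) ^ 4 / 12 + ρ * ((κ : ℂ) ^ 3 * η + c ^ 2 * κ * η ^ 3) / 3 + c ^ 2 * (η : ℂ) ^ 4 / 12
    - Complex.I * a₁ * κ ^ 3 / 6 - Complex.I * a₂ * c ^ 2 * η ^ 3 / 6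

/-- The `h²`-coefficient of the symbol of the numerical solution relative to that of the exact
solution. -/
def lowPoly (ρ a₁ a₂ c lam θ : ℝ) (N₀ : ℕ) (κ η : ℝ) : ℂ :=
  psiS ρ a₁ a₂ c κ η - lam ^ 2 * θ ^ 2 * (psi a₁ κ * psi a₂ η * psiL ρ a₁ a₂ κ η)
    + lam ^ 2 / 12 * psiL ρ a₁ a₂ κ η ^ 3
    - lam ^ 2 * (psiL ρ a₁ a₂ κ η * (-(ρ * κ * η) + (1 / 2 - θ) * (psi a₁ κ + psi a₂ η)) ^ 2)
    + N₀ * lam ^ 2 / 4 * psiL ρ a₁ a₂ κ η ^ 2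

/-- The low-wavenumber approximation of the symbol of the numerical solution. -/
def lowSym (ρ a₁ a₂ c lam θ : ℝ) (N₀ : ℕ) (h s t : ℝ) : ℂ :=
  Complex.exp (psiL ρ a₁ a₂ (s / h) (t / (c * h))) *
    (1 + h ^ 2 * lowPoly ρ a₁ a₂ c lam θ N₀ (s / h) (t / (c * h)))

namespace Scale

variable {α : Type} {S : Scale α}

theorem Big.mul_sub_mul {f f' g g' : α → ℂ} {n m : ℤ} {k l : ℕ} (hf : S.Big n k f)
    (hg : S.Big m l g') (hff : S.Big (n + 2) (k + 2) (fun x => f x - f' x))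
    (hgg : S.Big (m + 2) (l + 2) (fun x => g x - g' x)) :
    S.Big (n + m + 2) (k + l + 2) (fun x => f x * g x - f' x * g' x) := by
  have h1 := (hf.mul hgg).mono (m := n + m + 2) (l := k + l + 2) (by linarith) (by omega)
  have h2 := (hff.mul hg).mono (m := n + m + 2) (l := k + l + 2) (by linarith) (by omega)
  exact (h1.add h2).congr fun x _ => by ring

/-- Expansion of the symbol of a one-dimensional difference operator. -/
theorem Big.zSym_low (l a d : ℝ) {κ : α → ℝ} (hκ : S.Big 0 1 (fun x => (κ x : ℂ))) :
    S.Big 5 6 (fun x => zSym l a (S.h x) (d * S.h x * κ x) -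
      (l * d ^ 2 * S.h x * (-(κ x : ℂ) ^ 2) + l * a * d * S.h x * (Complex.I * κ x) +
      (S.h x : ℂ) ^ 3 * (l * d ^ 4 * κ x ^ 4 / 12 - Complex.I * (l * a * d ^ 3) * κ x ^ 3 / 6))) := by
  have hh : S.Big 1 0 (fun x => (S.h x : ℂ)) := by simpa using Big.h_zpow (S := S) 1
  have hh' : S.Big (-1) 0 (fun x => ((S.h x : ℂ))⁻¹) := by simpa using Big.h_zpow (S := S) (-1)
  have hs : S.Big 1 1 (fun x => ((d * S.h x * κ x : ℝ) : ℂ)) :=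
    ((hh.mul hκ).const_mul d).congr fun x _ => by push_cast; ring
  have h0 : S.Big 0 0 (fun x => ((d * S.h x * κ x : ℝ) : ℂ)) :=
    (hs.mono le_rfl (by norm_num : 1 ≤ 8)).bounded
  have h1 := ((hh'.mul (hs.cos h0)).const_mul (2 * l)).mono (m := 5) (l := 6) (by norm_num)
    (by norm_num)
  have h2 := ((hs.sin h0).const_mul (l * a * Complex.I)).mono (m := 5) (l := 6) (by norm_num)
    (by norm_num)
  refine (h1.add h2).congr fun x hx => ?_
  have hx0 : (S.h x : ℂ) ≠ 0 := by exact_mod_cast (S.h_pos x hx).ne'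
  have e : Real.sin (d * S.h x * κ x / 2) ^ 2 = (1 - Real.cos (d * S.h x * κ x)) / 2 := by
    rw [cos_eq_one_sub_sin_half]; ring
  unfold zSym xSym
  rw [e]
  generalize Real.cos (d * S.h x * κ x) = C
  generalize Real.sin (d * S.h x * κ x) = D
  push_cast
  field_simp
  ring

/-- Expansion of the symbol of the mixed difference operator. -/
theorem Big.xMix_low (ρ c lam : ℝ) (hc : c ≠ 0) {κ η : α → ℝ}
    (hκ : S.Big 0 1 (fun x => (κ x : ℂ))) (hη : S.Big 0 1 (fun x => (η x : ℂ))) :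
    S.Big 5 6 (fun x => (xMix ρ c lam (S.h x) (S.h x * κ x) (c * S.h x * η x) : ℂ) -
      (-(2 * lam * ρ) * S.h x * κ x * η x +
      (S.h x : ℂ) ^ 3 * (lam * ρ * (κ x ^ 3 * η x + c ^ 2 * κ x * η x ^ 3) / 3))) := by
  have hh : S.Big 1 0 (fun x => (S.h x : ℂ)) := by simpa using Big.h_zpow (S := S) 1
  have hh' : S.Big (-1) 0 (fun x => ((S.h x : ℂ))⁻¹) := by simpa using Big.h_zpow (S := S) (-1)
  have hs : S.Big 1 1 (fun x => ((S.h x * κ x : ℝ) : ℂ)) :=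
    (hh.mul hκ).congr fun x _ => by push_cast; ring
  have ht : S.Big 1 1 (fun x => ((c * S.h x * η x : ℝ) : ℂ)) :=
    ((hh.mul hη).const_mul c).congr fun x _ => by push_cast; ring
  have hs0 := (hs.mono le_rfl (by norm_num : 1 ≤ 8)).bounded
  have ht0 := (ht.mono le_rfl (by norm_num : 1 ≤ 8)).bounded
  have es := hs.sin hs0
  have et := ht.sin ht0
  have hs1 : S.Big 1 1 (fun x => ((Real.sin (S.h x * κ x) : ℝ) : ℂ)) := hs.of_norm_le fun x _ => by
    rw [Complex.norm_real, Complex.norm_real]; exact Real.abs_sin_le_abs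
  have ht1 : S.Big 1 1 (fun x => ((Real.sin (c * S.h x * η x) : ℝ) : ℂ)) :=
    ht.of_norm_le fun x _ => by
      rw [Complex.norm_real, Complex.norm_real]; exact Real.abs_sin_le_abs
  have b1 := (es.mul ht1).mono (m := 6) (l := 6) (by norm_num) (by norm_num)
  have b2 := (hs1.mul et).mono (m := 6) (l := 6) (by norm_num) (by norm_num)
  have b3 := ((es.mul et).mono (m := 9 + 1) (l := 2 + 8) (by norm_num) (by norm_num)).trade.mono
    (m := 6) (l := 6) (by norm_num) (by norm_num)
  have b4 := (((hs.pow 3).mul (ht.pow 3)).const_mul (1 / 36)).mono (m := 6) (l := 6)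
    (by norm_num) (by norm_num)
  have b5 := ((hh'.mul (((b1.add b2).sub b3).add b4)).const_mul (-(2 * lam * ρ) / c)).mono
    (m := 5) (l := 6) (by norm_num) (by norm_num)
  refine b5.congr fun x hx => ?_
  have hx0 : (S.h x : ℂ) ≠ 0 := by exact_mod_cast (S.h_pos x hx).ne'
  have hc0 : (c : ℂ) ≠ 0 := by exact_mod_cast hc
  unfold xMix
  generalize Real.sin (c * S.h x * η x) = C
  generalize Real.sin (S.h x * κ x) = D
  push_cast
  field_simp
  ring

/-- Each of `j` surplus powers of `h` pays for eight powers of `y`. -/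
theorem Big.trade_to {f : α → ℂ} {n m : ℤ} {k l : ℕ} (j : ℕ) (hf : S.Big n k f) (hn : m + j ≤ n)
    (hk : k ≤ l + 8 * j) : S.Big m l f := by
  induction j generalizing m l with
  | zero => exact hf.mono (by simpa using hn) (by simpa using hk)
  | succ j ih =>
    exact (ih (m := m + 1) (l := l + 8) (by push_cast at hn ⊢; linarith) (by linarith)).trade

theorem _root_.RannacherMCS.mcsFactor_eq (θ : ℝ) (z₀ z₁ z₂ : ℂ) : mcsFactor θ z₀ z₁ z₂ =
    1 + (z₀ + z₁ + z₂) * (1 / ((1 - θ * z₁) * (1 - θ * z₂))) +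
    (θ * z₀ * (z₀ + z₁ + z₂) + (1 / 2 - θ) * (z₀ + z₁ + z₂) ^ 2) *
      (1 / ((1 - θ * z₁) * (1 - θ * z₂))) ^ 2 := by
  rw [mcsFactor, one_div_pow, mul_one_div, mul_one_div]

/-- Expansion of the amplification factor: its logarithm is `z + T` up to fourth-order terms. -/
theorem Big.mcsFactor_low (θ : ℝ) {z₀ z₁ z₂ : α → ℂ} (h₀ : S.Big 1 2 z₀) (h₁ : S.Big 1 2 z₁)
    (h₂ : S.Big 1 2 z₂) (hp : ∀ x ∈ S.dom, 1 ≤ ‖(1 - θ * z₁ x) * (1 - θ * z₂ x)‖) :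
    S.Big 4 8 (fun x => mcsFactor θ (z₀ x) (z₁ x) (z₂ x) -
      Complex.exp ((z₀ x + z₁ x + z₂ x) + (z₀ x + z₁ x + z₂ x) *
        ((z₀ x + z₁ x + z₂ x) ^ 2 / 12 - θ ^ 2 * (z₁ x * z₂ x) -
          ((z₀ x + z₁ x + z₂ x) / 2 - θ * (z₁ x + z₂ x)) ^ 2))) := by
  obtain ⟨m, hm⟩ : ∃ m, m = fun x => z₁ x + z₂ x := ⟨_, rfl⟩
  obtain ⟨z, hz⟩ : ∃ z, z = fun x => z₀ x + z₁ x + z₂ x := ⟨_, rfl⟩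
  have bm : S.Big 1 2 m := hm ▸ h₁.add h₂
  have bz : S.Big 1 2 z := hz ▸ (h₀.add h₁).add h₂
  obtain ⟨T, hT⟩ : ∃ T, T = fun x => z x * (z x ^ 2 / 12 - θ ^ 2 * (z₁ x * z₂ x) -
    (z x / 2 - θ * m x) ^ 2) := ⟨_, rfl⟩
  have b12 : S.Big 2 4 (fun x => z₁ x * z₂ x) := h₁.mul h₂
  have bT : S.Big 3 6 T := by
    have a1 := ((bz.pow 2).const_mul (1 / 12)).mono (m := 2) (l := 4) (by norm_num) (by norm_num)
    have a2 := b12.const_mul ((θ : ℂ) ^ 2)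
    have a3 := (((bz.const_mul (1 / 2)).sub (bm.const_mul θ)).pow 2).mono (m := 2) (l := 4)
      (by norm_num) (by norm_num)
    refine (bz.mul ((a1.sub a2).sub a3)).congr fun x _ => ?_
    simp only [hT]
    ring
  obtain ⟨w, hw⟩ : ∃ w, w = fun x => z x + T x := ⟨_, rfl⟩
  have bw : S.Big 1 2 w := hw ▸ bz.add (bT.trade_to 1 (by norm_num) (by norm_num))
  obtain ⟨e, he⟩ : ∃ e, e = fun x => θ * m x - θ ^ 2 * (z₁ x * z₂ x) := ⟨_, rfl⟩
  have be : S.Big 1 2 e := he ▸ (bm.const_mul θ).sub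
    ((b12.trade_to 1 (by norm_num) (by norm_num)).const_mul ((θ : ℂ) ^ 2))
  obtain ⟨i, hi⟩ : ∃ i, i = fun x => 1 / ((1 - θ * z₁ x) * (1 - θ * z₂ x)) := ⟨_, rfl⟩
  have bi : S.Big 0 0 i := hi ▸ Big.inv_of_le one_pos fun x hx => by simpa using hp x hx
  obtain ⟨B, hB⟩ : ∃ B, B = fun x => θ * z₀ x * z x + (1 / 2 - θ) * z x ^ 2 := ⟨_, rfl⟩
  have bB : S.Big 2 4 B := by
    have a1 := (h₀.mul bz).const_mul θ
    have a2 := ((bz.pow 2).const_mul (1 / 2 - θ)).mono (m := 2) (l := 4) (by norm_num)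
      (by norm_num)
    refine (Big.add a1 a2).congr fun x _ => ?_
    simp only [hB]
    ring
  have bexp := (bw.exp_sub_sum ((bw.mono le_rfl (by norm_num : 2 ≤ 8)).bounded) 4).mono (m := 4)
    (l := 8) (by norm_num) (by norm_num)
  have c1 := ((bz.mul (be.pow 3)).mul bi).mono (m := 4) (l := 8) (by norm_num) (by norm_num)
  have c2 := ((bB.mul (be.pow 2)).mul ((bi.const_mul 2).add ((bi.pow 2).mono (m := 0) (l := 0)
    (by norm_num) (by norm_num)))).mono (m := 4) (l := 8) (by norm_num) (by norm_num)
  have c3 := (((bz.mul bm).mul b12).const_mul (-2 * (θ : ℂ) ^ 3)).mono (m := 4) (l := 8)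
    (by norm_num) (by norm_num)
  have c4 := (((bz.mul b12).mul b12).const_mul ((θ : ℂ) ^ 4)).trade_to (m := 4) (l := 8) 1
    (by norm_num) (by norm_num)
  have c5 := ((bB.mul b12).const_mul (-2 * (θ : ℂ) ^ 2)).mono (m := 4) (l := 8)
    (by norm_num) (by norm_num)
  have c6 := (bz.mul bT).mono (m := 4) (l := 8) (by norm_num) (by norm_num)
  have c7 := ((bT.pow 2).const_mul (1 / 2)).trade_to (m := 4) (l := 8) 1 (by norm_num) (by norm_num)
  have c8 := (((bz.pow 2).mul bT).const_mul (1 / 2)).trade_to (m := 4) (l := 8) 1 (by norm_num)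
    (by norm_num)
  have c9 := ((bz.mul (bT.pow 2)).const_mul (1 / 2)).trade_to (m := 4) (l := 8) 2 (by norm_num)
    (by norm_num)
  have c10 := ((bT.pow 3).const_mul (1 / 6)).trade_to (m := 4) (l := 8) 2 (by norm_num)
    (by norm_num)
  refine ((((((((((c1.add c2).add c3).add c4).add c5).sub c6).sub c7).sub c8).sub c9).sub c10).sub
    bexp).congr fun x hx => ?_
  have hp0 : (1 - θ * z₁ x) * (1 - θ * z₂ x) ≠ 0 := fun h0 => by
    have := hp x hx
    rw [h0, norm_zero] at this
    linarith
  have hie : i x = 1 + e x * i x := by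
    have : i x * ((1 - θ * z₁ x) * (1 - θ * z₂ x)) = 1 := by
      simp only [hi]; exact one_div_mul_cancel hp0
    simp only [he, hm]
    linear_combination this
  have hR : mcsFactor θ (z₀ x) (z₁ x) (z₂ x) = 1 + z x * i x + B x * i x ^ 2 := by
    simp only [mcsFactor_eq, hi, hB, hz]
  have hexp : Complex.exp ((z₀ x + z₁ x + z₂ x) + (z₀ x + z₁ x + z₂ x) *
        ((z₀ x + z₁ x + z₂ x) ^ 2 / 12 - θ ^ 2 * (z₁ x * z₂ x) -
          ((z₀ x + z₁ x + z₂ x) / 2 - θ * (z₁ x + z₂ x)) ^ 2)) = Complex.exp (w x) := by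
    simp only [hw, hT, hz, hm]
  rw [hR, hexp]
  have hi3 : i x = 1 + e x + e x ^ 2 + e x ^ 3 * i x := by
    linear_combination (1 + e x + e x ^ 2) * hie
  have hi2 : i x ^ 2 = 1 + 2 * e x + e x ^ 2 * (2 * i x + i x ^ 2) := by
    linear_combination (i x + 1 + e x * i x + 2 * e x) * hie
  have hsum : ∑ j ∈ Finset.range 4, w x ^ j / (j.factorial : ℂ) =
      1 + w x + w x ^ 2 / 2 + w x ^ 3 / 6 := by
    simp [Finset.sum_range_succ, Nat.factorial]
  rw [hsum]
  have h5 : 1 + z x * i x + B x * i x ^ 2 = 1 + z x * (1 + e x + e x ^ 2 + e x ^ 3 * i x) +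
      B x * (1 + 2 * e x + e x ^ 2 * (2 * i x + i x ^ 2)) := by rw [← hi3, ← hi2]
  rw [h5]
  have hz0 : z₀ x = z x - m x := by simp only [hz, hm]; ring
  simp only [hw, he, hB, hT, hz0]
  ring

end Scale

/-- The angles and step counts at which the phase `ph` is at most `h ^ (-1/4)`. -/
def region (lam : ℝ) (N₀ : ℕ) (ph : ℝ → ℝ → ℝ → ℝ) : Set (ℕ × ℝ × ℝ) :=
  {x | 0 < x.1 ∧ N₀ ≤ x.1 ∧ meshWidth lam x.1 ≤ 1 ∧ x.2.1 ≠ 0 ∧ x.2.2 ≠ 0 ∧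
    |x.2.1| ≤ Real.pi ∧ |x.2.2| ≤ Real.pi ∧
    ph (meshWidth lam x.1) x.2.1 x.2.2 ^ 4 * meshWidth lam x.1 ≤ 1}

theorem meshWidth_pos {lam : ℝ} (hlam : 0 < lam) {N : ℕ} (hN : 0 < N) : 0 < meshWidth lam N := by
  unfold meshWidth; positivity

/-- The time step is `lam * h`, and `N` of them reach time one. -/
theorem meshWidth_mul {lam : ℝ} (hlam : 0 < lam) {N : ℕ} (hN : 0 < N) :
    lam * meshWidth lam N * N = 1 := by
  have : (N : ℝ) ≠ 0 := by positivity
  unfold meshWidth; field_simp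

/-- In a region where the phase `ph` is at most `h ^ (-1/4)`, the large scale `y = 1 + |a| + |b|`
satisfies `h y⁸ = O(1)`, as `y⁸` is of the order of `ph ^ 4`. -/
theorem scale_bound {a b ph h : ℝ} (hph : a ^ 2 + b ^ 2 = ph) (hh : 0 < h) (h1 : h ≤ 1)
    (h4 : ph ^ 4 * h ≤ 1) : h * (1 + |a| + |b|) ^ 8 ≤ 1296 := by
  have hp : 0 ≤ ph := by rw [← hph]; positivity
  have e1 : (1 + |a| + |b|) ^ 2 ≤ 3 * (1 + ph) := by
    rw [← hph, ← sq_abs a, ← sq_abs b]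
    nlinarith [sq_nonneg (|a| - |b|), sq_nonneg (|a| - 1), sq_nonneg (|b| - 1)]
  have e2 : (1 + |a| + |b|) ^ 8 ≤ (3 * (1 + ph)) ^ 4 := by
    calc (1 + |a| + |b|) ^ 8 = ((1 + |a| + |b|) ^ 2) ^ 4 := by ring
      _ ≤ _ := pow_le_pow_left₀ (sq_nonneg _) e1 4
  have e3 : (1 + ph) ^ 4 ≤ 8 * (1 + ph ^ 4) := by
    nlinarith [sq_nonneg (ph ^ 2 - 1), sq_nonneg (ph - 1), sq_nonneg (ph ^ 2 - ph),
      mul_nonneg hp (sq_nonneg (ph - 1)), sq_nonneg (ph + 1)]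
  calc h * (1 + |a| + |b|) ^ 8 ≤ h * (81 * (8 * (1 + ph ^ 4))) := by
        refine mul_le_mul_of_nonneg_left (e2.trans ?_) hh.le
        rw [mul_pow]; linarith
    _ = 648 * (h + ph ^ 4 * h) := by ring
    _ ≤ 1296 := by linarith

/-- The scale of the low-wavenumber region. -/
def lowScale (c lam : ℝ) (N₀ : ℕ) (hlam : 0 < lam) : Scale (ℕ × ℝ × ℝ) where
  dom := region lam N₀ (phaseLow c)
  h x := meshWidth lam x.1
  y x := 1 + |x.2.1 / meshWidth lam x.1| + |x.2.2 / (c * meshWidth lam x.1)|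
  h_pos x hx := meshWidth_pos hlam hx.1
  h_le x hx := hx.2.2.1
  one_le x _ := by
    linarith [abs_nonneg (x.2.1 / meshWidth lam x.1),
      abs_nonneg (x.2.2 / (c * meshWidth lam x.1))]
  bound := ⟨1296, fun x hx => scale_bound rfl (meshWidth_pos hlam hx.1) hx.2.2.1
    hx.2.2.2.2.2.2.2⟩

/-- Polynomials are absorbed by exponentials. -/
theorem exists_pow_mul_exp_le {δ : ℝ} (hδ : 0 < δ) (n : ℕ) :
    ∃ C : ℝ, 0 < C ∧ ∀ x : ℝ, 0 ≤ x → x ^ n * Real.exp (-(δ * x)) ≤ C := by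
  refine ⟨n.factorial / δ ^ n, by positivity, fun x hx => ?_⟩
  have h1 := Real.pow_div_factorial_le_exp (δ * x) (by positivity) n
  rw [Real.exp_neg, ← div_eq_mul_inv, div_le_div_iff₀ (Real.exp_pos _) (by positivity)]
  rw [div_le_iff₀ (by positivity), mul_pow] at h1
  linarith

/-- Powers of the large scale are absorbed by the Gaussian-type envelope. -/
theorem exists_scale_pow_mul_exp_le {δ : ℝ} (hδ : 0 < δ) (n : ℕ) :
    ∃ C : ℝ, 0 < C ∧ ∀ a b : ℝ, (1 + |a| + |b|) ^ n * Real.exp (-(2 * δ * (a ^ 2 + b ^ 2))) ≤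
      C * Real.exp (-(δ * (a ^ 2 + b ^ 2))) := by
  obtain ⟨C, hC, h⟩ := exists_pow_mul_exp_le hδ n
  refine ⟨3 ^ n * (C * Real.exp δ), by positivity, fun a b => ?_⟩
  have e1 : 1 + |a| + |b| ≤ 3 * (1 + (a ^ 2 + b ^ 2)) := by
    rw [← sq_abs a, ← sq_abs b]
    nlinarith [sq_nonneg (|a| - 1), sq_nonneg (|b| - 1)]
  have e2 : (1 + |a| + |b|) ^ n ≤ 3 ^ n * (1 + (a ^ 2 + b ^ 2)) ^ n := by
    rw [← mul_pow]; exact pow_le_pow_left₀ (by positivity) e1 n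
  have e3 := h (1 + (a ^ 2 + b ^ 2)) (by positivity)
  have e4 : Real.exp (-(2 * δ * (a ^ 2 + b ^ 2))) = Real.exp (-(δ * (1 + (a ^ 2 + b ^ 2)))) *
      (Real.exp δ * Real.exp (-(δ * (a ^ 2 + b ^ 2)))) := by
    rw [← Real.exp_add, ← Real.exp_add]; congr 1; ring
  rw [e4]
  calc (1 + |a| + |b|) ^ n * (Real.exp (-(δ * (1 + (a ^ 2 + b ^ 2)))) *
      (Real.exp δ * Real.exp (-(δ * (a ^ 2 + b ^ 2)))))
      ≤ (3 ^ n * (1 + (a ^ 2 + b ^ 2)) ^ n) * (Real.exp (-(δ * (1 + (a ^ 2 + b ^ 2)))) *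
      (Real.exp δ * Real.exp (-(δ * (a ^ 2 + b ^ 2))))) :=
        mul_le_mul_of_nonneg_right e2 (by positivity)
    _ = 3 ^ n * (((1 + (a ^ 2 + b ^ 2)) ^ n * Real.exp (-(δ * (1 + (a ^ 2 + b ^ 2))))) *
      Real.exp δ) * Real.exp (-(δ * (a ^ 2 + b ^ 2))) := by ring
    _ ≤ _ := by gcongr

/-- Ellipticity of the model problem. -/
theorem psiL_re_le {ρ : ℝ} (a₁ a₂ κ η : ℝ) :
    (psiL ρ a₁ a₂ κ η).re ≤ -((1 - |ρ|) * (κ ^ 2 + η ^ 2)) := by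
  have e : (psiL ρ a₁ a₂ κ η).re = -(κ ^ 2 + η ^ 2) - 2 * (ρ * (κ * η)) := by
    simp [psiL, psi, pow_two]
    ring
  have h1 : |ρ * (κ * η)| ≤ |ρ| * ((κ ^ 2 + η ^ 2) / 2) := by
    rw [abs_mul]
    refine mul_le_mul_of_nonneg_left ?_ (abs_nonneg _)
    rw [abs_le]; constructor <;> nlinarith [sq_nonneg (κ - η), sq_nonneg (κ + η)]
  have h2 := neg_abs_le (ρ * (κ * η))
  rw [e]; linarith

theorem one_le_norm_eulerDenom {ρ a₁ a₂ c lam h : ℝ} (hρ : |ρ| < 1) (hc : 0 < c) (hlam : 0 < lam)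
    (hh : 0 < h) (s t : ℝ) : 1 ≤ ‖1 - 1 / 2 * zTot ρ a₁ a₂ c lam h s t‖ := by
  apply one_le_norm_one_sub
  have := zTot_re_nonpos hρ hc hlam hh a₁ a₂ s t
  have e : (1 / 2 * zTot ρ a₁ a₂ c lam h s t).re = 1 / 2 * (zTot ρ a₁ a₂ c lam h s t).re := by
    rw [show (1 / 2 : ℂ) = ((1 / 2 : ℝ) : ℂ) by push_cast; rfl, Complex.re_ofReal_mul]
  rw [e]; linarith

theorem one_le_norm_one_sub_zSym {θ l a h : ℝ} (hθ : 0 ≤ θ) (hl : 0 < l) (hh : 0 < h) (s : ℝ) :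
    1 ≤ ‖1 - (θ : ℂ) * zSym l a h s‖ := by
  apply one_le_norm_one_sub
  rw [Complex.re_ofReal_mul, zSym_re]
  nlinarith [xSym_nonneg hl hh s]

theorem one_le_norm_mcsDenom {θ a₁ a₂ c lam h : ℝ} (hθ : 0 ≤ θ) (hc : 0 < c) (hlam : 0 < lam)
    (hh : 0 < h) (s t : ℝ) : 1 ≤ ‖(1 - (θ : ℂ) * zSym lam a₁ h s) *
      (1 - (θ : ℂ) * zSym (lam / c ^ 2) (c * a₂) h t)‖ := by
  rw [norm_mul]
  exact one_le_mul_of_one_le_of_one_le (one_le_norm_one_sub_zSym hθ hlam hh s)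
    (one_le_norm_one_sub_zSym hθ (by positivity) hh t)

/-- At low wavenumbers the symbol of the numerical solution agrees with `lowSym` up to third-order
terms. -/
theorem mainSym_sub_lowSym_le {ρ a₁ a₂ c lam θ : ℝ} (hρ : |ρ| < 1) (hc : 0 < c) (hlam : 0 < lam)
    (hθ : 0 ≤ θ) (N₀ : ℕ) : ∃ C δ : ℝ, 0 < C ∧ 0 < δ ∧ ∀ x ∈ region lam N₀ (phaseLow c),
      ‖mainSym ρ a₁ a₂ c lam θ (meshWidth lam x.1) N₀ x.1 x.2.1 x.2.2 -
        lowSym ρ a₁ a₂ c lam θ N₀ (meshWidth lam x.1) x.2.1 x.2.2‖ ≤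
      C * (meshWidth lam x.1 ^ 3 *
        Real.exp (-(δ * phaseLow c (meshWidth lam x.1) x.2.1 x.2.2))) := by
  obtain ⟨S, hS⟩ : ∃ S, S = lowScale c lam N₀ hlam := ⟨_, rfl⟩
  have hdom : S.dom = region lam N₀ (phaseLow c) := by rw [hS]; rfl
  have hSh : S.h = fun x => meshWidth lam x.1 := by rw [hS]; rfl
  obtain ⟨κ, hκ⟩ : ∃ κ : ℕ × ℝ × ℝ → ℝ, κ = fun x => x.2.1 / S.h x := ⟨_, rfl⟩
  obtain ⟨η, hη⟩ : ∃ η : ℕ × ℝ × ℝ → ℝ, η = fun x => x.2.2 / (c * S.h x) := ⟨_, rfl⟩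
  have hSy : S.y = fun x => 1 + |κ x| + |η x| := by rw [hκ, hη, hSh, hS]; rfl
  have bκ : S.Big 0 1 (fun x => (κ x : ℂ)) := .of_le (C := 1) fun x hx => by
    simp only [hSy, Complex.norm_real, Real.norm_eq_abs]
    simp
    linarith [abs_nonneg (η x)]
  have bη : S.Big 0 1 (fun x => (η x : ℂ)) := .of_le (C := 1) fun x hx => by
    simp only [hSy, Complex.norm_real, Real.norm_eq_abs]
    simp
    linarith [abs_nonneg (κ x)]
  have bh : S.Big 1 0 (fun x => (S.h x : ℂ)) := by simpa using Scale.Big.h_zpow (S := S) 1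
  have bh' : S.Big (-1) 0 (fun x => ((S.h x : ℂ))⁻¹) := by
    simpa using Scale.Big.h_zpow (S := S) (-1)
  have hpos : ∀ x ∈ S.dom, 0 < S.h x := S.h_pos
  have es : ∀ x ∈ S.dom, x.2.1 = S.h x * κ x := fun x hx => by
    have := (hpos x hx).ne'
    simp only [hκ]; field_simp
  have et : ∀ x ∈ S.dom, x.2.2 = c * S.h x * η x := fun x hx => by
    have := (hpos x hx).ne'
    simp only [hη]; field_simp
  -- the symbols of the three parts of `A` and their expansions
  obtain ⟨z₁, hz₁⟩ : ∃ z : ℕ × ℝ × ℝ → ℂ, z = fun x => zSym lam a₁ (S.h x) x.2.1 := ⟨_, rfl⟩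
  obtain ⟨z₂, hz₂⟩ : ∃ z : ℕ × ℝ × ℝ → ℂ,
    z = fun x => zSym (lam / c ^ 2) (c * a₂) (S.h x) x.2.2 := ⟨_, rfl⟩
  obtain ⟨z₀, hz₀⟩ : ∃ z : ℕ × ℝ × ℝ → ℂ,
    z = fun x => (xMix ρ c lam (S.h x) x.2.1 x.2.2 : ℂ) := ⟨_, rfl⟩
  have hc0 : (c : ℂ) ≠ 0 := by exact_mod_cast hc.ne'
  have e1 : S.Big 5 6 (fun x => z₁ x - (lam * S.h x * psi a₁ (κ x) + lam * (S.h x : ℂ) ^ 3 *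
      ((κ x : ℂ) ^ 4 / 12 - Complex.I * a₁ * κ x ^ 3 / 6))) :=
    (Scale.Big.zSym_low lam a₁ 1 bκ).congr fun x hx => by
      simp only [hz₁, psi]
      rw [es x hx, one_mul]
      push_cast
      ring
  have e2 : S.Big 5 6 (fun x => z₂ x - (lam * S.h x * psi a₂ (η x) + lam * (S.h x : ℂ) ^ 3 *
      (c ^ 2 * (η x : ℂ) ^ 4 / 12 - Complex.I * a₂ * c ^ 2 * η x ^ 3 / 6))) :=
    (Scale.Big.zSym_low (lam / c ^ 2) (c * a₂) c bη).congr fun x hx => by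
      simp only [hz₂, psi]
      rw [et x hx]
      push_cast
      field_simp
  have e0 : S.Big 5 6 (fun x => z₀ x - (lam * S.h x * (-2 * ρ * κ x * η x) +
      lam * (S.h x : ℂ) ^ 3 * (ρ * (κ x ^ 3 * η x + c ^ 2 * κ x * η x ^ 3) / 3))) :=
    (Scale.Big.xMix_low ρ c lam hc.ne' bκ bη).congr fun x hx => by
      simp only [hz₀]
      rw [← es x hx, ← et x hx]
      ring
  have bψ₁ : S.Big 0 2 (fun x => psi a₁ (κ x)) := by
    have := (((bκ.pow 2).mono (m := 0) (l := 2) (by norm_num) (by norm_num)).neg).add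
      ((bκ.const_mul (Complex.I * a₁)).mono (m := 0) (l := 2) (by norm_num) (by norm_num))
    exact this
  have bψ₂ : S.Big 0 2 (fun x => psi a₂ (η x)) := by
    have := (((bη.pow 2).mono (m := 0) (l := 2) (by norm_num) (by norm_num)).neg).add
      ((bη.const_mul (Complex.I * a₂)).mono (m := 0) (l := 2) (by norm_num) (by norm_num))
    exact this
  have bψ₀ : S.Big 0 2 (fun x => -2 * ρ * κ x * η x) :=
    ((bκ.mul bη).const_mul (-2 * ρ)).congr fun x _ => by ring
  have bs₁ : S.Big 0 4 (fun x => (κ x : ℂ) ^ 4 / 12 - Complex.I * a₁ * κ x ^ 3 / 6) := by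
    have := (((bκ.pow 4).const_mul (1 / 12)).mono (m := 0) (l := 4) (by norm_num)
      (by norm_num)).sub (((bκ.pow 3).const_mul (Complex.I * a₁ / 6)).mono (m := 0) (l := 4)
      (by norm_num) (by norm_num))
    exact this.congr fun x _ => by ring
  have bs₂ : S.Big 0 4 (fun x => c ^ 2 * (η x : ℂ) ^ 4 / 12 -
      Complex.I * a₂ * c ^ 2 * η x ^ 3 / 6) := by
    have := (((bη.pow 4).const_mul ((c : ℂ) ^ 2 / 12)).mono (m := 0) (l := 4) (by norm_num)
      (by norm_num)).sub (((bη.pow 3).const_mul (Complex.I * a₂ * c ^ 2 / 6)).mono (m := 0)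
      (l := 4) (by norm_num) (by norm_num))
    exact this.congr fun x _ => by ring
  have bs₀ : S.Big 0 4 (fun x => ρ * ((κ x : ℂ) ^ 3 * η x + c ^ 2 * κ x * η x ^ 3) / 3) := by
    have := ((((bκ.pow 3).mul bη).const_mul (ρ / 3)).mono (m := 0) (l := 4) (by norm_num)
      (by norm_num)).add (((bκ.mul (bη.pow 3)).const_mul (ρ * (c : ℂ) ^ 2 / 3)).mono (m := 0)
      (l := 4) (by norm_num) (by norm_num))
    exact this.congr fun x _ => by ring
  -- every symbol agrees to leading order with the symbol of its differential operator
  have lead : ∀ {z p q : ℕ × ℝ × ℝ → ℂ}, S.Big 0 4 q →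
      S.Big 5 6 (fun x => z x - (lam * S.h x * p x + lam * (S.h x : ℂ) ^ 3 * q x)) →
      S.Big (1 + 2) (2 + 2) (fun x => z x - lam * S.h x * p x) := by
    intro z p q hq he
    have h1 := ((bh.pow 3).mul hq).const_mul lam
    exact ((he.trade_to (m := 1 + 2) (l := 2 + 2) 1 (by norm_num) (by norm_num)).add
      (h1.mono (m := 1 + 2) (l := 2 + 2) (by norm_num) (by norm_num))).congr fun x _ => by ring
  have big : ∀ {z p : ℕ × ℝ × ℝ → ℂ}, S.Big 0 2 p →
      S.Big (1 + 2) (2 + 2) (fun x => z x - lam * S.h x * p x) → S.Big 1 2 z := by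
    intro z p hp he
    have h1 := (bh.mul hp).const_mul lam
    exact ((he.trade_to (m := 1) (l := 2) 1 (by norm_num) (by norm_num)).add
      (h1.mono (m := 1) (l := 2) (by norm_num) (by norm_num))).congr fun x _ => by ring
  have l1 := lead bs₁ e1
  have l2 := lead bs₂ e2
  have l0 := lead bs₀ e0
  have b1 := big bψ₁ l1
  have b2 := big bψ₂ l2
  have b0 := big bψ₀ l0
  obtain ⟨z, hz⟩ : ∃ z : ℕ × ℝ × ℝ → ℂ, z = fun x => z₀ x + z₁ x + z₂ x := ⟨_, rfl⟩
  obtain ⟨Ψ, hΨ⟩ : ∃ p : ℕ × ℝ × ℝ → ℂ, p = fun x => psiL ρ a₁ a₂ (κ x) (η x) := ⟨_, rfl⟩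
  have hΨ' : ∀ x, Ψ x = psi a₁ (κ x) + psi a₂ (η x) - 2 * ρ * κ x * η x := fun x => by
    simp only [hΨ, psiL]
  have ez : S.Big 5 6 (fun x => z x - (lam * S.h x * Ψ x + lam * (S.h x : ℂ) ^ 3 *
      psiS ρ a₁ a₂ c (κ x) (η x))) :=
    ((e0.add e1).add e2).congr fun x _ => by
      simp only [hz, hΨ', psiS]
      ring
  have bz : S.Big 1 2 z := hz ▸ (b0.add b1).add b2
  have lz : S.Big (1 + 2) (2 + 2) (fun x => z x - lam * S.h x * Ψ x) :=
    ((l0.add l1).add l2).congr fun x _ => by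
      simp only [hz, hΨ']
      ring
  have bΨ : S.Big 0 2 Ψ := ((bψ₀.add bψ₁).add bψ₂).congr fun x _ => by rw [hΨ']; ring
  have bhΨ : ∀ {p : ℕ × ℝ × ℝ → ℂ}, S.Big 0 2 p → S.Big 1 2 (fun x => lam * S.h x * p x) :=
    fun hp => ((bh.mul hp).const_mul lam).congr fun x _ => by ring
  -- `T` is the third-order term of `log R`, and `lam³ h³ Q` its leading part
  obtain ⟨u, hu⟩ : ∃ u : ℕ × ℝ × ℝ → ℂ, u = fun x => z x / 2 - θ * (z₁ x + z₂ x) := ⟨_, rfl⟩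
  obtain ⟨γ, hγ⟩ : ∃ u : ℕ × ℝ × ℝ → ℂ, u = fun x => -(ρ * κ x * η x) +
    (1 / 2 - θ) * (psi a₁ (κ x) + psi a₂ (η x)) := ⟨_, rfl⟩
  have bu : S.Big 1 2 u := by
    have := (bz.const_mul (1 / 2)).sub ((b1.add b2).const_mul θ)
    exact this.congr fun x _ => by simp only [hu]; ring
  have bγ : S.Big 0 2 γ := by
    have := (bψ₀.const_mul (1 / 2)).add ((bψ₁.add bψ₂).const_mul (1 / 2 - θ))
    exact this.congr fun x _ => by simp only [hγ]; ring
  have lu : S.Big (1 + 2) (2 + 2) (fun x => u x - lam * S.h x * γ x) := by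
    have := (lz.const_mul (1 / 2)).sub ((l1.add l2).const_mul θ)
    exact this.congr fun x _ => by simp only [hu, hγ, hΨ']; ring
  obtain ⟨T, hT⟩ : ∃ T : ℕ × ℝ × ℝ → ℂ, T = fun x => z x * (z x ^ 2 / 12 - θ ^ 2 * (z₁ x * z₂ x) -
    u x ^ 2) := ⟨_, rfl⟩
  obtain ⟨Q, hQ⟩ : ∃ T : ℕ × ℝ × ℝ → ℂ, T = fun x => Ψ x * (Ψ x ^ 2 / 12 -
    θ ^ 2 * (psi a₁ (κ x) * psi a₂ (η x)) - γ x ^ 2) := ⟨_, rfl⟩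
  have qz := bz.mul_sub_mul (bhΨ bΨ) lz lz
  have q12 := b1.mul_sub_mul (bhΨ bψ₂) l1 l2
  have qu := bu.mul_sub_mul (bhΨ bγ) lu lu
  have bT2 : S.Big (1 + 1) (2 + 2) (fun x => (lam * S.h x) ^ 2 * (Ψ x ^ 2 / 12 -
      θ ^ 2 * (psi a₁ (κ x) * psi a₂ (η x)) - γ x ^ 2)) := by
    have := ((((bhΨ bΨ).mul (bhΨ bΨ)).const_mul (1 / 12)).sub
      (((bhΨ bψ₁).mul (bhΨ bψ₂)).const_mul ((θ : ℂ) ^ 2))).sub ((bhΨ bγ).mul (bhΨ bγ))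
    exact this.congr fun x _ => by ring
  have qT2 : S.Big (1 + 1 + 2) (2 + 2 + 2) (fun x => (z x ^ 2 / 12 - θ ^ 2 * (z₁ x * z₂ x) -
      u x ^ 2) - (lam * S.h x) ^ 2 * (Ψ x ^ 2 / 12 -
      θ ^ 2 * (psi a₁ (κ x) * psi a₂ (η x)) - γ x ^ 2)) := by
    have := ((qz.const_mul (1 / 12)).sub (q12.const_mul ((θ : ℂ) ^ 2))).sub qu
    exact this.congr fun x _ => by ring
  have lT : S.Big 5 8 (fun x => T x - (lam * S.h x) ^ 3 * Q x) :=
    ((bz.mul_sub_mul bT2 lz qT2).mono (m := 5) (l := 8) (by norm_num) (by norm_num)).congr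
      fun x _ => by simp only [hT, hQ]; ring
  have bQ : S.Big 0 6 Q := by
    have h1 := (((bΨ.pow 2).const_mul (1 / 12)).mono (m := 0) (l := 4) (by norm_num)
      (by norm_num))
    have h2 := (bψ₁.mul bψ₂).const_mul ((θ : ℂ) ^ 2)
    have h3 := ((bγ.pow 2).mono (m := 0) (l := 4) (by norm_num) (by norm_num))
    have := bΨ.mul ((h1.sub h2).sub h3)
    exact this.congr fun x _ => by simp only [hQ]; ring
  have bT : S.Big 3 6 T := by
    have h1 := (((bh.pow 3).mul bQ).const_mul ((lam : ℂ) ^ 3)).mono (m := 3) (l := 6) (by norm_num)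
      (by norm_num)
    exact ((lT.trade_to (m := 3) (l := 6) 1 (by norm_num) (by norm_num)).add h1).congr
      fun x _ => by ring
  obtain ⟨w, hw⟩ : ∃ w : ℕ × ℝ × ℝ → ℂ, w = fun x => z x + T x := ⟨_, rfl⟩
  have bw : S.Big 1 2 w := hw ▸ bz.add (bT.trade_to 1 (by norm_num) (by norm_num))
  have bounded : ∀ {p : ℕ × ℝ × ℝ → ℂ}, S.Big 1 2 p → S.Big 0 0 p := fun hp =>
    (hp.mono le_rfl (by norm_num : 2 ≤ 8)).bounded
  -- the factor `R` of one MCS step is `exp w` up to order `h⁴`, which over `N` steps costs `h³`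
  obtain ⟨R, hR⟩ : ∃ R : ℕ × ℝ × ℝ → ℂ, R = fun x => mcsFactor θ (z₀ x) (z₁ x) (z₂ x) := ⟨_, rfl⟩
  have bR : S.Big 4 8 (fun x => R x - Complex.exp (w x)) := by
    have := Scale.Big.mcsFactor_low θ b0 b1 b2 fun x hx => by
      simp only [hz₁, hz₂]
      exact one_le_norm_mcsDenom hθ hc hlam (hpos x hx) _ _
    refine this.congr fun x _ => ?_
    simp only [hR, hw, hT, hu, hz]
  have br : S.Big (3 + 1) 8 (fun x => (R x - Complex.exp (w x)) * Complex.exp (-w x)) := by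
    simpa using bR.mul ((bounded bw).neg.exp)
  have bRn := br.pow_nat (n := 3) (M := fun x => x.1 - N₀) (K := 1 / lam) (by norm_num) le_rfl
    fun x hx => by
      rw [hdom] at hx
      have h1 := meshWidth_mul hlam hx.1
      have h2 : ((x.1 - N₀ : ℕ) : ℝ) ≤ x.1 := by exact_mod_cast Nat.sub_le _ _
      have h3 := meshWidth_pos hlam hx.1
      rw [le_div_iff₀ hlam, hSh]
      simp only
      calc ((x.1 - N₀ : ℕ) : ℝ) * meshWidth lam x.1 * lam ≤ x.1 * meshWidth lam x.1 * lam := by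
            gcongr
        _ = 1 := by rw [← h1]; ring
  -- each of the finitely many Euler factors is `exp v` up to order `h³`
  obtain ⟨f, hf⟩ : ∃ f : ℕ × ℝ × ℝ → ℂ, f = fun x => 1 / (1 - 1 / 2 * z x) := ⟨_, rfl⟩
  have hf1 : ∀ x ∈ S.dom, 1 ≤ ‖1 - 1 / 2 * z x‖ := fun x hx => by
    have := one_le_norm_eulerDenom (a₁ := a₁) (a₂ := a₂) hρ hc hlam (hpos x hx) x.2.1 x.2.2
    simpa only [zTot, hz, hz₀, hz₁, hz₂] using this
  have bf : S.Big 0 0 f := hf ▸ Scale.Big.inv_of_le one_pos fun x hx => by simpa using hf1 x hx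
  obtain ⟨v, hv⟩ : ∃ v : ℕ × ℝ × ℝ → ℂ, v = fun x => z x / 2 + z x ^ 2 / 8 := ⟨_, rfl⟩
  have bz2 := ((bz.pow 2).const_mul (1 / 8)).mono (m := 2) (l := 4) (by norm_num) (by norm_num)
  have bv : S.Big 1 2 v :=
    ((bz.const_mul (1 / 2)).add (bz2.trade_to 1 (by norm_num) (by norm_num))).congr
      fun x _ => by simp only [hv]; ring
  have bφ : S.Big 3 6 (fun x => f x * Complex.exp (-v x) - 1) := by
    have h1 := ((bv.neg.exp_sub_sum (bounded bv).neg 3)).mono (m := 3) (l := 6) (by norm_num)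
      (by norm_num)
    have h2 := ((bz.pow 3).const_mul (1 / 16)).mono (m := 3) (l := 6) (by norm_num) (by norm_num)
    have h3 := ((bz.pow 4).const_mul (1 / 128)).trade_to (m := 3) (l := 6) 1 (by norm_num)
      (by norm_num)
    have := (((h1.add h2).add h3).mul bf).mono (m := 3) (l := 6) (by norm_num) (by norm_num)
    refine this.congr fun x hx => ?_
    have h0 : (1 - 1 / 2 * z x) ≠ 0 := fun h0 => by
      have := hf1 x hx
      rw [h0, norm_zero] at this
      linarith
    have hfx : f x * (1 - 1 / 2 * z x) = 1 := by simp only [hf]; exact one_div_mul_cancel h0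
    simp only [Finset.sum_range_succ, Finset.sum_range_zero, Nat.factorial, hv]
    push_cast
    linear_combination hfx
  have bφn := bφ.pow_sub_one ((bφ.trade_to (m := 1) (l := 8) 1 (by norm_num)
    (by norm_num)).bounded) (2 * N₀)
  -- `Ψ + D` is the total exponent `(N - N₀) w + 2 N₀ v`, and `D` is `h² * lowPoly` up to order `h³`
  obtain ⟨D, hD⟩ : ∃ D : ℕ × ℝ × ℝ → ℂ, D = fun x => (lam * (S.h x : ℂ))⁻¹ * w x - Ψ x +
    N₀ * (z x ^ 2 / 4 - T x) := ⟨_, rfl⟩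
  have hl0 : (lam : ℂ) ≠ 0 := by exact_mod_cast hlam.ne'
  have bDP : S.Big 3 8 (fun x => D x - (S.h x : ℂ) ^ 2 *
      lowPoly ρ a₁ a₂ c lam θ N₀ (κ x) (η x)) := by
    have h1 := ((bh'.mul ez).const_mul (1 / lam)).mono (m := 3) (l := 8) (by norm_num)
      (by norm_num)
    have h2 := ((bh'.mul lT).const_mul (1 / lam)).mono (m := 3) (l := 8) (by norm_num)
      (by norm_num)
    have h3 := (qz.const_mul (N₀ / 4)).mono (m := 3) (l := 8) (by norm_num) (by norm_num)
    have h4 := (bT.const_mul N₀).mono (m := 3) (l := 8) (by norm_num) (by norm_num)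
    refine (((h1.add h2).add h3).sub h4).congr fun x hx => ?_
    have hx0 : (S.h x : ℂ) ≠ 0 := by exact_mod_cast (hpos x hx).ne'
    simp only [hD, hw, lowPoly, hQ, hγ]
    have hΨx : psiL ρ a₁ a₂ (κ x) (η x) = Ψ x := by rw [hΨ]
    rw [hΨx]
    field_simp
    ring
  have bP : S.Big 0 6 (fun x => lowPoly ρ a₁ a₂ c lam θ N₀ (κ x) (η x)) := by
    have h1 := (((bs₀.add bs₁).add bs₂).mono (m := 0) (l := 6) (by norm_num) (by norm_num)).add
      (bQ.const_mul ((lam : ℂ) ^ 2))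
    have h2 := ((bΨ.pow 2).const_mul (N₀ * (lam : ℂ) ^ 2 / 4)).mono (m := 0) (l := 6) (by norm_num)
      (by norm_num)
    refine (h1.add h2).congr fun x _ => ?_
    have hΨx : psiL ρ a₁ a₂ (κ x) (η x) = Ψ x := by rw [hΨ]
    simp only [lowPoly, psiS, hQ, hγ, hΨx]
    ring
  have bD : S.Big 2 6 D := by
    have h1 := ((bh.pow 2).mul bP).mono (m := 2) (l := 6) (by norm_num) (by norm_num)
    exact ((bDP.trade_to (m := 2) (l := 6) 1 (by norm_num) (by norm_num)).add h1).congr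
      fun x _ => by ring
  have bD0 : S.Big 0 0 D := (bD.trade_to (m := 1) (l := 8) 1 (by norm_num) (by norm_num)).bounded
  have bED := (bD.exp_sub_sum bD0 2).trade_to (m := 3) (l := 8) 1 (by norm_num) (by norm_num)
  -- the relative error of the product of the `2 N₀` Euler factors and the `N - N₀` MCS factors
  have bAB : S.Big 3 8 (fun x => ((1 + (f x * Complex.exp (-v x) - 1)) ^ (2 * N₀) - 1) +
      ((1 + (R x - Complex.exp (w x)) * Complex.exp (-w x)) ^ (x.1 - N₀) - 1) +
      ((1 + (f x * Complex.exp (-v x) - 1)) ^ (2 * N₀) - 1) *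
      ((1 + (R x - Complex.exp (w x)) * Complex.exp (-w x)) ^ (x.1 - N₀) - 1)) := by
    exact ((bφn.mono le_rfl (by norm_num)).add bRn).add
      ((bφn.mul bRn).trade_to 1 (by norm_num) (by norm_num))
  have bfin := (bED.add bDP).add ((bD0.exp.mul bAB).mono (m := 3) (l := 8) (by norm_num)
    (by norm_num))
  obtain ⟨C₁, hC₁, hbd⟩ := bfin
  have hρ' : 0 < 1 - |ρ| := by linarith
  obtain ⟨C₂, hC₂, habs⟩ := exists_scale_pow_mul_exp_le (half_pos hρ') 8
  refine ⟨C₁ * C₂ + 1, (1 - |ρ|) / 2, by positivity, half_pos hρ', fun x hx => ?_⟩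
  rw [← hdom] at hx
  have hbx := hbd x hx
  have hx' := hx
  rw [hdom] at hx'
  have hmain : mainSym ρ a₁ a₂ c lam θ (meshWidth lam x.1) N₀ x.1 x.2.1 x.2.2 -
        lowSym ρ a₁ a₂ c lam θ N₀ (meshWidth lam x.1) x.2.1 x.2.2 =
      Complex.exp (Ψ x) * (Complex.exp (D x) - ∑ i ∈ Finset.range 2, D x ^ i / (i.factorial : ℂ) +
        (D x - (S.h x : ℂ) ^ 2 * lowPoly ρ a₁ a₂ c lam θ N₀ (κ x) (η x)) +
        Complex.exp (D x) * (((1 + (f x * Complex.exp (-v x) - 1)) ^ (2 * N₀) - 1) +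
      ((1 + (R x - Complex.exp (w x)) * Complex.exp (-w x)) ^ (x.1 - N₀) - 1) +
      ((1 + (f x * Complex.exp (-v x) - 1)) ^ (2 * N₀) - 1) *
      ((1 + (R x - Complex.exp (w x)) * Complex.exp (-w x)) ^ (x.1 - N₀) - 1))) := by
    have k1 : (1 + (f x * Complex.exp (-v x) - 1)) ^ (2 * N₀) =
        f x ^ (2 * N₀) * Complex.exp (-(2 * N₀ * v x)) := by
      rw [add_sub_cancel, mul_pow, ← Complex.exp_nat_mul]
      congr 2
      push_cast
      ring
    have k2 : (1 + (R x - Complex.exp (w x)) * Complex.exp (-w x)) ^ (x.1 - N₀) =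
        R x ^ (x.1 - N₀) * Complex.exp (-((x.1 - N₀ : ℂ) * w x)) := by
      have : 1 + (R x - Complex.exp (w x)) * Complex.exp (-w x) = R x * Complex.exp (-w x) := by
        rw [sub_mul, ← Complex.exp_add, add_neg_cancel, Complex.exp_zero]; ring
      rw [this, mul_pow, ← Complex.exp_nat_mul]
      congr 2
      rw [Nat.cast_sub hx'.2.1]
      ring
    have k3 : mainSym ρ a₁ a₂ c lam θ (meshWidth lam x.1) N₀ x.1 x.2.1 x.2.2 =
        f x ^ (2 * N₀) * R x ^ (x.1 - N₀) := by
      rw [mainSym, min_eq_right hx'.2.1]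
      simp only [hf, hR, hz, hz₀, hz₁, hz₂, zTot, ampl, hSh]
    have k4 : lowSym ρ a₁ a₂ c lam θ N₀ (meshWidth lam x.1) x.2.1 x.2.2 =
        Complex.exp (Ψ x) * (1 + (S.h x : ℂ) ^ 2 * lowPoly ρ a₁ a₂ c lam θ N₀ (κ x) (η x)) := by
      simp only [lowSym, hΨ, hκ, hη, hSh]
    have k5 : Complex.exp (Ψ x) * Complex.exp (D x) * (Complex.exp (-(2 * N₀ * v x)) *
        Complex.exp (-((x.1 - N₀ : ℂ) * w x))) = 1 := by
      rw [← Complex.exp_add, ← Complex.exp_add, ← Complex.exp_add]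
      have hx0 : (S.h x : ℂ) ≠ 0 := by exact_mod_cast (hpos x hx).ne'
      have hN : (lam : ℂ) * S.h x * x.1 = 1 := by
        rw [hSh]
        exact_mod_cast meshWidth_mul hlam hx'.1
      have hinv : (lam * (S.h x : ℂ))⁻¹ = x.1 := inv_eq_of_mul_eq_one_right hN
      rw [← Complex.exp_zero]
      congr 1
      simp only [hD, hinv, hv, hw]
      ring
    rw [k1, k2, k3, k4]
    simp only [Finset.sum_range_succ, Finset.sum_range_zero, Nat.factorial]
    push_cast
    linear_combination (-(f x ^ (2 * N₀) * R x ^ (x.1 - N₀))) * k5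
  rw [hmain, norm_mul, Complex.norm_exp]
  have hphase : phaseLow c (meshWidth lam x.1) x.2.1 x.2.2 = κ x ^ 2 + η x ^ 2 := by
    simp only [phaseLow, hκ, hη, hSh]
  rw [hphase]
  have hre : Real.exp (Ψ x).re ≤ Real.exp (-(2 * ((1 - |ρ|) / 2) * (κ x ^ 2 + η x ^ 2))) := by
    apply Real.exp_le_exp.2
    have := psiL_re_le (ρ := ρ) a₁ a₂ (κ x) (η x)
    simp only [hΨ]
    linarith
  have hab := habs (κ x) (η x)
  have hy : S.y x = 1 + |κ x| + |η x| := by rw [hSy]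
  have hh3 : S.h x ^ (3 : ℤ) = meshWidth lam x.1 ^ 3 := by
    rw [hSh]; exact_mod_cast rfl
  rw [hh3, hy] at hbx
  have hm3 : 0 < meshWidth lam x.1 ^ 3 := pow_pos (meshWidth_pos hlam hx'.1) 3
  refine (mul_le_mul hre hbx (norm_nonneg _) (Real.exp_pos _).le).trans ?_
  calc _ = C₁ * meshWidth lam x.1 ^ 3 * ((1 + |κ x| + |η x|) ^ 8 *
        Real.exp (-(2 * ((1 - |ρ|) / 2) * (κ x ^ 2 + η x ^ 2)))) := by ring
    _ ≤ C₁ * meshWidth lam x.1 ^ 3 * (C₂ *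
        Real.exp (-((1 - |ρ|) / 2 * (κ x ^ 2 + η x ^ 2)))) := by gcongr
    _ = C₁ * C₂ * (meshWidth lam x.1 ^ 3 *
        Real.exp (-((1 - |ρ|) / 2 * (κ x ^ 2 + η x ^ 2)))) := by ring
    _ ≤ _ := by
        refine mul_le_mul_of_nonneg_right (by linarith) (by positivity)

/-! ### High wavenumbers -/

/-- The phase at high wavenumbers. -/
def phaseHigh (s t : ℝ) : ℝ := (1 / s) ^ 2 + (1 / t) ^ 2

/-- The high-wavenumber approximation of the symbol of the numerical solution. -/
def highSym (ρ c lam θ : ℝ) (N₀ : ℕ) (h s t : ℝ) : ℝ :=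
  (h * c ^ 2 / (2 * lam * iota ρ c s t)) ^ (2 * N₀) *
    Real.exp (-(1 / (4 * lam ^ 2 * θ ^ 2) *
      (iota ρ c s t / (Real.sin (s / 2) ^ 2 * Real.sin (t / 2) ^ 2))))

theorem sq_le_sin_half_sq {s : ℝ} (hs : |s| ≤ Real.pi) :
    s ^ 2 / Real.pi ^ 2 ≤ Real.sin (s / 2) ^ 2 := by
  have h1 := Real.mul_le_sin (x := |s| / 2) (by positivity) (by linarith)
  have h2 : Real.sin (|s| / 2) ^ 2 = Real.sin (s / 2) ^ 2 := by
    rcases abs_choice s with h | h <;> rw [h]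
    rw [neg_div, Real.sin_neg, neg_sq]
  rw [← h2, ← sq_abs s, ← div_pow]
  refine pow_le_pow_left₀ (by positivity) (le_trans (le_of_eq ?_) h1) 2
  ring

theorem sin_half_sq_le (s : ℝ) : Real.sin (s / 2) ^ 2 ≤ s ^ 2 / 4 := by
  have h1 := Real.abs_sin_le_abs (x := s / 2)
  have := sq_le_sq' (by linarith [abs_nonneg (Real.sin (s / 2)), abs_nonneg (s / 2)]) h1
  rw [sq_abs, sq_abs] at this
  linarith

theorem sin_half_ne_zero {s : ℝ} (hs : |s| ≤ Real.pi) (h0 : s ≠ 0) : 0 < Real.sin (s / 2) ^ 2 :=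
  lt_of_lt_of_le (by positivity) (sq_le_sin_half_sq hs)

/-- The negative of the real part of the symbol of `Δt A`. -/
def xTot (ρ c lam h s t : ℝ) : ℝ :=
  xSym lam h s + xSym (lam / c ^ 2) h t - xMix ρ c lam h s t

theorem xTot_eq_iota {ρ c lam h : ℝ} (hc : c ≠ 0) (hh : h ≠ 0) (s t : ℝ) :
    xTot ρ c lam h s t = 4 * lam / (c ^ 2 * h) * iota ρ c s t := by
  have hs : Real.sin s = 2 * Real.sin (s / 2) * Real.cos (s / 2) := by
    rw [← Real.sin_two_mul]; ring_nf
  have ht : Real.sin t = 2 * Real.sin (t / 2) * Real.cos (t / 2) := by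
    rw [← Real.sin_two_mul]; ring_nf
  unfold xTot xSym xMix iota
  rw [hs, ht]
  field_simp
  ring

theorem le_xTot {ρ c lam h : ℝ} (hc : 0 < c) (hlam : 0 < lam) (hh : 0 < h) (s t : ℝ) :
    (1 - |ρ|) * (xSym lam h s + xSym (lam / c ^ 2) h t) ≤ xTot ρ c lam h s t := by
  have := (le_abs_self _).trans (xMix_le (ρ := ρ) hc hlam hh s t)
  unfold xTot
  linarith

theorem zTot_eq (ρ a₁ a₂ c lam h s t : ℝ) : zTot ρ a₁ a₂ c lam h s t = -(xTot ρ c lam h s t : ℂ) +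
    ((lam * a₁ * Real.sin s + lam / c ^ 2 * (c * a₂) * Real.sin t : ℝ) : ℂ) * Complex.I := by
  simp only [zTot, zSym, xTot]
  push_cast
  ring

theorem xSym_pos {l h s : ℝ} (hl : 0 < l) (hh : 0 < h) (hs : |s| ≤ Real.pi) (h0 : s ≠ 0) :
    0 < xSym l h s := by
  have := sin_half_ne_zero hs h0
  unfold xSym; positivity

/-- Lower bound for the exponent at high wavenumbers. -/
theorem le_high_exponent {ρ c lam θ s t : ℝ} (hρ : |ρ| < 1) (hc : 0 < c) (hlam : 0 < lam)
    (hθ : 0 < θ) (hs : |s| ≤ Real.pi) (ht : |t| ≤ Real.pi) (hs0 : s ≠ 0) (ht0 : t ≠ 0) :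
    (1 - |ρ|) * min 1 (c ^ 2) / (lam ^ 2 * θ ^ 2) * phaseHigh s t ≤ 1 / (4 * lam ^ 2 * θ ^ 2) *
      (iota ρ c s t / (Real.sin (s / 2) ^ 2 * Real.sin (t / 2) ^ 2)) := by
  have p1 := sin_half_ne_zero hs hs0
  have p2 := sin_half_ne_zero ht ht0
  have hι : (1 - |ρ|) * (c ^ 2 * Real.sin (s / 2) ^ 2 + Real.sin (t / 2) ^ 2) ≤ iota ρ c s t := by
    have h1 := le_xTot (ρ := ρ) (lam := 1) hc one_pos one_pos s t
    rw [xTot_eq_iota hc.ne' one_ne_zero] at h1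
    unfold xSym at h1
    have h2 := mul_le_mul_of_nonneg_left h1 (show 0 ≤ c ^ 2 / 4 by positivity)
    have e : c ^ 2 / 4 * (4 * 1 / (c ^ 2 * 1) * iota ρ c s t) = iota ρ c s t := by field_simp
    rw [e] at h2
    refine le_trans (le_of_eq ?_) h2
    field_simp
  have hρ' : 0 < 1 - |ρ| := by linarith
  have r1 : 4 * (1 / s) ^ 2 ≤ 1 / Real.sin (s / 2) ^ 2 := by
    rw [le_div_iff₀ p1]
    calc 4 * (1 / s) ^ 2 * Real.sin (s / 2) ^ 2 ≤ 4 * (1 / s) ^ 2 * (s ^ 2 / 4) := by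
          gcongr; exact sin_half_sq_le s
      _ = 1 := by field_simp
  have r2 : 4 * (1 / t) ^ 2 ≤ 1 / Real.sin (t / 2) ^ 2 := by
    rw [le_div_iff₀ p2]
    calc 4 * (1 / t) ^ 2 * Real.sin (t / 2) ^ 2 ≤ 4 * (1 / t) ^ 2 * (t ^ 2 / 4) := by
          gcongr; exact sin_half_sq_le t
      _ = 1 := by field_simp
  have m1 : min 1 (c ^ 2) ≤ 1 := min_le_left _ _
  have m2 : min 1 (c ^ 2) ≤ c ^ 2 := min_le_right _ _
  have m0 : 0 < min 1 (c ^ 2) := lt_min one_pos (by positivity)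
  have key : (1 - |ρ|) * (min 1 (c ^ 2) * (4 * phaseHigh s t)) ≤
      iota ρ c s t / (Real.sin (s / 2) ^ 2 * Real.sin (t / 2) ^ 2) := by
    calc (1 - |ρ|) * (min 1 (c ^ 2) * (4 * phaseHigh s t))
        = (1 - |ρ|) * (min 1 (c ^ 2) * (4 * (1 / s) ^ 2) + min 1 (c ^ 2) * (4 * (1 / t) ^ 2)) := by
          unfold phaseHigh; ring
      _ ≤ (1 - |ρ|) * (1 * (1 / Real.sin (s / 2) ^ 2) + c ^ 2 * (1 / Real.sin (t / 2) ^ 2)) := by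
          gcongr
      _ = (1 - |ρ|) * (c ^ 2 * Real.sin (s / 2) ^ 2 + Real.sin (t / 2) ^ 2) /
          (Real.sin (s / 2) ^ 2 * Real.sin (t / 2) ^ 2) := by
          have n1 : Real.sin (s / 2) ≠ 0 := fun h => by simp [h] at p1
          have n2 : Real.sin (t / 2) ≠ 0 := fun h => by simp [h] at p2
          field_simp
          ring
      _ ≤ _ := by gcongr
  calc _ = 1 / (4 * lam ^ 2 * θ ^ 2) * ((1 - |ρ|) * (min 1 (c ^ 2) * (4 * phaseHigh s t))) := by
        field_simp
    _ ≤ _ := by gcongr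

namespace Scale

variable {α : Type} {S : Scale α}

theorem Big.h_one : S.Big 1 0 (fun x => (S.h x : ℂ)) := by simpa using Big.h_zpow (S := S) 1

theorem Big.h_inv : S.Big (-1) 0 (fun x => ((S.h x : ℂ))⁻¹) := by
  simpa using Big.h_zpow (S := S) (-1)

theorem Big.one_div_xSym {l : ℝ} (hl : 0 < l) {s : α → ℝ} (hs : ∀ x ∈ S.dom, |s x| ≤ Real.pi)
    (h0 : ∀ x ∈ S.dom, s x ≠ 0) (hy : ∀ x ∈ S.dom, |1 / s x| ≤ S.y x) :
    S.Big 1 2 (fun x => 1 / (xSym l (S.h x) (s x) : ℂ)) := by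
  refine .inv_of_le (b := 4 * l / Real.pi ^ 2) (by positivity) fun x hx => ?_
  have hh := S.h_pos x hx
  have h1 := h0 x hx
  rw [Complex.norm_real, Real.norm_of_nonneg (xSym_nonneg hl hh _), zpow_one]
  have h2 : (1 / s x) ^ 2 ≤ S.y x ^ 2 := by
    rw [← sq_abs]; exact pow_le_pow_left₀ (abs_nonneg _) (hy x hx) 2
  calc 4 * l / Real.pi ^ 2 = 4 * l * (s x ^ 2 / Real.pi ^ 2) * (1 / s x) ^ 2 := by
        field_simp
    _ ≤ 4 * l * Real.sin (s x / 2) ^ 2 * S.y x ^ 2 := by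
        gcongr
        exact sq_le_sin_half_sq (hs x hx)
    _ = xSym l (S.h x) (s x) * (S.h x * S.y x ^ 2) := by
        unfold xSym; field_simp

theorem Big.sin_zero (s : α → ℝ) : S.Big 0 0 (fun x => ((Real.sin (s x) : ℝ) : ℂ)) :=
  .of_le (C := 1) fun x _ => by
    rw [Complex.norm_real]; simpa using Real.abs_sin_le_one _

theorem Big.of_xSym (l : ℝ) (s : α → ℝ) :
    S.Big (-1) 0 (fun x => (xSym l (S.h x) (s x) : ℂ)) := by
  have := (Big.h_inv (S := S)).mul ((Big.sin_zero (S := S) (fun x => s x / 2)).mul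
    (Big.sin_zero (S := S) (fun x => s x / 2)))
  refine ((this.const_mul (4 * l)).mono (by norm_num) (by norm_num)).congr fun x _ => ?_
  unfold xSym
  push_cast
  ring

theorem Big.of_xMix (ρ c lam : ℝ) (s t : α → ℝ) :
    S.Big (-1) 0 (fun x => (xMix ρ c lam (S.h x) (s x) (t x) : ℂ)) := by
  have := (Big.h_inv (S := S)).mul ((Big.sin_zero (S := S) s).mul (Big.sin_zero (S := S) t))
  refine ((this.const_mul (-(2 * lam * ρ / c))).mono (by norm_num) (by norm_num)).congr
    fun x _ => ?_
  unfold xMix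
  push_cast
  rw [div_mul_eq_div_div, div_eq_mul_inv _ (S.h x : ℂ)]
  ring

theorem Big.zSym_im (l a : ℝ) (s : α → ℝ) :
    S.Big 0 0 (fun x => ((l * a * Real.sin (s x) : ℝ) : ℂ) * Complex.I) :=
  ((Big.sin_zero (S := S) s).const_mul (l * a * Complex.I)).congr fun x _ => by push_cast; ring

theorem Big.of_zSym (l a : ℝ) (s : α → ℝ) :
    S.Big (-1) 0 (fun x => zSym l a (S.h x) (s x)) :=
  ((Big.of_xSym l s).neg.add ((Big.zSym_im l a s).mono (by norm_num) le_rfl)).congr fun x _ => by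
    simp only [zSym]

/-- The reciprocals of the implicit factors, at angles away from zero. -/
theorem Big.one_div_one_sub {l θ : ℝ} (hl : 0 < l) (hθ : 0 < θ) (a : ℝ) {s : α → ℝ}
    (hs : ∀ x ∈ S.dom, |s x| ≤ Real.pi)
    (h0 : ∀ x ∈ S.dom, s x ≠ 0) (hy : ∀ x ∈ S.dom, |1 / s x| ≤ S.y x) :
    S.Big 1 2 (fun x => 1 / (1 - θ * zSym l a (S.h x) (s x))) ∧
    S.Big 2 4 (fun x => 1 / (1 - θ * zSym l a (S.h x) (s x)) -
      1 / θ * (1 / (xSym l (S.h x) (s x) : ℂ))) := by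
  have hx := Big.one_div_xSym hl hs h0 hy
  have h1 : S.Big 1 2 (fun x => 1 / (1 - θ * zSym l a (S.h x) (s x))) := by
    refine (hx.const_mul (1 / θ)).of_norm_le fun x hxm => ?_
    have hh := S.h_pos x hxm
    have p := xSym_pos hl hh (hs x hxm) (h0 x hxm)
    have h2 : θ * xSym l (S.h x) (s x) ≤ ‖1 - θ * zSym l a (S.h x) (s x)‖ := by
      refine le_trans ?_ (Complex.re_le_norm _)
      rw [Complex.sub_re, Complex.re_ofReal_mul, zSym_re, Complex.one_re]
      linarith
    rw [norm_mul, norm_div, norm_div, norm_div, norm_one, Complex.norm_real, Complex.norm_real,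
      Real.norm_of_nonneg hθ.le, Real.norm_of_nonneg p.le, div_mul_div_comm, one_mul]
    exact one_div_le_one_div_of_le (by positivity) h2
  refine ⟨h1, ?_⟩
  have h2 := ((hx.const_mul (1 / θ)).mul h1).mul
    (((Big.const (-1)).add ((Big.zSym_im l a s).const_mul θ)))
  refine (h2.mono (by norm_num) (by norm_num)).congr fun x hxm => ?_
  have hh := S.h_pos x hxm
  have p : (xSym l (S.h x) (s x) : ℂ) ≠ 0 := by
    exact_mod_cast (xSym_pos hl hh (hs x hxm) (h0 x hxm)).ne'
  have q : 1 - θ * zSym l a (S.h x) (s x) ≠ 0 := fun h0 => by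
    have := one_le_norm_one_sub_zSym (a := a) hθ.le hl hh (s x)
    rw [h0, norm_zero] at this
    linarith
  have r : (θ : ℂ) ≠ 0 := by exact_mod_cast hθ.ne'
  have e : 1 - θ * zSym l a (S.h x) (s x) = 1 + θ * xSym l (S.h x) (s x) -
      θ * (((l * a * Real.sin (s x) : ℝ) : ℂ) * Complex.I) := by
    simp only [zSym]; ring
  have e' : (((l * a * Real.sin (s x) : ℝ) : ℂ) * Complex.I) =
      zSym l a (S.h x) (s x) + xSym l (S.h x) (s x) := by
    simp only [zSym]; ring
  rw [e']
  field_simp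
  ring

end Scale

/-- The scale of the high-wavenumber region. -/
def highScale (lam : ℝ) (N₀ : ℕ) (hlam : 0 < lam) : Scale (ℕ × ℝ × ℝ) where
  dom := region lam N₀ (fun _ s t => phaseHigh s t)
  h x := meshWidth lam x.1
  y x := 1 + |1 / x.2.1| + |1 / x.2.2|
  h_pos x hx := meshWidth_pos hlam hx.1
  h_le x hx := hx.2.2.1
  one_le x _ := by linarith [abs_nonneg (1 / x.2.1), abs_nonneg (1 / x.2.2)]
  bound := ⟨1296, fun x hx => scale_bound rfl (meshWidth_pos hlam hx.1) hx.2.2.1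
    hx.2.2.2.2.2.2.2⟩

theorem norm_zTot_bound {ρ a₁ a₂ c lam h : ℝ} (s t : ℝ) :
    xTot ρ c lam h s t / 2 ≤ ‖1 - 1 / 2 * zTot ρ a₁ a₂ c lam h s t‖ := by
  refine le_trans ?_ (Complex.re_le_norm _)
  have e : (1 / 2 * zTot ρ a₁ a₂ c lam h s t).re = 1 / 2 * (zTot ρ a₁ a₂ c lam h s t).re := by
    rw [show (1 / 2 : ℂ) = ((1 / 2 : ℝ) : ℂ) by push_cast; rfl, Complex.re_ofReal_mul]
  rw [Complex.sub_re, e, zTot_re, Complex.one_re]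
  unfold xTot
  linarith

/-- At high wavenumbers the symbol of the numerical solution agrees with `highSym` to relative
order `h`. -/
theorem mainSym_sub_highSym_le {ρ a₁ a₂ c lam θ : ℝ} (hρ : |ρ| < 1) (hc : 0 < c) (hlam : 0 < lam)
    (hθ : 0 < θ) (N₀ : ℕ) : ∃ C δ : ℝ, 0 < C ∧ 0 < δ ∧
      ∀ x ∈ region lam N₀ (fun _ s t => phaseHigh s t),
      ‖mainSym ρ a₁ a₂ c lam θ (meshWidth lam x.1) N₀ x.1 x.2.1 x.2.2 -
        (highSym ρ c lam θ N₀ (meshWidth lam x.1) x.2.1 x.2.2 : ℂ)‖ ≤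
      C * (meshWidth lam x.1 ^ (2 * N₀ + 1) * Real.exp (-(δ * phaseHigh x.2.1 x.2.2))) := by
  obtain ⟨S, hS⟩ : ∃ S, S = highScale lam N₀ hlam := ⟨_, rfl⟩
  have hdom : S.dom = region lam N₀ (fun _ s t => phaseHigh s t) := by rw [hS]; rfl
  have hSh : S.h = fun x => meshWidth lam x.1 := by rw [hS]; rfl
  have hSy : S.y = fun x => 1 + |1 / x.2.1| + |1 / x.2.2| := by rw [hS]; rfl
  have hpos : ∀ x ∈ S.dom, 0 < S.h x := S.h_pos
  have hs : ∀ x ∈ S.dom, |x.2.1| ≤ Real.pi := fun x hx => by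
    rw [hdom] at hx; exact hx.2.2.2.2.2.1
  have ht : ∀ x ∈ S.dom, |x.2.2| ≤ Real.pi := fun x hx => by
    rw [hdom] at hx; exact hx.2.2.2.2.2.2.1
  have hs0 : ∀ x ∈ S.dom, x.2.1 ≠ 0 := fun x hx => by rw [hdom] at hx; exact hx.2.2.2.1
  have ht0 : ∀ x ∈ S.dom, x.2.2 ≠ 0 := fun x hx => by rw [hdom] at hx; exact hx.2.2.2.2.1
  have hys : ∀ x ∈ S.dom, |1 / x.2.1| ≤ S.y x := fun x _ => by
    rw [hSy]; simp only; linarith [abs_nonneg (1 / x.2.2)]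
  have hyt : ∀ x ∈ S.dom, |1 / x.2.2| ≤ S.y x := fun x _ => by
    rw [hSy]; simp only; linarith [abs_nonneg (1 / x.2.1)]
  have hl2 : 0 < lam / c ^ 2 := by positivity
  have hρ' : 0 < 1 - |ρ| := by linarith
  have p1 : ∀ x ∈ S.dom, 0 < xSym lam (S.h x) x.2.1 := fun x hx =>
    xSym_pos hlam (hpos x hx) (hs x hx) (hs0 x hx)
  have p2 : ∀ x ∈ S.dom, 0 < xSym (lam / c ^ 2) (S.h x) x.2.2 := fun x hx =>
    xSym_pos hl2 (hpos x hx) (ht x hx) (ht0 x hx)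
  have pX : ∀ x ∈ S.dom, (1 - |ρ|) * xSym lam (S.h x) x.2.1 ≤
      xTot ρ c lam (S.h x) x.2.1 x.2.2 := fun x hx =>
    le_trans (mul_le_mul_of_nonneg_left (by linarith [p2 x hx]) hρ'.le)
      (le_xTot hc hlam (hpos x hx) _ _)
  have pX0 : ∀ x ∈ S.dom, 0 < xTot ρ c lam (S.h x) x.2.1 x.2.2 := fun x hx =>
    lt_of_lt_of_le (mul_pos hρ' (p1 x hx)) (pX x hx)
  -- the reciprocals of the implicit factors
  obtain ⟨i1, j1⟩ := Scale.Big.one_div_one_sub hlam hθ a₁ hs hs0 hys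
  obtain ⟨i2, j2⟩ := Scale.Big.one_div_one_sub hl2 hθ (c * a₂) ht ht0 hyt
  have k1 := (Scale.Big.one_div_xSym hlam hs hs0 hys).const_mul (1 / (θ : ℂ))
  have k2 := (Scale.Big.one_div_xSym hl2 ht ht0 hyt).const_mul (1 / (θ : ℂ))
  obtain ⟨i, hi⟩ : ∃ i : ℕ × ℝ × ℝ → ℂ, i = fun x => 1 / ((1 - θ * zSym lam a₁ (S.h x) x.2.1) *
    (1 - θ * zSym (lam / c ^ 2) (c * a₂) (S.h x) x.2.2)) := ⟨_, rfl⟩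
  obtain ⟨j, hj⟩ : ∃ i : ℕ × ℝ × ℝ → ℂ, i = fun x => 1 / θ * (1 / (xSym lam (S.h x) x.2.1 : ℂ)) *
    (1 / θ * (1 / (xSym (lam / c ^ 2) (S.h x) x.2.2 : ℂ))) := ⟨_, rfl⟩
  have bi : S.Big 2 4 i := (i1.mul i2).congr fun x _ => by
    simp only [hi]; rw [one_div_mul_one_div]
  have bj : S.Big 2 4 j := (k1.mul k2).congr fun x _ => by simp only [hj]
  have bij : S.Big 3 6 (fun x => i x - j x) :=
    (((j1.mul i2).mono (m := 3) (l := 6) (by norm_num) (by norm_num)).add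
      ((k1.mul j2).mono (m := 3) (l := 6) (by norm_num) (by norm_num))).congr fun x _ => by
      simp only [hi, hj]
      rw [← one_div_mul_one_div]
      ring
  obtain ⟨z₀, hz₀⟩ : ∃ z : ℕ × ℝ × ℝ → ℂ,
    z = fun x => (xMix ρ c lam (S.h x) x.2.1 x.2.2 : ℂ) := ⟨_, rfl⟩
  obtain ⟨z, hz⟩ : ∃ z : ℕ × ℝ × ℝ → ℂ,
    z = fun x => zTot ρ a₁ a₂ c lam (S.h x) x.2.1 x.2.2 := ⟨_, rfl⟩
  obtain ⟨X, hX⟩ : ∃ z : ℕ × ℝ × ℝ → ℂ,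
    z = fun x => (xTot ρ c lam (S.h x) x.2.1 x.2.2 : ℂ) := ⟨_, rfl⟩
  have b0 : S.Big (-1) 0 z₀ := hz₀ ▸ Scale.Big.of_xMix ρ c lam _ _
  have bz : S.Big (-1) 0 z := ((b0.add (Scale.Big.of_zSym lam a₁ _)).add
    (Scale.Big.of_zSym (lam / c ^ 2) (c * a₂) _)).congr fun x _ => by
      simp only [hz, hz₀]; rfl
  have bzX : S.Big 0 0 (fun x => z x + X x) :=
    ((Scale.Big.zSym_im (S := S) lam a₁ (fun x => x.2.1)).add
      (Scale.Big.zSym_im (lam / c ^ 2) (c * a₂) (fun x => x.2.2))).congr fun x _ => by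
      simp only [hz, hX, zTot_eq]; push_cast; ring
  -- one MCS step multiplies by `R = exp (-om)` up to order `h²`, where `om` is of order `h`
  obtain ⟨om, h_om⟩ : ∃ w : ℕ × ℝ × ℝ → ℂ, w = fun x => X x * j x := ⟨_, rfl⟩
  have bzi : S.Big 2 8 (fun x => z x * i x + om x) :=
    (((bz.mul bij).mono (m := 2) (l := 8) (by norm_num) (by norm_num)).add
      ((bzX.mul bj).mono (m := 2) (l := 8) (by norm_num) (by norm_num))).congr fun x _ => by
      simp only [h_om]; ring
  have b_om : S.Big 1 4 om :=
    (((bzX.mul bj).mono (m := 1) (l := 4) (by norm_num) (by norm_num)).sub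
      ((bz.mul bj).mono (m := 1) (l := 4) (by norm_num) (by norm_num))).congr fun x _ => by
      simp only [h_om]; ring
  have b_om0 : S.Big 0 0 om := (b_om.mono le_rfl (by norm_num : 4 ≤ 8)).bounded
  have bB : S.Big 2 8 (fun x => (θ * z₀ x * z x + (1 / 2 - θ) * z x ^ 2) * i x ^ 2) := by
    have h1 := ((b0.mul bz).const_mul θ).add
      (((bz.pow 2).const_mul (1 / 2 - θ)).mono (m := -1 + -1) (l := 0 + 0) (by norm_num)
        (by norm_num))
    exact ((h1.mul (bi.pow 2)).mono (m := 2) (l := 8) (by norm_num) (by norm_num)).congr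
      fun x _ => by ring
  obtain ⟨R, hR⟩ : ∃ R : ℕ × ℝ × ℝ → ℂ,
    R = fun x => ampl ρ a₁ a₂ c lam θ (S.h x) x.2.1 x.2.2 := ⟨_, rfl⟩
  have bR : S.Big 2 8 (fun x => R x - Complex.exp (-om x)) := by
    have h1 := (b_om.neg.exp_sub_sum b_om0.neg 2).mono (m := 2) (l := 8) (by norm_num) (by norm_num)
    refine ((bzi.add bB).sub h1).congr fun x _ => ?_
    simp only [hR, ampl, mcsFactor_eq, Finset.sum_range_succ, Finset.sum_range_zero, Nat.factorial,
      hi, hz, hz₀, zTot]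
    push_cast
    ring
  have br : S.Big (1 + 1) 8 (fun x => (R x - Complex.exp (-om x)) * Complex.exp (om x)) := by
    simpa using bR.mul b_om0.exp
  have bRn := br.pow_nat (n := 1) (M := fun x => x.1 - N₀) (K := 1 / lam) le_rfl le_rfl
    fun x hx => by
      rw [hdom] at hx
      have h1 := meshWidth_mul hlam hx.1
      have h2 : ((x.1 - N₀ : ℕ) : ℝ) ≤ x.1 := by exact_mod_cast Nat.sub_le _ _
      have h3 := meshWidth_pos hlam hx.1
      rw [le_div_iff₀ hlam, hSh]
      simp only
      calc ((x.1 - N₀ : ℕ) : ℝ) * meshWidth lam x.1 * lam ≤ x.1 * meshWidth lam x.1 * lam := by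
            gcongr
        _ = 1 := by rw [← h1]; ring
  -- one Euler half-step divides by about `X / 2`, which is of order `h⁻¹`
  obtain ⟨f, hf⟩ : ∃ f : ℕ × ℝ × ℝ → ℂ, f = fun x => 1 / (1 - 1 / 2 * z x) := ⟨_, rfl⟩
  obtain ⟨g, hg⟩ : ∃ f : ℕ × ℝ × ℝ → ℂ, f = fun x => 2 * (1 / X x) := ⟨_, rfl⟩
  have bX : S.Big 1 2 (fun x => 1 / X x) := by
    refine ((Scale.Big.one_div_xSym hlam hs hs0 hys).const_mul (1 / (1 - |ρ| : ℝ))).of_norm_le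
      fun x hx => ?_
    rw [norm_mul, norm_div, norm_div, norm_div, norm_one, hX, Complex.norm_real, Complex.norm_real,
      Complex.norm_real, Real.norm_of_nonneg hρ'.le, Real.norm_of_nonneg (p1 x hx).le,
      Real.norm_of_nonneg (pX0 x hx).le, div_mul_div_comm, one_mul]
    exact one_div_le_one_div_of_le (mul_pos hρ' (p1 x hx)) (pX x hx)
  have bg : S.Big 1 2 g := hg ▸ bX.const_mul 2
  have bf : S.Big 1 2 f := bg.of_norm_le fun x hx => by
    have h1 := norm_zTot_bound (ρ := ρ) (a₁ := a₁) (a₂ := a₂) (c := c) (lam := lam) (h := S.h x)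
      x.2.1 x.2.2
    have h2 := pX0 x hx
    simp only [hf, hg, hz, hX]
    rw [norm_mul, norm_div, norm_div, norm_one, Complex.norm_real, Real.norm_of_nonneg h2.le]
    calc 1 / ‖1 - 1 / 2 * zTot ρ a₁ a₂ c lam (S.h x) x.2.1 x.2.2‖
        ≤ 1 / (xTot ρ c lam (S.h x) x.2.1 x.2.2 / 2) :=
          one_div_le_one_div_of_le (by positivity) h1
      _ = ‖(2 : ℂ)‖ * (1 / xTot ρ c lam (S.h x) x.2.1 x.2.2) := by simp; ring
  have bfg : S.Big (1 + 1) 4 (fun x => f x - g x) := by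
    have h1 := (bf.mul bg).mul ((bzX.const_mul (1 / 2)).sub (.const 1))
    refine (h1.mono (m := 1 + 1) (l := 4) (by norm_num) (by norm_num)).congr fun x hx => ?_
    have h2 : X x ≠ 0 := by simp only [hX]; exact_mod_cast (pX0 x hx).ne'
    have h3 : (1 - 1 / 2 * z x) ≠ 0 := fun h0 => by
      have := one_le_norm_eulerDenom (a₁ := a₁) (a₂ := a₂) hρ hc hlam (hpos x hx) x.2.1 x.2.2
      simp only [hz] at h0
      rw [h0, norm_zero] at this
      linarith
    have h4 : f x * (1 - 1 / 2 * z x) = 1 := by simp only [hf]; exact one_div_mul_cancel h3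
    have h5 : g x * X x = 2 := by simp only [hg]; field_simp
    linear_combination g x * h4 - (1 / 2) * f x * h5
  have bm := bf.pow_sub_pow bg bfg (by norm_num) (2 * N₀)
  -- the product of the `2 N₀` Euler factors and the `N - N₀` MCS factors; the latter are written as
  -- `N` factors `exp (-om)` times the bounded correction `exp (N₀ om)`
  have bE : S.Big 1 4 (fun x => Complex.exp (N₀ * om x) - 1) := by
    have := ((b_om.const_mul N₀).exp_sub_sum (b_om0.const_mul N₀) 1).mono (m := 1) (l := 4)
      (by norm_num) (by norm_num)
    exact this.congr fun x _ => by simp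
  have bfm := bf.pow (2 * N₀)
  have c1 := (bfm.mul ((b_om0.const_mul N₀).exp.mul bRn)).mono (m := (2 * N₀ + 1 : ℕ))
    (l := 8 * N₀ + 8) (by push_cast; linarith) (by omega)
  have c2 := (bfm.mul bE).mono (m := (2 * N₀ + 1 : ℕ)) (l := 8 * N₀ + 8)
    (by push_cast; linarith) (by omega)
  have c3 := bm.mono (m := (2 * N₀ + 1 : ℕ)) (l := 8 * N₀ + 8) (by push_cast; linarith) (by omega)
  obtain ⟨C₁, hC₁, hbd⟩ := (c1.add c2).add c3
  have hm0 : 0 < min 1 (c ^ 2) := lt_min one_pos (by positivity)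
  obtain ⟨d, hd⟩ : ∃ d : ℝ, d = (1 - |ρ|) * min 1 (c ^ 2) / (lam ^ 2 * θ ^ 2) := ⟨_, rfl⟩
  have hd0 : 0 < d := by rw [hd]; positivity
  obtain ⟨C₂, hC₂, habs⟩ := exists_scale_pow_mul_exp_le (half_pos hd0) (8 * N₀ + 8)
  refine ⟨C₁ * C₂ + 1, d / 2, by positivity, half_pos hd0, fun x hx => ?_⟩
  rw [← hdom] at hx
  have hbx := hbd x hx
  have hx' := hx
  rw [hdom] at hx'
  have hh0 := meshWidth_pos hlam hx'.1
  -- `N om` is the real exponent of `highSym`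
  obtain ⟨Ω, hΩ⟩ : ∃ Ω : ℝ, Ω = 1 / (4 * lam ^ 2 * θ ^ 2) *
      (iota ρ c x.2.1 x.2.2 / (Real.sin (x.2.1 / 2) ^ 2 * Real.sin (x.2.2 / 2) ^ 2)) := ⟨_, rfl⟩
  have n1 := sin_half_ne_zero (hs x hx) (hs0 x hx)
  have n2 := sin_half_ne_zero (ht x hx) (ht0 x hx)
  have hN_om : (x.1 : ℂ) * om x = Ω := by
    have hN : (x.1 : ℝ) = 1 / (lam * meshWidth lam x.1) := by
      rw [← meshWidth_mul hlam hx'.1]; field_simp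
    have e : (x.1 : ℝ) * (xTot ρ c lam (S.h x) x.2.1 x.2.2 *
        (1 / θ * (1 / xSym lam (S.h x) x.2.1) *
          (1 / θ * (1 / xSym (lam / c ^ 2) (S.h x) x.2.2)))) = Ω := by
      rw [hΩ, hN, xTot_eq_iota hc.ne' (hpos x hx).ne', hSh]
      have m1 : Real.sin (x.2.1 / 2) ≠ 0 := fun h => by simp [h] at n1
      have m2 : Real.sin (x.2.2 / 2) ≠ 0 := fun h => by simp [h] at n2
      unfold xSym
      field_simp
    rw [← e]
    simp only [h_om, hX, hj]
    push_cast
    ring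
  have hgm : g x ^ (2 * N₀) = (((meshWidth lam x.1 * c ^ 2 / (2 * lam * iota ρ c x.2.1 x.2.2)) ^
      (2 * N₀) : ℝ) : ℂ) := by
    have e : 2 * (1 / xTot ρ c lam (S.h x) x.2.1 x.2.2) =
        meshWidth lam x.1 * c ^ 2 / (2 * lam * iota ρ c x.2.1 x.2.2) := by
      rw [xTot_eq_iota hc.ne' (hpos x hx).ne', hSh]
      field_simp
      ring
    rw [← e]
    simp only [hg, hX]
    push_cast
    rfl
  have hhigh : (highSym ρ c lam θ N₀ (meshWidth lam x.1) x.2.1 x.2.2 : ℂ) =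
      g x ^ (2 * N₀) * Complex.exp (-Ω) := by
    rw [hgm, highSym, ← hΩ]
    push_cast
    rfl
  have hmain : mainSym ρ a₁ a₂ c lam θ (meshWidth lam x.1) N₀ x.1 x.2.1 x.2.2 =
      f x ^ (2 * N₀) * R x ^ (x.1 - N₀) := by
    rw [mainSym, min_eq_right hx'.2.1]
    simp only [hf, hR, hz, hSh]
  have hRn : R x ^ (x.1 - N₀) = (1 + (R x - Complex.exp (-om x)) * Complex.exp (om x)) ^ (x.1 - N₀) *
      (Complex.exp (-Ω) * Complex.exp (N₀ * om x)) := by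
    have e : R x = (1 + (R x - Complex.exp (-om x)) * Complex.exp (om x)) * Complex.exp (-om x) := by
      have : Complex.exp (om x) * Complex.exp (-om x) = 1 := by rw [← Complex.exp_add]; simp
      linear_combination (Complex.exp (-om x) - R x) * this
    conv_lhs => rw [e]
    rw [mul_pow, ← Complex.exp_nat_mul, ← Complex.exp_add, ← hN_om, Nat.cast_sub hx'.2.1]
    congr 2
    ring
  rw [hmain, hhigh, hRn]
  have hfac : f x ^ (2 * N₀) * ((1 + (R x - Complex.exp (-om x)) * Complex.exp (om x)) ^ (x.1 - N₀) *
      (Complex.exp (-Ω) * Complex.exp (N₀ * om x))) - g x ^ (2 * N₀) * Complex.exp (-Ω) =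
      Complex.exp (-Ω) * (f x ^ (2 * N₀) * (Complex.exp (N₀ * om x) *
        ((1 + (R x - Complex.exp (-om x)) * Complex.exp (om x)) ^ (x.1 - N₀) - 1)) +
        f x ^ (2 * N₀) * (Complex.exp (N₀ * om x) - 1) + (f x ^ (2 * N₀) - g x ^ (2 * N₀))) := by
    ring
  rw [hfac, norm_mul, ← Complex.ofReal_neg, Complex.norm_exp_ofReal]
  have hre : Real.exp (-Ω) ≤ Real.exp (-(2 * (d / 2) * ((1 / x.2.1) ^ 2 + (1 / x.2.2) ^ 2))) := by
    apply Real.exp_le_exp.2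
    have := le_high_exponent hρ hc hlam hθ (hs x hx) (ht x hx) (hs0 x hx) (ht0 x hx)
    rw [← hΩ, ← hd, phaseHigh] at this
    linarith
  have hab := habs (1 / x.2.1) (1 / x.2.2)
  rw [zpow_natCast, hSy, hSh] at hbx
  refine (mul_le_mul hre hbx (norm_nonneg _) (Real.exp_pos _).le).trans ?_
  rw [phaseHigh]
  calc _ = C₁ * meshWidth lam x.1 ^ (2 * N₀ + 1) * ((1 + |1 / x.2.1| + |1 / x.2.2|) ^ (8 * N₀ + 8) *
        Real.exp (-(2 * (d / 2) * ((1 / x.2.1) ^ 2 + (1 / x.2.2) ^ 2)))) := by ring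
    _ ≤ C₁ * meshWidth lam x.1 ^ (2 * N₀ + 1) * (C₂ *
        Real.exp (-(d / 2 * ((1 / x.2.1) ^ 2 + (1 / x.2.2) ^ 2)))) := by gcongr
    _ = C₁ * C₂ * (meshWidth lam x.1 ^ (2 * N₀ + 1) *
        Real.exp (-(d / 2 * ((1 / x.2.1) ^ 2 + (1 / x.2.2) ^ 2)))) := by ring
    _ ≤ _ := by
        refine mul_le_mul_of_nonneg_right (by linarith) (by positivity)

/-! ### One angle away from zero, one bounded wavenumber -/

/-- The phase where the first angle is away from zero and the second wavenumber is bounded. -/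
def phaseCS (c h s t : ℝ) : ℝ := (1 / s) ^ 2 + (t / (c * h)) ^ 2

/-- For `θ = 1/2`, the approximation of the symbol of the numerical solution where the first angle
is away from zero and the second wavenumber is bounded. -/
def csSym (a c lam : ℝ) (N₀ N : ℕ) (h s t : ℝ) : ℂ :=
  (((-1) ^ (N - N₀) * (h / (2 * lam * Real.sin (s / 2) ^ 2)) ^ (2 * N₀) *
    Real.exp (-(1 / (lam ^ 2 * Real.sin (s / 2) ^ 2))) : ℝ) : ℂ) *
    Complex.exp (psi a (t / (c * h)))

theorem one_div_sin_half_sq_ge {s : ℝ} (hs : |s| ≤ Real.pi) (h0 : s ≠ 0) :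
    4 * (1 / s) ^ 2 ≤ 1 / Real.sin (s / 2) ^ 2 := by
  rw [le_div_iff₀ (sin_half_ne_zero hs h0)]
  calc 4 * (1 / s) ^ 2 * Real.sin (s / 2) ^ 2 ≤ 4 * (1 / s) ^ 2 * (s ^ 2 / 4) := by
        gcongr; exact sin_half_sq_le s
    _ = 1 := by field_simp

theorem one_div_sin_half_sq_le {s : ℝ} (hs : |s| ≤ Real.pi) (h0 : s ≠ 0) :
    1 / Real.sin (s / 2) ^ 2 ≤ Real.pi ^ 2 * (1 / s) ^ 2 := by
  rw [div_le_iff₀ (sin_half_ne_zero hs h0)]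
  calc (1 : ℝ) = Real.pi ^ 2 * (1 / s) ^ 2 * (s ^ 2 / Real.pi ^ 2) := by
        have := Real.pi_pos.ne'
        field_simp
    _ ≤ _ := by gcongr; exact sq_le_sin_half_sq hs

theorem norm_exp_psi (a κ : ℝ) : ‖Complex.exp (psi a κ)‖ = Real.exp (-κ ^ 2) := by
  rw [Complex.norm_exp]
  congr 1
  simp [psi, pow_two]

/-- The scale of the region where the first angle is away from zero and the second wavenumber is
bounded. -/
def csScale (c lam : ℝ) (N₀ : ℕ) (hlam : 0 < lam) : Scale (ℕ × ℝ × ℝ) where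
  dom := region lam N₀ (phaseCS c)
  h x := meshWidth lam x.1
  y x := 1 + |1 / x.2.1| + |x.2.2 / (c * meshWidth lam x.1)|
  h_pos x hx := meshWidth_pos hlam hx.1
  h_le x hx := hx.2.2.1
  one_le x _ := by
    linarith [abs_nonneg (1 / x.2.1), abs_nonneg (x.2.2 / (c * meshWidth lam x.1))]
  bound := ⟨1296, fun x hx => scale_bound rfl (meshWidth_pos hlam hx.1) hx.2.2.1
    hx.2.2.2.2.2.2.2⟩

/-- For `θ = 1/2`, minus the amplification factor of one MCS step where `z₁` is large, `z₂` is small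
and `z₀` moderate: it is `1 + 4 / z₁ + z₂` up to second-order terms. -/
theorem Scale.Big.mcsFactor_cs {α : Type} {S : Scale α} {z₀ z₁ z₂ x₁ : α → ℂ}
    (h₀ : S.Big 0 1 z₀) (h₂ : S.Big 1 2 z₂)
    (hi : S.Big 1 2 (fun x => 1 / (1 - ((1 / 2 : ℝ) : ℂ) * z₁ x)))
    (hj : S.Big 2 4 (fun x => 1 / (1 - ((1 / 2 : ℝ) : ℂ) * z₁ x) -
      1 / ((1 / 2 : ℝ) : ℂ) * (1 / x₁ x)))
    (hn₁ : ∀ x ∈ S.dom, 1 ≤ ‖1 - ((1 / 2 : ℝ) : ℂ) * z₁ x‖)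
    (hn₂ : ∀ x ∈ S.dom, 1 ≤ ‖1 - ((1 / 2 : ℝ) : ℂ) * z₂ x‖) :
    S.Big 2 8 (fun x => -mcsFactor (1 / 2) (z₀ x) (z₁ x) (z₂ x) -
      (1 + (z₂ x - 4 * (1 / x₁ x)))) := by
  obtain ⟨i, hi'⟩ : ∃ i : α → ℂ, i = fun x => 1 / (1 - ((1 / 2 : ℝ) : ℂ) * z₁ x) := ⟨_, rfl⟩
  obtain ⟨k, hk'⟩ : ∃ i : α → ℂ, i = fun x => 1 / (1 - ((1 / 2 : ℝ) : ℂ) * z₂ x) := ⟨_, rfl⟩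
  rw [← hi'] at hi
  have hj' : S.Big 2 4 (fun x => i x - 2 * (1 / x₁ x)) := hj.congr fun x _ => by
    simp only [hi']; push_cast; ring
  have hk : S.Big 0 0 k := hk' ▸ Scale.Big.inv_of_le one_pos fun x hx => by simpa using hn₂ x hx
  have e1 : ∀ x ∈ S.dom, i x * (1 - 1 / 2 * z₁ x) = 1 := fun x hx => by
    simp only [hi']; push_cast
    refine one_div_mul_cancel fun h0 => ?_
    have := hn₁ x hx
    push_cast at this
    rw [h0, norm_zero] at this
    linarith
  have e2 : ∀ x ∈ S.dom, k x * (1 - 1 / 2 * z₂ x) = 1 := fun x hx => by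
    simp only [hk']; push_cast
    refine one_div_mul_cancel fun h0 => ?_
    have := hn₂ x hx
    push_cast at this
    rw [h0, norm_zero] at this
    linarith
  have b1 : S.Big 2 8 (fun x => z₀ x ^ 2 * (i x * k x) ^ 2) :=
    ((h₀.pow 2).mul ((hi.mul hk).pow 2)).mono (by norm_num) (by norm_num)
  -- `m` is twice the product of `1 + z₁ z₂ / 4` and `1 / (1 - z₁/2)`, written without the large `z₁`
  obtain ⟨m, hm⟩ : ∃ m : α → ℂ, m = fun x => -z₂ x + (2 + z₂ x) * i x := ⟨_, rfl⟩
  have h20 : S.Big 0 0 z₂ := (h₂.mono le_rfl (by norm_num : 2 ≤ 8)).bounded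
  have bm : S.Big 1 2 m := by
    have := h₂.neg.add ((((Scale.Big.const (S := S) 2).add h20).mul hi).mono (m := 1) (l := 2)
      (by norm_num) (by norm_num))
    exact this.congr fun x _ => by simp only [hm]
  have b2 : S.Big 2 8 (fun x => z₀ x * m x * i x * k x ^ 2) :=
    (((h₀.mul bm).mul hi).mul (hk.pow 2)).mono (by norm_num) (by norm_num)
  have b3 : S.Big 2 8 (fun x => k x * z₂ x * m x) :=
    ((hk.mul h₂).mul bm).mono (by norm_num) (by norm_num)
  have b4 : S.Big 2 8 (fun x => z₂ x * i x) := (h₂.mul hi).mono (by norm_num) (by norm_num)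
  have b5 := hj'.mono (m := 2) (l := 8) le_rfl (by norm_num)
  have tot := ((((b1.const_mul (-1 / 2)).add (b2.const_mul (-1 / 2))).add
    (b3.const_mul (-1 / 2))).sub b4).sub (b5.const_mul 2)
  refine tot.congr fun x hx => ?_
  have f1 := e1 x hx
  have f2 := e2 x hx
  have hR : mcsFactor (1 / 2) (z₀ x) (z₁ x) (z₂ x) = 1 + (z₀ x + z₁ x + z₂ x) * (i x * k x) +
      1 / 2 * z₀ x * (z₀ x + z₁ x + z₂ x) * (i x * k x) ^ 2 := by
    rw [mcsFactor_eq, ← one_div_mul_one_div, hi', hk']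
    push_cast
    ring
  rw [hR]
  simp only [hm]
  generalize i x = u at f1 ⊢
  generalize k x = v at f2 ⊢
  have u0 : u ≠ 0 := fun h => by simp [h] at f1
  have v0 : v ≠ 0 := fun h => by simp [h] at f2
  have g1 : z₁ x = 2 - 2 / u := by field_simp; linear_combination (-2) * f1
  have g2 : z₂ x = 2 - 2 / v := by field_simp; linear_combination (-2) * f2
  rw [g1, g2]
  generalize 1 / x₁ x = w
  field_simp
  ring


/-- For `θ = 1/2`, the symbol of the numerical solution agrees with `csSym` to relative order `h`
where the first angle is away from zero and the second wavenumber is bounded. -/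
theorem mainSym_sub_csSym_le {ρ a₁ a₂ c lam : ℝ} (hρ : |ρ| < 1) (hc : 0 < c) (hlam : 0 < lam)
    (N₀ : ℕ) : ∃ C δ : ℝ, 0 < C ∧ 0 < δ ∧ ∀ x ∈ region lam N₀ (phaseCS c),
      ‖mainSym ρ a₁ a₂ c lam (1 / 2) (meshWidth lam x.1) N₀ x.1 x.2.1 x.2.2 -
        csSym a₂ c lam N₀ x.1 (meshWidth lam x.1) x.2.1 x.2.2‖ ≤
      C * (meshWidth lam x.1 ^ (2 * N₀ + 1) *
        Real.exp (-(δ * phaseCS c (meshWidth lam x.1) x.2.1 x.2.2))) := by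
  obtain ⟨S, hS⟩ : ∃ S, S = csScale c lam N₀ hlam := ⟨_, rfl⟩
  have hdom : S.dom = region lam N₀ (phaseCS c) := by rw [hS]; rfl
  have hSh : S.h = fun x => meshWidth lam x.1 := by rw [hS]; rfl
  obtain ⟨η, hη⟩ : ∃ η : ℕ × ℝ × ℝ → ℝ, η = fun x => x.2.2 / (c * S.h x) := ⟨_, rfl⟩
  have hSy : S.y = fun x => 1 + |1 / x.2.1| + |η x| := by rw [hη, hSh, hS]; rfl
  have hpos : ∀ x ∈ S.dom, 0 < S.h x := S.h_pos
  have hs : ∀ x ∈ S.dom, |x.2.1| ≤ Real.pi := fun x hx => by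
    rw [hdom] at hx; exact hx.2.2.2.2.2.1
  have hs0 : ∀ x ∈ S.dom, x.2.1 ≠ 0 := fun x hx => by rw [hdom] at hx; exact hx.2.2.2.1
  have hys : ∀ x ∈ S.dom, |1 / x.2.1| ≤ S.y x := fun x _ => by
    rw [hSy]; simp only; linarith [abs_nonneg (η x)]
  have bη : S.Big 0 1 (fun x => (η x : ℂ)) := .of_le (C := 1) fun x hx => by
    simp only [hSy, Complex.norm_real, Real.norm_eq_abs]
    simp
    positivity
  have et : ∀ x ∈ S.dom, x.2.2 = c * S.h x * η x := fun x hx => by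
    have := (hpos x hx).ne'
    simp only [hη]; field_simp
  have hl2 : 0 < lam / c ^ 2 := by positivity
  have hρ' : 0 < 1 - |ρ| := by linarith
  have hc0 : (c : ℂ) ≠ 0 := by exact_mod_cast hc.ne'
  have p1 : ∀ x ∈ S.dom, 0 < xSym lam (S.h x) x.2.1 := fun x hx =>
    xSym_pos hlam (hpos x hx) (hs x hx) (hs0 x hx)
  have pX : ∀ x ∈ S.dom, (1 - |ρ|) * xSym lam (S.h x) x.2.1 ≤
      xTot ρ c lam (S.h x) x.2.1 x.2.2 := fun x hx =>
    le_trans (mul_le_mul_of_nonneg_left (by linarith [xSym_nonneg hl2 (hpos x hx) x.2.2]) hρ'.le)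
      (le_xTot hc hlam (hpos x hx) _ _)
  have bh : S.Big 1 0 (fun x => (S.h x : ℂ)) := Scale.Big.h_one
  -- the symbols of the three parts of `A`
  obtain ⟨i1, j1⟩ := Scale.Big.one_div_one_sub hlam (show (0 : ℝ) < 1 / 2 by norm_num) a₁ hs hs0 hys
  obtain ⟨z₁, hz₁⟩ : ∃ z : ℕ × ℝ × ℝ → ℂ, z = fun x => zSym lam a₁ (S.h x) x.2.1 := ⟨_, rfl⟩
  obtain ⟨z₂, hz₂⟩ : ∃ z : ℕ × ℝ × ℝ → ℂ,
    z = fun x => zSym (lam / c ^ 2) (c * a₂) (S.h x) x.2.2 := ⟨_, rfl⟩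
  obtain ⟨z₀, hz₀⟩ : ∃ z : ℕ × ℝ × ℝ → ℂ,
    z = fun x => (xMix ρ c lam (S.h x) x.2.1 x.2.2 : ℂ) := ⟨_, rfl⟩
  obtain ⟨x₁, hx₁⟩ : ∃ z : ℕ × ℝ × ℝ → ℂ,
    z = fun x => (xSym lam (S.h x) x.2.1 : ℂ) := ⟨_, rfl⟩
  obtain ⟨z, hz⟩ : ∃ z : ℕ × ℝ × ℝ → ℂ,
    z = fun x => zTot ρ a₁ a₂ c lam (S.h x) x.2.1 x.2.2 := ⟨_, rfl⟩
  have bψ : S.Big 0 2 (fun x => psi a₂ (η x)) := by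
    have := (((bη.pow 2).mono (m := 0) (l := 2) (by norm_num) (by norm_num)).neg).add
      ((bη.const_mul (Complex.I * a₂)).mono (m := 0) (l := 2) (by norm_num) (by norm_num))
    exact this
  have bs : S.Big 0 4 (fun x => c ^ 2 * (η x : ℂ) ^ 4 / 12 -
      Complex.I * a₂ * c ^ 2 * η x ^ 3 / 6) := by
    have := (((bη.pow 4).const_mul ((c : ℂ) ^ 2 / 12)).mono (m := 0) (l := 4) (by norm_num)
      (by norm_num)).sub (((bη.pow 3).const_mul (Complex.I * a₂ * c ^ 2 / 6)).mono (m := 0)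
      (l := 4) (by norm_num) (by norm_num))
    exact this.congr fun x _ => by ring
  have e2 : S.Big 3 6 (fun x => z₂ x - lam * S.h x * psi a₂ (η x)) := by
    have h1 := (Scale.Big.zSym_low (lam / c ^ 2) (c * a₂) c bη).mono (m := 3) (l := 6)
      (by norm_num) le_rfl
    have h2 := (((bh.pow 3).mul bs).const_mul lam).mono (m := 3) (l := 6) (by norm_num)
      (by norm_num)
    refine (h1.add h2).congr fun x hx => ?_
    simp only [hz₂, psi]
    rw [et x hx]
    push_cast
    field_simp
    ring
  have bψ' : S.Big 1 2 (fun x => lam * S.h x * psi a₂ (η x)) :=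
    ((bh.mul bψ).const_mul lam).congr fun x _ => by ring
  have b2 : S.Big 1 2 z₂ :=
    ((e2.trade_to (m := 1) (l := 2) 1 (by norm_num) (by norm_num)).add bψ').congr
      fun x _ => by ring
  have b0 : S.Big 0 1 z₀ := by
    refine (((bη.mul (Scale.Big.sin_zero (fun x => x.2.1))).const_mul (2 * lam * ρ)).mono (m := 0)
      (l := 1) (by norm_num) (by norm_num)).of_norm_le fun x hx => ?_
    have h1 : |Real.sin x.2.2| ≤ c * S.h x * |η x| := by
      have := Real.abs_sin_le_abs (x := x.2.2)
      rwa [et x hx, abs_mul, abs_of_pos (mul_pos hc (hpos x hx)), ← et x hx] at this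
    have hh := hpos x hx
    simp only [hz₀, xMix, norm_mul, Complex.norm_real, Real.norm_eq_abs, abs_neg, abs_div, abs_mul,
      abs_of_pos hc, abs_of_pos hh, Complex.norm_ofNat, abs_two]
    calc 2 * |lam| * |ρ| / (c * S.h x) * (|Real.sin x.2.1| * |Real.sin x.2.2|)
        ≤ 2 * |lam| * |ρ| / (c * S.h x) * (|Real.sin x.2.1| * (c * S.h x * |η x|)) := by gcongr
      _ = _ := by field_simp
  -- one MCS step multiplies by `-exp om` up to order `h²`, where `om` is of order `h`
  obtain ⟨om, h_om⟩ : ∃ w : ℕ × ℝ × ℝ → ℂ,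
    w = fun x => lam * S.h x * psi a₂ (η x) - 4 * (1 / x₁ x) := ⟨_, rfl⟩
  have bx₁ : S.Big 1 2 (fun x => 1 / x₁ x) := by
    simp only [hx₁]; exact Scale.Big.one_div_xSym hlam hs hs0 hys
  have b_om : S.Big 1 2 om := h_om ▸ bψ'.sub (bx₁.const_mul 4)
  have b_om0 : S.Big 0 0 om := (b_om.mono le_rfl (by norm_num : 2 ≤ 8)).bounded
  obtain ⟨R, hR⟩ : ∃ R : ℕ × ℝ × ℝ → ℂ,
    R = fun x => -ampl ρ a₁ a₂ c lam (1 / 2) (S.h x) x.2.1 x.2.2 := ⟨_, rfl⟩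
  have bR : S.Big 2 8 (fun x => R x - Complex.exp (om x)) := by
    have h1 := (b_om.exp_sub_sum b_om0 2).mono (m := 2) (l := 8) (by norm_num) (by norm_num)
    have h2 := Scale.Big.mcsFactor_cs (z₀ := z₀) (z₁ := z₁) (z₂ := z₂) (x₁ := x₁) b0 b2
      (by simpa only [hz₁] using i1) (by simpa only [hz₁, hx₁] using j1)
      (fun x hx => by
        simp only [hz₁]
        exact one_le_norm_one_sub_zSym (by norm_num) hlam (hpos x hx) _)
      (fun x hx => by
        simp only [hz₂]
        exact one_le_norm_one_sub_zSym (by norm_num) hl2 (hpos x hx) _)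
    have h3 := e2.mono (m := 2) (l := 8) (by norm_num) (by norm_num)
    refine ((h2.add h3).sub h1).congr fun x _ => ?_
    simp only [hR, ampl, hz₀, hz₁, hz₂, h_om, Finset.sum_range_succ, Finset.sum_range_zero,
      Nat.factorial]
    push_cast
    ring
  have br : S.Big (1 + 1) 8 (fun x => (R x - Complex.exp (om x)) * Complex.exp (-om x)) := by
    simpa using bR.mul b_om0.neg.exp
  have bRn := br.pow_nat (n := 1) (M := fun x => x.1 - N₀) (K := 1 / lam) le_rfl le_rfl
    fun x hx => by
      rw [hdom] at hx
      have h1 := meshWidth_mul hlam hx.1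
      have h2 : ((x.1 - N₀ : ℕ) : ℝ) ≤ x.1 := by exact_mod_cast Nat.sub_le _ _
      have h3 := meshWidth_pos hlam hx.1
      rw [le_div_iff₀ hlam, hSh]
      simp only
      calc ((x.1 - N₀ : ℕ) : ℝ) * meshWidth lam x.1 * lam ≤ x.1 * meshWidth lam x.1 * lam := by
            gcongr
        _ = 1 := by rw [← h1]; ring
  -- in the Euler factors only the symbol of the direction with the large angle matters
  obtain ⟨f, hf⟩ : ∃ f : ℕ × ℝ × ℝ → ℂ, f = fun x => 1 / (1 - 1 / 2 * z x) := ⟨_, rfl⟩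
  obtain ⟨g, hg⟩ : ∃ f : ℕ × ℝ × ℝ → ℂ, f = fun x => 2 * (1 / x₁ x) := ⟨_, rfl⟩
  have bg : S.Big 1 2 g := hg ▸ bx₁.const_mul 2
  have bf : S.Big 1 2 f := (bg.const_mul (1 / (1 - |ρ| : ℝ))).of_norm_le fun x hx => by
    have h1 := norm_zTot_bound (ρ := ρ) (a₁ := a₁) (a₂ := a₂) (c := c) (lam := lam) (h := S.h x)
      x.2.1 x.2.2
    have h2 := p1 x hx
    simp only [hf, hg, hz, hx₁]
    rw [norm_mul, norm_mul, norm_div, norm_div, norm_div, norm_one, Complex.norm_real,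
      Complex.norm_real, Real.norm_of_nonneg h2.le, Real.norm_of_nonneg hρ'.le]
    calc 1 / ‖1 - 1 / 2 * zTot ρ a₁ a₂ c lam (S.h x) x.2.1 x.2.2‖
        ≤ 1 / ((1 - |ρ|) * xSym lam (S.h x) x.2.1 / 2) :=
          one_div_le_one_div_of_le (by positivity) (by linarith [pX x hx])
      _ = 1 / (1 - |ρ|) * (‖(2 : ℂ)‖ * (1 / xSym lam (S.h x) x.2.1)) := by
          rw [Complex.norm_ofNat]; field_simp
  have bzX : S.Big 0 1 (fun x => z x + x₁ x) := by
    have h1 := (Scale.Big.zSym_im (S := S) lam a₁ (fun x => x.2.1)).mono (m := 0) (l := 1) le_rfl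
      (by norm_num)
    have h2 := ((b2.mono le_rfl (by norm_num : 2 ≤ 8)).bounded).mono (m := 0) (l := 1) le_rfl
      (by norm_num)
    refine ((b0.add h1).add h2).congr fun x _ => ?_
    simp only [hz, hz₀, hz₂, hx₁, zTot]
    rw [zSym.eq_1 lam a₁]
    ring
  have bfg : S.Big (1 + 1) 5 (fun x => f x - g x) := by
    have h1 := (bf.mul bg).mul ((bzX.const_mul (1 / 2)).sub
      ((Scale.Big.const (S := S) 1).mono (m := 0) (l := 1) le_rfl (by norm_num)))
    refine (h1.mono (m := 1 + 1) (l := 5) (by norm_num) (by norm_num)).congr fun x hx => ?_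
    have h2 : x₁ x ≠ 0 := by simp only [hx₁]; exact_mod_cast (p1 x hx).ne'
    have h3 : (1 - 1 / 2 * z x) ≠ 0 := fun h0 => by
      have := one_le_norm_eulerDenom (a₁ := a₁) (a₂ := a₂) hρ hc hlam (hpos x hx) x.2.1 x.2.2
      simp only [hz] at h0
      rw [h0, norm_zero] at this
      linarith
    have h4 : f x * (1 - 1 / 2 * z x) = 1 := by simp only [hf]; exact one_div_mul_cancel h3
    have h5 : g x * x₁ x = 2 := by simp only [hg]; field_simp
    linear_combination g x * h4 - (1 / 2) * f x * h5
  have bm := bf.pow_sub_pow bg bfg (by norm_num) (2 * N₀)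
  -- the product of the `2 N₀` Euler factors and the `N - N₀` MCS factors, up to the sign of the
  -- latter, which are written as `N` factors `exp om` times the bounded correction `exp (-N₀ om)`
  have bE : S.Big 1 2 (fun x => Complex.exp (-(N₀ * om x)) - 1) := by
    have := ((b_om.const_mul N₀).neg.exp_sub_sum (b_om0.const_mul N₀).neg 1).mono (m := 1) (l := 2)
      (by norm_num) (by norm_num)
    exact this.congr fun x _ => by simp
  have bfm := bf.pow (2 * N₀)
  have c1 := (bfm.mul ((b_om0.const_mul N₀).neg.exp.mul bRn)).mono (m := (2 * N₀ + 1 : ℕ))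
    (l := 10 * N₀ + 10) (by push_cast; linarith) (by omega)
  have c2 := (bfm.mul bE).mono (m := (2 * N₀ + 1 : ℕ)) (l := 10 * N₀ + 10)
    (by push_cast; linarith) (by omega)
  have c3 := bm.mono (m := (2 * N₀ + 1 : ℕ)) (l := 10 * N₀ + 10) (by push_cast; linarith) (by omega)
  obtain ⟨C₁, hC₁, hbd⟩ := (c1.add c2).add c3
  have hm0 : 0 < min 1 (4 / lam ^ 2) := lt_min one_pos (by positivity)
  obtain ⟨d, hd⟩ : ∃ d : ℝ, d = min 1 (4 / lam ^ 2) := ⟨_, rfl⟩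
  have hd0 : 0 < d := by rw [hd]; positivity
  obtain ⟨C₂, hC₂, habs⟩ := exists_scale_pow_mul_exp_le (half_pos hd0) (10 * N₀ + 10)
  refine ⟨C₁ * C₂ + 1, d / 2, by positivity, half_pos hd0, fun x hx => ?_⟩
  rw [← hdom] at hx
  have hbx := hbd x hx
  have hx' := hx
  rw [hdom] at hx'
  have hh0 := meshWidth_pos hlam hx'.1
  have n1 := sin_half_ne_zero (hs x hx) (hs0 x hx)
  have m1 : Real.sin (x.2.1 / 2) ≠ 0 := fun h => by simp [h] at n1
  -- `N om` is the exponent of `csSym`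
  obtain ⟨Ω, hΩ⟩ : ∃ Ω : ℂ, Ω = -((1 / (lam ^ 2 * Real.sin (x.2.1 / 2) ^ 2) : ℝ) : ℂ) +
    psi a₂ (η x) := ⟨_, rfl⟩
  have hN_om : (x.1 : ℂ) * om x = Ω := by
    have hN : (x.1 : ℂ) * (lam * (meshWidth lam x.1 : ℂ)) = 1 := by
      have := meshWidth_mul hlam hx'.1
      rw [← Complex.ofReal_one, ← this]
      push_cast
      ring
    have e : (x.1 : ℝ) * (4 * (1 / xSym lam (S.h x) x.2.1)) =
        1 / (lam ^ 2 * Real.sin (x.2.1 / 2) ^ 2) := by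
      have hN : (x.1 : ℝ) = 1 / (lam * meshWidth lam x.1) := by
        rw [← meshWidth_mul hlam hx'.1]; field_simp
      rw [hN, hSh]
      unfold xSym
      field_simp
    rw [hΩ, ← e]
    simp only [h_om, hx₁, hSh]
    push_cast
    linear_combination psi a₂ (η x) * hN
  have hgm : g x ^ (2 * N₀) = (((meshWidth lam x.1 / (2 * lam * Real.sin (x.2.1 / 2) ^ 2)) ^
      (2 * N₀) : ℝ) : ℂ) := by
    have e : 2 * (1 / xSym lam (S.h x) x.2.1) =
        meshWidth lam x.1 / (2 * lam * Real.sin (x.2.1 / 2) ^ 2) := by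
      rw [hSh]
      unfold xSym
      field_simp
      ring
    rw [← e]
    simp only [hg, hx₁]
    push_cast
    rfl
  have hcs : csSym a₂ c lam N₀ x.1 (meshWidth lam x.1) x.2.1 x.2.2 =
      (-1) ^ (x.1 - N₀) * (g x ^ (2 * N₀) * Complex.exp Ω) := by
    have hη' : x.2.2 / (c * meshWidth lam x.1) = η x := by rw [hη, hSh]
    rw [hgm, csSym, hΩ, hη', Complex.exp_add]
    push_cast
    ring
  have hmain : mainSym ρ a₁ a₂ c lam (1 / 2) (meshWidth lam x.1) N₀ x.1 x.2.1 x.2.2 =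
      (-1) ^ (x.1 - N₀) * (f x ^ (2 * N₀) * R x ^ (x.1 - N₀)) := by
    rw [mainSym, min_eq_right hx'.2.1]
    simp only [hf, hR, hz, hSh]
    rw [mul_left_comm, ← mul_pow, neg_one_mul, neg_neg]
  have hRn : R x ^ (x.1 - N₀) = (1 + (R x - Complex.exp (om x)) * Complex.exp (-om x)) ^ (x.1 - N₀) *
      (Complex.exp Ω * Complex.exp (-(N₀ * om x))) := by
    have e : R x = (1 + (R x - Complex.exp (om x)) * Complex.exp (-om x)) * Complex.exp (om x) := by
      have : Complex.exp (om x) * Complex.exp (-om x) = 1 := by rw [← Complex.exp_add]; simp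
      linear_combination (Complex.exp (om x) - R x) * this
    conv_lhs => rw [e]
    rw [mul_pow, ← Complex.exp_nat_mul, ← Complex.exp_add, ← hN_om, Nat.cast_sub hx'.2.1]
    congr 2
    ring
  rw [hmain, hcs, hRn]
  have hfac : (-1) ^ (x.1 - N₀) * (f x ^ (2 * N₀) *
      ((1 + (R x - Complex.exp (om x)) * Complex.exp (-om x)) ^ (x.1 - N₀) *
      (Complex.exp Ω * Complex.exp (-(N₀ * om x))))) -
      (-1) ^ (x.1 - N₀) * (g x ^ (2 * N₀) * Complex.exp Ω) =
      (-1) ^ (x.1 - N₀) * (Complex.exp Ω * (f x ^ (2 * N₀) * (Complex.exp (-(N₀ * om x)) *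
        ((1 + (R x - Complex.exp (om x)) * Complex.exp (-om x)) ^ (x.1 - N₀) - 1)) +
        f x ^ (2 * N₀) * (Complex.exp (-(N₀ * om x)) - 1) + (f x ^ (2 * N₀) - g x ^ (2 * N₀)))) := by
    ring
  rw [hfac, norm_mul, norm_pow, norm_neg, norm_one, one_pow, one_mul, norm_mul]
  have hre : ‖Complex.exp Ω‖ ≤ Real.exp (-(2 * (d / 2) * ((1 / x.2.1) ^ 2 + η x ^ 2))) := by
    rw [hΩ, Complex.exp_add, norm_mul, norm_exp_psi, ← Complex.ofReal_neg, Complex.norm_exp_ofReal,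
      ← Real.exp_add]
    apply Real.exp_le_exp.2
    have h1 := one_div_sin_half_sq_ge (hs x hx) (hs0 x hx)
    have h2 : 1 / (lam ^ 2 * Real.sin (x.2.1 / 2) ^ 2) =
        1 / lam ^ 2 * (1 / Real.sin (x.2.1 / 2) ^ 2) := by field_simp
    have h3 : d * (1 / x.2.1) ^ 2 ≤ 1 / lam ^ 2 * (4 * (1 / x.2.1) ^ 2) := by
      have : d ≤ 4 / lam ^ 2 := hd ▸ min_le_right _ _
      calc d * (1 / x.2.1) ^ 2 ≤ 4 / lam ^ 2 * (1 / x.2.1) ^ 2 := by gcongr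
        _ = _ := by ring
    have h4 : 1 / lam ^ 2 * (4 * (1 / x.2.1) ^ 2) ≤
        1 / lam ^ 2 * (1 / Real.sin (x.2.1 / 2) ^ 2) := by gcongr
    have h5 : d * η x ^ 2 ≤ 1 * η x ^ 2 :=
      mul_le_mul_of_nonneg_right (hd ▸ min_le_left _ _) (sq_nonneg _)
    rw [h2]
    linarith
  have hab := habs (1 / x.2.1) (η x)
  have hph : phaseCS c (meshWidth lam x.1) x.2.1 x.2.2 = (1 / x.2.1) ^ 2 + η x ^ 2 := by
    rw [phaseCS, hη, hSh]
  rw [zpow_natCast, hSy, hSh] at hbx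
  refine (mul_le_mul hre hbx (norm_nonneg _) (Real.exp_pos _).le).trans ?_
  rw [hph]
  calc _ = C₁ * meshWidth lam x.1 ^ (2 * N₀ + 1) * ((1 + |1 / x.2.1| + |η x|) ^ (10 * N₀ + 10) *
        Real.exp (-(2 * (d / 2) * ((1 / x.2.1) ^ 2 + η x ^ 2)))) := by ring
    _ ≤ C₁ * meshWidth lam x.1 ^ (2 * N₀ + 1) * (C₂ *
        Real.exp (-(d / 2 * ((1 / x.2.1) ^ 2 + η x ^ 2)))) := by gcongr
    _ = C₁ * C₂ * (meshWidth lam x.1 ^ (2 * N₀ + 1) *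
        Real.exp (-(d / 2 * ((1 / x.2.1) ^ 2 + η x ^ 2)))) := by ring
    _ ≤ _ := by
        refine mul_le_mul_of_nonneg_right (by linarith) (by positivity)


/-- Global size of `highSym`: the negative powers of the angles in front are absorbed by the exponential. -/
theorem highSym_le {ρ c lam θ : ℝ} (hρ : |ρ| < 1) (hc : 0 < c) (hlam : 0 < lam) (hθ : 0 < θ)
    (N₀ : ℕ) : ∃ C δ : ℝ, 0 < C ∧ 0 < δ ∧ ∀ h s t : ℝ, 0 < h → |s| ≤ Real.pi → |t| ≤ Real.pi →
      s ≠ 0 → t ≠ 0 →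
      |highSym ρ c lam θ N₀ h s t| ≤ C * (h ^ (2 * N₀) * Real.exp (-(δ * phaseHigh s t))) := by
  have hρ' : 0 < 1 - |ρ| := by linarith
  have hm0 : 0 < min 1 (c ^ 2) := lt_min one_pos (by positivity)
  obtain ⟨d, hd⟩ : ∃ d : ℝ, d = (1 - |ρ|) * min 1 (c ^ 2) / (lam ^ 2 * θ ^ 2) := ⟨_, rfl⟩
  have hd0 : 0 < d := by rw [hd]; positivity
  obtain ⟨C₂, hC₂, habs⟩ := exists_scale_pow_mul_exp_le (half_pos hd0) (2 * (2 * N₀))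
  obtain ⟨K, hK⟩ : ∃ K : ℝ, K = Real.pi ^ 2 / (2 * lam * (1 - |ρ|)) := ⟨_, rfl⟩
  have hK0 : 0 < K := by rw [hK]; positivity
  refine ⟨K ^ (2 * N₀) * C₂, d / 2, by positivity, half_pos hd0, fun h s t hh hs ht hs0 ht0 => ?_⟩
  have hex := le_high_exponent hρ hc hlam hθ hs ht hs0 ht0
  rw [← hd] at hex
  have n1 := sin_half_ne_zero hs hs0
  have hι : (1 - |ρ|) * (c ^ 2 * Real.sin (s / 2) ^ 2) ≤ iota ρ c s t := by
    have h1 := le_xTot (ρ := ρ) (lam := 1) hc one_pos one_pos s t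
    rw [xTot_eq_iota hc.ne' one_ne_zero] at h1
    unfold xSym at h1
    have h2 := mul_le_mul_of_nonneg_left h1 (show 0 ≤ c ^ 2 / 4 by positivity)
    have e : c ^ 2 / 4 * (4 * 1 / (c ^ 2 * 1) * iota ρ c s t) = iota ρ c s t := by field_simp
    rw [e] at h2
    refine le_trans ?_ h2
    have e : c ^ 2 / 4 * ((1 - |ρ|) * (4 * 1 / 1 * Real.sin (s / 2) ^ 2 +
        4 * (1 / c ^ 2) / 1 * Real.sin (t / 2) ^ 2)) = (1 - |ρ|) * (c ^ 2 * Real.sin (s / 2) ^ 2) +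
        (1 - |ρ|) * Real.sin (t / 2) ^ 2 := by field_simp
    rw [e]
    have : 0 ≤ (1 - |ρ|) * Real.sin (t / 2) ^ 2 := by positivity
    linarith
  have hι0 : 0 < iota ρ c s t := lt_of_lt_of_le (by positivity) hι
  have hb : h * c ^ 2 / (2 * lam * iota ρ c s t) ≤ K * h * (1 + |1 / s| + |1 / t|) ^ 2 := by
    calc h * c ^ 2 / (2 * lam * iota ρ c s t)
        ≤ h * c ^ 2 / (2 * lam * ((1 - |ρ|) * (c ^ 2 * Real.sin (s / 2) ^ 2))) := by gcongr
      _ = h / (2 * lam * (1 - |ρ|)) * (1 / Real.sin (s / 2) ^ 2) := by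
          have : Real.sin (s / 2) ≠ 0 := fun h => by simp [h] at n1
          field_simp
      _ ≤ h / (2 * lam * (1 - |ρ|)) * (Real.pi ^ 2 * (1 / s) ^ 2) := by
          gcongr; exact one_div_sin_half_sq_le hs hs0
      _ = K * h * |1 / s| ^ 2 := by rw [hK, sq_abs]; ring
      _ ≤ _ := by
          gcongr
          linarith [abs_nonneg (1 / t)]
  have hab := habs (1 / s) (1 / t)
  rw [highSym, abs_of_nonneg (by positivity)]
  calc _ ≤ (K * h * (1 + |1 / s| + |1 / t|) ^ 2) ^ (2 * N₀) *
        Real.exp (-(2 * (d / 2) * ((1 / s) ^ 2 + (1 / t) ^ 2))) := by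
        refine mul_le_mul (pow_le_pow_left₀ (by positivity) hb _) (Real.exp_le_exp.2 ?_)
          (Real.exp_pos _).le (by positivity)
        rw [phaseHigh] at hex
        linarith
    _ = K ^ (2 * N₀) * h ^ (2 * N₀) * ((1 + |1 / s| + |1 / t|) ^ (2 * (2 * N₀)) *
        Real.exp (-(2 * (d / 2) * ((1 / s) ^ 2 + (1 / t) ^ 2)))) := by
        rw [mul_pow, mul_pow, ← pow_mul, mul_assoc]
    _ ≤ K ^ (2 * N₀) * h ^ (2 * N₀) * (C₂ *
        Real.exp (-(d / 2 * ((1 / s) ^ 2 + (1 / t) ^ 2)))) := by gcongr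
    _ = _ := by rw [phaseHigh]; ring

/-- Global size of `csSym`, as for `highSym`. -/
theorem norm_csSym_le (a : ℝ) {c lam : ℝ} (hlam : 0 < lam) (N₀ : ℕ) :
    ∃ C δ : ℝ, 0 < C ∧ 0 < δ ∧ ∀ (N : ℕ) (h s t : ℝ), 0 < h → |s| ≤ Real.pi → s ≠ 0 →
      ‖csSym a c lam N₀ N h s t‖ ≤ C * (h ^ (2 * N₀) * Real.exp (-(δ * phaseCS c h s t))) := by
  obtain ⟨d, hd⟩ : ∃ d : ℝ, d = min 1 (4 / lam ^ 2) := ⟨_, rfl⟩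
  have hd0 : 0 < d := hd ▸ lt_min one_pos (by positivity)
  obtain ⟨C₂, hC₂, habs⟩ := exists_scale_pow_mul_exp_le (half_pos hd0) (2 * (2 * N₀))
  obtain ⟨K, hK⟩ : ∃ K : ℝ, K = Real.pi ^ 2 / (2 * lam) := ⟨_, rfl⟩
  have hK0 : 0 < K := by rw [hK]; positivity
  refine ⟨K ^ (2 * N₀) * C₂, d / 2, by positivity, half_pos hd0, fun N h s t hh hs hs0 => ?_⟩
  obtain ⟨η, hη⟩ : ∃ η : ℝ, η = t / (c * h) := ⟨_, rfl⟩
  have n1 := sin_half_ne_zero hs hs0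
  have m1 : Real.sin (s / 2) ≠ 0 := fun h => by simp [h] at n1
  have hb : h / (2 * lam * Real.sin (s / 2) ^ 2) ≤ K * h * (1 + |1 / s| + |η|) ^ 2 := by
    calc h / (2 * lam * Real.sin (s / 2) ^ 2)
        = h / (2 * lam) * (1 / Real.sin (s / 2) ^ 2) := by field_simp
      _ ≤ h / (2 * lam) * (Real.pi ^ 2 * (1 / s) ^ 2) := by
          gcongr; exact one_div_sin_half_sq_le hs hs0
      _ = K * h * |1 / s| ^ 2 := by rw [hK, sq_abs]; ring
      _ ≤ _ := by
          gcongr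
          linarith [abs_nonneg η]
  have hex : d * ((1 / s) ^ 2 + η ^ 2) ≤ 1 / (lam ^ 2 * Real.sin (s / 2) ^ 2) + η ^ 2 := by
    have h1 := one_div_sin_half_sq_ge hs hs0
    have h2 : 1 / (lam ^ 2 * Real.sin (s / 2) ^ 2) =
        1 / lam ^ 2 * (1 / Real.sin (s / 2) ^ 2) := by field_simp
    have h3 : d * (1 / s) ^ 2 ≤ 1 / lam ^ 2 * (4 * (1 / s) ^ 2) := by
      have : d ≤ 4 / lam ^ 2 := hd ▸ min_le_right _ _
      calc d * (1 / s) ^ 2 ≤ 4 / lam ^ 2 * (1 / s) ^ 2 := by gcongr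
        _ = _ := by ring
    have h4 : 1 / lam ^ 2 * (4 * (1 / s) ^ 2) ≤
        1 / lam ^ 2 * (1 / Real.sin (s / 2) ^ 2) := by gcongr
    have h5 : d * η ^ 2 ≤ 1 * η ^ 2 :=
      mul_le_mul_of_nonneg_right (hd ▸ min_le_left _ _) (sq_nonneg _)
    rw [h2]
    linarith
  have hab := habs (1 / s) η
  rw [csSym, norm_mul, norm_exp_psi, Complex.norm_real, norm_mul, norm_mul, norm_pow, norm_neg,
    norm_one, one_pow, one_mul, Real.norm_of_nonneg (Real.exp_pos _).le,
    Real.norm_of_nonneg (by positivity), mul_assoc, ← Real.exp_add, phaseCS, ← hη]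
  calc _ ≤ (K * h * (1 + |1 / s| + |η|) ^ 2) ^ (2 * N₀) *
        Real.exp (-(2 * (d / 2) * ((1 / s) ^ 2 + η ^ 2))) := by
        gcongr
        linarith
    _ = K ^ (2 * N₀) * h ^ (2 * N₀) * ((1 + |1 / s| + |η|) ^ (2 * (2 * N₀)) *
        Real.exp (-(2 * (d / 2) * ((1 / s) ^ 2 + η ^ 2)))) := by
        rw [mul_pow, mul_pow, ← pow_mul, mul_assoc]
    _ ≤ K ^ (2 * N₀) * h ^ (2 * N₀) * (C₂ *
        Real.exp (-(d / 2 * ((1 / s) ^ 2 + η ^ 2)))) := by gcongr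
    _ = _ := by ring

/-- The scheme does not distinguish the two space directions. -/
theorem mainSym_swap {c : ℝ} (hc : c ≠ 0) (ρ a₁ a₂ lam θ h : ℝ) (N₀ n : ℕ) (s t : ℝ) :
    mainSym ρ a₂ a₁ c⁻¹ (lam / c) θ (c * h) N₀ n t s = mainSym ρ a₁ a₂ c lam θ h N₀ n s t := by
  have e0 : xMix ρ c⁻¹ (lam / c) (c * h) t s = xMix ρ c lam h s t := by
    unfold xMix; field_simp
  have e1 : zSym (lam / c) a₂ (c * h) t = zSym (lam / c ^ 2) (c * a₂) h t := by
    unfold zSym xSym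
    congr 3 <;> field_simp
  have e2 : zSym (lam / c / c⁻¹ ^ 2) (c⁻¹ * a₁) (c * h) s = zSym lam a₁ h s := by
    unfold zSym xSym
    congr 3 <;> field_simp
  have ez : zTot ρ a₂ a₁ c⁻¹ (lam / c) (c * h) t s = zTot ρ a₁ a₂ c lam h s t := by
    unfold zTot; rw [e0, e1, e2]; ring
  have eR : ampl ρ a₂ a₁ c⁻¹ (lam / c) θ (c * h) t s = ampl ρ a₁ a₂ c lam θ h s t := by
    unfold ampl mcsFactor; rw [e0, e1, e2]; ring
  rw [mainSym, mainSym, ez, eR]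

/-! ### Intermediate wavenumbers -/

section real_factor

variable {ρ θ : ℝ}

/-- The amplification factor of one MCS step for real symbols. The arguments `x₁`, `x₂` are minus the
symbols of the two one-dimensional operators, so they are nonnegative. -/
def realFactor (θ z₀ x₁ x₂ : ℝ) : ℝ :=
  1 + (z₀ - x₁ - x₂) * (1 / ((1 + θ * x₁) * (1 + θ * x₂))) +
    (θ * z₀ * (z₀ - x₁ - x₂) + (1 / 2 - θ) * (z₀ - x₁ - x₂) ^ 2) *
      (1 / ((1 + θ * x₁) * (1 + θ * x₂))) ^ 2

/-- A lower bound for the factor `Q = q + (4 θ - 1) / 2 * m + z₀ / 2` in `1 - R = (m - z₀) Q / p²`, with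
`m = x₁ + x₂`, `q = 1 + θ² x₁ x₂` and `p = (1 + θ x₁) (1 + θ x₂)`. This is where the condition on `θ`
enters: `q` and `m` dominate `2 θ g` and `2 g`, where `g` is the geometric mean of `x₁` and `x₂`, while
`z₀ / 2` can be as negative as `-|ρ| g`, and the sum is at least `(6 θ - 1 - |ρ|) g`. -/
theorem exists_le_realFactor_aux (hθ : max (1 / 4) ((1 + |ρ|) / 6) < θ) :
    ∃ δ : ℝ, 0 < δ ∧ ∀ z₀ x₁ x₂ : ℝ, 0 ≤ x₁ → 0 ≤ x₂ → z₀ ^ 2 ≤ 4 * ρ ^ 2 * (x₁ * x₂) →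
      δ * ((1 + θ ^ 2 * (x₁ * x₂)) + (x₁ + x₂)) ≤
        (1 + θ ^ 2 * (x₁ * x₂)) + (4 * θ - 1) / 2 * (x₁ + x₂) + z₀ / 2 := by
  have h1 : 1 / 4 < θ := lt_of_le_of_lt (le_max_left _ _) hθ
  have h2 : (1 + |ρ|) / 6 < θ := lt_of_le_of_lt (le_max_right _ _) hθ
  obtain ⟨δ, hδ⟩ : ∃ δ : ℝ, δ = min 1 (min ((4 * θ - 1) / 2)
    ((6 * θ - 1 - |ρ|) / (2 * (θ + 1)))) := ⟨_, rfl⟩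
  have d1 : δ ≤ 1 := hδ ▸ min_le_left _ _
  have d2 : δ ≤ (4 * θ - 1) / 2 := hδ ▸ (min_le_right _ _).trans (min_le_left _ _)
  have d3 : δ ≤ (6 * θ - 1 - |ρ|) / (2 * (θ + 1)) := hδ ▸ (min_le_right _ _).trans (min_le_right _ _)
  rw [le_div_iff₀ (by linarith)] at d3
  refine ⟨δ, ?_, fun z₀ x₁ x₂ hx₁ hx₂ hz => ?_⟩
  · rw [hδ]
    exact lt_min one_pos (lt_min (by linarith) (div_pos (by linarith) (by linarith)))
  -- the geometric mean, to which all terms are compared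
  obtain ⟨g, hg⟩ : ∃ g : ℝ, g = √(x₁ * x₂) := ⟨_, rfl⟩
  have hg0 : 0 ≤ g := hg ▸ Real.sqrt_nonneg _
  have hgg : g ^ 2 = x₁ * x₂ := by rw [hg]; exact Real.sq_sqrt (mul_nonneg hx₁ hx₂)
  have hz' : |z₀| ≤ 2 * |ρ| * g := by
    apply abs_le_of_sq_le_sq _ (by positivity)
    rw [mul_pow, mul_pow, sq_abs, hgg]
    linarith
  have hm : 2 * g ≤ x₁ + x₂ := by
    apply le_of_sq_le_sq _ (by positivity)
    nlinarith [sq_nonneg (x₁ - x₂)]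
  have hq : 2 * θ * g ≤ 1 + θ ^ 2 * (x₁ * x₂) := by
    rw [← hgg]; nlinarith [sq_nonneg (1 - θ * g)]
  have h3 := (abs_le.1 hz').1
  have h4 := mul_le_mul_of_nonneg_left hq (sub_nonneg.2 d1)
  have h5 := mul_le_mul_of_nonneg_left hm (sub_nonneg.2 d2)
  have h6 := mul_le_mul_of_nonneg_right d3 hg0
  nlinarith

set_option maxHeartbeats 400000 in
/-- Without convection, and away from the regions of the leading-order terms, the amplification factor `R`
stays away from `±1`. Write `m = x₁ + x₂`, `q = 1 + θ² x₁ x₂`, `p = (1 + θ x₁) (1 + θ x₂) = q + θ m`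
and `Q` for the quantity bounded in `exists_le_realFactor_aux`. Then `1 - R = (m - z₀) Q / p²` and
`1 + R = (((1 - 2 θ) m - z₀)² / 2 + 2 q Q) / p²`. For `θ = 1/2` the term with `m²` drops out, and
`1 + R` may vanish to first order where `q / p` is small. -/
theorem exists_le_one_sub_realFactor (hρ : |ρ| < 1) (hθ : max (1 / 4) ((1 + |ρ|) / 6) < θ) :
    ∃ δ : ℝ, 0 < δ ∧ ∀ z₀ x₁ x₂ : ℝ, 0 ≤ x₁ → 0 ≤ x₂ → z₀ ^ 2 ≤ 4 * ρ ^ 2 * (x₁ * x₂) →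
      |z₀| ≤ |ρ| * (x₁ + x₂) →
      δ * ((x₁ + x₂) / ((1 + θ * x₁) * (1 + θ * x₂))) ≤ 1 - realFactor θ z₀ x₁ x₂ ∧
      (θ ≠ 1 / 2 →
        δ * ((x₁ + x₂) / ((1 + θ * x₁) * (1 + θ * x₂))) ≤ 1 + realFactor θ z₀ x₁ x₂) ∧
      (θ = 1 / 2 → δ * ((1 + θ ^ 2 * (x₁ * x₂)) / ((1 + θ * x₁) * (1 + θ * x₂))) ≤
        1 + realFactor θ z₀ x₁ x₂) := by
  obtain ⟨δ, hδ, H⟩ := exists_le_realFactor_aux hθ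
  have h1 : 1 / 4 < θ := lt_of_le_of_lt (le_max_left _ _) hθ
  have hρ' : 0 < 1 - |ρ| := by linarith
  obtain ⟨e, he⟩ : ∃ e : ℝ, e = min 1 (4 * δ * θ ^ 2) := ⟨_, rfl⟩
  have he0 : 0 < e := he ▸ lt_min one_pos (by positivity)
  have he1 : e ≤ 1 := he ▸ min_le_left _ _
  have he2 : e ≤ 4 * δ * θ ^ 2 := he ▸ min_le_right _ _
  obtain ⟨ν, hν⟩ : ∃ ν : ℝ, ν = if θ = 1 / 2 then 1 else
    min (2 * δ) (e * (1 - 2 * θ) ^ 2 / (4 * θ)) := ⟨_, rfl⟩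
  have hν0 : 0 < ν := by
    rw [hν]
    split_ifs with h
    · exact one_pos
    · have : 1 - 2 * θ ≠ 0 := fun h' => h (by linarith)
      exact lt_min (by linarith) (by positivity)
  obtain ⟨d, hd⟩ : ∃ d : ℝ, d = min (min ((1 - |ρ|) * (δ / (1 + θ))) (2 * δ / (1 + θ))) ν := ⟨_, rfl⟩
  have hd0 : 0 < d := by
    rw [hd]; exact lt_min (lt_min (by positivity) (by positivity)) hν0
  have hd1 : d ≤ (1 - |ρ|) * (δ / (1 + θ)) := hd ▸ (min_le_left _ _).trans (min_le_left _ _)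
  have hd2 : d ≤ 2 * δ / (1 + θ) := hd ▸ (min_le_left _ _).trans (min_le_right _ _)
  have hd3 : d ≤ ν := hd ▸ min_le_right _ _
  refine ⟨d, hd0, fun z₀ x₁ x₂ hx₁ hx₂ hz hz' => ?_⟩
  have hQ := H z₀ x₁ x₂ hx₁ hx₂ hz
  obtain ⟨q, hq⟩ : ∃ q : ℝ, q = 1 + θ ^ 2 * (x₁ * x₂) := ⟨_, rfl⟩
  obtain ⟨m, hm⟩ : ∃ m : ℝ, m = x₁ + x₂ := ⟨_, rfl⟩
  obtain ⟨p, hp⟩ : ∃ p : ℝ, p = (1 + θ * x₁) * (1 + θ * x₂) := ⟨_, rfl⟩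
  obtain ⟨Q, hQd⟩ : ∃ Q : ℝ, Q = q + (4 * θ - 1) / 2 * m + z₀ / 2 := ⟨_, rfl⟩
  have hpe : p = q + θ * m := by rw [hp, hq, hm]; ring
  have hm0 : 0 ≤ m := by rw [hm]; positivity
  have hq1 : 1 ≤ q := by rw [hq]; nlinarith [mul_nonneg (sq_nonneg θ) (mul_nonneg hx₁ hx₂)]
  have hp0 : 0 < p := by rw [hpe]; nlinarith
  rw [← hq, ← hm, ← hQd] at hQ
  have hQp : δ / (1 + θ) * p ≤ Q := by
    refine le_trans ?_ hQ
    rw [div_mul_eq_mul_div, div_le_iff₀ (by linarith), hpe]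
    nlinarith [mul_nonneg hδ.le hm0, mul_nonneg (mul_nonneg hδ.le (by linarith : 0 ≤ θ)) (by linarith : 0 ≤ q)]
  have hQ0 : 0 < Q := lt_of_lt_of_le (by positivity) hQp
  have hX : (1 - |ρ|) * m ≤ m - z₀ := by
    have := (le_abs_self z₀).trans hz'
    rw [← hm] at this
    linarith
  have e1 : 1 - realFactor θ z₀ x₁ x₂ = (m - z₀) * Q / p ^ 2 := by
    rw [realFactor, ← hp]
    have e : z₀ - x₁ - x₂ = z₀ - m := by rw [hm]; ring
    rw [e]
    field_simp
    rw [hQd, hpe]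
    ring
  have hX0 : 0 ≤ m - z₀ := le_trans (by positivity) hX
  have e2 : 1 + realFactor θ z₀ x₁ x₂ = (1 / 2 * ((1 - 2 * θ) * m - z₀) ^ 2 + 2 * q * Q) / p ^ 2 := by
    rw [realFactor, ← hp]
    have e : z₀ - x₁ - x₂ = z₀ - m := by rw [hm]; ring
    rw [e]
    field_simp
    rw [hQd, hpe]
    ring
  rw [← hq, ← hm, ← hp]
  refine ⟨?_, fun hne => ?_, fun heq => ?_⟩
  · rw [e1]
    calc d * (m / p) ≤ (1 - |ρ|) * (δ / (1 + θ)) * (m / p) := by gcongr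
      _ = (1 - |ρ|) * m * (δ / (1 + θ) * p) / p ^ 2 := by field_simp
      _ ≤ _ := by gcongr
  · rw [e2]
    have hν1 : ν ≤ 2 * δ := by rw [hν, if_neg hne]; exact min_le_left _ _
    have hν2 : ν * θ ≤ e * (1 - 2 * θ) ^ 2 / 4 := by
      have : ν ≤ e * (1 - 2 * θ) ^ 2 / (4 * θ) := by rw [hν, if_neg hne]; exact min_le_right _ _
      calc ν * θ ≤ e * (1 - 2 * θ) ^ 2 / (4 * θ) * θ := by gcongr
        _ = _ := by field_simp
    have hzq : θ ^ 2 * z₀ ^ 2 ≤ q ^ 2 := by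
      have h2 : ρ ^ 2 ≤ 1 := by rw [← sq_abs]; exact pow_le_one₀ (abs_nonneg ρ) hρ.le
      have h3 : 4 * ρ ^ 2 * (x₁ * x₂) ≤ 4 * (x₁ * x₂) := by
        have := mul_le_mul_of_nonneg_right h2 (mul_nonneg hx₁ hx₂)
        linarith
      have h4 : θ ^ 2 * z₀ ^ 2 ≤ θ ^ 2 * (4 * (x₁ * x₂)) := by gcongr; linarith
      refine h4.trans ?_
      rw [hq]; linarith [sq_nonneg (1 - θ ^ 2 * (x₁ * x₂))]
    have hA : (1 - 2 * θ) ^ 2 * m ^ 2 / 2 - z₀ ^ 2 ≤ ((1 - 2 * θ) * m - z₀) ^ 2 := by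
      linarith [sq_nonneg ((1 - 2 * θ) * m - 2 * z₀)]
    have hF : ν * (m * p) ≤ 1 / 2 * ((1 - 2 * θ) * m - z₀) ^ 2 + 2 * q * Q := by
      have k1 : e * ((1 - 2 * θ) ^ 2 * m ^ 2 / 2 - z₀ ^ 2) ≤ ((1 - 2 * θ) * m - z₀) ^ 2 :=
        (mul_le_mul_of_nonneg_left hA he0.le).trans
          (mul_le_of_le_one_left (sq_nonneg _) he1)
      have k2 : e * z₀ ^ 2 ≤ 4 * δ * q ^ 2 := by
        calc e * z₀ ^ 2 ≤ 4 * δ * θ ^ 2 * z₀ ^ 2 := by gcongr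
          _ = 4 * δ * (θ ^ 2 * z₀ ^ 2) := by ring
          _ ≤ _ := by gcongr
      have k3 : 2 * q * (δ * (q + m)) ≤ 2 * q * Q := by gcongr
      have k4 : ν * (m * q) ≤ 2 * δ * (m * q) := by gcongr
      have k5 : ν * θ * m ^ 2 ≤ e * (1 - 2 * θ) ^ 2 / 4 * m ^ 2 := by gcongr
      rw [hpe]
      linarith
    calc d * (m / p) ≤ ν * (m / p) := by gcongr
      _ = ν * (m * p) / p ^ 2 := by field_simp
      _ ≤ _ := by gcongr
  · rw [e2]
    calc d * (q / p) ≤ 2 * δ / (1 + θ) * (q / p) := by gcongr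
      _ = 2 * q * (δ / (1 + θ) * p) / p ^ 2 := by field_simp
      _ ≤ _ := by
        gcongr
        have : 2 * q * (δ / (1 + θ) * p) ≤ 2 * q * Q := by gcongr
        linarith [sq_nonneg ((1 - 2 * θ) * m - z₀)]

end real_factor

/-! ### The effect of convection -/

section perturbation

variable {θ z₀ x₁ x₂ b₁ b₂ ε : ℝ}

/-- Effect of the convection terms on the reciprocal of the implicit factors. -/
theorem norm_inv_mcsDenom_sub_le (hθ : 0 ≤ θ) (hx₁ : 0 ≤ x₁) (hx₂ : 0 ≤ x₂) (hε : ε ≤ 1)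
    (h₁ : |b₁| ≤ ε * (1 + θ * x₁)) (h₂ : |b₂| ≤ ε * (1 + θ * x₂)) :
    ‖1 / ((1 - θ * (-(x₁ : ℂ) + b₁ * Complex.I)) * (1 - θ * (-(x₂ : ℂ) + b₂ * Complex.I)))‖ ≤
      1 / ((1 + θ * x₁) * (1 + θ * x₂)) ∧
    ‖1 / ((1 - θ * (-(x₁ : ℂ) + b₁ * Complex.I)) * (1 - θ * (-(x₂ : ℂ) + b₂ * Complex.I))) -
      ((1 / ((1 + θ * x₁) * (1 + θ * x₂)) : ℝ) : ℂ)‖ ≤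
      (2 * θ + θ ^ 2) * ε * (1 / ((1 + θ * x₁) * (1 + θ * x₂))) := by
  obtain ⟨A, hA⟩ : ∃ A : ℝ, A = 1 + θ * x₁ := ⟨_, rfl⟩
  obtain ⟨B, hB⟩ : ∃ A : ℝ, A = 1 + θ * x₂ := ⟨_, rfl⟩
  have hA1 : 1 ≤ A := by rw [hA]; linarith [mul_nonneg hθ hx₁]
  have hB1 : 1 ≤ B := by rw [hB]; linarith [mul_nonneg hθ hx₂]
  rw [← hA] at h₁ ⊢
  rw [← hB] at h₂ ⊢
  have hε0 : 0 ≤ ε := by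
    by_contra h
    have := (abs_nonneg b₁).trans h₁
    nlinarith
  obtain ⟨u, hu⟩ : ∃ u : ℂ, u = 1 - θ * (-(x₁ : ℂ) + b₁ * Complex.I) := ⟨_, rfl⟩
  obtain ⟨v, hv⟩ : ∃ u : ℂ, u = 1 - θ * (-(x₂ : ℂ) + b₂ * Complex.I) := ⟨_, rfl⟩
  rw [← hu, ← hv]
  have hu' : u = A - θ * b₁ * Complex.I := by rw [hu, hA]; push_cast; ring
  have hv' : v = B - θ * b₂ * Complex.I := by rw [hv, hB]; push_cast; ring
  have nu : A ≤ ‖u‖ := by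
    refine le_trans (le_of_eq ?_) (Complex.re_le_norm u); rw [hu']; simp
  have nv : B ≤ ‖v‖ := by
    refine le_trans (le_of_eq ?_) (Complex.re_le_norm v); rw [hv']; simp
  have hA0 : 0 < A := by linarith
  have hB0 : 0 < B := by linarith
  have u0 : u ≠ 0 := norm_pos_iff.1 (by linarith)
  have v0 : v ≠ 0 := norm_pos_iff.1 (by linarith)
  have i1 : ‖1 / (u * v)‖ ≤ 1 / (A * B) := by
    rw [norm_div, norm_one, norm_mul]
    exact one_div_le_one_div_of_le (by positivity) (by gcongr)
  refine ⟨i1, ?_⟩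
  have hd : ‖(A * B : ℂ) - u * v‖ ≤ (2 * θ + θ ^ 2) * ε * (A * B) := by
    have e : (A * B : ℂ) - u * v = θ * A * (b₂ * Complex.I) + θ * B * (b₁ * Complex.I) +
        θ ^ 2 * (b₁ * b₂) := by
      rw [hu', hv']; linear_combination (-(θ : ℂ) ^ 2 * b₁ * b₂) * Complex.I_sq
    have n1 : ‖(θ * A * (b₂ * Complex.I) : ℂ)‖ = θ * A * |b₂| := by
      simp [abs_of_nonneg hθ, abs_of_pos hA0]
    have n2 : ‖(θ * B * (b₁ * Complex.I) : ℂ)‖ = θ * B * |b₁| := by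
      simp [abs_of_nonneg hθ, abs_of_pos hB0]
    have n3 : ‖(θ ^ 2 * (b₁ * b₂) : ℂ)‖ = θ ^ 2 * (|b₁| * |b₂|) := by
      simp [abs_of_nonneg hθ]
    rw [e]
    refine (norm_add₃_le).trans ?_
    rw [n1, n2, n3]
    have hAB : ε * A * (ε * B) ≤ ε * (A * B) := by
      have : ε * ε ≤ ε * 1 := by gcongr
      calc ε * A * (ε * B) = ε * ε * (A * B) := by ring
        _ ≤ ε * 1 * (A * B) := by gcongr
        _ = _ := by ring
    calc θ * A * |b₂| + θ * B * |b₁| + θ ^ 2 * (|b₁| * |b₂|)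
        ≤ θ * A * (ε * B) + θ * B * (ε * A) + θ ^ 2 * (ε * (A * B)) := by
          have t := (mul_le_mul h₁ h₂ (abs_nonneg _) (by positivity)).trans hAB
          exact add_le_add (add_le_add (mul_le_mul_of_nonneg_left h₂ (by positivity))
            (mul_le_mul_of_nonneg_left h₁ (by positivity)))
            (mul_le_mul_of_nonneg_left t (by positivity))
      _ = _ := by ring
  have e : 1 / (u * v) - ((1 / (A * B) : ℝ) : ℂ) =
      1 / (u * v) * ((1 / (A * B) : ℝ) : ℂ) * ((A * B : ℂ) - u * v) := by
    have a0 : (A : ℂ) ≠ 0 := by exact_mod_cast hA0.ne'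
    have b0 : (B : ℂ) ≠ 0 := by exact_mod_cast hB0.ne'
    push_cast
    field_simp
  rw [e, norm_mul, norm_mul, Complex.norm_real, Real.norm_of_nonneg (by positivity)]
  calc _ ≤ 1 / (A * B) * (1 / (A * B)) * ((2 * θ + θ ^ 2) * ε * (A * B)) := by gcongr
    _ = _ := by field_simp

/-- Convection changes the amplification factor by a small multiple of `m / p`, the quantity that bounds
`1 - |R|` from below, provided that the imaginary parts are small relative to the real ones. -/
theorem norm_mcsFactor_sub_realFactor_le (hθ : 0 < θ) : ∃ C : ℝ, 0 < C ∧
    ∀ z₀ x₁ x₂ b₁ b₂ ε : ℝ, 0 ≤ x₁ → 0 ≤ x₂ → |z₀| ≤ x₁ + x₂ → ε ≤ 1 →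
    |b₁| ≤ ε * (1 + θ * x₁) → |b₂| ≤ ε * (1 + θ * x₂) →
    |b₁| ≤ ε * (x₁ + x₂) → |b₂| ≤ ε * (x₁ + x₂) →
    ‖mcsFactor θ z₀ (-(x₁ : ℂ) + b₁ * Complex.I) (-(x₂ : ℂ) + b₂ * Complex.I) -
      (realFactor θ z₀ x₁ x₂ : ℂ)‖ ≤ C * ε * ((x₁ + x₂) / ((1 + θ * x₁) * (1 + θ * x₂))) := by
  obtain ⟨D, hD⟩ : ∃ D : ℝ, D = 2 * θ + θ ^ 2 := ⟨_, rfl⟩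
  have hD0 : 0 < D := by rw [hD]; positivity
  obtain ⟨B, hB⟩ : ∃ B : ℝ, B = θ * 2 + |1 / 2 - θ| * 12 := ⟨_, rfl⟩
  have hB0 : 0 < B := by rw [hB]; positivity
  refine ⟨2 + 2 * D + (B + B * (2 * D)) / θ, by positivity,
    fun z₀ x₁ x₂ b₁ b₂ ε hx₁ hx₂ hz₀ hε h₁ h₂ h₃ h₄ => ?_⟩
  obtain ⟨n1, n2⟩ := norm_inv_mcsDenom_sub_le hθ.le hx₁ hx₂ hε h₁ h₂
  have hp0 : 0 < (1 + θ * x₁) * (1 + θ * x₂) := by positivity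
  have hε0 : 0 ≤ ε := by
    by_contra h
    have := (abs_nonneg b₁).trans h₁
    nlinarith [mul_nonneg hθ.le hx₁]
  have hmi : (x₁ + x₂) * (1 / ((1 + θ * x₁) * (1 + θ * x₂))) ≤ 1 / θ := by
    rw [mul_one_div, div_le_div_iff₀ hp0 hθ]
    nlinarith [mul_nonneg (sq_nonneg θ) (mul_nonneg hx₁ hx₂)]
  rw [mcsFactor_eq, realFactor, div_eq_mul_one_div (x₁ + x₂)]
  rw [← hD] at n2
  generalize 1 / ((1 - θ * (-(x₁ : ℂ) + b₁ * Complex.I)) * (1 - θ * (-(x₂ : ℂ) + b₂ * Complex.I))) = ic at n1 n2 ⊢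
  have hi0 : 0 < 1 / ((1 + θ * x₁) * (1 + θ * x₂)) := by positivity
  generalize 1 / ((1 + θ * x₁) * (1 + θ * x₂)) = i at n1 n2 hi0 hmi ⊢
  obtain ⟨m, hm⟩ : ∃ m : ℝ, m = x₁ + x₂ := ⟨_, rfl⟩
  have hm0 : 0 ≤ m := by rw [hm]; positivity
  rw [← hm] at hz₀ h₃ h₄ hmi ⊢
  obtain ⟨zc, hzc⟩ : ∃ z : ℂ, z = z₀ + (-(x₁ : ℂ) + b₁ * Complex.I) +
    (-(x₂ : ℂ) + b₂ * Complex.I) := ⟨_, rfl⟩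
  obtain ⟨zr, hzr⟩ : ∃ z : ℝ, z = z₀ - x₁ - x₂ := ⟨_, rfl⟩
  rw [← hzc, ← hzr]
  have k1 : ‖zc - zr‖ ≤ 2 * ε * m := by
    have e : zc - zr = b₁ * Complex.I + b₂ * Complex.I := by rw [hzc, hzr]; push_cast; ring
    rw [e]
    refine (norm_add_le _ _).trans ?_
    simp only [norm_mul, Complex.norm_I, mul_one, Complex.norm_real, Real.norm_eq_abs]
    linarith
  have k2 : ‖(zr : ℂ)‖ ≤ 2 * m := by
    rw [Complex.norm_real, Real.norm_eq_abs, hzr, abs_le]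
    rw [abs_le] at hz₀
    constructor <;> linarith
  have k3 : ‖zc‖ ≤ 4 * m := by
    have : zc = (zc - zr) + zr := by ring
    rw [this]
    refine (norm_add_le _ _).trans ?_
    have : ε * m ≤ 1 * m := by gcongr
    linarith
  have k0 : ‖(z₀ : ℂ)‖ ≤ m := by rwa [Complex.norm_real, Real.norm_eq_abs]
  have kθ : ‖(1 / 2 - θ : ℂ)‖ = |1 / 2 - θ| := by
    rw [← Real.norm_eq_abs, ← Complex.norm_real]; push_cast; rfl
  have kθ' : ‖(θ : ℂ)‖ = θ := by rw [Complex.norm_real, Real.norm_of_nonneg hθ.le]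
  have s1 : ‖zc * ic - zr * i‖ ≤ 2 * ε * m * i + 2 * m * (D * ε * i) := by
    have e : zc * ic - zr * i = (zc - zr) * ic + zr * (ic - i) := by ring
    rw [e]
    refine (norm_add_le _ _).trans ?_
    rw [norm_mul, norm_mul]
    gcongr
  have s2 : ‖(θ * z₀ * zc + (1 / 2 - θ) * zc ^ 2) - (θ * z₀ * zr + (1 / 2 - θ) * zr ^ 2 : ℂ)‖ ≤
      B * ε * m ^ 2 := by
    have e : (θ * z₀ * zc + (1 / 2 - θ) * zc ^ 2) - (θ * z₀ * zr + (1 / 2 - θ) * zr ^ 2 : ℂ) =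
      θ * z₀ * (zc - zr) + (1 / 2 - θ) * ((zc - zr) * (zc + zr)) := by ring
    rw [e]
    refine (norm_add_le _ _).trans ?_
    rw [norm_mul, norm_mul, norm_mul, norm_mul, kθ, kθ']
    calc _ ≤ θ * m * (2 * ε * m) + |1 / 2 - θ| * ((2 * ε * m) * (4 * m + 2 * m)) := by
          gcongr
          exact (norm_add_le _ _).trans (add_le_add k3 k2)
      _ = B * ε * m ^ 2 := by rw [hB]; ring
  have s3 : ‖(θ * z₀ * zr + (1 / 2 - θ) * zr ^ 2 : ℂ)‖ ≤ B * m ^ 2 := by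
    refine (norm_add_le _ _).trans ?_
    rw [norm_mul, norm_mul, norm_mul, norm_pow, kθ, kθ']
    calc _ ≤ θ * m * (2 * m) + |1 / 2 - θ| * (2 * m) ^ 2 := by gcongr
      _ ≤ B * m ^ 2 := by
        rw [hB]
        nlinarith [mul_nonneg (abs_nonneg (1 / 2 - θ)) (sq_nonneg m)]
  have s4 : ‖ic ^ 2 - (i : ℂ) ^ 2‖ ≤ D * ε * i * (2 * i) := by
    have e : ic ^ 2 - (i : ℂ) ^ 2 = (ic - i) * (ic + i) := by ring
    rw [e, norm_mul]
    gcongr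
    refine (norm_add_le _ _).trans ?_
    rw [Complex.norm_real, Real.norm_of_nonneg hi0.le]
    linarith
  have e : 1 + zc * ic + (θ * z₀ * zc + (1 / 2 - θ) * zc ^ 2) * ic ^ 2 -
      ((1 + zr * i + (θ * z₀ * zr + (1 / 2 - θ) * zr ^ 2) * i ^ 2 : ℝ) : ℂ) =
      (zc * ic - zr * i) + ((θ * z₀ * zc + (1 / 2 - θ) * zc ^ 2) -
        (θ * z₀ * zr + (1 / 2 - θ) * zr ^ 2 : ℂ)) * ic ^ 2 +
      (θ * z₀ * zr + (1 / 2 - θ) * zr ^ 2 : ℂ) * (ic ^ 2 - (i : ℂ) ^ 2) := by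
    push_cast; ring
  rw [e]
  refine norm_add₃_le.trans ?_
  rw [norm_mul, norm_mul, norm_pow]
  calc _ ≤ (2 * ε * m * i + 2 * m * (D * ε * i)) + B * ε * m ^ 2 * i ^ 2 +
        B * m ^ 2 * (D * ε * i * (2 * i)) := by gcongr
    _ = (2 + 2 * D) * ε * (m * i) + (B + B * (2 * D)) * ε * (m * i) * (m * i) := by ring
    _ ≤ (2 + 2 * D) * ε * (m * i) + (B + B * (2 * D)) * ε * (m * i) * (1 / θ) := by gcongr
    _ = _ := by ring

/-- For `θ = 1/2` the effect of the convection terms is also small relative to `q / p`. -/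
theorem norm_mcsFactor_sub_realFactor_half_le : ∃ C : ℝ, 0 < C ∧
    ∀ z₀ x₁ x₂ b₁ b₂ ε : ℝ, 0 ≤ x₁ → 0 ≤ x₂ → |z₀| ≤ x₁ + x₂ → z₀ ^ 2 ≤ 4 * (x₁ * x₂) → ε ≤ 1 →
    |b₁| ≤ ε * (1 + 1 / 2 * x₁) → |b₂| ≤ ε * (1 + 1 / 2 * x₂) →
    x₁ * |b₂| ≤ ε * (4 + x₁ * x₂) → x₂ * |b₁| ≤ ε * (4 + x₁ * x₂) →
    |b₁| * |b₂| ≤ ε * (4 + x₁ * x₂) →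
    ‖mcsFactor (1 / 2) z₀ (-(x₁ : ℂ) + b₁ * Complex.I) (-(x₂ : ℂ) + b₂ * Complex.I) -
      (realFactor (1 / 2) z₀ x₁ x₂ : ℂ)‖ ≤
      C * ε * ((1 + (1 / 2) ^ 2 * (x₁ * x₂)) / ((1 + 1 / 2 * x₁) * (1 + 1 / 2 * x₂))) := by
  obtain ⟨D, hD⟩ : ∃ D : ℝ, D = 2 * (1 / 2 : ℝ) + (1 / 2) ^ 2 := ⟨_, rfl⟩
  have hD0 : 0 < D := by rw [hD]; positivity
  refine ⟨16 * D + 2 * (3 + D) + 2 * (3 + 2 * D), by positivity,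
    fun z₀ x₁ x₂ b₁ b₂ ε hx₁ hx₂ hz₀ hz hε h₁ h₂ h₃ h₄ h₅ => ?_⟩
  obtain ⟨n1, n2⟩ := norm_inv_mcsDenom_sub_le (θ := 1 / 2) (by norm_num) hx₁ hx₂ hε h₁ h₂
  have hp0 : 0 < (1 + 1 / 2 * x₁) * (1 + 1 / 2 * x₂) := by positivity
  have hε0 : 0 ≤ ε := by
    by_contra h
    have := (abs_nonneg b₁).trans h₁
    nlinarith
  obtain ⟨q, hq⟩ : ∃ q : ℝ, q = 1 + (1 / 2) ^ 2 * (x₁ * x₂) := ⟨_, rfl⟩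
  have hq1 : 1 ≤ q := by rw [hq]; nlinarith [mul_nonneg hx₁ hx₂]
  have hi1 : 1 / ((1 + 1 / 2 * x₁) * (1 + 1 / 2 * x₂)) ≤ 1 := by
    rw [div_le_one hp0]; nlinarith [mul_nonneg hx₁ hx₂]
  have hzi : |z₀| * (1 / ((1 + 1 / 2 * x₁) * (1 + 1 / 2 * x₂))) ≤ 2 := by
    rw [mul_one_div, div_le_iff₀ hp0]
    nlinarith [mul_nonneg hx₁ hx₂]
  obtain ⟨zc, hzc⟩ : ∃ z : ℂ, z = (-(x₁ : ℂ) + b₁ * Complex.I) := ⟨_, rfl⟩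
  obtain ⟨wc, hwc⟩ : ∃ z : ℂ, z = (-(x₂ : ℂ) + b₂ * Complex.I) := ⟨_, rfl⟩
  have hic : 1 / ((1 - ((1 / 2 : ℝ) : ℂ) * zc) * (1 - ((1 / 2 : ℝ) : ℂ) * wc)) *
      ((1 - 1 / 2 * zc) * (1 - 1 / 2 * wc)) = 1 := by
    push_cast
    refine one_div_mul_cancel fun h0 => ?_
    rw [hzc, hwc] at h0
    rcases mul_eq_zero.1 h0 with h | h
    · have := congrArg Complex.re h; simp at this; linarith
    · have := congrArg Complex.re h; simp at this; linarith
  have hir : 1 / ((1 + 1 / 2 * x₁) * (1 + 1 / 2 * x₂)) * ((1 + 1 / 2 * x₁) * (1 + 1 / 2 * x₂)) = 1 :=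
    one_div_mul_cancel hp0.ne'
  rw [mcsFactor_eq, realFactor, div_eq_mul_one_div (1 + (1 / 2) ^ 2 * (x₁ * x₂)), ← hq]
  rw [← hD, ← hzc, ← hwc] at n2
  rw [← hzc, ← hwc] at n1 ⊢
  generalize 1 / ((1 - ((1 / 2 : ℝ) : ℂ) * zc) * (1 - ((1 / 2 : ℝ) : ℂ) * wc)) = ic at n1 n2 hic ⊢
  have hi0 : 0 < 1 / ((1 + 1 / 2 * x₁) * (1 + 1 / 2 * x₂)) := by positivity
  generalize 1 / ((1 + 1 / 2 * x₁) * (1 + 1 / 2 * x₂)) = i at n1 n2 hi0 hi1 hzi hir ⊢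
  obtain ⟨qc, hqc⟩ : ∃ z : ℂ, z = 1 + 1 / 4 * (zc * wc) := ⟨_, rfl⟩
  have k1 : ‖qc - q‖ ≤ 3 * ε * q := by
    have e : qc - q = 1 / 4 * (-(b₁ * b₂) - x₁ * (b₂ * Complex.I) - x₂ * (b₁ * Complex.I)) := by
      rw [hqc, hq, hzc, hwc]; push_cast
      linear_combination (1 / 4 * (b₁ : ℂ) * b₂) * Complex.I_sq
    have t : ‖(-(b₁ * b₂) - x₁ * (b₂ * Complex.I) - x₂ * (b₁ * Complex.I) : ℂ)‖ ≤
        |b₁| * |b₂| + x₁ * |b₂| + x₂ * |b₁| := by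
      refine (norm_sub_le _ _).trans (add_le_add ((norm_sub_le _ _).trans (add_le_add ?_ ?_)) ?_)
      · simp
      · simp [abs_of_nonneg hx₁]
      · simp [abs_of_nonneg hx₂]
    rw [e, norm_mul]
    have n4 : ‖(1 / 4 : ℂ)‖ = 1 / 4 := by simp
    rw [n4]
    have : 4 * q = 4 + x₁ * x₂ := by rw [hq]; ring
    rw [← this] at h₃ h₄ h₅
    nlinarith
  have s2 : ‖ic ^ 2 - (i : ℂ) ^ 2‖ ≤ D * ε * i * (2 * i) := by
    have e : ic ^ 2 - (i : ℂ) ^ 2 = (ic - i) * (ic + i) := by ring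
    rw [e, norm_mul]
    gcongr
    refine (norm_add_le _ _).trans ?_
    rw [Complex.norm_real, Real.norm_of_nonneg hi0.le]
    linarith
  have kz : ‖(z₀ : ℂ)‖ = |z₀| := by rw [Complex.norm_real, Real.norm_eq_abs]
  have kq : ‖(q : ℂ)‖ = q := by rw [Complex.norm_real, Real.norm_of_nonneg (by linarith)]
  have ki : ‖(i : ℂ)‖ = i := by rw [Complex.norm_real, Real.norm_of_nonneg hi0.le]
  have s3 : ‖qc * ic - q * i‖ ≤ (3 + D) * ε * q * i := by
    have e : qc * ic - q * i = (qc - q) * ic + q * (ic - i) := by ring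
    rw [e]
    refine (norm_add_le _ _).trans ?_
    rw [norm_mul, norm_mul, kq]
    calc _ ≤ 3 * ε * q * i + q * (D * ε * i) := by gcongr
      _ = _ := by ring
  have s4 : ‖qc * ic ^ 2 - q * (i : ℂ) ^ 2‖ ≤ (3 + 2 * D) * ε * q * i * i := by
    have e : qc * ic ^ 2 - q * (i : ℂ) ^ 2 = (qc - q) * ic ^ 2 + q * (ic ^ 2 - (i : ℂ) ^ 2) := by ring
    rw [e]
    refine (norm_add_le _ _).trans ?_
    rw [norm_mul, norm_mul, norm_pow, kq]
    calc _ ≤ 3 * ε * q * i ^ 2 + q * (D * ε * i * (2 * i)) := by gcongr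
      _ = _ := by ring
  -- `1 + R = (z₀² / 2 + 2 q (p + z₀ / 2)) / p²`
  have e : 1 + (z₀ + zc + wc) * ic + ((((1 / 2 : ℝ) : ℂ)) * z₀ * (z₀ + zc + wc) +
      (1 / 2 - ((1 / 2 : ℝ) : ℂ)) * (z₀ + zc + wc) ^ 2) * ic ^ 2 -
      ((1 + (z₀ - x₁ - x₂) * i + (1 / 2 * z₀ * (z₀ - x₁ - x₂) +
        (1 / 2 - 1 / 2) * (z₀ - x₁ - x₂) ^ 2) * i ^ 2 : ℝ) : ℂ) =
      1 / 2 * z₀ ^ 2 * (ic ^ 2 - (i : ℂ) ^ 2) + 2 * (qc * ic - q * i) +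
        z₀ * (qc * ic ^ 2 - q * (i : ℂ) ^ 2) := by
    have hir' : (i : ℂ) * ((1 + 1 / 2 * x₁) * (1 + 1 / 2 * x₂)) = 1 := by
      have := congrArg Complex.ofReal hir
      push_cast at this
      exact this
    rw [hqc, hq]
    push_cast
    linear_combination (-2 - z₀ * ic) * hic + (2 + z₀ * i) * hir'
  rw [e]
  refine norm_add₃_le.trans ?_
  have k4 : ‖(1 / 2 * z₀ ^ 2 : ℂ)‖ ≤ 8 * q := by
    rw [norm_mul, norm_pow, kz, sq_abs]
    have n4 : ‖(1 / 2 : ℂ)‖ = 1 / 2 := by simp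
    rw [n4, hq]
    linarith
  rw [norm_mul, norm_mul 2, norm_mul (z₀ : ℂ), Complex.norm_ofNat, kz]
  calc _ ≤ 8 * q * (D * ε * i * (2 * i)) + 2 * ((3 + D) * ε * q * i) +
        |z₀| * ((3 + 2 * D) * ε * q * i * i) := by gcongr
    _ = 16 * D * ε * (q * i) * i + 2 * (3 + D) * ε * (q * i) +
        (3 + 2 * D) * ε * (q * i) * (|z₀| * i) := by ring
    _ ≤ 16 * D * ε * (q * i) * 1 + 2 * (3 + D) * ε * (q * i) +
        (3 + 2 * D) * ε * (q * i) * 2 := by gcongr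
    _ = _ := by ring

end perturbation

/-! ### Decay outside the regions of the leading-order terms -/

section decay

/-- The imaginary part of the symbol of a one-dimensional difference operator is of the order of the
square root of `h` times its real part. -/
theorem zSym_im_sq_le {l h : ℝ} (hl : 0 < l) (hh : 0 < h) (a s : ℝ) :
    (l * a * Real.sin s) ^ 2 ≤ l * a ^ 2 * h * xSym l h s := by
  have hs : Real.sin s = 2 * Real.sin (s / 2) * Real.cos (s / 2) := by
    rw [← Real.sin_two_mul]; ring_nf
  have e : l * a ^ 2 * h * xSym l h s = 4 * (l * a) ^ 2 * Real.sin (s / 2) ^ 2 := by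
    unfold xSym; field_simp
  rw [e, hs]
  have := Real.cos_sq_le_one (s / 2)
  calc (l * a * (2 * Real.sin (s / 2) * Real.cos (s / 2))) ^ 2
      = 4 * (l * a) ^ 2 * Real.sin (s / 2) ^ 2 * Real.cos (s / 2) ^ 2 := by ring
    _ ≤ 4 * (l * a) ^ 2 * Real.sin (s / 2) ^ 2 * 1 := by gcongr
    _ = _ := by ring

theorem le_xSym {l h s : ℝ} (hl : 0 < l) (hh : 0 < h) (hs : |s| ≤ Real.pi) :
    4 * l / Real.pi ^ 2 * h * (s / h) ^ 2 ≤ xSym l h s := by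
  have := sq_le_sin_half_sq hs
  calc 4 * l / Real.pi ^ 2 * h * (s / h) ^ 2 = 4 * l / h * (s ^ 2 / Real.pi ^ 2) := by
        field_simp
    _ ≤ _ := by unfold xSym; gcongr

theorem le_one_div_xSym {l h s : ℝ} (hl : 0 < l) (hh : 0 < h) (hs : |s| ≤ Real.pi) (h0 : s ≠ 0) :
    1 / l * h * (1 / s) ^ 2 ≤ 1 / xSym l h s := by
  rw [le_div_iff₀ (xSym_pos hl hh hs h0)]
  have := sin_half_sq_le s
  calc 1 / l * h * (1 / s) ^ 2 * xSym l h s = 4 * (1 / s) ^ 2 * Real.sin (s / 2) ^ 2 := by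
        unfold xSym; field_simp
    _ ≤ 4 * (1 / s) ^ 2 * (s ^ 2 / 4) := by gcongr
    _ = 1 := by field_simp

/-- The four phases measure the sizes of the symbols of the difference operators. -/
theorem exists_phase_le {c lam : ℝ} (hc : 0 < c) (hlam : 0 < lam) :
    ∃ k : ℝ, 0 < k ∧ ∀ h s t : ℝ, 0 < h → |s| ≤ Real.pi → |t| ≤ Real.pi → s ≠ 0 → t ≠ 0 →
      k * h * phaseLow c h s t ≤ xSym lam h s + xSym (lam / c ^ 2) h t ∧
      k * h * phaseHigh s t ≤ 1 / xSym lam h s + 1 / xSym (lam / c ^ 2) h t ∧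
      k * h * phaseCS c h s t ≤ 8 / xSym lam h s + xSym (lam / c ^ 2) h t ∧
      k * h * phaseCS c⁻¹ (c * h) t s ≤ xSym lam h s + 8 / xSym (lam / c ^ 2) h t := by
  have hl2 : 0 < lam / c ^ 2 := by positivity
  have hpi := Real.pi_pos
  obtain ⟨k, hk⟩ : ∃ k : ℝ, k = min (4 * lam / Real.pi ^ 2) (min (1 / lam) (1 / (lam / c ^ 2))) :=
    ⟨_, rfl⟩
  have k1 : k ≤ 4 * lam / Real.pi ^ 2 := hk ▸ min_le_left _ _
  have k2 : k ≤ 1 / lam := hk ▸ (min_le_right _ _).trans (min_le_left _ _)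
  have k3 : k ≤ 1 / (lam / c ^ 2) := hk ▸ (min_le_right _ _).trans (min_le_right _ _)
  have k0 : 0 < k := by
    rw [hk]; exact lt_min (by positivity) (lt_min (by positivity) (by positivity))
  refine ⟨k, k0, fun h s t hh hs ht hs0 ht0 => ?_⟩
  have a1 : k * h * (s / h) ^ 2 ≤ xSym lam h s :=
    le_trans (by gcongr) (le_xSym hlam hh hs)
  have a2 : k * h * (t / (c * h)) ^ 2 ≤ xSym (lam / c ^ 2) h t := by
    refine le_trans ?_ (le_xSym hl2 hh ht)
    calc k * h * (t / (c * h)) ^ 2 ≤ 4 * lam / Real.pi ^ 2 * h * (t / (c * h)) ^ 2 := by gcongr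
      _ = _ := by field_simp
  have a3 : k * h * (1 / s) ^ 2 ≤ 1 / xSym lam h s :=
    le_trans (by gcongr) (le_one_div_xSym hlam hh hs hs0)
  have a4 : k * h * (1 / t) ^ 2 ≤ 1 / xSym (lam / c ^ 2) h t :=
    le_trans (by gcongr) (le_one_div_xSym hl2 hh ht ht0)
  have p1 := xSym_pos hlam hh hs hs0
  have p2 := xSym_pos hl2 hh ht ht0
  have b3 : 1 / xSym lam h s ≤ 8 / xSym lam h s := by gcongr; norm_num
  have b4 : 1 / xSym (lam / c ^ 2) h t ≤ 8 / xSym (lam / c ^ 2) h t := by gcongr; norm_num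
  have e : s / (c⁻¹ * (c * h)) = s / h := by field_simp
  refine ⟨?_, ?_, ?_, ?_⟩
  · rw [phaseLow, mul_add]; linarith
  · rw [phaseHigh, mul_add]; linarith
  · rw [phaseCS, mul_add]; linarith
  · rw [phaseCS, mul_add, e]; linarith

/-- Away from both the lowest and the highest wavenumbers, `m / p` is not too small, where `m = x₁ + x₂`
and `p = (1 + θ x₁) (1 + θ x₂)`. Which of the three terms of `p = 1 + θ m + θ² x₁ x₂` is largest decides
which of the lower bounds applies. -/
theorem exists_rate_sum {θ k : ℝ} (hθ : 0 < θ) (hk : 0 < k) : ∃ r : ℝ, 0 < r ∧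
    ∀ h x₁ x₂ A B : ℝ, 0 < h → 0 < x₁ → 0 < x₂ → k * h * A ≤ x₁ + x₂ →
      k * h * B ≤ 1 / x₁ + 1 / x₂ →
      ∃ Y : ℝ, (Y = 1 / h ∨ Y = A ∨ Y = B) ∧
        r * h * Y ≤ (x₁ + x₂) / ((1 + θ * x₁) * (1 + θ * x₂)) := by
  refine ⟨min (k / 3) (min (1 / (3 * θ)) (k / (3 * θ ^ 2))), by positivity,
    fun h x₁ x₂ A B hh hx₁ hx₂ hA hB => ?_⟩
  have r1 := min_le_left (k / 3) (min (1 / (3 * θ)) (k / (3 * θ ^ 2)))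
  have r2 := (min_le_right (k / 3) (min (1 / (3 * θ)) (k / (3 * θ ^ 2)))).trans (min_le_left _ _)
  have r3 := (min_le_right (k / 3) (min (1 / (3 * θ)) (k / (3 * θ ^ 2)))).trans (min_le_right _ _)
  have r0 : 0 < min (k / 3) (min (1 / (3 * θ)) (k / (3 * θ ^ 2))) := by positivity
  generalize min (k / 3) (min (1 / (3 * θ)) (k / (3 * θ ^ 2))) = r at r1 r2 r3 r0
  have hp : (1 + θ * x₁) * (1 + θ * x₂) = 1 + θ * (x₁ + x₂) + θ ^ 2 * (x₁ * x₂) := by ring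
  rw [hp]
  obtain ⟨u, hu⟩ : ∃ u, u = θ * (x₁ + x₂) := ⟨_, rfl⟩
  obtain ⟨v, hv⟩ : ∃ u, u = θ ^ 2 * (x₁ * x₂) := ⟨_, rfl⟩
  rw [← hu, ← hv]
  have hu0 : 0 < u := by rw [hu]; positivity
  have hv0 : 0 < v := by rw [hv]; positivity
  by_cases c1 : u ≤ 1 ∧ v ≤ 1
  · refine ⟨A, .inr (.inl rfl), ?_⟩
    rcases le_or_gt A 0 with hA0 | hA0
    · exact (mul_nonpos_of_nonneg_of_nonpos (by positivity) hA0).trans (by positivity)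
    calc r * h * A ≤ k / 3 * h * A := by gcongr
      _ ≤ (x₁ + x₂) / 3 := by linarith
      _ ≤ _ := by gcongr; linarith
  by_cases c2 : v ≤ u
  · have c3 : 1 ≤ u := by
      by_contra h'
      exact c1 ⟨by linarith, by linarith⟩
    refine ⟨1 / h, .inl rfl, ?_⟩
    calc r * h * (1 / h) = r := by field_simp
      _ ≤ 1 / (3 * θ) := r2
      _ = (x₁ + x₂) / (3 * u) := by rw [hu]; field_simp
      _ ≤ _ := by gcongr; linarith
  · have c3 : 1 ≤ v := by
      by_contra h'
      exact c1 ⟨by linarith, by linarith⟩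
    refine ⟨B, .inr (.inr rfl), ?_⟩
    rcases le_or_gt B 0 with hB0 | hB0
    · exact (mul_nonpos_of_nonneg_of_nonpos (by positivity) hB0).trans (by positivity)
    calc r * h * B ≤ k / (3 * θ ^ 2) * h * B := by gcongr
      _ = 1 / (3 * θ ^ 2) * (k * h * B) := by ring
      _ ≤ 1 / (3 * θ ^ 2) * (1 / x₁ + 1 / x₂) := by gcongr
      _ = (x₁ + x₂) / (3 * v) := by rw [hv]; field_simp; ring
      _ ≤ _ := by gcongr; linarith

/-- For `θ = 1/2` and `q = 1 + x₁ x₂ / 4`, the ratio `q / p` is not too small unless one angle is away from zero and the other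
wavenumber is bounded. -/
theorem exists_rate_prod {k : ℝ} (hk : 0 < k) : ∃ r : ℝ, 0 < r ∧
    ∀ h x₁ x₂ A B : ℝ, 0 < h → 0 < x₁ → 0 < x₂ → k * h * A ≤ 8 / x₁ + x₂ →
      k * h * B ≤ x₁ + 8 / x₂ →
      ∃ Y : ℝ, (Y = 1 / h ∨ Y = A ∨ Y = B) ∧
        r * h * Y ≤ (1 + (1 / 2) ^ 2 * (x₁ * x₂)) / ((1 + 1 / 2 * x₁) * (1 + 1 / 2 * x₂)) := by
  refine ⟨min (k / 16) (1 / 2), by positivity, fun h x₁ x₂ A B hh hx₁ hx₂ hA hB => ?_⟩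
  have r1 := min_le_left (k / 16) (1 / 2)
  have r2 := min_le_right (k / 16) (1 / 2)
  have r0 : 0 < min (k / 16) (1 / 2) := by positivity
  generalize min (k / 16) (1 / 2) = r at r1 r2 r0
  obtain ⟨q, hq⟩ : ∃ q, q = 1 + (1 / 2) ^ 2 * (x₁ * x₂) := ⟨_, rfl⟩
  have hq0 : 0 < q := by rw [hq]; positivity
  have hp : (1 + 1 / 2 * x₁) * (1 + 1 / 2 * x₂) = q + 1 / 2 * (x₁ + x₂) := by rw [hq]; ring
  rw [hp, ← hq]
  have key : ∀ A x y : ℝ, 0 < x → 0 < y → y ≤ x → q < 1 / 2 * (x + y) →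
      q = 1 + (1 / 2) ^ 2 * (x * y) → k * h * A ≤ 8 / x + y →
      r * h * A ≤ q / (q + 1 / 2 * (x + y)) := by
    intro A x y hx hy hxy hqx hqe hA
    rcases le_or_gt A 0 with hA0 | hA0
    · exact (mul_nonpos_of_nonneg_of_nonpos (by positivity) hA0).trans (by positivity)
    calc r * h * A ≤ k / 16 * h * A := by gcongr
      _ = 1 / 16 * (k * h * A) := by ring
      _ ≤ 1 / 16 * (8 / x + y) := by gcongr
      _ ≤ 1 / 16 * (8 / x + 2 * y) := by linarith
      _ = q / (2 * x) := by rw [hqe]; field_simp; ring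
      _ ≤ _ := by gcongr; linarith
  rcases le_or_gt (1 / 2 * (x₁ + x₂)) q with c1 | c1
  · refine ⟨1 / h, .inl rfl, ?_⟩
    calc r * h * (1 / h) = r := by field_simp
      _ ≤ 1 / 2 := r2
      _ = q / (2 * q) := by field_simp
      _ ≤ _ := by gcongr; linarith
  rcases le_total x₂ x₁ with c2 | c2
  · exact ⟨A, .inr (.inl rfl), key A x₁ x₂ hx₁ hx₂ c2 c1 hq hA⟩
  · refine ⟨B, .inr (.inr rfl), ?_⟩
    rw [add_comm x₁]
    exact key B x₂ x₁ hx₂ hx₁ c2 (by linarith) (by rw [hq]; ring) (by linarith)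

/-- A contraction rate `h Y` with `Y` at least of order `h ^ (-1/4)` makes the powers up to the final
time smaller than any power of `h`. -/
theorem exists_pow_le_of_rate {lam r b : ℝ} (hlam : 0 < lam) (hr : 0 < r) (hb : 0 < b) (N₀ w : ℕ) :
    ∃ K : ℝ, 0 < K ∧ ∀ (N : ℕ) (Y R : ℝ), 0 < N → 2 * N₀ ≤ N → 0 ≤ Y →
      b ≤ Y ^ 4 * meshWidth lam N → 0 ≤ R → R ≤ 1 - r * meshWidth lam N * Y →
      R ^ (N - N₀) ≤ K * meshWidth lam N ^ w := by
  obtain ⟨C, hC, hexp⟩ := exists_pow_mul_exp_le (δ := r / (2 * lam)) (by positivity) (4 * w)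
  refine ⟨C / b ^ w, by positivity, fun N Y R hN hN₀ hY hbY hR hR1 => ?_⟩
  have hh := meshWidth_pos hlam hN
  have hm := meshWidth_mul hlam hN
  generalize meshWidth lam N = h at hh hm hbY hR1 ⊢
  have h1 : R ≤ Real.exp (-(r * h * Y)) := hR1.trans (by linarith [Real.add_one_le_exp (-(r * h * Y))])
  have h2 : R ^ (N - N₀) ≤ Real.exp (-(r / (2 * lam) * Y)) := by
    calc R ^ (N - N₀) ≤ Real.exp (-(r * h * Y)) ^ (N - N₀) := pow_le_pow_left₀ hR h1 _
      _ = Real.exp (((N - N₀ : ℕ) : ℝ) * -(r * h * Y)) := by rw [← Real.exp_nat_mul]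
      _ ≤ _ := by
        apply Real.exp_le_exp.2
        have h3 : (N : ℝ) ≤ 2 * ((N - N₀ : ℕ) : ℝ) := by exact_mod_cast (by omega : N ≤ 2 * (N - N₀))
        have h4 : r / (2 * lam) * Y = (N : ℝ) / 2 * (r * h * Y) := by
          have : r / (2 * lam) * Y = r / (2 * lam) * Y * (lam * h * N) := by rw [hm, mul_one]
          rw [this]; field_simp
        have h5 : 0 ≤ r * h * Y := by positivity
        rw [h4]
        nlinarith
  refine h2.trans ?_
  have h3 := hexp Y hY
  have h4 : (b / h) ^ w ≤ Y ^ (4 * w) := by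
    rw [pow_mul]
    refine pow_le_pow_left₀ (by positivity) ?_ w
    rw [div_le_iff₀ hh]
    exact hbY
  have h5 : (b / h) ^ w * Real.exp (-(r / (2 * lam) * Y)) ≤ C :=
    (mul_le_mul_of_nonneg_right h4 (Real.exp_pos _).le).trans h3
  rw [div_mul_eq_mul_div C, le_div_iff₀ (by positivity)]
  rw [div_pow, div_mul_eq_mul_div, div_le_iff₀ (by positivity)] at h5
  linarith


/-- The perturbation of the real amplification factor by convection is small relative to `m / p`, and
for `θ = 1/2` also relative to `q / p`, when the phases are large. -/
theorem convection_bounds {θ ε β k h x₁ x₂ b₁ b₂ : ℝ} (hθ : 0 < θ) (hε : 0 < ε) (hβ : 0 < β)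
    (hk : 0 < k) (hh : 0 < h) (hx₁ : 0 < x₁) (hx₂ : 0 < x₂) (hb₁ : b₁ ^ 2 ≤ β * h * x₁)
    (hb₂ : b₂ ^ 2 ≤ β * h * x₂) (hs₁ : β * h ≤ 4 * θ * ε ^ 2) (hs₂ : β * h ≤ ε) :
    (|b₁| ≤ ε * (1 + θ * x₁) ∧ |b₂| ≤ ε * (1 + θ * x₂)) ∧ |b₁| * |b₂| ≤ ε * (4 + x₁ * x₂) ∧
    (∀ A, β / (ε ^ 2 * k) ≤ A → k * h * A ≤ x₁ + x₂ →
      |b₁| ≤ ε * (x₁ + x₂) ∧ |b₂| ≤ ε * (x₁ + x₂)) ∧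
    (∀ A, β / (ε ^ 2 * k) ≤ A → k * h * A ≤ 8 / x₁ + x₂ → x₁ * |b₂| ≤ ε * (4 + x₁ * x₂)) ∧
    (∀ A, β / (ε ^ 2 * k) ≤ A → k * h * A ≤ x₁ + 8 / x₂ → x₂ * |b₁| ≤ ε * (4 + x₁ * x₂)) := by
  have hA : ∀ A y, β / (ε ^ 2 * k) ≤ A → k * h * A ≤ y → β * h ≤ ε ^ 2 * y := by
    intro A y h1 h2
    rw [div_le_iff₀ (by positivity)] at h1
    calc β * h ≤ A * (ε ^ 2 * k) * h := by gcongr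
      _ = ε ^ 2 * (k * h * A) := by ring
      _ ≤ _ := by gcongr
  have one : ∀ b x, 0 < x → b ^ 2 ≤ β * h * x → |b| ≤ ε * (1 + θ * x) := by
    intro b x hx hb
    apply abs_le_of_sq_le_sq _ (by positivity)
    calc b ^ 2 ≤ β * h * x := hb
      _ ≤ 4 * θ * ε ^ 2 * x := by gcongr
      _ ≤ (ε * (1 + θ * x)) ^ 2 := by nlinarith [mul_nonneg (sq_nonneg ε) (sq_nonneg (1 - θ * x))]
  have two : ∀ b x m, 0 < x → x ≤ m → b ^ 2 ≤ β * h * x → β * h ≤ ε ^ 2 * m → |b| ≤ ε * m := by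
    intro b x m hx hm hb hm'
    have hm0 : 0 < m := by linarith
    apply abs_le_of_sq_le_sq _ (by positivity)
    calc b ^ 2 ≤ β * h * x := hb
      _ ≤ β * h * m := by gcongr
      _ ≤ ε ^ 2 * m * m := by gcongr
      _ = _ := by ring
  have three : ∀ b x y, 0 < x → 0 < y → b ^ 2 ≤ β * h * y → β * h ≤ ε ^ 2 * (8 / x + y) →
      x * |b| ≤ ε * (4 + x * y) := by
    intro b x y hx hy hb hxy
    have : x * |b| = |x * b| := by rw [abs_mul, abs_of_pos hx]
    rw [this]
    apply abs_le_of_sq_le_sq _ (by positivity)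
    calc (x * b) ^ 2 = x ^ 2 * b ^ 2 := by ring
      _ ≤ x ^ 2 * (β * h * y) := by gcongr
      _ ≤ x ^ 2 * (ε ^ 2 * (8 / x + y) * y) := by gcongr
      _ = ε ^ 2 * (8 * (x * y) + (x * y) ^ 2) := by field_simp
      _ ≤ ε ^ 2 * (4 + x * y) ^ 2 := by gcongr; nlinarith
      _ = _ := by ring
  refine ⟨⟨one _ _ hx₁ hb₁, one _ _ hx₂ hb₂⟩, ?_, fun A h1 h2 => ?_, fun A h1 h2 => ?_,
    fun A h1 h2 => ?_⟩
  · rw [← abs_mul]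
    apply abs_le_of_sq_le_sq _ (by positivity)
    calc (b₁ * b₂) ^ 2 = b₁ ^ 2 * b₂ ^ 2 := by ring
      _ ≤ (β * h * x₁) * (β * h * x₂) := by gcongr
      _ = (β * h) ^ 2 * (x₁ * x₂) := by ring
      _ ≤ ε ^ 2 * (x₁ * x₂) := by gcongr
      _ ≤ ε ^ 2 * (4 + x₁ * x₂) ^ 2 := by
        gcongr
        nlinarith [mul_pos hx₁ hx₂]
      _ = _ := by ring
  · have := hA A _ h1 h2
    exact ⟨two _ _ _ hx₁ (by linarith) hb₁ this, two _ _ _ hx₂ (by linarith) hb₂ this⟩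
  · exact three _ _ _ hx₁ hx₂ hb₂ (hA A _ h1 h2)
  · rw [mul_comm x₁ x₂]
    exact three _ _ _ hx₂ hx₁ hb₁ (by rw [add_comm]; exact hA A _ h1 h2)

theorem exists_meshWidth_le {lam h₀ : ℝ} (hlam : 0 < lam) (h0 : 0 < h₀) (M : ℕ) :
    ∃ N₁ : ℕ, ∀ N ≥ N₁, 0 < N ∧ M ≤ N ∧ meshWidth lam N ≤ h₀ := by
  obtain ⟨n, hn⟩ := exists_nat_gt (1 / (lam * h₀))
  refine ⟨max (max n M) 1, fun N hN => ?_⟩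
  have h1 : n ≤ N := (le_max_left n M).trans ((le_max_left _ _).trans hN)
  have h2 : M ≤ N := (le_max_right n M).trans ((le_max_left _ _).trans hN)
  have h3 : 0 < N := (le_max_right _ 1).trans hN
  refine ⟨h3, h2, ?_⟩
  have h4 : (0 : ℝ) < N := by exact_mod_cast h3
  have h5 : (n : ℝ) ≤ N := by exact_mod_cast h1
  rw [meshWidth, div_le_iff₀ (by positivity)]
  rw [div_lt_iff₀ (by positivity)] at hn
  nlinarith [mul_le_mul_of_nonneg_right h5 (mul_pos hlam h0).le]

set_option maxHeartbeats 1000000 in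
/-- The symbol of the numerical solution is smaller than any power of `h` outside the regions that
carry the leading-order terms. -/
theorem mainSym_intermediate_le {ρ a₁ a₂ c lam θ : ℝ} (hρ : |ρ| < 1) (hc : 0 < c) (hlam : 0 < lam)
    (hθ : max (1 / 4) ((1 + |ρ|) / 6) < θ) (N₀ w : ℕ) :
    ∃ (K : ℝ) (N₁ : ℕ), 0 < K ∧ ∀ N ≥ N₁, ∀ s t : ℝ, s ≠ 0 → t ≠ 0 → |s| ≤ Real.pi → |t| ≤ Real.pi →
      1 < phaseLow c (meshWidth lam N) s t ^ 4 * meshWidth lam N →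
      1 < phaseHigh s t ^ 4 * meshWidth lam N →
      (θ = 1 / 2 → 1 < phaseCS c (meshWidth lam N) s t ^ 4 * meshWidth lam N ∧
        1 < phaseCS c⁻¹ (c * meshWidth lam N) t s ^ 4 * (c * meshWidth lam N)) →
      ‖mainSym ρ a₁ a₂ c lam θ (meshWidth lam N) N₀ N s t‖ ≤ K * meshWidth lam N ^ w := by
  have hθ0 : 0 < θ := lt_trans (by norm_num) (lt_of_le_of_lt (le_max_left _ _) hθ)
  have hl2 : 0 < lam / c ^ 2 := by positivity
  obtain ⟨δ, hδ, hreal⟩ := exists_le_one_sub_realFactor hρ hθ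
  obtain ⟨Cm, hCm, hpm⟩ := norm_mcsFactor_sub_realFactor_le hθ0
  obtain ⟨Cq, hCq, hpq⟩ := norm_mcsFactor_sub_realFactor_half_le
  obtain ⟨k, hk, hphase⟩ := exists_phase_le hc hlam
  obtain ⟨rm, hrm, hratem⟩ := exists_rate_sum hθ0 hk
  obtain ⟨rq, hrq, hrateq⟩ := exists_rate_prod hk
  obtain ⟨ε, hε⟩ : ∃ ε : ℝ, ε = min 1 (min (δ / (2 * Cm)) (δ / (2 * Cq))) := ⟨_, rfl⟩
  have hε0 : 0 < ε := by rw [hε]; positivity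
  have hε1 : ε ≤ 1 := hε ▸ min_le_left _ _
  have hεm : Cm * ε ≤ δ / 2 := by
    have : ε ≤ δ / (2 * Cm) := hε ▸ (min_le_right _ _).trans (min_le_left _ _)
    calc Cm * ε ≤ Cm * (δ / (2 * Cm)) := by gcongr
      _ = δ / 2 := by field_simp
  have hεq : Cq * ε ≤ δ / 2 := by
    have : ε ≤ δ / (2 * Cq) := hε ▸ (min_le_right _ _).trans (min_le_right _ _)
    calc Cq * ε ≤ Cq * (δ / (2 * Cq)) := by gcongr
      _ = δ / 2 := by field_simp
  -- the squared imaginary parts are at most `β h` times the real parts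
  obtain ⟨β, hβ⟩ : ∃ β : ℝ, β = lam * (a₁ ^ 2 + a₂ ^ 2) + 1 := ⟨_, rfl⟩
  have hβ0 : 0 < β := by rw [hβ]; positivity
  obtain ⟨B, hB⟩ : ∃ B : ℝ, B = β / (ε ^ 2 * k) := ⟨_, rfl⟩
  have hB0 : 0 < B := by rw [hB]; positivity
  obtain ⟨b, hb⟩ : ∃ b : ℝ, b = min 1 (1 / c) := ⟨_, rfl⟩
  have hb0 : 0 < b := by rw [hb]; positivity
  have hb1 : b ≤ 1 := hb ▸ min_le_left _ _
  have hb2 : b ≤ 1 / c := hb ▸ min_le_right _ _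
  obtain ⟨Km, hKm, hpowm⟩ := exists_pow_le_of_rate hlam (show 0 < δ / 2 * rm by positivity) hb0 N₀ w
  obtain ⟨Kq, hKq, hpowq⟩ := exists_pow_le_of_rate hlam (show 0 < δ / 2 * rq by positivity) hb0 N₀ w
  -- `h₀` is so small that all phases in question exceed the threshold `B` of `convection_bounds`
  obtain ⟨h₀, hh₀⟩ : ∃ h₀ : ℝ, h₀ = min (min 1 (1 / B ^ 4)) (min (1 / (c * B ^ 4))
    (min (4 * θ * ε ^ 2 / β) (ε / β))) := ⟨_, rfl⟩
  have hh₀0 : 0 < h₀ := by rw [hh₀]; positivity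
  obtain ⟨N₁, hN₁⟩ := exists_meshWidth_le hlam hh₀0 (2 * N₀)
  refine ⟨Km + Kq, N₁, by positivity, fun N hN s t hs0 ht0 hs ht hL hH hX => ?_⟩
  obtain ⟨hN0, hNN, hle⟩ := hN₁ N hN
  have hh := meshWidth_pos hlam hN0
  have hpm' := hpowm N
  have hpq' := hpowq N
  obtain ⟨h, hhd⟩ : ∃ h, h = meshWidth lam N := ⟨_, rfl⟩
  rw [← hhd] at hL hH hX hle hh hpm' hpq' ⊢
  have s1 : h ≤ 1 := hle.trans (hh₀ ▸ (min_le_left _ _).trans (min_le_left _ _))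
  have s2 : h ≤ 1 / B ^ 4 := hle.trans (hh₀ ▸ (min_le_left _ _).trans (min_le_right _ _))
  have s3 : h ≤ 1 / (c * B ^ 4) := hle.trans (hh₀ ▸ (min_le_right _ _).trans (min_le_left _ _))
  have s4 : h ≤ 4 * θ * ε ^ 2 / β := hle.trans
    (hh₀ ▸ (min_le_right _ _).trans ((min_le_right _ _).trans (min_le_left _ _)))
  have s5 : h ≤ ε / β := hle.trans
    (hh₀ ▸ (min_le_right _ _).trans ((min_le_right _ _).trans (min_le_right _ _)))
  rw [le_div_iff₀ (by positivity)] at s2 s3 s4 s5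
  have big : ∀ A, 0 ≤ A → 1 < A ^ 4 * h → B ≤ A := by
    intro A hA0 hA
    by_contra hlt
    have : A ^ 4 ≤ B ^ 4 := pow_le_pow_left₀ hA0 (by linarith) 4
    nlinarith
  have big' : ∀ A, 0 ≤ A → 1 < A ^ 4 * (c * h) → B ≤ A := by
    intro A hA0 hA
    by_contra hlt
    have : A ^ 4 ≤ B ^ 4 := pow_le_pow_left₀ hA0 (by linarith) 4
    have := mul_le_mul_of_nonneg_right this (mul_pos hc hh).le
    linarith
  obtain ⟨pL, pH, pX, pY⟩ := hphase h s t hh hs ht hs0 ht0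
  have hL0 : 0 ≤ phaseLow c h s t := by rw [phaseLow]; positivity
  have hH0 : 0 ≤ phaseHigh s t := by rw [phaseHigh]; positivity
  have hX0 : 0 ≤ phaseCS c h s t := by rw [phaseCS]; positivity
  have hY0 : 0 ≤ phaseCS c⁻¹ (c * h) t s := by rw [phaseCS]; positivity
  have q1 := xSym_pos hlam hh hs hs0
  have q2 := xSym_pos hl2 hh ht ht0
  have hz2 := xMix_sq_le (ρ := ρ) (lam := lam) hc hh s t
  have hz1 := xMix_le (ρ := ρ) hc hlam hh s t
  have hb₁ := zSym_im_sq_le hlam hh a₁ s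
  have hb₂ := zSym_im_sq_le hl2 hh (c * a₂) t
  -- the Euler factors are at most one, and the real quantities on which `R` depends are generalized
  have hamp : ‖mainSym ρ a₁ a₂ c lam θ h N₀ N s t‖ ≤ ‖ampl ρ a₁ a₂ c lam θ h s t‖ ^ (N - N₀) := by
    rw [mainSym, norm_mul, norm_pow, norm_pow]
    refine mul_le_of_le_one_left (by positivity) (pow_le_one₀ (norm_nonneg _) ?_)
    rw [norm_div, norm_one]
    exact (div_le_one (by linarith [one_le_norm_eulerDenom (a₁ := a₁) (a₂ := a₂) hρ hc hlam hh s t])).2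
      (one_le_norm_eulerDenom hρ hc hlam hh s t)
  have hc2 : lam / c ^ 2 * (c * a₂) ^ 2 * h * xSym (lam / c ^ 2) h t =
      lam * a₂ ^ 2 * h * xSym (lam / c ^ 2) h t := by field_simp
  rw [hc2] at hb₂
  refine hamp.trans ?_
  rw [ampl, zSym, zSym]
  generalize xSym lam h s = x₁ at *
  generalize xSym (lam / c ^ 2) h t = x₂ at *
  generalize xMix ρ c lam h s t = z₀ at *
  generalize lam * a₁ * Real.sin s = b₁ at *
  generalize lam / c ^ 2 * (c * a₂) * Real.sin t = b₂ at *
  have hb₁' : b₁ ^ 2 ≤ β * h * x₁ := hb₁.trans (by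
    gcongr; rw [hβ]; nlinarith [mul_nonneg hlam.le (sq_nonneg a₂)])
  have hb₂' : b₂ ^ 2 ≤ β * h * x₂ := hb₂.trans (by
    gcongr; rw [hβ]; nlinarith [mul_nonneg hlam.le (sq_nonneg a₁)])
  obtain ⟨⟨u1, u2⟩, u3, u4, u5, u6⟩ := convection_bounds hθ0 hε0 hβ0 hk hh q1 q2 hb₁' hb₂'
    (by linarith) (by linarith)
  rw [← hB] at u4 u5 u6
  have hz1' : |z₀| ≤ x₁ + x₂ := hz1.trans (mul_le_of_le_one_left (by positivity) hρ.le)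
  obtain ⟨r1, r2, r3⟩ := hreal z₀ x₁ x₂ q1.le q2.le hz2 hz1
  obtain ⟨v1, v2⟩ := u4 _ (big _ hL0 hL) pL
  have e1 := hpm z₀ x₁ x₂ b₁ b₂ ε q1.le q2.le hz1' hε1 u1 u2 v1 v2
  have hsplit : ∀ Rc : ℂ, ∀ Rr : ℝ, ‖Rc‖ ≤ |Rr| + ‖Rc - Rr‖ := by
    intro Rc Rr
    have : Rc = Rr + (Rc - Rr) := by ring
    calc ‖Rc‖ = ‖(Rr : ℂ) + (Rc - Rr)‖ := by rw [← this]
      _ ≤ _ := (norm_add_le _ _).trans (by rw [Complex.norm_real, Real.norm_eq_abs])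
  have hYh : ∀ Y, Y = 1 / h → 0 ≤ Y ∧ b ≤ Y ^ 4 * h := by
    rintro Y rfl
    refine ⟨by positivity, hb1.trans ?_⟩
    have : (1 / h) ^ 4 * h = 1 / h ^ 3 := by field_simp
    rw [this]
    exact one_le_one_div (by positivity) (pow_le_one₀ hh.le s1)
  -- the case in which `1 - R` controls the decay
  have case_m : |realFactor θ z₀ x₁ x₂| ≤ 1 - δ * ((x₁ + x₂) / ((1 + θ * x₁) * (1 + θ * x₂))) →
      ‖mcsFactor θ z₀ (-(x₁ : ℂ) + b₁ * Complex.I) (-(x₂ : ℂ) + b₂ * Complex.I)‖ ^ (N - N₀) ≤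
        (Km + Kq) * h ^ w := by
    intro hR
    obtain ⟨Y, hY, hrY⟩ := hratem h x₁ x₂ _ _ hh q1 q2 pL pH
    obtain ⟨hYn, hYb⟩ : 0 ≤ Y ∧ b ≤ Y ^ 4 * h := by
      rcases hY with h' | h' | h'
      · exact hYh Y h'
      · rw [h']; exact ⟨hL0, by linarith⟩
      · rw [h']; exact ⟨hH0, by linarith⟩
    refine (hpm' Y _ hN0 hNN hYn hYb (norm_nonneg _) ((hsplit _ _).trans
      ((add_le_add hR e1).trans ?_))).trans (by gcongr; linarith)
    have h1 := mul_le_mul_of_nonneg_right hεm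
      (show 0 ≤ (x₁ + x₂) / ((1 + θ * x₁) * (1 + θ * x₂)) by positivity)
    have h2 := mul_le_mul_of_nonneg_left hrY (half_pos hδ).le
    linarith
  -- for `θ = 1/2` the factor `1 + R` is controlled by `q / p` only, and it matters where `R < 0`
  by_cases hhalf : θ = 1 / 2
  · rcases le_or_gt 0 (realFactor θ z₀ x₁ x₂) with h' | h'
    · exact case_m (by rw [abs_of_nonneg h']; linarith)
    obtain ⟨hX1, hX2⟩ := hX hhalf
    have hR := r3 hhalf
    have u5' := u5 _ (big _ hX0 hX1) pX
    have u6' := u6 _ (big' _ hY0 hX2) pY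
    subst hhalf
    have hz4 : z₀ ^ 2 ≤ 4 * (x₁ * x₂) := by
      have h2 : ρ ^ 2 ≤ 1 := by rw [← sq_abs]; exact pow_le_one₀ (abs_nonneg ρ) hρ.le
      have := mul_le_mul_of_nonneg_right h2 (mul_pos q1 q2).le
      linarith
    have e2 := hpq z₀ x₁ x₂ b₁ b₂ ε q1.le q2.le hz1' hz4 hε1 u1 u2 u5' u6' u3
    obtain ⟨Y, hY, hrY⟩ := hrateq h x₁ x₂ _ _ hh q1 q2 pX pY
    obtain ⟨hYn, hYb⟩ : 0 ≤ Y ∧ b ≤ Y ^ 4 * h := by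
      rcases hY with h' | h' | h'
      · exact hYh Y h'
      · rw [h']; exact ⟨hX0, by linarith⟩
      · rw [h']
        refine ⟨hY0, hb2.trans ?_⟩
        rw [div_le_iff₀ hc]
        linarith
    refine (hpq' Y _ hN0 hNN hYn hYb (norm_nonneg _) ((hsplit _ _).trans
      ((add_le_add (le_of_eq (abs_of_neg h')) e2).trans ?_))).trans (by gcongr; linarith)
    have h1 := mul_le_mul_of_nonneg_right hεq
      (show 0 ≤ (1 + (1 / 2) ^ 2 * (x₁ * x₂)) / ((1 + 1 / 2 * x₁) * (1 + 1 / 2 * x₂)) by positivity)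
    have h2 := mul_le_mul_of_nonneg_left hrY (half_pos hδ).le
    linarith
  · exact case_m (abs_le.2 ⟨by linarith [r2 hhalf], by linarith⟩)

end decay

/-! ### Periodization -/

/-- The fundamental box. -/
def box : Set (ℝ × ℝ) := Set.Ioc (-Real.pi) Real.pi ×ˢ Set.Ioc (-Real.pi) Real.pi

theorem measurableSet_box : MeasurableSet box := measurableSet_Ioc.prod measurableSet_Ioc

theorem boxMeasure_eq : boxMeasure = volume.restrict box := by
  rw [boxMeasure, Measure.prod_restrict]; rfl

/-- The lattice of periods. -/
def period (n : ℤ × ℤ) : ℝ × ℝ := (2 * Real.pi * n.1, 2 * Real.pi * n.2)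

/-- The translates of the fundamental box by the periods form a partition of the plane. -/
theorem integral_eq_tsum_box {g : ℝ × ℝ → ℂ} (hg : Integrable g) :
    HasSum (fun n : ℤ × ℤ => ∫ p, g (p + period n) ∂boxMeasure) (∫ p, g p) := by
  have h2 : 0 < 2 * Real.pi := by linarith [Real.pi_pos]
  have hI : ∀ n : ℤ, Set.Ioc (-Real.pi + n • (2 * Real.pi)) (-Real.pi + (n + 1) • (2 * Real.pi)) =
      Set.Ioc (-Real.pi + 2 * Real.pi * n) (Real.pi + 2 * Real.pi * n) := fun n => by
    congr 1 <;> simp only [zsmul_eq_mul] <;> push_cast <;> ring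
  have hU := iUnion_Ioc_add_zsmul h2 (-Real.pi)
  have hD := Set.pairwise_disjoint_Ioc_add_zsmul (-Real.pi) (2 * Real.pi)
  simp only [hI] at hU hD
  let S : ℤ × ℤ → Set (ℝ × ℝ) := fun n =>
    Set.Ioc (-Real.pi + 2 * Real.pi * n.1) (Real.pi + 2 * Real.pi * n.1) ×ˢ
      Set.Ioc (-Real.pi + 2 * Real.pi * n.2) (Real.pi + 2 * Real.pi * n.2)
  have hSU : ⋃ n, S n = Set.univ := by
    refine Set.eq_univ_of_forall fun p => ?_
    obtain ⟨m, hm⟩ := Set.mem_iUnion.1 (hU ▸ Set.mem_univ p.1)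
    obtain ⟨n, hn⟩ := Set.mem_iUnion.1 (hU ▸ Set.mem_univ p.2)
    exact Set.mem_iUnion.2 ⟨(m, n), hm, hn⟩
  have hSD : Pairwise (Function.onFun Disjoint S) := by
    intro m n hmn
    rw [Function.onFun, Set.disjoint_prod]
    by_cases h1 : m.1 = n.1
    · exact .inr (hD fun h2 => hmn (Prod.ext h1 h2))
    · exact .inl (hD h1)
  have key := hasSum_integral_iUnion (μ := (volume : Measure (ℝ × ℝ))) (f := g)
    (fun n => (measurableSet_Ioc.prod measurableSet_Ioc : MeasurableSet (S n))) hSD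
    hg.integrableOn
  rw [hSU, setIntegral_univ] at key
  have e : (fun n : ℤ × ℤ => ∫ p, g (p + period n) ∂boxMeasure) = fun n => ∫ p in S n, g p := by
    ext n
    have h3 := (measurePreserving_add_right (volume : Measure (ℝ × ℝ))
      (period n)).setIntegral_preimage_emb (measurableEmbedding_addRight (period n)) g (S n)
    have h4 : (fun p => p + period n) ⁻¹' S n = box := by
      ext p
      simp only [S, box, period, Set.mem_preimage, Set.mem_prod, Set.mem_Ioc, Prod.fst_add,
        Prod.snd_add, add_lt_add_iff_right, add_le_add_iff_right]
    rw [boxMeasure_eq, ← h4]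
    exact h3
  rw [e]
  exact key

/-- Periodization of a symbol on the plane: its Fourier integral at lattice points is an integral
over the fundamental box. The terms other than the central one are dominated by `b`. -/
theorem exists_periodization {F : ℝ → ℝ → ℂ} (hF : Measurable (Function.uncurry F))
    (hFi : Integrable (Function.uncurry F)) (hFb : ∃ C, ∀ s t, ‖F s t‖ ≤ C)
    {b : ℤ × ℤ → ℝ} (hb : Summable b) (hFb' : ∀ n ≠ 0, ∀ p ∈ box,
      ‖Function.uncurry F (p + period n)‖ ≤ b n) (hb0 : b 0 = 0) :
    ∃ E : ℝ → ℝ → ℂ, IsSymbol E ∧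
      (∀ p ∈ box, ‖E p.1 p.2 - F p.1 p.2‖ ≤ ∑' n, b n) ∧
      ∀ (h₁ h₂ : ℝ) (j k : ℤ), invMixedFourier h₁ h₂ E j k =
        1 / (4 * (Real.pi : ℂ) ^ 2 * h₁ * h₂) *
          ∫ p : ℝ × ℝ, F p.1 p.2 * Complex.exp (Complex.I * j * p.1) *
            Complex.exp (Complex.I * k * p.2) := by
  classical
  obtain ⟨C, hC⟩ := hFb
  let G : ℤ × ℤ → ℝ × ℝ → ℂ := fun n => box.indicator fun p => Function.uncurry F (p + period n)
  have hGm : ∀ n, Measurable (G n) := fun n =>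
    (hF.comp (measurable_id.add_const _)).indicator measurableSet_box
  have hp0 : ∀ p : ℝ × ℝ, p + period 0 = p := fun p => by ext <;> simp [period]
  have hb' : ∀ n, n ≠ 0 → ∀ p, ‖G n p‖ ≤ b n := by
    intro n hn p
    by_cases hp : p ∈ box
    · simp only [G, Set.indicator_of_mem hp]; exact hFb' n hn p hp
    · simp only [G, Set.indicator_of_notMem hp, norm_zero]
      exact (norm_nonneg _).trans (hFb' n hn (0, 0) (by
        simp only [box, Set.mem_prod, Set.mem_Ioc]
        constructor <;> constructor <;> linarith [Real.pi_pos]))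
  have hG0 : ∀ p, ‖G 0 p‖ ≤ C := by
    intro p
    by_cases hp : p ∈ box
    · simp only [G, Set.indicator_of_mem hp]; exact hC _ _
    · simp only [G, Set.indicator_of_notMem hp, norm_zero]; exact (norm_nonneg _).trans (hC 0 0)
  let B : ℤ × ℤ → ℝ := fun n => b n + if n = 0 then C else 0
  have hBs : Summable B := hb.add (summable_of_ne_finset_zero (s := {0}) fun n hn => by
    rw [if_neg (by simpa using hn)])
  have hGB : ∀ n p, ‖G n p‖ ≤ B n := by
    intro n p
    by_cases hn : n = 0
    · subst hn; simp only [B, if_pos, hb0, zero_add]; exact hG0 p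
    · simp only [B, if_neg hn, add_zero]; exact hb' n hn p
  have hGs : ∀ p, Summable fun n => G n p := fun p => .of_norm_bounded hBs fun n => hGB n p
  have hEm : Measurable fun p => ∑' n, G n p :=
    measurable_of_tendsto_metrizable' atTop
      (f := fun (A : Finset (ℤ × ℤ)) p => ∑ n ∈ A, G n p)
      (fun A => Finset.measurable_sum _ fun n _ => hGm n)
      (tendsto_pi_nhds.2 fun p => (hGs p).hasSum)
  let E : ℝ → ℝ → ℂ := fun s t => ∑' n, G n (s, t)
  have hE : IsSymbol E := ⟨hEm, ∑' n, B n, fun s t _ _ _ _ =>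
    tsum_of_norm_bounded hBs.hasSum fun n => hGB n _⟩
  refine ⟨E, hE, fun p hp => ?_, fun h₁ h₂ j k => ?_⟩
  · have e : E p.1 p.2 - F p.1 p.2 = ∑' n, if n = 0 then 0 else G n p := by
      have h1 := (hGs p).tsum_eq_add_tsum_ite 0
      have h2 : G 0 p = F p.1 p.2 := by
        simp only [G, Set.indicator_of_mem hp, hp0]; rfl
      simp only [E, Prod.mk.eta]
      rw [h1, h2]
      ring
    rw [e]
    refine tsum_of_norm_bounded hb.hasSum fun n => ?_
    split_ifs with hn
    · rw [hn, hb0, norm_zero]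
    · exact hb' n hn p
  · rw [invMixedFourier_eq hE]
    congr 1
    let e : ℝ × ℝ → ℂ := fun p => Complex.exp (Complex.I * j * p.1) * Complex.exp (Complex.I * k * p.2)
    have hen : ∀ p, ‖e p‖ = 1 := fun p => by
      simp only [e, norm_mul, norm_exp_I_int, one_mul]
    have hec : Continuous e := by fun_prop
    have hep : ∀ p n, e (p + period n) = e p := by
      intro p n
      have aux : ∀ (j m : ℤ) (s : ℝ), Complex.exp (Complex.I * j * ((s + 2 * Real.pi * m : ℝ) : ℂ)) =
          Complex.exp (Complex.I * j * s) := by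
        intro j m s
        have : Complex.I * j * ((s + 2 * Real.pi * m : ℝ) : ℂ) =
            Complex.I * j * s + ((j * m : ℤ) : ℂ) * (2 * Real.pi * Complex.I) := by push_cast; ring
        rw [this, Complex.exp_add, Complex.exp_int_mul_two_pi_mul_I, mul_one]
      simp only [e, period, Prod.fst_add, Prod.snd_add]
      rw [aux, aux]
    have hg : Integrable fun p : ℝ × ℝ => Function.uncurry F p * e p :=
      hFi.mul_bdd (c := 1) hec.aestronglyMeasurable (Eventually.of_forall fun p => (hen p).le)
    have h1 := integral_eq_tsum_box hg
    have h2 : HasSum (fun n => ∫ p, G n p * e p ∂boxMeasure)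
        (∫ p, ∑' n, G n p * e p ∂boxMeasure) := by
      apply hasSum_integral_of_summable_integral_norm
      · intro n
        exact (memLp_one_iff_integrable.1 (MemLp.of_bound (C := B n)
          ((hGm n).mul hec.measurable).aestronglyMeasurable (Eventually.of_forall fun p => by
            rw [norm_mul, hen, mul_one]; exact hGB n p)))
      · refine Summable.of_nonneg_of_le (fun n => integral_nonneg fun p => norm_nonneg _)
          (fun n => ?_) (hBs.mul_right (boxMeasure.real Set.univ))
        refine (integral_mono_of_nonneg (Eventually.of_forall fun p => norm_nonneg _)
          (integrable_const (B n)) (Eventually.of_forall fun p => ?_)).trans ?_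
        · simp only [norm_mul, hen, mul_one]; exact hGB n p
        · rw [integral_const, smul_eq_mul, mul_comm]
    have h3 : (fun n => ∫ p, G n p * e p ∂boxMeasure) =
        fun n => ∫ p, Function.uncurry F (p + period n) * e (p + period n) ∂boxMeasure := by
      ext n
      rw [boxMeasure_eq]
      refine setIntegral_congr_fun measurableSet_box fun p hp => ?_
      simp only [G, Set.indicator_of_mem hp, hep]
    rw [h3] at h2
    have h4 := h2.unique h1
    calc _ = ∫ p, ∑' n, G n p * e p ∂boxMeasure := by
          congr 1; ext p
          rw [tsum_mul_right]; simp only [E, e, Prod.mk.eta, mul_assoc]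
      _ = _ := h4
      _ = _ := by congr 1; ext p; simp only [e, Function.uncurry, mul_assoc]

/-! ### Fourier representation of the Gaussian and its derivatives -/

section gauss

variable {ρ : ℝ}

/-- Continuous functions of at most polynomial growth on the plane. -/
structure PolyGrowth (P : ℝ → ℝ → ℂ) : Prop where
  cont : Continuous (Function.uncurry P)
  growth : ∃ (C : ℝ) (n : ℕ), 0 ≤ C ∧ ∀ κ η, ‖P κ η‖ ≤ C * (1 + |κ| + |η|) ^ n

namespace PolyGrowth

variable {P Q : ℝ → ℝ → ℂ}

theorem const (a : ℂ) : PolyGrowth fun _ _ => a :=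
  ⟨continuous_const, ‖a‖, 0, norm_nonneg _, fun _ _ => by simp⟩

theorem mul (hP : PolyGrowth P) (hQ : PolyGrowth Q) : PolyGrowth fun κ η => P κ η * Q κ η := by
  obtain ⟨C, n, hC, h⟩ := hP.growth
  obtain ⟨D, m, hD, h'⟩ := hQ.growth
  refine ⟨hP.cont.mul hQ.cont, C * D, n + m, mul_nonneg hC hD, fun κ η => ?_⟩
  rw [norm_mul, pow_add]
  calc _ ≤ (C * (1 + |κ| + |η|) ^ n) * (D * (1 + |κ| + |η|) ^ m) :=
        mul_le_mul (h κ η) (h' κ η) (norm_nonneg _) (by positivity)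
    _ = _ := by ring

theorem add (hP : PolyGrowth P) (hQ : PolyGrowth Q) : PolyGrowth fun κ η => P κ η + Q κ η := by
  obtain ⟨C, n, hC, h⟩ := hP.growth
  obtain ⟨D, m, hD, h'⟩ := hQ.growth
  refine ⟨hP.cont.add hQ.cont, C + D, n + m, add_nonneg hC hD, fun κ η => ?_⟩
  have h1 : 1 ≤ 1 + |κ| + |η| := by linarith [abs_nonneg κ, abs_nonneg η]
  refine (norm_add_le _ _).trans ((add_le_add (h κ η) (h' κ η)).trans ?_)
  rw [add_mul]
  gcongr <;> first | exact h1 | omega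

theorem fst : PolyGrowth fun κ _ => (κ : ℂ) :=
  ⟨by simp only [Function.uncurry_def]; fun_prop, 1, 1, zero_le_one, fun κ η => by
    rw [Complex.norm_real, Real.norm_eq_abs]; linarith [abs_nonneg η]⟩

theorem snd : PolyGrowth fun _ η => (η : ℂ) :=
  ⟨by simp only [Function.uncurry_def]; fun_prop, 1, 1, zero_le_one, fun κ η => by
    rw [Complex.norm_real, Real.norm_eq_abs]; linarith [abs_nonneg κ]⟩

theorem const_mul (a : ℂ) (hP : PolyGrowth P) : PolyGrowth fun κ η => a * P κ η := (const a).mul hP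

end PolyGrowth

/-- Integrability of a product Gaussian. -/
theorem integrable_gauss_prod {δ : ℝ} (hδ : 0 < δ) :
    Integrable fun p : ℝ × ℝ => Real.exp (-(δ * (p.1 ^ 2 + p.2 ^ 2))) := by
  have h := (integrable_exp_neg_mul_sq hδ).mul_prod (integrable_exp_neg_mul_sq hδ)
  refine h.congr (Eventually.of_forall fun p => ?_)
  simp only
  rw [← Real.exp_add]
  congr 1
  ring

theorem continuous_psiL (ρ a₁ a₂ : ℝ) : Continuous (Function.uncurry (psiL ρ a₁ a₂)) := by
  simp only [Function.uncurry_def, psiL, psi]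
  fun_prop

/-- Polynomial factors cost half of the Gaussian decay. -/
theorem PolyGrowth.exists_gauss_le {P : ℝ → ℝ → ℂ} (hρ : |ρ| < 1) (hP : PolyGrowth P)
    (a₁ a₂ : ℝ) : ∃ C : ℝ, 0 ≤ C ∧ ∀ κ η, ‖P κ η * Complex.exp (psiL ρ a₁ a₂ κ η)‖ ≤
      C * Real.exp (-((1 - |ρ|) / 2 * (κ ^ 2 + η ^ 2))) := by
  obtain ⟨C, n, hC, h⟩ := hP.growth
  have hδ : 0 < (1 - |ρ|) / 2 := by linarith
  obtain ⟨D, hD, h'⟩ := exists_scale_pow_mul_exp_le hδ n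
  refine ⟨C * D, by positivity, fun κ η => ?_⟩
  rw [norm_mul, Complex.norm_exp]
  calc _ ≤ C * (1 + |κ| + |η|) ^ n * Real.exp (-(2 * ((1 - |ρ|) / 2) * (κ ^ 2 + η ^ 2))) := by
        refine mul_le_mul (h κ η) (Real.exp_le_exp.2 ?_) (Real.exp_pos _).le (by positivity)
        have := psiL_re_le (ρ := ρ) a₁ a₂ κ η
        linarith
    _ ≤ C * (D * Real.exp (-((1 - |ρ|) / 2 * (κ ^ 2 + η ^ 2)))) := by
        rw [mul_assoc]; exact mul_le_mul_of_nonneg_left (h' κ η) hC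
    _ = _ := by ring

theorem PolyGrowth.integrable {P : ℝ → ℝ → ℂ} (hρ : |ρ| < 1) (hP : PolyGrowth P) (a₁ a₂ : ℝ) :
    Integrable fun p : ℝ × ℝ => P p.1 p.2 * Complex.exp (psiL ρ a₁ a₂ p.1 p.2) := by
  obtain ⟨C, hC, h⟩ := hP.exists_gauss_le hρ a₁ a₂
  refine ((integrable_gauss_prod (show 0 < (1 - |ρ|) / 2 by linarith)).const_mul C).mono'
    ?_ (Eventually.of_forall fun p => h p.1 p.2)
  exact (hP.cont.mul (Complex.continuous_exp.comp (continuous_psiL ρ a₁ a₂))).aestronglyMeasurable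

/-- The plane wave with wavenumbers scaled by `√2`. -/
def planeWave (x y : ℝ) (p : ℝ × ℝ) : ℂ := Complex.exp (Complex.I * (√2 * (p.1 * x + p.2 * y) : ℝ))

theorem norm_planeWave (x y : ℝ) (p : ℝ × ℝ) : ‖planeWave x y p‖ = 1 := by
  rw [planeWave, mul_comm, Complex.norm_exp_ofReal_mul_I]

theorem continuous_planeWave (x y : ℝ) : Continuous (planeWave x y) := by
  unfold planeWave; fun_prop

/-- `f` is the real part of the Fourier integral of `P` times the Gaussian whose transform is
`phiRho ρ`. The wavenumbers are scaled by `√2`, so that `½ ∂ₓ² + (a₁/√2) ∂ₓ` acts as `psi a₁`. -/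
structure HasGaussSymbol (ρ : ℝ) (f : ℝ → ℝ → ℝ) (P : ℝ → ℝ → ℂ) : Prop where
  poly : PolyGrowth P
  eq : ∀ x y, f x y = (1 / (2 * (Real.pi : ℂ) ^ 2) * ∫ p : ℝ × ℝ,
    P p.1 p.2 * Complex.exp (psiL ρ 0 0 p.1 p.2) * planeWave x y p).re

namespace HasGaussSymbol

variable {f g : ℝ → ℝ → ℝ} {P Q : ℝ → ℝ → ℂ}

theorem integrable_wave (hρ : |ρ| < 1) (hP : PolyGrowth P) (x y : ℝ) : Integrable fun p : ℝ × ℝ =>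
    P p.1 p.2 * Complex.exp (psiL ρ 0 0 p.1 p.2) * planeWave x y p :=
  (hP.integrable hρ 0 0).mul_bdd (c := 1) (continuous_planeWave x y).aestronglyMeasurable
    (Eventually.of_forall fun p => (norm_planeWave x y p).le)

theorem congr (hf : HasGaussSymbol ρ f P) (h : ∀ κ η, Q κ η = P κ η) : HasGaussSymbol ρ f Q := by
  have : Q = P := by ext κ η; exact h κ η
  rwa [this]

theorem add (hρ : |ρ| < 1) (hf : HasGaussSymbol ρ f P) (hg : HasGaussSymbol ρ g Q) :
    HasGaussSymbol ρ (f + g) (fun κ η => P κ η + Q κ η) where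
  poly := hf.poly.add hg.poly
  eq x y := by
    simp only [Pi.add_apply, add_mul]
    rw [integral_add (integrable_wave hρ hf.poly x y) (integrable_wave hρ hg.poly x y), mul_add,
      Complex.add_re, ← hf.eq, ← hg.eq]

theorem smul (c : ℝ) (hf : HasGaussSymbol ρ f P) :
    HasGaussSymbol ρ (c • f) (fun κ η => c * P κ η) where
  poly := hf.poly.const_mul c
  eq x y := by
    simp only [Pi.smul_apply, smul_eq_mul, mul_assoc (c : ℂ)]
    rw [integral_const_mul, mul_left_comm, Complex.re_ofReal_mul, ← hf.eq]

theorem sub (hρ : |ρ| < 1) (hf : HasGaussSymbol ρ f P) (hg : HasGaussSymbol ρ g Q) :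
    HasGaussSymbol ρ (f - g) (fun κ η => P κ η - Q κ η) := by
  have h := hf.add hρ (hg.smul (-1))
  have e : f + (-1 : ℝ) • g = f - g := by ext; simp [sub_eq_add_neg]
  rw [e] at h
  exact h.congr fun κ η => by push_cast; ring

/-- Differentiation under the Fourier integral, along either coordinate direction. -/
theorem hasDerivAt_aux (hρ : |ρ| < 1) (hP : PolyGrowth P) (r : ℝ × ℝ → ℝ) {A : ℝ → ℝ → ℂ}
    (hA : PolyGrowth A) (hAr : ∀ p : ℝ × ℝ, A p.1 p.2 = Complex.I * √2 * r p) (w : ℝ → ℝ × ℝ)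
    (hw : ∀ p s, HasDerivAt (fun s => √2 * (p.1 * (w s).1 + p.2 * (w s).2)) (√2 * r p) s) (x : ℝ) :
    HasDerivAt (fun s => (1 / (2 * (Real.pi : ℂ) ^ 2) * ∫ p : ℝ × ℝ,
      P p.1 p.2 * Complex.exp (psiL ρ 0 0 p.1 p.2) * planeWave (w s).1 (w s).2 p).re)
      (1 / (2 * (Real.pi : ℂ) ^ 2) * ∫ p : ℝ × ℝ, (A p.1 p.2 * P p.1 p.2) *
        Complex.exp (psiL ρ 0 0 p.1 p.2) * planeWave (w x).1 (w x).2 p).re x := by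
  have hAP := hA.mul hP
  have key := (hasDerivAt_integral_of_dominated_loc_of_deriv_le (μ := (volume : Measure (ℝ × ℝ)))
    (x₀ := x) (s := Set.univ) (F := fun s p => P p.1 p.2 * Complex.exp (psiL ρ 0 0 p.1 p.2) *
      planeWave (w s).1 (w s).2 p)
    (F' := fun s p => (A p.1 p.2 * P p.1 p.2) *
        Complex.exp (psiL ρ 0 0 p.1 p.2) * planeWave (w s).1 (w s).2 p)
    (bound := fun p => ‖(A p.1 p.2 * P p.1 p.2) * Complex.exp (psiL ρ 0 0 p.1 p.2)‖)
    Filter.univ_mem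
    (Eventually.of_forall fun s => (integrable_wave hρ hP _ _).aestronglyMeasurable)
    (integrable_wave hρ hP _ _) (integrable_wave hρ hAP _ _).aestronglyMeasurable
    (Eventually.of_forall fun p s _ => by rw [norm_mul, norm_planeWave, mul_one])
    (hAP.integrable hρ 0 0).norm
    (Eventually.of_forall fun p s _ => by
      have h1 := ((hw p s).ofReal_comp.const_mul Complex.I).cexp
      have h2 := h1.const_mul (P p.1 p.2 * Complex.exp (psiL ρ 0 0 p.1 p.2))
      refine h2.congr_deriv ?_
      rw [hAr, planeWave]
      push_cast
      ring)).2
  exact Complex.reCLM.hasFDerivAt.comp_hasDerivAt x (key.const_mul (1 / (2 * (Real.pi : ℂ) ^ 2)))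

theorem dx (hρ : |ρ| < 1) (hf : HasGaussSymbol ρ f P) :
    HasGaussSymbol ρ (Dx f) (fun κ η => Complex.I * √2 * κ * P κ η) where
  poly := (PolyGrowth.fst.const_mul (Complex.I * √2)).mul hf.poly
  eq x y := by
    have h := hasDerivAt_aux hρ hf.poly Prod.fst (PolyGrowth.fst.const_mul (Complex.I * √2))
      (fun p => rfl) (fun s => (s, y)) (fun p s => by
        have := (((hasDerivAt_id s).const_mul p.1).add_const (p.2 * y)).const_mul √2
        simpa using this) x
    have e : (fun s => f s y) = _ := funext fun s => hf.eq s y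
    rw [Dx, e]
    exact h.deriv

theorem dy (hρ : |ρ| < 1) (hf : HasGaussSymbol ρ f P) :
    HasGaussSymbol ρ (Dy f) (fun κ η => Complex.I * √2 * η * P κ η) where
  poly := (PolyGrowth.snd.const_mul (Complex.I * √2)).mul hf.poly
  eq x y := by
    have h := hasDerivAt_aux hρ hf.poly Prod.snd (PolyGrowth.snd.const_mul (Complex.I * √2))
      (fun p => rfl) (fun s => (x, s)) (fun p s => by
        have := (((hasDerivAt_id s).const_mul p.2).const_add (p.1 * x)).const_mul √2
        simpa using this) y
    have e : (fun s => f x s) = _ := funext fun s => hf.eq x s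
    rw [Dy, e]
    exact h.deriv

theorem sqrt_two_sq : ((√2 : ℝ) : ℂ) ^ 2 = 2 := by
  rw [← Complex.ofReal_pow, Real.sq_sqrt (by norm_num)]; norm_num

theorem div_sqrt_two (a : ℝ) : ((a / √2 : ℝ) : ℂ) * √2 = a := by
  rw [← Complex.ofReal_mul, div_mul_cancel₀ _ (by positivity)]

/-- The factor `√2` in the wavenumbers turns `½ ∂ₓ² + (a₁/√2) ∂ₓ` into multiplication by `psi a₁`. -/
theorem opX (hρ : |ρ| < 1) (a₁ : ℝ) (hf : HasGaussSymbol ρ f P) :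
    HasGaussSymbol ρ (opX a₁ f) (fun κ η => psi a₁ κ * P κ η) := by
  refine ((((hf.dx hρ).dx hρ).smul (1 / 2)).add hρ ((hf.dx hρ).smul (a₁ / √2))).congr fun κ η => ?_
  have h1 := sqrt_two_sq
  have h2 := div_sqrt_two a₁
  rw [psi]
  generalize ((a₁ / √2 : ℝ) : ℂ) = u at h2 ⊢
  push_cast
  linear_combination (-(Complex.I * κ * P κ η)) * h2 - (1 / 2 * (κ : ℂ) ^ 2 * P κ η * Complex.I ^ 2) * h1 - (κ ^ 2 * P κ η) * Complex.I_sq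

theorem opY (hρ : |ρ| < 1) (a₂ : ℝ) (hf : HasGaussSymbol ρ f P) :
    HasGaussSymbol ρ (opY a₂ f) (fun κ η => psi a₂ η * P κ η) := by
  refine ((((hf.dy hρ).dy hρ).smul (1 / 2)).add hρ ((hf.dy hρ).smul (a₂ / √2))).congr fun κ η => ?_
  have h1 := sqrt_two_sq
  have h2 := div_sqrt_two a₂
  rw [psi]
  generalize ((a₂ / √2 : ℝ) : ℂ) = u at h2 ⊢
  push_cast
  linear_combination (-(Complex.I * η * P κ η)) * h2 - (1 / 2 * (η : ℂ) ^ 2 * P κ η * Complex.I ^ 2) * h1 - (η ^ 2 * P κ η) * Complex.I_sq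

theorem dxdy (hρ : |ρ| < 1) (hf : HasGaussSymbol ρ f P) :
    HasGaussSymbol ρ (Dx (Dy f)) (fun κ η => -(2 * κ * η) * P κ η) := by
  refine ((hf.dy hρ).dx hρ).congr fun κ η => ?_
  have h1 := sqrt_two_sq
  linear_combination (-(κ * η * P κ η) * Complex.I ^ 2) * h1 - (2 * κ * η * P κ η) * Complex.I_sq

theorem opL (hρ : |ρ| < 1) (a₁ a₂ : ℝ) (hf : HasGaussSymbol ρ f P) :
    HasGaussSymbol ρ (opL ρ a₁ a₂ f) (fun κ η => psiL ρ a₁ a₂ κ η * P κ η) :=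
  (((hf.opX hρ a₁).add hρ ((hf.dxdy hρ).smul ρ)).add hρ (hf.opY hρ a₂)).congr fun κ η => by
    rw [psiL]; ring

theorem opG (hρ : |ρ| < 1) (a₁ a₂ θ : ℝ) (hf : HasGaussSymbol ρ f P) :
    HasGaussSymbol ρ (opG ρ a₁ a₂ θ f)
      (fun κ η => (-(ρ * κ * η) + (1 / 2 - θ) * (psi a₁ κ + psi a₂ η)) * P κ η) :=
  (((hf.dxdy hρ).smul (ρ / 2)).add hρ (((hf.opX hρ a₁).add hρ (hf.opY hρ a₂)).smul
    (1 / 2 - θ))).congr fun κ η => by push_cast; ring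

/-- The operator `S` of the spatial error acts as the `h²`-coefficient of the symbol of `A`. -/
theorem opS (hρ : |ρ| < 1) (a₁ a₂ c : ℝ) (hf : HasGaussSymbol ρ f P) :
    HasGaussSymbol ρ (opS ρ a₁ a₂ c f) (fun κ η => psiS ρ a₁ a₂ c κ η * P κ η) := by
  have d1 := (((hf.dx hρ).dx hρ).dx hρ)
  have d2 := ((((hf.dy hρ).dx hρ).dx hρ).dx hρ).add hρ
    (((((hf.dy hρ).dy hρ).dy hρ).dx hρ).smul (c ^ 2))
  have d3 := (((hf.dy hρ).dy hρ).dy hρ)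
  have h := (((((d1.dx hρ).smul (1 / 48)).add hρ (d2.smul (ρ / 12))).add hρ
    ((d3.dy hρ).smul (c ^ 2 / 48))).add hρ (d1.smul (a₁ / (12 * √2)))).add hρ
      (d3.smul (a₂ * c ^ 2 / (12 * √2)))
  refine h.congr fun κ η => ?_
  have h1 := sqrt_two_sq
  have e1 : (a₁ / (12 * √2) : ℝ) = a₁ / √2 / 12 := by field_simp
  have e2 : (a₂ * c ^ 2 / (12 * √2) : ℝ) = a₂ / √2 * c ^ 2 / 12 := by field_simp
  have h2 := div_sqrt_two a₁
  have h3 := div_sqrt_two a₂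
  rw [psiS, e1, e2]
  push_cast at h2 h3 ⊢
  generalize ((a₁ : ℂ) / (√2 : ℝ)) = u at h2 ⊢
  generalize ((a₂ : ℂ) / (√2 : ℝ)) = v at h3 ⊢
  generalize ((√2 : ℝ) : ℂ) = r at *
  have hI3 : Complex.I ^ 3 = -Complex.I := Complex.I_pow_three
  have hI4 : Complex.I ^ 4 = 1 := Complex.I_pow_four
  have hr4 : r ^ 4 = 4 := by linear_combination (r ^ 2 + 2) * h1
  have hu : u * r ^ 3 = 2 * a₁ := by linear_combination (u * r) * h1 + 2 * h2
  have hv : v * r ^ 3 = 2 * a₂ := by linear_combination (v * r) * h1 + 2 * h3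
  have q1 : Complex.I ^ 4 * r ^ 4 = 4 := by rw [hI4, hr4, one_mul]
  have q2 : u * (Complex.I ^ 3 * r ^ 3) = -(2 * a₁ * Complex.I) := by
    rw [hI3]; linear_combination (-Complex.I) * hu
  have q3 : v * (Complex.I ^ 3 * r ^ 3) = -(2 * a₂ * Complex.I) := by
    rw [hI3]; linear_combination (-Complex.I) * hv
  linear_combination (-(1 / 48) * (κ : ℂ) ^ 4 * P κ η - ρ / 12 * (κ ^ 3 * η + c ^ 2 * κ * η ^ 3) * P κ η -
    c ^ 2 / 48 * η ^ 4 * P κ η) * q1 - (κ ^ 3 * P κ η / 12) * q2 - (c ^ 2 * η ^ 3 * P κ η / 12) * q3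

end HasGaussSymbol

end gauss

section low_fold

variable {ρ : ℝ}

theorem integral_cexp_neg_mul_sq_add {b : ℝ} (hb : 0 < b) (u v : ℂ) :
    ∫ x : ℝ, Complex.exp (-b * (x : ℂ) ^ 2 + u * x + v) =
      (√(Real.pi / b) : ℝ) * Complex.exp (v + u ^ 2 / (4 * b)) := by
  have h := integral_cexp_quadratic (b := (-b : ℂ)) (by simpa using hb) u v
  rw [h]
  congr 1
  · rw [neg_neg, Real.sqrt_eq_rpow, Complex.ofReal_cpow (by positivity)]
    push_cast
    rfl
  · congr 1
    have : (b : ℂ) ≠ 0 := by exact_mod_cast hb.ne'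
    field_simp
    ring

theorem one_sub_sq_pos (hρ : |ρ| < 1) : 0 < 1 - ρ ^ 2 := by
  have := (sq_lt_one_iff_abs_lt_one ρ).2 hρ
  linarith

/-- The Fourier representation of the bivariate normal density. -/
theorem hasGaussSymbol_phiRho (hρ : |ρ| < 1) : HasGaussSymbol ρ (phiRho ρ) (fun _ _ => 1) where
  poly := PolyGrowth.const 1
  eq x y := by
    have hD := one_sub_sq_pos hρ
    have hDc : (1 - (ρ : ℂ) ^ 2) ≠ 0 := by exact_mod_cast hD.ne'
    have hI := HasGaussSymbol.integrable_wave hρ (PolyGrowth.const 1) x y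
    have h2 := HasGaussSymbol.sqrt_two_sq
    have inner (κ : ℝ) : ∫ η : ℝ, (1 : ℂ) * Complex.exp (psiL ρ 0 0 κ η) * planeWave x y (κ, η) =
        (√Real.pi : ℝ) * Complex.exp (-((1 - ρ ^ 2 : ℝ) : ℂ) * (κ : ℂ) ^ 2 +
          (Complex.I * √2 * (x - ρ * y)) * κ + (-(y : ℂ) ^ 2 / 2)) := by
      have h := integral_cexp_neg_mul_sq_add one_pos
        (-2 * ρ * κ + Complex.I * √2 * y) (-(κ : ℂ) ^ 2 + Complex.I * √2 * x * κ)
      rw [div_one] at h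
      calc _ = ∫ η : ℝ, Complex.exp (-(1 : ℝ) * (η : ℂ) ^ 2 +
            (-2 * ρ * κ + Complex.I * √2 * y) * η + (-(κ : ℂ) ^ 2 + Complex.I * √2 * x * κ)) := by
            congr 1
            ext η
            rw [one_mul, planeWave, ← Complex.exp_add, psiL, psi, psi]
            congr 1
            push_cast
            ring
        _ = _ := by
            rw [h]
            congr 2
            push_cast
            linear_combination (Complex.I ^ 2 * y ^ 2 / 4) * h2 + (y ^ 2 / 2 : ℂ) * Complex.I_sq
    rw [Measure.volume_eq_prod, integral_prod _ hI]
    simp only [inner]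
    rw [integral_const_mul, integral_cexp_neg_mul_sq_add hD]
    have e : (-(y : ℂ) ^ 2 / 2 + (Complex.I * √2 * (x - ρ * y)) ^ 2 / (4 * ((1 - ρ ^ 2 : ℝ) : ℂ))) =
        ((-((x ^ 2 - 2 * ρ * x * y + y ^ 2) / (2 * (1 - ρ ^ 2))) : ℝ) : ℂ) := by
      push_cast
      field_simp
      linear_combination 2 * (x - ρ * y : ℂ) ^ 2 * Complex.I ^ 2 * h2 +
        4 * (x - ρ * y : ℂ) ^ 2 * Complex.I_sq
    rw [e, ← Complex.ofReal_exp]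
    have e2 : (1 / (2 * (Real.pi : ℂ) ^ 2)) = ((1 / (2 * Real.pi ^ 2) : ℝ) : ℂ) := by push_cast; rfl
    rw [e2, ← Complex.ofReal_mul, ← Complex.ofReal_mul, ← Complex.ofReal_mul, Complex.ofReal_re,
      phiRho, ← mul_assoc, ← mul_assoc]
    congr 1
    have hp := Real.pi_pos
    have e3 : √(4 * Real.pi ^ 2 * (1 - ρ ^ 2)) = 2 * Real.pi * √(1 - ρ ^ 2) := by
      rw [Real.sqrt_mul (by positivity), show 4 * Real.pi ^ 2 = (2 * Real.pi) ^ 2 by ring,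
        Real.sqrt_sq (by positivity)]
    rw [e3, Real.sqrt_div hp.le]
    have e4 : √Real.pi * √Real.pi = Real.pi := Real.mul_self_sqrt hp.le
    have e5 : 0 < √(1 - ρ ^ 2) := Real.sqrt_pos.2 hD
    field_simp
    linear_combination (-1) * e4

/-! ### The low-wavenumber part of the approximation -/

/-- The operator defining `Clow` has symbol `lowPoly`. -/
theorem hasGaussSymbol_lowPoly (hρ : |ρ| < 1) (a₁ a₂ c lam θ : ℝ) (N₀ : ℕ) :
    HasGaussSymbol ρ (opS ρ a₁ a₂ c (phiRho ρ)
      - (lam ^ 2 * θ ^ 2) • opX a₁ (opY a₂ (opL ρ a₁ a₂ (phiRho ρ)))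
      + (lam ^ 2 / 12) • opL ρ a₁ a₂ (opL ρ a₁ a₂ (opL ρ a₁ a₂ (phiRho ρ)))
      - (lam ^ 2) • opL ρ a₁ a₂ (opG ρ a₁ a₂ θ (opG ρ a₁ a₂ θ (phiRho ρ)))
      + ((N₀ : ℝ) * lam ^ 2 / 4) • opL ρ a₁ a₂ (opL ρ a₁ a₂ (phiRho ρ)))
      (lowPoly ρ a₁ a₂ c lam θ N₀) := by
  have h0 := hasGaussSymbol_phiRho hρ
  have hL := h0.opL hρ a₁ a₂
  have hLL := hL.opL hρ a₁ a₂
  refine (((((h0.opS hρ a₁ a₂ c).sub hρ (((hL.opY hρ a₂).opX hρ a₁).smul (lam ^ 2 * θ ^ 2))).add hρ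
    ((hLL.opL hρ a₁ a₂).smul (lam ^ 2 / 12))).sub hρ
    ((((h0.opG hρ a₁ a₂ θ).opG hρ a₁ a₂ θ).opL hρ a₁ a₂).smul (lam ^ 2))).add hρ
      (hLL.smul ((N₀ : ℝ) * lam ^ 2 / 4))).congr fun κ η => ?_
  rw [lowPoly]
  push_cast
  ring

theorem exactSolution_one_eq (a₁ a₂ x y : ℝ) (hρ : |ρ| < 1) : exactSolution ρ a₁ a₂ x y 1 =
    1 / 2 * phiRho ρ ((x + a₁) / √2) ((y + a₂) / √2) := by
  have hD := one_sub_sq_pos hρ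
  have hp := Real.pi_pos
  rw [exactSolution, phiRho, ← mul_assoc]
  have e3 : √(4 * Real.pi ^ 2 * (1 - ρ ^ 2)) = 2 * Real.pi * √(1 - ρ ^ 2) := by
    rw [Real.sqrt_mul (by positivity), show 4 * Real.pi ^ 2 = (2 * Real.pi) ^ 2 by ring,
      Real.sqrt_sq (by positivity)]
  have e5 : 0 < √(1 - ρ ^ 2) := Real.sqrt_pos.2 hD
  have h2 : √2 ^ 2 = 2 := Real.sq_sqrt (by norm_num)
  have h2' : 0 < √2 := by positivity
  congr 1
  · rw [e3]; field_simp; norm_num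
  · congr 1
    have e6 : ((x + a₁) / √2) ^ 2 = (x + a₁) ^ 2 / 2 := by rw [div_pow, h2]
    have e7 : ((y + a₂) / √2) ^ 2 = (y + a₂) ^ 2 / 2 := by rw [div_pow, h2]
    have e8 : 2 * ρ * ((x + a₁) / √2) * ((y + a₂) / √2) = 2 * ρ * (x + a₁) * (y + a₂) / 2 := by
      field_simp
      linear_combination (ρ * (x + a₁) * (y + a₂)) * h2.symm
    rw [e6, e7, e8]
    field_simp
    ring

/-- The drift is a translation of the Gaussian, that is a modulation of its transform. -/
theorem planeWave_shift (a₁ a₂ x y : ℝ) (p : ℝ × ℝ) :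
    Complex.exp (psiL ρ 0 0 p.1 p.2) * planeWave ((x + a₁) / √2) ((y + a₂) / √2) p =
      Complex.exp (psiL ρ a₁ a₂ p.1 p.2) * Complex.exp (Complex.I * (p.1 * x + p.2 * y)) := by
  rw [planeWave, ← Complex.exp_add, ← Complex.exp_add]
  have h2' : 0 < √2 := by positivity
  have : √2 * (p.1 * ((x + a₁) / √2) + p.2 * ((y + a₂) / √2)) =
    p.1 * (x + a₁) + p.2 * (y + a₂) := by field_simp
  rw [this, psiL, psiL, psi, psi, psi, psi]
  congr 1
  push_cast
  ring

theorem HasGaussSymbol.eq_shift {f : ℝ → ℝ → ℝ} {P : ℝ → ℝ → ℂ} (hf : HasGaussSymbol ρ f P)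
    (a₁ a₂ x y : ℝ) : f ((x + a₁) / √2) ((y + a₂) / √2) = (1 / (2 * (Real.pi : ℂ) ^ 2) *
      ∫ p : ℝ × ℝ, P p.1 p.2 * Complex.exp (psiL ρ a₁ a₂ p.1 p.2) *
        Complex.exp (Complex.I * (p.1 * x + p.2 * y))).re := by
  rw [hf.eq]
  simp only [mul_assoc, planeWave_shift]

theorem exists_abs_Clow_le (hρ : |ρ| < 1) (a₁ a₂ c lam θ : ℝ) (N₀ : ℕ) :
    ∃ C : ℝ, 0 < C ∧ ∀ x y, |Clow ρ a₁ a₂ c lam θ N₀ x y| ≤ C := by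
  have hP := hasGaussSymbol_lowPoly hρ a₁ a₂ c lam θ N₀
  refine ⟨‖(1 / (2 * (Real.pi : ℂ) ^ 2))‖ * (∫ p : ℝ × ℝ, ‖lowPoly ρ a₁ a₂ c lam θ N₀ p.1 p.2 *
    Complex.exp (psiL ρ 0 0 p.1 p.2)‖) + 1, by positivity, fun x y => ?_⟩
  rw [Clow, Pi.smul_apply, Pi.smul_apply, smul_eq_mul, abs_mul, hP.eq]
  have h1 := Complex.abs_re_le_norm (1 / (2 * (Real.pi : ℂ) ^ 2) * ∫ p : ℝ × ℝ,
    lowPoly ρ a₁ a₂ c lam θ N₀ p.1 p.2 * Complex.exp (psiL ρ 0 0 p.1 p.2) *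
      planeWave ((x + a₁) / √2) ((y + a₂) / √2) p)
  rw [norm_mul] at h1
  have h2 := norm_integral_le_integral_norm (μ := volume) (fun p : ℝ × ℝ =>
    lowPoly ρ a₁ a₂ c lam θ N₀ p.1 p.2 * Complex.exp (psiL ρ 0 0 p.1 p.2) *
      planeWave ((x + a₁) / √2) ((y + a₂) / √2) p)
  simp only [norm_mul _ (planeWave _ _ _), norm_planeWave, mul_one] at h2
  have h3 := h1.trans (mul_le_mul_of_nonneg_left h2 (norm_nonneg _))
  have h4 : |(1 / 2 : ℝ)| ≤ 1 := by norm_num [abs_of_pos]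
  calc _ ≤ 1 * _ := mul_le_mul h4 h3 (abs_nonneg _) zero_le_one
    _ ≤ _ := by rw [one_mul]; linarith

/-- The exact solution plus the low-wavenumber correction as one Fourier integral. -/
theorem exactSolution_add_Clow (hρ : |ρ| < 1) (a₁ a₂ c lam θ : ℝ) (N₀ : ℕ) (h x y : ℝ) :
    exactSolution ρ a₁ a₂ x y 1 + h ^ 2 * Clow ρ a₁ a₂ c lam θ N₀ x y =
      (1 / (4 * (Real.pi : ℂ) ^ 2) * ∫ p : ℝ × ℝ, Complex.exp (psiL ρ a₁ a₂ p.1 p.2) *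
        (1 + h ^ 2 * lowPoly ρ a₁ a₂ c lam θ N₀ p.1 p.2) *
          Complex.exp (Complex.I * (p.1 * x + p.2 * y))).re := by
  have h1 := ((hasGaussSymbol_phiRho hρ).add hρ
    ((hasGaussSymbol_lowPoly hρ a₁ a₂ c lam θ N₀).smul (h ^ 2))).eq_shift a₁ a₂ x y
  rw [exactSolution_one_eq a₁ a₂ x y hρ, Clow, Pi.smul_apply, Pi.smul_apply, smul_eq_mul,
    mul_left_comm, ← mul_add]
  rw [Pi.add_apply, Pi.add_apply, Pi.smul_apply, Pi.smul_apply, smul_eq_mul] at h1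
  rw [h1, ← Complex.re_ofReal_mul, ← mul_assoc]
  congr 2
  · push_cast; ring
  · congr 1
    ext p
    push_cast
    ring

theorem integral_prod_comp_div {G : ℝ → ℝ → ℂ} {a b : ℝ} (ha : 0 < a) (hb : 0 < b)
    (hG : Integrable (Function.uncurry G))
    (hG' : Integrable fun p : ℝ × ℝ => G (p.1 / a) (p.2 / b)) :
    ∫ p : ℝ × ℝ, G (p.1 / a) (p.2 / b) = a * b * ∫ p : ℝ × ℝ, G p.1 p.2 := by
  have h2 := integral_prod _ hG
  simp only [Function.uncurry] at h2
  rw [Measure.volume_eq_prod, integral_prod _ hG', h2]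
  have h1 (x : ℝ) : ∫ y, G (x / a) (y / b) = b * ∫ y, G (x / a) y := by
    have := Measure.integral_comp_div (G (x / a)) b
    rw [this, abs_of_pos hb, Complex.real_smul]
  simp only [h1]
  rw [integral_const_mul, Measure.integral_comp_div (fun x => ∫ y, G x y) a, abs_of_pos ha,
    Complex.real_smul]
  ring

/-- Global size of `lowSym`, also outside the fundamental box. -/
theorem exists_norm_lowSym_le (hρ : |ρ| < 1) (a₁ a₂ c lam θ : ℝ) (N₀ : ℕ) :
    ∃ C δ : ℝ, 0 < C ∧ 0 < δ ∧ ∀ h s t, 0 < h → h ≤ 1 →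
      ‖lowSym ρ a₁ a₂ c lam θ N₀ h s t‖ ≤ C * Real.exp (-(δ * phaseLow c h s t)) := by
  obtain ⟨C₁, hC₁, h1⟩ := (PolyGrowth.const 1).exists_gauss_le hρ a₁ a₂
  obtain ⟨C₂, hC₂, h2⟩ := (hasGaussSymbol_lowPoly hρ a₁ a₂ c lam θ N₀).poly.exists_gauss_le hρ a₁ a₂
  refine ⟨C₁ + C₂ + 1, (1 - |ρ|) / 2, by positivity, by linarith, fun h s t hh hh1 => ?_⟩
  rw [lowSym, phaseLow]
  generalize s / h = κ
  generalize t / (c * h) = η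
  have e : Complex.exp (psiL ρ a₁ a₂ κ η) * (1 + (h : ℂ) ^ 2 * lowPoly ρ a₁ a₂ c lam θ N₀ κ η) =
    1 * Complex.exp (psiL ρ a₁ a₂ κ η) + (h : ℂ) ^ 2 * (lowPoly ρ a₁ a₂ c lam θ N₀ κ η *
      Complex.exp (psiL ρ a₁ a₂ κ η)) := by ring
  rw [e]
  refine (norm_add_le _ _).trans ?_
  rw [norm_mul ((h : ℂ) ^ 2), norm_pow, Complex.norm_real, Real.norm_eq_abs, abs_of_pos hh]
  have h3 : h ^ 2 ≤ 1 := pow_le_one₀ hh.le hh1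
  have h4 := mul_le_mul h3 (h2 κ η) (norm_nonneg _) zero_le_one
  have h5 := h1 κ η
  have h6 := Real.exp_pos (-((1 - |ρ|) / 2 * (κ ^ 2 + η ^ 2)))
  linarith

theorem continuous_lowSym (hρ : |ρ| < 1) (a₁ a₂ c lam θ : ℝ) (N₀ : ℕ) (h : ℝ) :
    Continuous (Function.uncurry (lowSym ρ a₁ a₂ c lam θ N₀ h)) := by
  have h1 : Continuous fun p : ℝ × ℝ => (p.1 / h, p.2 / (c * h)) := by fun_prop
  have h2 := (hasGaussSymbol_lowPoly hρ a₁ a₂ c lam θ N₀).poly.cont.comp h1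
  have h3 := (continuous_psiL ρ a₁ a₂).comp h1
  have h4 : Continuous fun _ : ℝ × ℝ => (h : ℂ) := continuous_const
  exact (Complex.continuous_exp.comp h3).mul (continuous_const.add ((h4.pow 2).mul h2))

theorem integrable_exp_neg_phaseLow {δ c h : ℝ} (hδ : 0 < δ) (hc : 0 < c) (hh : 0 < h) :
    Integrable fun p : ℝ × ℝ => Real.exp (-(δ * phaseLow c h p.1 p.2)) := by
  have h1 : 0 < δ / h ^ 2 := by positivity
  have h2 : 0 < δ / (c * h) ^ 2 := by positivity
  refine ((integrable_exp_neg_mul_sq h1).mul_prod (integrable_exp_neg_mul_sq h2)).congr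
    (Eventually.of_forall fun p => ?_)
  simp only
  rw [← Real.exp_add, phaseLow]
  congr 1
  field_simp
  ring

theorem summable_exp_neg_abs {ν : ℝ} (hν : 0 < ν) :
    Summable fun n : ℤ × ℤ => Real.exp (-(ν * (|(n.1 : ℝ)| + |(n.2 : ℝ)|))) := by
  have h1 : Summable fun m : ℤ => Real.exp (-(ν * |(m : ℝ)|)) := by
    have h0 : Summable fun n : ℕ => Real.exp (-(ν * n)) := by
      have := summable_geometric_of_lt_one (Real.exp_pos (-ν)).le (Real.exp_lt_one_iff.2 (by linarith))
      refine this.congr fun n => ?_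
      rw [← Real.exp_nat_mul]
      congr 1
      ring
    refine Summable.of_nat_of_neg (h0.congr fun n => ?_) (h0.congr fun n => ?_) <;> simp
  refine (h1.mul_of_nonneg h1 (fun _ => (Real.exp_pos _).le) (fun _ => (Real.exp_pos _).le)).congr
    fun n => ?_
  rw [← Real.exp_add]
  congr 1
  ring

/-- A point of the fundamental interval moved by `m` periods is at least `π |m|` away from zero. -/
theorem pi_mul_abs_le {s : ℝ} (hs : s ∈ Set.Ioc (-Real.pi) Real.pi) (m : ℤ) :
    Real.pi * |(m : ℝ)| ≤ |s + 2 * Real.pi * m| := by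
  rcases eq_or_ne m 0 with rfl | hm
  · simp
  have h1 : (1 : ℝ) ≤ |(m : ℝ)| := by exact_mod_cast Int.one_le_abs hm
  have h2 : |s| ≤ Real.pi := abs_le.2 ⟨hs.1.le, hs.2⟩
  have h3 : |2 * Real.pi * (m : ℝ)| - |s| ≤ |s + 2 * Real.pi * m| := by
    have := abs_sub_abs_le_abs_sub (2 * Real.pi * (m : ℝ)) (-s)
    rw [abs_neg] at this
    rwa [show 2 * Real.pi * (m : ℝ) - -s = s + 2 * Real.pi * m by ring] at this
  rw [abs_mul, abs_of_pos (by positivity : 0 < 2 * Real.pi)] at h3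
  nlinarith [Real.pi_pos]

theorem abs_le_sq_of_int (m : ℤ) : |(m : ℝ)| ≤ (Real.pi * |(m : ℝ)|) ^ 2 := by
  rcases eq_or_ne m 0 with rfl | hm
  · simp
  have h1 : (1 : ℝ) ≤ |(m : ℝ)| := by exact_mod_cast Int.one_le_abs hm
  have h2 : 1 ≤ Real.pi := by linarith [Real.pi_gt_three]
  have h3 : |(m : ℝ)| ≤ Real.pi * |(m : ℝ)| := le_mul_of_one_le_left (abs_nonneg _) h2
  nlinarith

theorem exists_exp_neg_div_le {ν : ℝ} (hν : 0 < ν) (w : ℕ) :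
    ∃ K : ℝ, 0 < K ∧ ∀ h : ℝ, 0 < h → Real.exp (-(ν * (1 / h))) ≤ K * h ^ w := by
  obtain ⟨K, hK, H⟩ := exists_pow_mul_exp_le hν w
  refine ⟨K, hK, fun h hh => ?_⟩
  have := H (1 / h) (by positivity)
  rw [div_pow, one_pow, one_div, inv_mul_le_iff₀ (by positivity)] at this
  linarith

/-- A function on the plane that is small outside the fundamental box agrees, up to a high power of
`h`, with a symbol that has the same Fourier integrals on the grid. -/
theorem exists_fold {ν C : ℝ} (hν : 0 < ν) (hC : 0 < C) (w : ℕ) : ∃ K : ℝ, 0 < K ∧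
    ∀ h : ℝ, 0 < h → ∀ F : ℝ → ℝ → ℂ, Measurable (Function.uncurry F) →
      Integrable (Function.uncurry F) → (∃ M, ∀ s t, ‖F s t‖ ≤ M) →
      (∀ n : ℤ × ℤ, n ≠ 0 → ∀ p ∈ box, ‖F (p.1 + 2 * Real.pi * n.1) (p.2 + 2 * Real.pi * n.2)‖ ≤
        C * Real.exp (-(ν * (1 / h + (|(n.1 : ℝ)| + |(n.2 : ℝ)|))))) →
      ∃ E : ℝ → ℝ → ℂ, IsSymbol E ∧ (∀ p ∈ box, ‖E p.1 p.2 - F p.1 p.2‖ ≤ K * h ^ w) ∧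
        ∀ (h₁ h₂ : ℝ) (j k : ℤ), invMixedFourier h₁ h₂ E j k =
          1 / (4 * (Real.pi : ℂ) ^ 2 * h₁ * h₂) *
            ∫ p : ℝ × ℝ, F p.1 p.2 * Complex.exp (Complex.I * j * p.1) *
              Complex.exp (Complex.I * k * p.2) := by
  classical
  obtain ⟨K₀, hK₀, hK⟩ := exists_exp_neg_div_le hν w
  have hS := summable_exp_neg_abs hν
  have hSpos : 0 ≤ ∑' n : ℤ × ℤ, Real.exp (-(ν * (|(n.1 : ℝ)| + |(n.2 : ℝ)|))) :=
    tsum_nonneg fun _ => (Real.exp_pos _).le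
  refine ⟨C * K₀ * (∑' n : ℤ × ℤ, Real.exp (-(ν * (|(n.1 : ℝ)| + |(n.2 : ℝ)|))) + 1),
    by positivity, fun h hh F hF hFi hFb hFp => ?_⟩
  obtain ⟨b, hbdef⟩ : ∃ b : ℤ × ℤ → ℝ, b = fun n => if n = 0 then 0 else
    C * Real.exp (-(ν * (1 / h + (|(n.1 : ℝ)| + |(n.2 : ℝ)|)))) := ⟨_, rfl⟩
  have hble : ∀ n, b n ≤ C * (K₀ * h ^ w) *
      Real.exp (-(ν * (|(n.1 : ℝ)| + |(n.2 : ℝ)|))) := fun n => by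
    rw [hbdef]
    simp only
    split_ifs
    · positivity
    · rw [mul_add, neg_add, Real.exp_add, ← mul_assoc]
      exact mul_le_mul_of_nonneg_right (mul_le_mul_of_nonneg_left (hK h hh) hC.le)
        (Real.exp_pos _).le
  have hb0 : ∀ n, 0 ≤ b n := fun n => by
    rw [hbdef]
    simp only
    split_ifs
    · exact le_rfl
    · positivity
  have hbs : Summable b := Summable.of_nonneg_of_le hb0 hble (hS.mul_left _)
  obtain ⟨E, hE, hEF, hEI⟩ := exists_periodization hF hFi hFb hbs (fun n hn p hp => by
    rw [hbdef]
    simp only [if_neg hn]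
    exact hFp n hn p hp) (by rw [hbdef]; simp)
  refine ⟨E, hE, fun p hp => (hEF p hp).trans ?_, hEI⟩
  calc ∑' n, b n ≤ ∑' n : ℤ × ℤ, C * (K₀ * h ^ w) *
        Real.exp (-(ν * (|(n.1 : ℝ)| + |(n.2 : ℝ)|))) := hbs.tsum_le_tsum hble (hS.mul_left _)
    _ = C * (K₀ * h ^ w) * ∑' n : ℤ × ℤ, Real.exp (-(ν * (|(n.1 : ℝ)| + |(n.2 : ℝ)|))) :=
        tsum_mul_left
    _ ≤ _ := by
        have : 0 < C * K₀ * h ^ w := by positivity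
        nlinarith

/-- The exact solution plus the low-wavenumber correction is, on the grid, the inverse transform of
a symbol that differs from `lowSym` by the aliased part of a Gaussian only. -/
theorem exists_low_fold (hρ : |ρ| < 1) {c : ℝ} (hc : 0 < c) (a₁ a₂ lam θ : ℝ) (N₀ w : ℕ) :
    ∃ K : ℝ, 0 < K ∧ ∀ h, 0 < h → h ≤ 1 → ∃ E : ℝ → ℝ → ℂ, IsSymbol E ∧
      (∀ p ∈ box, ‖E p.1 p.2 - lowSym ρ a₁ a₂ c lam θ N₀ h p.1 p.2‖ ≤ K * h ^ w) ∧
      ∀ j k : ℤ, exactSolution ρ a₁ a₂ (j * h) (k * (c * h)) 1 +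
        h ^ 2 * Clow ρ a₁ a₂ c lam θ N₀ (j * h) (k * (c * h)) = gridOf h (c * h) E j k := by
  obtain ⟨C, δ, hC, hδ, hb⟩ := exists_norm_lowSym_le hρ a₁ a₂ c lam θ N₀
  -- `μ` compares both directions of the phase, with mesh widths `h` and `c h`, to the same scale
  obtain ⟨μ, hμ0, hμ1, hμc⟩ : ∃ μ : ℝ, 0 < μ ∧ μ ≤ 1 ∧ μ ≤ 1 / c ^ 2 :=
    ⟨min 1 (1 / c ^ 2), lt_min one_pos (by positivity), min_le_left _ _, min_le_right _ _⟩
  have hν : 0 < δ * μ / 2 := by positivity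
  obtain ⟨K, hK, hfold⟩ := exists_fold hν hC w
  refine ⟨K, hK, fun h hh hh1 => ?_⟩
  have hcont := continuous_lowSym hρ a₁ a₂ c lam θ N₀ h
  have hint : Integrable (Function.uncurry (lowSym ρ a₁ a₂ c lam θ N₀ h)) :=
    ((integrable_exp_neg_phaseLow hδ hc hh).const_mul C).mono' hcont.aestronglyMeasurable
      (Eventually.of_forall fun p => hb h p.1 p.2 hh hh1)
  have hbd : ∀ s t, ‖lowSym ρ a₁ a₂ c lam θ N₀ h s t‖ ≤ C := fun s t => by
    refine (hb h s t hh hh1).trans (mul_le_of_le_one_right hC.le (Real.exp_le_one_iff.2 ?_))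
    have : 0 ≤ phaseLow c h s t := by rw [phaseLow]; positivity
    nlinarith
  obtain ⟨E, hE, hEF, hEI⟩ := hfold h hh _ hcont.measurable hint ⟨C, hbd⟩
    (fun n hn p hp => by
      refine (hb h _ _ hh hh1).trans
        (mul_le_mul_of_nonneg_left (Real.exp_le_exp.2 (neg_le_neg ?_)) hC.le)
      have q1 : |(n.1 : ℝ)| ≤ (p.1 + 2 * Real.pi * n.1) ^ 2 := (abs_le_sq_of_int _).trans (by
        rw [← sq_abs (p.1 + _)]
        exact pow_le_pow_left₀ (by positivity) (pi_mul_abs_le hp.1 _) 2)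
      have q2 : |(n.2 : ℝ)| ≤ (p.2 + 2 * Real.pi * n.2) ^ 2 := (abs_le_sq_of_int _).trans (by
        rw [← sq_abs (p.2 + _)]
        exact pow_le_pow_left₀ (by positivity) (pi_mul_abs_le hp.2 _) 2)
      have q3 : 1 ≤ |(n.1 : ℝ)| + |(n.2 : ℝ)| := by
        by_cases h1 : n.1 = 0
        · have h2 : n.2 ≠ 0 := fun h2 => hn (Prod.ext h1 h2)
          have : (1 : ℝ) ≤ |(n.2 : ℝ)| := by exact_mod_cast Int.one_le_abs h2
          linarith [abs_nonneg (n.1 : ℝ)]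
        · have : (1 : ℝ) ≤ |(n.1 : ℝ)| := by exact_mod_cast Int.one_le_abs h1
          linarith [abs_nonneg (n.2 : ℝ)]
      have q4 : 1 ≤ 1 / h := by rw [le_div_iff₀ hh]; linarith
      have q5 : 1 / h ≤ 1 / h ^ 2 := by
        rw [← one_div_pow]; nlinarith
      have q6 : μ * (|(n.1 : ℝ)| + |(n.2 : ℝ)|) * (1 / h ^ 2) ≤
          phaseLow c h (p.1 + 2 * Real.pi * n.1) (p.2 + 2 * Real.pi * n.2) := by
        rw [phaseLow, div_pow, div_pow, mul_pow]
        have r1 : μ * |(n.1 : ℝ)| ≤ (p.1 + 2 * Real.pi * n.1) ^ 2 :=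
          (mul_le_of_le_one_left (abs_nonneg _) hμ1).trans q1
        have r2 : μ * |(n.2 : ℝ)| ≤ (p.2 + 2 * Real.pi * n.2) ^ 2 / c ^ 2 := by
          have := mul_le_mul hμc q2 (abs_nonneg _) (by positivity)
          rwa [one_div, inv_mul_eq_div] at this
        have r3 := mul_le_mul_of_nonneg_right (add_le_add r1 r2)
          (show 0 ≤ 1 / h ^ 2 by positivity)
        calc _ = (μ * |(n.1 : ℝ)| + μ * |(n.2 : ℝ)|) * (1 / h ^ 2) := by ring
          _ ≤ _ := r3
          _ = _ := by field_simp
      have q7 : 1 / h + (|(n.1 : ℝ)| + |(n.2 : ℝ)|) ≤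
          2 * ((|(n.1 : ℝ)| + |(n.2 : ℝ)|) * (1 / h ^ 2)) := by
        have := mul_le_mul q3 q5 (by positivity) (by positivity)
        have := mul_le_mul_of_nonneg_left (q4.trans q5)
          (show 0 ≤ |(n.1 : ℝ)| + |(n.2 : ℝ)| by positivity)
        linarith
      have q8 := mul_le_mul_of_nonneg_left q6 hδ.le
      have q9 := mul_le_mul_of_nonneg_left q7 hν.le
      nlinarith)
  refine ⟨E, hE, hEF, fun j k => ?_⟩
  · rw [gridOf, hEI, exactSolution_add_Clow hρ]
    congr 1
    have hhc : (h : ℂ) ≠ 0 := by exact_mod_cast hh.ne'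
    have hcc : (c : ℂ) ≠ 0 := by exact_mod_cast hc.ne'
    have hG : Integrable fun p : ℝ × ℝ => Complex.exp (psiL ρ a₁ a₂ p.1 p.2) *
        (1 + (h : ℂ) ^ 2 * lowPoly ρ a₁ a₂ c lam θ N₀ p.1 p.2) *
          Complex.exp (Complex.I * (p.1 * (j * h : ℝ) + p.2 * (k * (c * h) : ℝ))) := by
      have h1 := ((PolyGrowth.const 1).add ((hasGaussSymbol_lowPoly hρ a₁ a₂ c lam θ N₀).poly.const_mul
        ((h : ℂ) ^ 2))).integrable hρ a₁ a₂
      refine (h1.mul_bdd (c := 1) (g := fun p : ℝ × ℝ => Complex.exp (Complex.I *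
        (p.1 * (j * h : ℝ) + p.2 * (k * (c * h) : ℝ)))) (by
          apply Continuous.aestronglyMeasurable; fun_prop)
        (Eventually.of_forall fun p => ?_)).congr (Eventually.of_forall fun p => ?_)
      · have : Complex.I * (p.1 * (j * h : ℝ) + p.2 * (k * (c * h) : ℝ)) =
          ((p.1 * (j * h) + p.2 * (k * (c * h)) : ℝ) : ℂ) * Complex.I := by push_cast; ring
        rw [this, Complex.norm_exp_ofReal_mul_I]
      · simp only; ring
    have e (p : ℝ × ℝ) : lowSym ρ a₁ a₂ c lam θ N₀ h p.1 p.2 * Complex.exp (Complex.I * j * p.1) *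
        Complex.exp (Complex.I * k * p.2) =
        Complex.exp (psiL ρ a₁ a₂ (p.1 / h) (p.2 / (c * h))) *
        (1 + (h : ℂ) ^ 2 * lowPoly ρ a₁ a₂ c lam θ N₀ (p.1 / h) (p.2 / (c * h))) *
          Complex.exp (Complex.I * ((p.1 / h : ℝ) * (j * h : ℝ) +
            (p.2 / (c * h) : ℝ) * (k * (c * h) : ℝ))) := by
      rw [lowSym, mul_assoc _ (Complex.exp (Complex.I * j * p.1)), ← Complex.exp_add]
      congr 2
      push_cast
      field_simp
    have hG' := (hint.mul_bdd (c := 1) (g := fun p : ℝ × ℝ => Complex.exp (Complex.I * j * p.1) *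
        Complex.exp (Complex.I * k * p.2)) (by
          apply Continuous.aestronglyMeasurable; fun_prop) (Eventually.of_forall fun p => by
          rw [norm_mul, norm_exp_I_int, norm_exp_I_int, one_mul]))
    simp only [e]
    rw [integral_prod_comp_div (G := fun κ η => Complex.exp (psiL ρ a₁ a₂ κ η) *
        (1 + (h : ℂ) ^ 2 * lowPoly ρ a₁ a₂ c lam θ N₀ κ η) *
          Complex.exp (Complex.I * (κ * (j * h : ℝ) + η * (k * (c * h) : ℝ)))) hh (mul_pos hc hh) hG
      (hG'.congr (Eventually.of_forall fun p => by
        simp only [Function.uncurry]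
        rw [← mul_assoc]; exact e p))]
    refine Eq.trans ?_ (mul_assoc _ _ _)
    congr 1
    push_cast
    field_simp

end low_fold

/-! ### The exact solution of the model problem -/

section model

variable {ρ : ℝ}

/-- Logarithmic `x`-derivative of `exactSolution`; with the roles of the variables exchanged, the
`y`-derivative. -/
def logDeriv₁ (ρ a₁ a₂ x y t : ℝ) : ℝ :=
  -((x + a₁ * t) - ρ * (y + a₂ * t)) / (2 * t * (1 - ρ ^ 2))

theorem exactSolution_swap (ρ a₁ a₂ x y t : ℝ) :
    exactSolution ρ a₁ a₂ x y t = exactSolution ρ a₂ a₁ y x t := by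
  rw [exactSolution, exactSolution]
  congr 2
  ring

theorem hasDerivAt_logDeriv₁_fst (ρ a₁ a₂ x y t : ℝ) :
    HasDerivAt (fun s => logDeriv₁ ρ a₁ a₂ s y t) (-1 / (2 * t * (1 - ρ ^ 2))) x := by
  have := ((((hasDerivAt_id x).add_const (a₁ * t)).sub_const (ρ * (y + a₂ * t))).neg).div_const
    (2 * t * (1 - ρ ^ 2))
  exact this

theorem hasDerivAt_logDeriv₁_snd (ρ a₁ a₂ x y t : ℝ) :
    HasDerivAt (fun s => logDeriv₁ ρ a₁ a₂ x s t) (ρ / (2 * t * (1 - ρ ^ 2))) y := by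
  have := (((((hasDerivAt_id y).add_const (a₂ * t)).const_mul ρ).const_sub (x + a₁ * t)).neg).div_const
    (2 * t * (1 - ρ ^ 2))
  refine this.congr_deriv ?_
  ring

theorem hasDerivAt_exactSolution_fst (hρ : |ρ| < 1) (a₁ a₂ x y : ℝ) {t : ℝ} (ht : 0 < t) :
    HasDerivAt (fun s => exactSolution ρ a₁ a₂ s y t)
      (exactSolution ρ a₁ a₂ x y t * logDeriv₁ ρ a₁ a₂ x y t) x := by
  have hD := one_sub_sq_pos hρ
  have h1 : HasDerivAt (fun s : ℝ => s + a₁ * t) 1 x := (hasDerivAt_id x).add_const _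
  have h2 := (((((h1.pow 2).add_const ((y + a₂ * t) ^ 2)).sub
    ((h1.const_mul (2 * ρ)).mul_const (y + a₂ * t))).const_mul
      (-(1 / (4 * t)) * (1 / (1 - ρ ^ 2)))).exp).const_mul (1 / (4 * Real.pi * t * √(1 - ρ ^ 2)))
  refine h2.congr_deriv ?_
  rw [exactSolution, logDeriv₁]
  simp only [Pi.pow_apply, Pi.sub_apply]
  refine Eq.trans ?_ (mul_assoc _ _ _).symm
  congr 2
  push_cast
  field_simp
  ring

theorem hasDerivAt_exactSolution_snd (hρ : |ρ| < 1) (a₁ a₂ x y : ℝ) {t : ℝ} (ht : 0 < t) :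
    HasDerivAt (fun s => exactSolution ρ a₁ a₂ x s t)
      (exactSolution ρ a₁ a₂ x y t * logDeriv₁ ρ a₂ a₁ y x t) y := by
  simp only [exactSolution_swap ρ a₁ a₂]
  exact hasDerivAt_exactSolution_fst hρ a₂ a₁ y x ht

theorem iteratedDeriv_exactSolution_fst (hρ : |ρ| < 1) (a₁ a₂ x y : ℝ) {t : ℝ} (ht : 0 < t) :
    iteratedDeriv 2 (fun s => exactSolution ρ a₁ a₂ s y t) x =
      exactSolution ρ a₁ a₂ x y t *
        (logDeriv₁ ρ a₁ a₂ x y t ^ 2 - 1 / (2 * t * (1 - ρ ^ 2))) := by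
  have e : deriv (fun s => exactSolution ρ a₁ a₂ s y t) =
      fun s => exactSolution ρ a₁ a₂ s y t * logDeriv₁ ρ a₁ a₂ s y t :=
    funext fun s => (hasDerivAt_exactSolution_fst hρ a₁ a₂ s y ht).deriv
  rw [iteratedDeriv_succ, iteratedDeriv_one, e, ((hasDerivAt_exactSolution_fst hρ a₁ a₂ x y ht).fun_mul
    (hasDerivAt_logDeriv₁_fst ρ a₁ a₂ x y t)).deriv]
  ring

theorem hasDerivAt_exactSolution_time (hρ : |ρ| < 1) (a₁ a₂ x y : ℝ) {t : ℝ} (ht : 0 < t) :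
    HasDerivAt (fun s => exactSolution ρ a₁ a₂ x y s)
      (exactSolution ρ a₁ a₂ x y t * (-(1 / t) + ((x + a₁ * t) ^ 2 + (y + a₂ * t) ^ 2
        - 2 * ρ * (x + a₁ * t) * (y + a₂ * t)) / (4 * t ^ 2 * (1 - ρ ^ 2))
        + a₁ * logDeriv₁ ρ a₁ a₂ x y t + a₂ * logDeriv₁ ρ a₂ a₁ y x t)) t := by
  have hD := one_sub_sq_pos hρ
  have hD' : 0 < √(1 - ρ ^ 2) := Real.sqrt_pos.2 hD
  have hp := Real.pi_pos
  have h1 : HasDerivAt (fun s : ℝ => x + a₁ * s) a₁ t := by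
    simpa using ((hasDerivAt_id t).const_mul a₁).const_add x
  have h2 : HasDerivAt (fun s : ℝ => y + a₂ * s) a₂ t := by
    simpa using ((hasDerivAt_id t).const_mul a₂).const_add y
  have h3 := ((h1.pow 2).add (h2.pow 2)).sub ((h1.const_mul (2 * ρ)).mul h2)
  have h4 : HasDerivAt (fun s : ℝ => -(1 / (4 * s)) * (1 / (1 - ρ ^ 2)))
      (1 / (4 * t ^ 2 * (1 - ρ ^ 2))) t := by
    have := (((hasDerivAt_id t).const_mul 4).fun_inv (by simp [ht.ne'])).neg.mul_const
      (1 / (1 - ρ ^ 2))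
    simp only [← one_div] at this
    refine this.congr_deriv ?_
    simp only [id]
    field_simp
  have h5 : HasDerivAt (fun s : ℝ => 1 / (4 * Real.pi * s * √(1 - ρ ^ 2)))
      (-(1 / (4 * Real.pi * t * √(1 - ρ ^ 2))) * (1 / t)) t := by
    have := (((hasDerivAt_id t).const_mul (4 * Real.pi)).mul_const (√(1 - ρ ^ 2))).fun_inv (by
      simp only [id]; positivity)
    simp only [← one_div] at this
    refine this.congr_deriv ?_
    simp only [id]
    field_simp
  refine (h5.mul (h4.mul h3).exp).congr_deriv ?_
  rw [exactSolution, logDeriv₁, logDeriv₁]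
  simp only [Pi.add_apply, Pi.pow_apply, Pi.sub_apply, Pi.mul_apply]
  generalize Real.exp _ = Ex
  field_simp
  ring

theorem contDiffOn_exactSolution (hρ : |ρ| < 1) (a₁ a₂ : ℝ) :
    ContDiffOn ℝ ∞ (fun q : ℝ × ℝ × ℝ => exactSolution ρ a₁ a₂ q.1 q.2.1 q.2.2)
      {q | 0 < q.2.2} := by
  have hD' : 0 < √(1 - ρ ^ 2) := Real.sqrt_pos.2 (one_sub_sq_pos hρ)
  have hp := Real.pi_pos
  unfold exactSolution
  refine ContDiffOn.mul ?_ (ContDiffOn.exp (ContDiffOn.mul (ContDiffOn.mul (ContDiffOn.neg ?_)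
    contDiffOn_const) ?_))
  · refine contDiffOn_const.div (by fun_prop) fun q hq => ?_
    have : 0 < q.2.2 := hq
    positivity
  · refine contDiffOn_const.div (by fun_prop) fun q hq => ?_
    have : 0 < q.2.2 := hq
    positivity
  · fun_prop

theorem exactSolution_le (hρ : |ρ| < 1) (a₁ a₂ x y : ℝ) {t : ℝ} (ht : 0 < t) :
    |exactSolution ρ a₁ a₂ x y t| ≤ 1 / (4 * Real.pi * t * √(1 - ρ ^ 2)) *
      Real.exp (-((1 - |ρ|) / (4 * t * (1 - ρ ^ 2)) * ((x + a₁ * t) ^ 2 + (y + a₂ * t) ^ 2))) := by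
  have hD := one_sub_sq_pos hρ
  have hD' : 0 < √(1 - ρ ^ 2) := Real.sqrt_pos.2 hD
  have hp := Real.pi_pos
  rw [exactSolution, abs_of_pos (by positivity)]
  refine mul_le_mul_of_nonneg_left (Real.exp_le_exp.2 ?_) (by positivity)
  generalize x + a₁ * t = X
  generalize y + a₂ * t = Y
  have h1 : 2 * ρ * X * Y ≤ |ρ| * (X ^ 2 + Y ^ 2) := by
    have h2 := le_abs_self (ρ * (X * Y))
    rw [abs_mul, abs_mul] at h2
    rw [← sq_abs X, ← sq_abs Y]
    nlinarith [mul_nonneg (abs_nonneg ρ) (sq_nonneg (|X| - |Y|))]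
  have h3 : 0 ≤ 1 / (4 * t * (1 - ρ ^ 2)) := by positivity
  have h4 := mul_le_mul_of_nonneg_left (show (1 - |ρ|) * (X ^ 2 + Y ^ 2) ≤
    X ^ 2 + Y ^ 2 - 2 * ρ * X * Y by linarith) h3
  calc _ = -(1 / (4 * t * (1 - ρ ^ 2)) * (X ^ 2 + Y ^ 2 - 2 * ρ * X * Y)) := by field_simp
    _ ≤ -(1 / (4 * t * (1 - ρ ^ 2)) * ((1 - |ρ|) * (X ^ 2 + Y ^ 2))) := neg_le_neg h4
    _ = _ := by ring

theorem integrable_exactSolution (hρ : |ρ| < 1) (a₁ a₂ : ℝ) {t : ℝ} (ht : 0 < t) :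
    Integrable fun p : ℝ × ℝ => exactSolution ρ a₁ a₂ p.1 p.2 t := by
  have hD := one_sub_sq_pos hρ
  have h1 := (integrable_gauss_prod (δ := (1 - |ρ|) / (4 * t * (1 - ρ ^ 2)))
    (div_pos (by linarith) (by positivity))).comp_add_right ((a₁ * t, a₂ * t) : ℝ × ℝ)
  refine (h1.const_mul (1 / (4 * Real.pi * t * √(1 - ρ ^ 2)))).mono' ?_
    (Eventually.of_forall fun p => exactSolution_le hρ a₁ a₂ p.1 p.2 ht)
  apply Continuous.aestronglyMeasurable
  unfold exactSolution
  fun_prop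

/-- The density at time one without drift has total mass one. -/
theorem integral_exactSolution_one (hρ : |ρ| < 1) :
    ∫ p : ℝ × ℝ, exactSolution ρ 0 0 p.1 p.2 1 = 1 := by
  have hD := one_sub_sq_pos hρ
  have hD' : 0 < √(1 - ρ ^ 2) := Real.sqrt_pos.2 hD
  have hp := Real.pi_pos
  have hI := integrable_exactSolution hρ 0 0 one_pos
  rw [Measure.volume_eq_prod, integral_prod _ hI]
  have inner (x : ℝ) : ∫ y, exactSolution ρ 0 0 x y 1 =
      1 / (4 * Real.pi * √(1 - ρ ^ 2)) * √(Real.pi / (1 / (4 * (1 - ρ ^ 2)))) *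
        Real.exp (-(1 / 4) * x ^ 2) := by
    rw [← integral_gaussian, ← integral_add_right_eq_self _ (ρ * x), ← integral_const_mul,
      ← integral_mul_const]
    congr 1
    ext y
    rw [exactSolution, mul_one (4 * Real.pi)]
    refine Eq.trans ?_ (mul_assoc _ _ _).symm
    rw [← Real.exp_add]
    congr 2
    field_simp
    ring
  simp only [inner]
  rw [integral_const_mul, integral_gaussian]
  have e1 : √(Real.pi / (1 / (4 * (1 - ρ ^ 2)))) * √(Real.pi / (1 / 4)) =
      4 * Real.pi * √(1 - ρ ^ 2) := by
    rw [← Real.sqrt_mul (by positivity),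
      show Real.pi / (1 / (4 * (1 - ρ ^ 2))) * (Real.pi / (1 / 4)) =
        (4 * Real.pi) ^ 2 * (1 - ρ ^ 2) by field_simp,
      Real.sqrt_mul (by positivity), Real.sqrt_sq (by positivity)]
  rw [mul_assoc, e1]
  field_simp

/-- Parabolic scaling. -/
theorem mul_exactSolution_scale (a₁ a₂ : ℝ) {t : ℝ} (ht : 0 < t) (q : ℝ × ℝ) :
    t * exactSolution ρ a₁ a₂ (√t * q.1 - a₁ * t) (√t * q.2 - a₂ * t) t =
      exactSolution ρ 0 0 q.1 q.2 1 := by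
  have hs : √t ^ 2 = t := Real.sq_sqrt ht.le
  rw [exactSolution, exactSolution, ← mul_assoc]
  congr 1
  · field_simp
  · congr 1
    have e : (√t * q.1 - a₁ * t + a₁ * t) ^ 2 + (√t * q.2 - a₂ * t + a₂ * t) ^ 2 -
        2 * ρ * (√t * q.1 - a₁ * t + a₁ * t) * (√t * q.2 - a₂ * t + a₂ * t) =
        t * (q.1 ^ 2 + q.2 ^ 2 - 2 * ρ * q.1 * q.2) := by
      linear_combination (q.1 ^ 2 + q.2 ^ 2 - 2 * ρ * q.1 * q.2) * hs
    rw [e]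
    field_simp
    ring

/-- After the parabolic change of variables the density no longer depends on `t`, which makes the limit
`t → 0` a case of dominated convergence. -/
theorem integral_exactSolution_mul (a₁ a₂ : ℝ) {t : ℝ} (ht : 0 < t) (f : ℝ × ℝ → ℝ) :
    ∫ p : ℝ × ℝ, exactSolution ρ a₁ a₂ p.1 p.2 t * f p =
      ∫ q : ℝ × ℝ, exactSolution ρ 0 0 q.1 q.2 1 *
        f (√t * q.1 - a₁ * t, √t * q.2 - a₂ * t) := by
  rw [← integral_sub_right_eq_self (fun p : ℝ × ℝ => exactSolution ρ a₁ a₂ p.1 p.2 t * f p)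
    ((a₁ * t, a₂ * t) : ℝ × ℝ)]
  have h := Measure.integral_comp_smul (volume : Measure (ℝ × ℝ)) (fun p : ℝ × ℝ =>
    exactSolution ρ a₁ a₂ (p - (a₁ * t, a₂ * t)).1 (p - (a₁ * t, a₂ * t)).2 t *
      f (p - (a₁ * t, a₂ * t))) √t
  rw [Module.finrank_prod, Module.finrank_self, Real.sq_sqrt ht.le,
    abs_of_pos (by positivity), smul_eq_mul] at h
  rw [eq_inv_mul_iff_mul_eq₀ ht.ne'] at h
  rw [← h, ← integral_const_mul]
  congr 1
  ext q
  rw [← mul_assoc, ← mul_exactSolution_scale a₁ a₂ ht q]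
  rfl

theorem isModelSolution_exactSolution (hρ : |ρ| < 1) (a₁ a₂ : ℝ) :
    IsModelSolution ρ a₁ a₂ (exactSolution ρ a₁ a₂) where
  smooth := contDiffOn_exactSolution hρ a₁ a₂
  pde x y t ht := by
    have hD := one_sub_sq_pos hρ
    have e : (fun s => deriv (fun r => exactSolution ρ a₁ a₂ r s t) x) =
        fun s => exactSolution ρ a₁ a₂ x s t * logDeriv₁ ρ a₁ a₂ x s t :=
      funext fun s => (hasDerivAt_exactSolution_fst hρ a₁ a₂ x s ht).deriv
    have e2 : iteratedDeriv 2 (fun s => exactSolution ρ a₁ a₂ x s t) y =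
        exactSolution ρ a₁ a₂ x y t *
          (logDeriv₁ ρ a₂ a₁ y x t ^ 2 - 1 / (2 * t * (1 - ρ ^ 2))) := by
      simp only [exactSolution_swap ρ a₁ a₂]
      exact iteratedDeriv_exactSolution_fst hρ a₂ a₁ y x ht
    rw [(hasDerivAt_exactSolution_time hρ a₁ a₂ x y ht).deriv, e, e2,
      iteratedDeriv_exactSolution_fst hρ a₁ a₂ x y ht,
      (hasDerivAt_exactSolution_fst hρ a₁ a₂ x y ht).deriv,
      (hasDerivAt_exactSolution_snd hρ a₁ a₂ x y ht).deriv,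
      ((hasDerivAt_exactSolution_snd hρ a₁ a₂ x y ht).fun_mul
        (hasDerivAt_logDeriv₁_snd ρ a₁ a₂ x y t)).deriv]
    generalize exactSolution ρ a₁ a₂ x y t = u
    rw [logDeriv₁, logDeriv₁]
    field_simp
    ring
  integrable t ht := integrable_exactSolution hρ a₁ a₂ ht
  initial f hf hM := by
    obtain ⟨M, hM⟩ := hM
    have hI := integrable_exactSolution hρ 0 0 one_pos
    have h1 : Tendsto (fun t : ℝ => ∫ q : ℝ × ℝ, exactSolution ρ 0 0 q.1 q.2 1 *
        f (√t * q.1 - a₁ * t, √t * q.2 - a₂ * t)) (𝓝[>] 0)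
        (𝓝 (∫ q : ℝ × ℝ, exactSolution ρ 0 0 q.1 q.2 1 * f (0, 0))) := by
      refine tendsto_integral_filter_of_dominated_convergence
        (fun q => ‖exactSolution ρ 0 0 q.1 q.2 1‖ * M) (Eventually.of_forall fun t => ?_)
        (Eventually.of_forall fun t => Eventually.of_forall fun q => ?_) (hI.norm.mul_const M)
        (Eventually.of_forall fun q => ?_)
      · exact hI.aestronglyMeasurable.mul (Continuous.aestronglyMeasurable (by fun_prop))
      · rw [norm_mul]
        exact mul_le_mul_of_nonneg_left (hM _) (norm_nonneg _)
      · have hc : Continuous fun t : ℝ => exactSolution ρ 0 0 q.1 q.2 1 *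
            f (√t * q.1 - a₁ * t, √t * q.2 - a₂ * t) := by fun_prop
        have := hc.tendsto 0
        simp only [Real.sqrt_zero, zero_mul, mul_zero, sub_zero] at this
        exact this.mono_left nhdsWithin_le_nhds
    rw [integral_mul_const, integral_exactSolution_one hρ, one_mul] at h1
    refine h1.congr' ?_
    filter_upwards [self_mem_nhdsWithin] with t ht
    exact (integral_exactSolution_mul a₁ a₂ ht f).symm

end model

/-! ### The high-wavenumber part of the approximation -/

theorem integrableOn_rect {H : ℝ × ℝ → ℝ} (hH : IntegrableOn H box) {a b c d : ℝ}
    (ha : -Real.pi ≤ a) (hb : b ≤ Real.pi) (hc : -Real.pi ≤ c) (hd : d ≤ Real.pi) :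
    IntegrableOn H (Set.Ioc a b ×ˢ Set.Ioc c d) :=
  hH.mono_set (Set.prod_mono (Set.Ioc_subset_Ioc ha hb) (Set.Ioc_subset_Ioc hc hd))

theorem setIntegral_rect {H : ℝ × ℝ → ℝ} {a b c d : ℝ} (hab : a ≤ b) (hcd : c ≤ d)
    (hH : IntegrableOn H (Set.Ioc a b ×ˢ Set.Ioc c d)) :
    ∫ p in Set.Ioc a b ×ˢ Set.Ioc c d, H p = ∫ t in c..d, ∫ s in a..b, H (s, t) := by
  rw [IntegrableOn, Measure.volume_eq_prod, ← Measure.prod_restrict] at hH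
  rw [Measure.volume_eq_prod, ← Measure.prod_restrict, integral_prod_symm _ hH,
    intervalIntegral.integral_of_le hcd]
  refine integral_congr_ae (Eventually.of_forall fun t => ?_)
  simp only
  rw [intervalIntegral.integral_of_le hab]

/-- For a function symmetric about the origin, integration over the box reduces to the half with
nonnegative first angle, here split into two squares. -/
theorem setIntegral_box_of_even {H : ℝ × ℝ → ℝ} (hH : IntegrableOn H box)
    (he : ∀ s t, H (-s, -t) = H (s, t)) : ∫ p in box, H p =
      2 * ((∫ t in (0 : ℝ)..Real.pi, ∫ s in (0 : ℝ)..Real.pi, H (s, t)) +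
        ∫ t in (-Real.pi)..(0 : ℝ), ∫ s in (0 : ℝ)..Real.pi, H (s, t)) := by
  have hp := Real.pi_pos.le
  have hp' : -Real.pi ≤ 0 := by linarith
  have hpp : -Real.pi ≤ Real.pi := by linarith
  have hU : box = (Set.Ioc 0 Real.pi ×ˢ Set.Ioc (-Real.pi) Real.pi) ∪
      (Set.Ioc (-Real.pi) 0 ×ˢ Set.Ioc (-Real.pi) Real.pi) := by
    rw [← Set.union_prod, Set.union_comm, Set.Ioc_union_Ioc_eq_Ioc hp' hp]; rfl
  have hA : (Set.Ioc 0 Real.pi ×ˢ Set.Ioc (-Real.pi) Real.pi) =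
      (Set.Ioc 0 Real.pi ×ˢ Set.Ioc 0 Real.pi) ∪ (Set.Ioc 0 Real.pi ×ˢ Set.Ioc (-Real.pi) 0) := by
    rw [← Set.prod_union, Set.union_comm (Set.Ioc 0 Real.pi), Set.Ioc_union_Ioc_eq_Ioc hp' hp]
  have d0 : Disjoint (Set.Ioc 0 Real.pi) (Set.Ioc (-Real.pi) 0) :=
    (Set.Ioc_disjoint_Ioc_of_le le_rfl).symm
  have i1 := integrableOn_rect hH hp' le_rfl le_rfl le_rfl
  have i2 := integrableOn_rect hH le_rfl hp le_rfl le_rfl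
  have i3 := integrableOn_rect hH hp' le_rfl hp' le_rfl
  have i4 := integrableOn_rect hH hp' le_rfl le_rfl hp
  have e1 : ∫ p in Set.Ioc (-Real.pi) 0 ×ˢ Set.Ioc (-Real.pi) Real.pi, H p =
      ∫ p in Set.Ioc 0 Real.pi ×ˢ Set.Ioc (-Real.pi) Real.pi, H p := by
    rw [setIntegral_rect hp' hpp i2, setIntegral_rect hp hpp i1]
    have h1 := intervalIntegral.integral_comp_neg (a := -Real.pi) (b := Real.pi)
      (fun t => ∫ s in (-Real.pi)..0, H (s, t))
    rw [neg_neg] at h1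
    rw [← h1]
    congr 1
    ext t
    have h2 := intervalIntegral.integral_comp_neg (a := 0) (b := Real.pi) (fun s => H (s, -t))
    rw [neg_zero] at h2
    rw [← h2]
    simp only [he]
  have e2 : ∫ p in Set.Ioc 0 Real.pi ×ˢ Set.Ioc (-Real.pi) Real.pi, H p =
      (∫ t in (0 : ℝ)..Real.pi, ∫ s in (0 : ℝ)..Real.pi, H (s, t)) +
        ∫ t in (-Real.pi)..(0 : ℝ), ∫ s in (0 : ℝ)..Real.pi, H (s, t) := by
    rw [hA, setIntegral_union (Set.disjoint_prod.2 (.inr d0))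
      (measurableSet_Ioc.prod measurableSet_Ioc) i3 i4, setIntegral_rect hp hp i3,
      setIntegral_rect hp hp' i4]
  rw [hU, setIntegral_union (Set.disjoint_prod.2 (.inl d0))
      (measurableSet_Ioc.prod measurableSet_Ioc) i1 i2, e1, e2, two_mul]

theorem isSymbol_highSym {ρ c lam θ h : ℝ} (hρ : |ρ| < 1) (hc : 0 < c) (hlam : 0 < lam) (hθ : 0 < θ)
    (hh : 0 < h) (N₀ : ℕ) : IsSymbol fun s t => (highSym ρ c lam θ N₀ h s t : ℂ) := by
  obtain ⟨C, δ, hC, hδ, hb⟩ := highSym_le hρ hc hlam hθ N₀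
  refine ⟨?_, C * h ^ (2 * N₀), fun s t hs0 ht0 hs ht => ?_⟩
  · simp only [Function.uncurry_def, highSym, iota]
    fun_prop
  · rw [Complex.norm_real, Real.norm_eq_abs]
    refine (hb h s t hh hs ht hs0 ht0).trans (mul_le_mul_of_nonneg_left
      (mul_le_of_le_one_right (by positivity) (Real.exp_le_one_iff.2 ?_)) hC.le)
    have : 0 ≤ phaseHigh s t := by rw [phaseHigh]; positivity
    nlinarith

theorem re_mul_exp_exp (r : ℝ) (j k : ℤ) (s t : ℝ) : ((r : ℂ) * Complex.exp (Complex.I * j * s) *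
    Complex.exp (Complex.I * k * t)).re = r * Real.cos (j * s + k * t) := by
  rw [mul_assoc, ← Complex.exp_add,
    show Complex.I * j * s + Complex.I * k * t = ((j * s + k * t : ℝ) : ℂ) * Complex.I by
      push_cast; ring, Complex.re_ofReal_mul, Complex.exp_ofReal_mul_I_re]

theorem gridOf_ofReal {E : ℝ → ℝ → ℝ} (hE : IsSymbol fun s t => (E s t : ℂ)) (h₁ h₂ : ℝ) (j k : ℤ) :
    gridOf h₁ h₂ (fun s t => (E s t : ℂ)) j k = 1 / (4 * Real.pi ^ 2 * h₁ * h₂) *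
      ∫ p in box, E p.1 p.2 * Real.cos (j * p.1 + k * p.2) := by
  have hI := ((hE.mul (IsSymbol.expX j)).mul (IsSymbol.expY k)).integrable
  rw [gridOf, invMixedFourier_eq hE,
    show (1 / (4 * (Real.pi : ℂ) ^ 2 * h₁ * h₂)) = ((1 / (4 * Real.pi ^ 2 * h₁ * h₂) : ℝ) : ℂ) by
      push_cast; rfl, Complex.re_ofReal_mul]
  congr 1
  have h := integral_re (𝕜 := ℂ) hI
  refine h.symm.trans ?_
  rw [boxMeasure_eq]
  congr 1
  ext p
  exact re_mul_exp_exp _ j k p.1 p.2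

/-- The symbol `highSym` needs no periodization: its grid function is the high-wavenumber term itself. -/
theorem gridOf_highSym {ρ c lam θ h : ℝ} (hρ : |ρ| < 1) (hc : 0 < c) (hlam : 0 < lam) (hθ : 0 < θ)
    (hh : 0 < h) (N₀ : ℕ) (j k : ℤ) :
    gridOf h (c * h) (fun s t => (highSym ρ c lam θ N₀ h s t : ℂ)) j k =
      h ^ (2 * (N₀ : ℤ) - 2) * Chigh ρ c lam θ N₀ j k := by
  have hE := isSymbol_highSym hρ hc hlam hθ hh N₀
  have e (s t : ℝ) : highSym ρ c lam θ N₀ h s t * Real.cos (j * s + k * t) =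
      (h * c ^ 2) ^ (2 * N₀) * highIntegrand ρ c lam θ N₀ j k s t := by
    rw [highSym, highIntegrand, div_pow]
    have : -(1 / (4 * lam ^ 2 * θ ^ 2) *
      (iota ρ c s t / (Real.sin (s / 2) ^ 2 * Real.sin (t / 2) ^ 2))) =
      -(1 / (4 * lam ^ 2 * θ ^ 2)) *
      (iota ρ c s t / (Real.sin (s / 2) ^ 2 * Real.sin (t / 2) ^ 2)) := by ring
    rw [this]
    ring
  have hpos : (h * c ^ 2) ^ (2 * N₀) ≠ 0 := by positivity
  have hI : IntegrableOn (fun p : ℝ × ℝ => highIntegrand ρ c lam θ N₀ j k p.1 p.2) box := by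
    have h1 := ((hE.mul (IsSymbol.expX j)).mul (IsSymbol.expY k)).integrable.re
    rw [boxMeasure_eq] at h1
    have h2 := h1.const_mul ((h * c ^ 2) ^ (2 * N₀))⁻¹
    refine h2.congr (Eventually.of_forall fun p => ?_)
    simp only
    have h3 := re_mul_exp_exp (highSym ρ c lam θ N₀ h p.1 p.2) j k p.1 p.2
    rw [inv_mul_eq_iff_eq_mul₀ hpos, ← e]
    exact h3
  have heven (s t : ℝ) : highIntegrand ρ c lam θ N₀ j k (-s) (-t) =
      highIntegrand ρ c lam θ N₀ j k s t := by
    have hi : iota ρ c (-s) (-t) = iota ρ c s t := by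
      simp only [iota, neg_div, Real.sin_neg, Real.cos_neg]; ring
    rw [highIntegrand, highIntegrand, hi, neg_div, neg_div, Real.sin_neg, Real.sin_neg, neg_sq,
      neg_sq, show (j : ℝ) * -s + k * -t = -(j * s + k * t) by ring, Real.cos_neg]
  rw [gridOf_ofReal hE]
  simp only [e]
  have hbox := setIntegral_box_of_even hI heven
  simp only at hbox
  rw [integral_const_mul, hbox, Chigh, ← mul_add]
  generalize (∫ t in (0 : ℝ)..Real.pi, ∫ s in (0 : ℝ)..Real.pi,
    highIntegrand ρ c lam θ N₀ j k s t) = J₁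
  generalize (∫ t in (-Real.pi)..(0 : ℝ), ∫ s in (0 : ℝ)..Real.pi,
    highIntegrand ρ c lam θ N₀ j k s t) = J₂
  have e1 : h ^ (2 * (N₀ : ℤ) - 2) = h ^ (2 * N₀) / h ^ 2 := by
    rw [zpow_sub₀ hh.ne', zpow_mul, zpow_ofNat, zpow_natCast, pow_mul]
  have e2 : c ^ (4 * (N₀ : ℤ) - 1) = c ^ (4 * N₀) / c := by
    rw [zpow_sub₀ hc.ne', zpow_mul, zpow_ofNat, zpow_natCast, pow_mul, zpow_one]
  rw [e1, e2, mul_pow, ← pow_mul, show 2 * (2 * N₀) = 4 * N₀ by ring]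
  have := Real.pi_pos
  field_simp
  norm_num

theorem abs_gridOf_le {E : ℝ → ℝ → ℂ} (hE : IsSymbol E) {h₁ h₂ : ℝ} (hh₁ : 0 < h₁) (hh₂ : 0 < h₂)
    (j k : ℤ) : |gridOf h₁ h₂ E j k| ≤
      1 / (4 * Real.pi ^ 2 * h₁ * h₂) * ∫ p, ‖E p.1 p.2‖ ∂boxMeasure := by
  have hp := Real.pi_pos
  refine (Complex.abs_re_le_norm _).trans ?_
  rw [invMixedFourier_eq hE, norm_mul,
    show (1 / (4 * (Real.pi : ℂ) ^ 2 * h₁ * h₂)) = ((1 / (4 * Real.pi ^ 2 * h₁ * h₂) : ℝ) : ℂ) by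
      push_cast; rfl, Complex.norm_real, Real.norm_of_nonneg (by positivity)]
  refine mul_le_mul_of_nonneg_left ((norm_integral_le_integral_norm _).trans (le_of_eq ?_))
    (by positivity)
  congr 1
  ext p
  rw [norm_mul, norm_mul, norm_exp_I_int, norm_exp_I_int, mul_one, mul_one]

/-- The coefficient is the grid function of `highSym` for `h = 1`, whose symbol is integrable. -/
theorem exists_abs_Chigh_le {ρ c lam θ : ℝ} (hρ : |ρ| < 1) (hc : 0 < c) (hlam : 0 < lam)
    (hθ : 0 < θ) (N₀ : ℕ) : ∃ C : ℝ, 0 < C ∧ ∀ j k, |Chigh ρ c lam θ N₀ j k| ≤ C := by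
  refine ⟨1 / (4 * Real.pi ^ 2 * 1 * (c * 1)) *
    (∫ p, ‖(highSym ρ c lam θ N₀ 1 p.1 p.2 : ℂ)‖ ∂boxMeasure) + 1, ?_, fun j k => ?_⟩
  · have := Real.pi_pos
    positivity
  · have h1 := abs_gridOf_le (isSymbol_highSym hρ hc hlam hθ one_pos N₀) one_pos
      (mul_pos hc one_pos) j k
    rw [gridOf_highSym hρ hc hlam hθ one_pos, one_zpow, one_mul] at h1
    linarith

/-! ### The Craig--Sneyd part of the approximation -/

theorem phi_eq (x : ℝ) : phi x = 1 / √(2 * Real.pi) * Real.exp (-(x ^ 2 / 2)) := by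
  rw [phi, ProbabilityTheory.gaussianPDFReal]
  simp only [NNReal.coe_one, sub_zero, mul_one]
  rw [one_div, neg_div]

/-- The Fourier integral of the one-dimensional Gaussian factor of `csSym`. -/
theorem integral_exp_psi_mul (a : ℝ) {m : ℝ} (hm : 0 < m) (k : ℤ) :
    ∫ t : ℝ, Complex.exp (psi a (t / m)) * Complex.exp (Complex.I * k * t) =
      ((m * √Real.pi * Real.exp (-((k * m + a) ^ 2 / 4)) : ℝ) : ℂ) := by
  have hmc : (m : ℂ) ≠ 0 := by exact_mod_cast hm.ne'
  have h := integral_cexp_neg_mul_sq_add (b := 1 / m ^ 2) (by positivity)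
    (Complex.I * (a / m + k)) 0
  have e1 : √(Real.pi / (1 / m ^ 2)) = m * √Real.pi := by
    rw [div_div_eq_mul_div, div_one, Real.sqrt_mul Real.pi_pos.le, Real.sqrt_sq hm.le, mul_comm]
  rw [e1] at h
  calc _ = ∫ t : ℝ, Complex.exp (-((1 / m ^ 2 : ℝ) : ℂ) * (t : ℂ) ^ 2 +
        Complex.I * (a / m + k) * t + 0) := by
        congr 1
        ext t
        rw [← Complex.exp_add, psi]
        congr 1
        push_cast
        field_simp
        ring
    _ = _ := by
        rw [h, Complex.ofReal_mul _ (Real.exp _), Complex.ofReal_exp]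
        congr 2
        push_cast
        field_simp
        linear_combination ((a : ℂ) + k * m) ^ 2 * Complex.I_sq

/-- The Craig--Sneyd term is, on the grid, the inverse transform of `csSym` up to aliasing. The Gaussian
factor is periodized in the second variable; in the first one `csSym` is cut off outside `(-π, π]`,
so that no other period contributes. -/
theorem exists_cs_fold (a : ℝ) {c lam : ℝ} (hc : 0 < c) (hlam : 0 < lam) (N₀ w : ℕ) :
    ∃ K : ℝ, 0 < K ∧ ∀ N, N₀ ≤ N → ∀ h, 0 < h → h ≤ 1 → ∃ E : ℝ → ℝ → ℂ, IsSymbol E ∧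
      (∀ p ∈ box, p.1 ≠ 0 → ‖E p.1 p.2 - csSym a c lam N₀ N h p.1 p.2‖ ≤ K * h ^ w) ∧
      ∀ j k : ℤ, gridOf h (c * h) E j k = h ^ (2 * (N₀ : ℤ) - 1) *
        (-1 : ℝ) ^ ((N : ℤ) - (N₀ : ℤ)) * CcsX a lam N₀ j (k * (c * h)) := by
  classical
  obtain ⟨C, δ, hC, hδ, hb⟩ := norm_csSym_le a (c := c) hlam N₀
  have hν : 0 < δ * (1 / c ^ 2) / 2 := by positivity
  obtain ⟨K, hK, hfold⟩ := exists_fold hν hC w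
  refine ⟨K, hK, fun N hN h hh hh1 => ?_⟩
  obtain ⟨S, hS⟩ : ∃ S : Set ℝ, S = Set.Ioc (-Real.pi) Real.pi \ {0} := ⟨_, rfl⟩
  have hSm : MeasurableSet S := hS ▸ measurableSet_Ioc.diff (measurableSet_singleton 0)
  obtain ⟨g, hg⟩ : ∃ g : ℝ → ℝ, g = fun s =>
    (-1) ^ (N - N₀) * (h / (2 * lam * Real.sin (s / 2) ^ 2)) ^ (2 * N₀) *
    Real.exp (-(1 / (lam ^ 2 * Real.sin (s / 2) ^ 2))) := ⟨_, rfl⟩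
  have hcs (s t : ℝ) : csSym a c lam N₀ N h s t = (g s : ℂ) * Complex.exp (psi a (t / (c * h))) := by
    rw [csSym, hg]
  have hgm : Measurable g := by rw [hg]; fun_prop
  obtain ⟨F, hF⟩ : ∃ F : ℝ → ℝ → ℂ, F = fun s t =>
    S.indicator (fun s => (g s : ℂ)) s * Complex.exp (psi a (t / (c * h))) := ⟨_, rfl⟩
  have hFS {s : ℝ} (hs : s ∈ S) (t : ℝ) : F s t = csSym a c lam N₀ N h s t := by
    rw [hF, hcs]; simp only [Set.indicator_of_mem hs]
  have hFS' {s : ℝ} (hs : s ∉ S) (t : ℝ) : F s t = 0 := by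
    rw [hF]; simp only [Set.indicator_of_notMem hs, zero_mul]
  have hh2 : h ^ (2 * N₀) ≤ 1 := pow_le_one₀ hh.le hh1
  have hSmem {s : ℝ} (hs : s ∈ S) : |s| ≤ Real.pi ∧ s ≠ 0 := by
    rw [hS] at hs; exact ⟨abs_le.2 ⟨hs.1.1.le, hs.1.2⟩, hs.2⟩
  have hFle (s t : ℝ) : ‖F s t‖ ≤ C * Real.exp (-(δ * (t / (c * h)) ^ 2)) := by
    by_cases hs : s ∈ S
    · rw [hFS hs]
      refine (hb N h s t hh (hSmem hs).1 (hSmem hs).2).trans (mul_le_mul_of_nonneg_left ?_ hC.le)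
      refine (mul_le_of_le_one_left (Real.exp_pos _).le hh2).trans (Real.exp_le_exp.2 ?_)
      rw [phaseCS]
      nlinarith [sq_nonneg (1 / s)]
    · rw [hFS' hs, norm_zero]; positivity
  have hpsi : Measurable fun t : ℝ => Complex.exp (psi a (t / (c * h))) := by
    unfold psi; fun_prop
  have hind : Measurable (S.indicator fun s => (g s : ℂ)) :=
    (Complex.measurable_ofReal.comp hgm).indicator hSm
  have hFm : Measurable (Function.uncurry F) := by
    rw [hF]
    exact (hind.comp measurable_fst).mul (hpsi.comp measurable_snd)
  have hind1 : Integrable (S.indicator fun s => (g s : ℂ)) := by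
    rw [integrable_indicator_iff hSm]
    refine Measure.integrableOn_of_bounded (M := C) ?_
      (Complex.measurable_ofReal.comp hgm).aestronglyMeasurable ?_
    · rw [hS]
      exact ((measure_mono Set.sdiff_subset).trans_lt (by simp)).ne
    · filter_upwards [ae_restrict_mem hSm] with s hs
      have h1 := hFle s 0
      rw [hFS hs, hcs, norm_mul, norm_exp_psi] at h1
      simpa using h1
  have hexp : Integrable fun t : ℝ => Complex.exp (psi a (t / (c * h))) := by
    refine (integrable_exp_neg_mul_sq (b := 1 / (c * h) ^ 2) (by positivity)).mono'
      hpsi.aestronglyMeasurable (Eventually.of_forall fun t => ?_)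
    rw [norm_exp_psi]
    refine le_of_eq ?_
    congr 1
    field_simp
  have hFi : Integrable (Function.uncurry F) := by
    rw [hF]
    exact hind1.mul_prod hexp
  obtain ⟨E, hE, hEF, hEI⟩ := hfold h hh F hFm hFi ⟨C, fun s t => (hFle s t).trans
    (mul_le_of_le_one_right hC.le (Real.exp_le_one_iff.2 (by
      have : 0 ≤ δ * (t / (c * h)) ^ 2 := by positivity
      linarith)))⟩ (fun n hn p hp => by
    by_cases hn1 : n.1 = 0
    · have hn2 : n.2 ≠ 0 := fun h2 => hn (Prod.ext hn1 h2)
      refine (hFle _ _).trans (mul_le_mul_of_nonneg_left (Real.exp_le_exp.2 (neg_le_neg ?_)) hC.le)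
      have q2 : |(n.2 : ℝ)| ≤ (p.2 + 2 * Real.pi * n.2) ^ 2 := (abs_le_sq_of_int _).trans (by
        rw [← sq_abs (p.2 + _)]
        exact pow_le_pow_left₀ (by positivity) (pi_mul_abs_le hp.2 _) 2)
      have q3 : (1 : ℝ) ≤ |(n.2 : ℝ)| := by exact_mod_cast Int.one_le_abs hn2
      have q4 : 1 ≤ 1 / h := by rw [le_div_iff₀ hh]; linarith
      have q5 : 1 / h ≤ 1 / h ^ 2 := by
        rw [← one_div_pow]; nlinarith
      have q7 : 1 / h + |(n.2 : ℝ)| ≤ 2 * (|(n.2 : ℝ)| * (1 / h ^ 2)) := by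
        have := mul_le_mul q3 q5 (by positivity) (by positivity)
        have := mul_le_mul_of_nonneg_left (q4.trans q5) (abs_nonneg (n.2 : ℝ))
        linarith
      have q8 : |(n.2 : ℝ)| * (1 / h ^ 2) * (1 / c ^ 2) ≤
          ((p.2 + 2 * Real.pi * n.2) / (c * h)) ^ 2 := by
        rw [div_pow]
        calc _ = |(n.2 : ℝ)| / (c * h) ^ 2 := by field_simp
          _ ≤ _ := by gcongr
      rw [hn1, Int.cast_zero, abs_zero, zero_add]
      have q9 := mul_le_mul_of_nonneg_left q8 hδ.le
      have q10 := mul_le_mul_of_nonneg_left q7 hν.le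
      linarith
    · have : p.1 + 2 * Real.pi * n.1 ∉ S := fun hs => by
        rw [hS] at hs
        have h1 := pi_mul_abs_le hp.1 n.1
        have h3 : (1 : ℝ) ≤ |(n.1 : ℝ)| := by exact_mod_cast Int.one_le_abs hn1
        have hpi := Real.pi_pos
        have h4 := hs.1.1
        have h5 := hs.1.2
        have h6 := hp.1.1
        have h7 := hp.1.2
        have h8 : (n.1 : ℝ) < 1 := by nlinarith
        have h9 : -1 < (n.1 : ℝ) := by nlinarith
        have h10 : n.1 < 1 := by exact_mod_cast h8
        have h11 : -1 < n.1 := by exact_mod_cast h9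
        omega
      rw [hFS' this, norm_zero]
      positivity)
  refine ⟨E, hE, fun p hp hp0 => ?_, fun j k => ?_⟩
  · have hpS : p.1 ∈ S := by rw [hS]; exact ⟨hp.1, hp0⟩
    rw [← hFS hpS]
    exact hEF p hp
  · have e (p : ℝ × ℝ) : F p.1 p.2 * Complex.exp (Complex.I * j * p.1) *
        Complex.exp (Complex.I * k * p.2) =
        (S.indicator (fun s => (g s : ℂ)) p.1 * Complex.exp (Complex.I * j * p.1)) *
        (Complex.exp (psi a (p.2 / (c * h))) * Complex.exp (Complex.I * k * p.2)) := by
      rw [hF]; ring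
    have hind2 : Integrable fun s : ℝ =>
        S.indicator (fun s => (g s : ℂ)) s * Complex.exp (Complex.I * j * s) :=
      hind1.mul_bdd (c := 1) (Continuous.aestronglyMeasurable (by fun_prop))
        (Eventually.of_forall fun s => (norm_exp_I_int j s).le)
    have e3 : (∫ s : ℝ, S.indicator (fun s => (g s : ℂ)) s * Complex.exp (Complex.I * j * s)).re =
        ∫ s in (-Real.pi)..Real.pi, g s * Real.cos (j * s) := by
      refine (integral_re (𝕜 := ℂ) hind2).symm.trans ?_
      rw [intervalIntegral.integral_of_le (by linarith [Real.pi_pos]),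
        ← integral_indicator measurableSet_Ioc]
      refine integral_congr_ae ?_
      filter_upwards [Measure.ae_ne volume (0 : ℝ)] with s hs0
      have h1 : (((g s : ℝ) : ℂ) * Complex.exp (Complex.I * j * s)).re = g s * Real.cos (j * s) := by
        rw [show Complex.I * j * s = ((j * s : ℝ) : ℂ) * Complex.I by push_cast; ring,
          Complex.re_ofReal_mul, Complex.exp_ofReal_mul_I_re]
      by_cases hs : s ∈ Set.Ioc (-Real.pi) Real.pi
      · have hs' : s ∈ S := by rw [hS]; exact ⟨hs, hs0⟩
        rw [Set.indicator_of_mem hs', Set.indicator_of_mem hs]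
        exact h1
      · have hs' : s ∉ S := by rw [hS]; exact fun h => hs h.1
        rw [Set.indicator_of_notMem hs', Set.indicator_of_notMem hs, zero_mul]
        simp
    rw [gridOf, hEI]
    simp only [e]
    rw [Measure.volume_eq_prod, integral_prod_mul (fun s : ℝ =>
      S.indicator (fun s => (g s : ℂ)) s * Complex.exp (Complex.I * j * s))
      (fun t : ℝ => Complex.exp (psi a (t / (c * h))) * Complex.exp (Complex.I * k * t)),
      integral_exp_psi_mul a (mul_pos hc hh),
      show (1 / (4 * (Real.pi : ℂ) ^ 2 * h * (c * h : ℝ))) =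
        ((1 / (4 * Real.pi ^ 2 * h * (c * h)) : ℝ) : ℂ) by push_cast; rfl,
      Complex.re_ofReal_mul, Complex.re_mul_ofReal, e3, CcsX, phi_eq]
    have e4 : ∫ s in (-Real.pi)..Real.pi, g s * Real.cos (j * s) = (-1) ^ (N - N₀) * h ^ (2 * N₀) *
        ∫ s in (-Real.pi)..Real.pi, Real.cos (j * s) / (2 * lam * Real.sin (s / 2) ^ 2) ^ (2 * N₀) *
        Real.exp (-(1 / (lam ^ 2 * Real.sin (s / 2) ^ 2))) := by
      rw [← intervalIntegral.integral_const_mul]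
      congr 1
      ext s
      rw [hg]
      simp only [div_pow]
      ring
    rw [e4]
    generalize (∫ s in (-Real.pi)..Real.pi,
      Real.cos (j * s) / (2 * lam * Real.sin (s / 2) ^ 2) ^ (2 * N₀) *
        Real.exp (-(1 / (lam ^ 2 * Real.sin (s / 2) ^ 2)))) = J
    have e5 : ((N : ℤ) - (N₀ : ℤ)) = ((N - N₀ : ℕ) : ℤ) := by omega
    have e6 : h ^ (2 * (N₀ : ℤ) - 1) = h ^ (2 * N₀) / h := by
      rw [zpow_sub₀ hh.ne', zpow_mul, zpow_ofNat, zpow_natCast, pow_mul, zpow_one]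
    have e7 : ((k * (c * h) + a) / √2) ^ 2 / 2 = (k * (c * h) + a) ^ 2 / 4 := by
      rw [div_pow, Real.sq_sqrt (by norm_num)]; ring
    have hp := Real.pi_pos
    have e8 : √2 * √(2 * Real.pi) = 2 * √Real.pi := by
      rw [Real.sqrt_mul (by norm_num), ← mul_assoc, Real.mul_self_sqrt (by norm_num)]
    have e9 : √Real.pi * √Real.pi = Real.pi := Real.mul_self_sqrt hp.le
    have e10 : 1 / (2 * √2 * Real.pi) * (1 / √(2 * Real.pi)) = √Real.pi / (4 * Real.pi ^ 2) := by
      rw [show 1 / (2 * √2 * Real.pi) * (1 / √(2 * Real.pi)) =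
        1 / (2 * Real.pi * (√2 * √(2 * Real.pi))) by field_simp, e8]
      rw [div_eq_div_iff (by positivity) (by positivity)]
      linear_combination (-4 * Real.pi) * e9
    rw [e5, zpow_natCast, e6, e7]
    calc _ = √Real.pi / (4 * Real.pi ^ 2) * (h ^ (2 * N₀) / h * (-1) ^ (N - N₀) *
          Real.exp (-((k * (c * h) + a) ^ 2 / 4)) * J) := by field_simp
      _ = _ := by rw [← e10]; ring

theorem exists_abs_CcsX_le (a : ℝ) {lam : ℝ} (hlam : 0 < lam) (N₀ : ℕ) :
    ∃ C : ℝ, 0 < C ∧ ∀ j y, |CcsX a lam N₀ j y| ≤ C := by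
  obtain ⟨C, δ, hC, hδ, hb⟩ := norm_csSym_le 0 (c := 1) hlam N₀
  have hp := Real.pi_pos
  have hint (j : ℤ) : ‖∫ s in (-Real.pi)..Real.pi,
      Real.cos (j * s) / (2 * lam * Real.sin (s / 2) ^ 2) ^ (2 * N₀) *
        Real.exp (-(1 / (lam ^ 2 * Real.sin (s / 2) ^ 2)))‖ ≤ C * |Real.pi - -Real.pi| := by
    refine intervalIntegral.norm_integral_le_of_norm_le_const_ae ?_
    filter_upwards [Measure.ae_ne volume (0 : ℝ)] with s hs0 hs
    rw [Set.uIoc_of_le (by linarith)] at hs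
    have h1 := hb 0 1 s 0 one_pos (abs_le.2 ⟨hs.1.le, hs.2⟩) hs0
    have hg : 0 ≤ (1 / (2 * lam * Real.sin (s / 2) ^ 2)) ^ (2 * N₀) *
        Real.exp (-(1 / (lam ^ 2 * Real.sin (s / 2) ^ 2))) := by positivity
    rw [csSym, norm_mul, norm_exp_psi, Nat.zero_sub, pow_zero, one_mul, Complex.norm_real,
      Real.norm_of_nonneg hg, one_pow, zero_div, one_mul] at h1
    simp only [ne_eq, OfNat.ofNat_ne_zero, not_false_eq_true, zero_pow, neg_zero, Real.exp_zero,
      mul_one] at h1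
    have h2 : Real.exp (-(δ * phaseCS 1 1 s 0)) ≤ 1 := by
      refine Real.exp_le_one_iff.2 ?_
      have : 0 ≤ phaseCS 1 1 s 0 := by rw [phaseCS]; positivity
      nlinarith
    have h3 : (1 / (2 * lam * Real.sin (s / 2) ^ 2)) ^ (2 * N₀) *
        Real.exp (-(1 / (lam ^ 2 * Real.sin (s / 2) ^ 2))) ≤ C :=
      h1.trans (mul_le_of_le_one_right hC.le h2)
    rw [div_mul_eq_mul_div, mul_div_assoc, norm_mul]
    refine (mul_le_of_le_one_left (norm_nonneg _) (Real.abs_cos_le_one _)).trans ?_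
    rw [one_div_pow, one_div_mul_eq_div] at h3 hg
    rwa [Real.norm_of_nonneg hg]
  refine ⟨1 / (2 * √2 * Real.pi) * (1 / √(2 * Real.pi)) * (C * |Real.pi - -Real.pi|) + 1,
    by positivity, fun j y => ?_⟩
  rw [CcsX, abs_mul, phi_eq, abs_of_nonneg (by positivity)]
  have h1 : Real.exp (-(((y + a) / √2) ^ 2 / 2)) ≤ 1 := by
    refine Real.exp_le_one_iff.2 ?_
    have : 0 ≤ ((y + a) / √2) ^ 2 / 2 := by positivity
    linarith
  have h2 : 1 / (2 * √2 * Real.pi) * (1 / √(2 * Real.pi) * Real.exp (-(((y + a) / √2) ^ 2 / 2))) ≤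
      1 / (2 * √2 * Real.pi) * (1 / √(2 * Real.pi)) :=
    mul_le_mul_of_nonneg_left (mul_le_of_le_one_right (by positivity) h1) (by positivity)
  have h3 := mul_le_mul h2 (hint j) (norm_nonneg _) (by positivity)
  rw [Real.norm_eq_abs] at h3
  linarith

/-- Exchanging the two coordinate directions, which rescales `c`, `lam` and `h`. -/
theorem CcsX_swap (a : ℝ) {c lam h : ℝ} (hc : 0 < c) (hlam : 0 < lam) (hh : 0 < h) (N₀ : ℕ)
    (k : ℤ) (x : ℝ) : (c * h) ^ (2 * (N₀ : ℤ) - 1) * CcsX a (lam / c) N₀ k x =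
      h ^ (2 * (N₀ : ℤ) - 1) * CcsY a c lam N₀ x k := by
  have e6 : (c * h) ^ (2 * (N₀ : ℤ) - 1) = c ^ (2 * N₀) / c * h ^ (2 * (N₀ : ℤ) - 1) := by
    rw [mul_zpow]
    congr 1
    rw [zpow_sub₀ hc.ne', zpow_mul, zpow_ofNat, zpow_natCast, pow_mul, zpow_one]
  have e4 : (∫ t in (-Real.pi)..Real.pi,
      Real.cos (k * t) / (2 * (lam / c ^ 2) * Real.sin (t / 2) ^ 2) ^ (2 * N₀) *
        Real.exp (-(c ^ 2 / (lam ^ 2 * Real.sin (t / 2) ^ 2)))) = c ^ (2 * N₀) *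
      ∫ s in (-Real.pi)..Real.pi, Real.cos (k * s) / (2 * (lam / c) * Real.sin (s / 2) ^ 2) ^ (2 * N₀) *
        Real.exp (-(1 / ((lam / c) ^ 2 * Real.sin (s / 2) ^ 2))) := by
    rw [← intervalIntegral.integral_const_mul]
    congr 1
    ext s
    have h1 : c ^ 2 / (lam ^ 2 * Real.sin (s / 2) ^ 2) =
        1 / ((lam / c) ^ 2 * Real.sin (s / 2) ^ 2) := by
      rw [div_pow, div_mul_eq_mul_div, one_div_div]
    have h2 : 2 * (lam / c ^ 2) * Real.sin (s / 2) ^ 2 =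
        2 * (lam / c) * Real.sin (s / 2) ^ 2 / c := by field_simp
    rw [h1, h2, div_pow _ c, div_div_eq_mul_div]
    ring
  rw [e6, CcsX, CcsY, e4]
  generalize (∫ s in (-Real.pi)..Real.pi,
    Real.cos (k * s) / (2 * (lam / c) * Real.sin (s / 2) ^ 2) ^ (2 * N₀) *
        Real.exp (-(1 / ((lam / c) ^ 2 * Real.sin (s / 2) ^ 2)))) = J
  have := Real.pi_pos
  field_simp

theorem exists_abs_CcsY_le (a : ℝ) {c lam : ℝ} (hc : 0 < c) (hlam : 0 < lam) (N₀ : ℕ) :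
    ∃ C : ℝ, 0 < C ∧ ∀ x k, |CcsY a c lam N₀ x k| ≤ C := by
  obtain ⟨C, hC, hb⟩ := exists_abs_CcsX_le a (div_pos hlam hc) N₀
  refine ⟨(c * 1) ^ (2 * (N₀ : ℤ) - 1) * C, by positivity, fun x k => ?_⟩
  have h1 := CcsX_swap a hc hlam one_pos N₀ k x
  rw [one_zpow, one_mul (CcsY _ _ _ _ _ _)] at h1
  rw [← h1, abs_mul, abs_of_pos (by positivity)]
  exact mul_le_mul_of_nonneg_left (hb k x) (by positivity)

theorem IsSymbol.swap {E : ℝ → ℝ → ℂ} (hE : IsSymbol E) : IsSymbol fun s t => E t s := by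
  obtain ⟨C, hC⟩ := hE.bounded
  exact ⟨hE.measurable.comp measurable_swap, C, fun s t h1 h2 h3 h4 => hC t s h2 h1 h4 h3⟩

theorem gridOf_swap {E : ℝ → ℝ → ℂ} (hE : IsSymbol E) (h₁ h₂ : ℝ) (j k : ℤ) :
    gridOf h₁ h₂ (fun s t => E t s) j k = gridOf h₂ h₁ E k j := by
  rw [gridOf, gridOf, invMixedFourier_eq hE, invMixedFourier_eq hE.swap]
  unfold boxMeasure
  rw [← integral_prod_swap]
  congr 2
  · ring
  · congr 1
    ext p
    simp only [Prod.fst_swap, Prod.snd_swap]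
    ring

/-- The second Craig--Sneyd term, from the first one by exchanging the coordinate directions. -/
theorem exists_cs_fold_swap (a : ℝ) {c lam : ℝ} (hc : 0 < c) (hlam : 0 < lam) (N₀ w : ℕ) :
    ∃ K : ℝ, 0 < K ∧ ∀ N, N₀ ≤ N → ∀ h, 0 < h → c * h ≤ 1 → ∃ E : ℝ → ℝ → ℂ, IsSymbol E ∧
      (∀ p ∈ box, p.2 ≠ 0 →
        ‖E p.1 p.2 - csSym a c⁻¹ (lam / c) N₀ N (c * h) p.2 p.1‖ ≤ K * h ^ w) ∧
      ∀ j k : ℤ, gridOf h (c * h) E j k = h ^ (2 * (N₀ : ℤ) - 1) *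
        (-1 : ℝ) ^ ((N : ℤ) - (N₀ : ℤ)) * CcsY a c lam N₀ (j * h) k := by
  obtain ⟨K, hK, hf⟩ := exists_cs_fold a (inv_pos.2 hc) (div_pos hlam hc) N₀ w
  refine ⟨K * c ^ w, by positivity, fun N hN h hh hch => ?_⟩
  obtain ⟨E, hE, hEF, hEI⟩ := hf N hN (c * h) (by positivity) hch
  refine ⟨fun s t => E t s, hE.swap, fun p hp h0 => ?_, fun j k => ?_⟩
  · have := hEF (p.2, p.1) ⟨hp.2, hp.1⟩ h0
    rwa [mul_pow, ← mul_assoc] at this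
  · rw [gridOf_swap hE]
    have := hEI k j
    rw [inv_mul_cancel_left₀ hc.ne'] at this
    rw [this, mul_right_comm, CcsX_swap a hc hlam hh]
    ring

/-! ### Symbols of real grid functions -/

/-- The reflected conjugate of a symbol is the symbol of the conjugate grid function. -/
theorem invMixedFourier_conj_neg (E : ℝ → ℝ → ℂ) (h₁ h₂ : ℝ) (j k : ℤ) :
    invMixedFourier h₁ h₂ (fun s t => (starRingEnd ℂ) (E (-s) (-t))) j k =
      (starRingEnd ℂ) (invMixedFourier h₁ h₂ E j k) := by
  have conj_int (f : ℝ → ℂ) : ∫ s in (-Real.pi)..Real.pi, (starRingEnd ℂ) (f s) =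
      (starRingEnd ℂ) (∫ s in (-Real.pi)..Real.pi, f s) := by
    rw [intervalIntegral.integral_of_le (by linarith [Real.pi_pos]),
      intervalIntegral.integral_of_le (by linarith [Real.pi_pos]), integral_conj]
  have neg_int (f : ℝ → ℂ) : ∫ s in (-Real.pi)..Real.pi, f (-s) =
      ∫ s in (-Real.pi)..Real.pi, f s := by
    rw [intervalIntegral.integral_comp_neg, neg_neg]
  unfold invMixedFourier
  rw [map_mul, ← conj_int, ← neg_int]
  congr 1
  · simp only [map_div₀, map_one, map_mul, map_pow, Complex.conj_ofReal, map_ofNat]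
  · congr 1
    ext t
    rw [← conj_int, ← neg_int]
    congr 1
    ext s
    simp only [neg_neg, map_mul, ← Complex.exp_conj, Complex.conj_I, Complex.conj_ofReal,
      Complex.ofReal_neg, map_intCast, neg_mul, mul_neg]

theorem invMixedFourier_congr {E F : ℝ → ℝ → ℂ} (hE : IsSymbol E) (hF : IsSymbol F)
    (h : ∀ s t, |s| < Real.pi → |t| < Real.pi → E s t = F s t) (h₁ h₂ : ℝ) (j k : ℤ) :
    invMixedFourier h₁ h₂ E j k = invMixedFourier h₁ h₂ F j k := by
  rw [invMixedFourier_eq hE, invMixedFourier_eq hF, boxMeasure_eq]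
  congr 1
  refine integral_congr_ae ?_
  have h1 : ∀ᵐ s : ℝ, s ≠ Real.pi := Measure.ae_ne volume _
  have hx := (Measure.quasiMeasurePreserving_fst (μ := (volume : Measure ℝ))
    (ν := (volume : Measure ℝ))).ae h1
  have hy := (Measure.quasiMeasurePreserving_snd (μ := (volume : Measure ℝ))
    (ν := (volume : Measure ℝ))).ae h1
  filter_upwards [ae_restrict_mem measurableSet_box, ae_restrict_of_ae hx, ae_restrict_of_ae hy]
    with p hp hpx hpy
  rw [h p.1 p.2 (abs_lt.2 ⟨hp.1.1, lt_of_le_of_ne hp.1.2 hpx⟩)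
    (abs_lt.2 ⟨hp.2.1, lt_of_le_of_ne hp.2.2 hpy⟩)]

/-- A real part is taken in `gridOf`, while `HasFourierBound` asks for the full transform: averaging the
symbol with its reflected conjugate makes the transform real and keeps an even bound. On the sides of
the square, where the reflection leaves `(-π, π]²`, the symbol is set to zero. -/
theorem hasFourierBound_gridOf {E : ℝ → ℝ → ℂ} (hE : IsSymbol E) {B : ℝ → ℝ → ℝ}
    (hB : ∀ s t, s ≠ 0 → t ≠ 0 → |s| < Real.pi → |t| < Real.pi → ‖E s t‖ ≤ B s t)
    (hBe : ∀ s t, B (-s) (-t) = B s t) (hB0 : ∀ s t, 0 ≤ B s t) (h₁ h₂ : ℝ) :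
    HasFourierBound h₁ h₂ (gridOf h₁ h₂ E) B := by
  classical
  obtain ⟨E', hE'⟩ : ∃ E' : ℝ → ℝ → ℂ, E' = fun s t => (starRingEnd ℂ) (E (-s) (-t)) := ⟨_, rfl⟩
  have hE's : IsSymbol E' := by
    obtain ⟨C, hC⟩ := hE.bounded
    refine ⟨?_, C, fun s t h1 h2 h3 h4 => ?_⟩
    · rw [hE']
      have : Measurable fun p : ℝ × ℝ => (-p.1, -p.2) := by fun_prop
      exact (RCLike.continuous_conj (K := ℂ)).measurable.comp (hE.measurable.comp this)
    · rw [hE']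
      simp only [RCLike.norm_conj]
      exact hC _ _ (neg_ne_zero.2 h1) (neg_ne_zero.2 h2) (by rwa [abs_neg]) (by rwa [abs_neg])
  have hG := (IsSymbol.const (1 / 2)).mul (hE.add hE's)
  obtain ⟨F, hF⟩ : ∃ F : ℝ → ℝ → ℂ, F = fun s t => if |s| < Real.pi ∧ |t| < Real.pi then
    1 / 2 * (E s t + E' s t) else 0 := ⟨_, rfl⟩
  have hFs : IsSymbol F := by
    obtain ⟨C, hC⟩ := hG.bounded
    refine ⟨?_, max C 0, fun s t h1 h2 h3 h4 => ?_⟩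
    · rw [hF]
      refine Measurable.ite ?_ hG.measurable measurable_const
      exact (measurableSet_lt measurable_fst.abs measurable_const).inter
        (measurableSet_lt measurable_snd.abs measurable_const)
    · rw [hF]
      simp only
      split_ifs
      · exact (hC s t h1 h2 h3 h4).trans (le_max_left _ _)
      · simp
  refine ⟨F, hFs.measurable, fun j k => ?_, fun s t hs hs' ht ht' => ?_⟩
  · rw [invMixedFourier_congr hFs hG (fun s t hs ht => by rw [hF]; simp only [if_pos (And.intro hs ht)]),
      invMixedFourier_const_mul, invMixedFourier_add hE hE's, hE', invMixedFourier_conj_neg,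
      Complex.add_conj, gridOf]
    push_cast
    ring
  · rw [hF]
    simp only
    split_ifs with hlt
    · have h1 := hB s t (abs_pos.1 hs) (abs_pos.1 ht) hlt.1 hlt.2
      have h2 := hB (-s) (-t) (neg_ne_zero.2 (abs_pos.1 hs)) (neg_ne_zero.2 (abs_pos.1 ht))
        (by rw [abs_neg]; exact hlt.1) (by rw [abs_neg]; exact hlt.2)
      rw [hBe] at h2
      have h3 : ‖E' s t‖ ≤ B s t := by rw [hE']; simpa only [RCLike.norm_conj] using h2
      rw [norm_mul]
      have h4 := norm_add_le (E s t) (E' s t)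
      have h5 : ‖(1 / 2 : ℂ)‖ = 1 / 2 := by norm_num
      rw [h5]
      linarith
    · rw [norm_zero]; exact hB0 s t

/-! ### The error of the approximation, uniformly in the angles -/

/-- Where a phase exceeds `h ^ (-1/4)`, its exponential is smaller than any power of `h`. -/
theorem exists_exp_far_le {δ b : ℝ} (hδ : 0 < δ) (hb : 0 < b) (w : ℕ) : ∃ K : ℝ, 0 < K ∧
    ∀ h P : ℝ, 0 < h → 0 ≤ P → 1 < P ^ 4 * (b * h) → Real.exp (-(δ * P)) ≤ K * h ^ w := by
  obtain ⟨K, hK, H⟩ := exists_pow_mul_exp_le hδ (4 * w)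
  refine ⟨K * b ^ w, by positivity, fun h P hh hP hfar => ?_⟩
  have h1 : 1 ≤ (P ^ 4 * (b * h)) ^ w := one_le_pow₀ hfar.le
  calc Real.exp (-(δ * P)) ≤ (P ^ 4 * (b * h)) ^ w * Real.exp (-(δ * P)) :=
        le_mul_of_one_le_left (Real.exp_pos _).le h1
    _ = P ^ (4 * w) * Real.exp (-(δ * P)) * (b * h) ^ w := by rw [mul_pow, ← pow_mul]; ring
    _ ≤ K * (b * h) ^ w := mul_le_mul_of_nonneg_right (H P hP) (by positivity)
    _ = _ := by rw [mul_pow]; ring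

/-- Two phases whose product is of order `h⁻²` are not both below `h ^ (-1/4)`. -/
theorem far_of_near {P Q a b κ m h : ℝ} (hh : 0 < h) (hm : 0 < m)
    (hκ : 0 < κ) (hma : m ≤ a) (hmb : m ≤ b) (hsmall : h ^ 6 < κ ^ 4 * (m * m))
    (hPQ : κ ≤ P * Q * h ^ 2) (hP4 : P ^ 4 * (a * h) ≤ 1) : 1 < Q ^ 4 * (b * h) := by
  have h1 : κ ^ 4 ≤ (P * Q * h ^ 2) ^ 4 := pow_le_pow_left₀ hκ.le hPQ 4
  have h2 : κ ^ 4 * (m * m) ≤ (P * Q * h ^ 2) ^ 4 * (a * b) :=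
    mul_le_mul h1 (mul_le_mul hma hmb hm.le (hm.le.trans hma)) (by positivity) (by positivity)
  have h3 : (P * Q * h ^ 2) ^ 4 * (a * b) = (P ^ 4 * (a * h)) * (Q ^ 4 * (b * h)) * h ^ 6 := by ring
  have hb : 0 < b := hm.trans_le hmb
  have h4 : 0 ≤ Q ^ 4 * (b * h) := by positivity
  have h5 : (P ^ 4 * (a * h)) * (Q ^ 4 * (b * h)) ≤ Q ^ 4 * (b * h) := mul_le_of_le_one_left h4 hP4
  have h6 : 0 < h ^ 6 := by positivity
  have h7 : 1 * h ^ 6 < Q ^ 4 * (b * h) * h ^ 6 := by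
    calc 1 * h ^ 6 < (P ^ 4 * (a * h)) * (Q ^ 4 * (b * h)) * h ^ 6 := by rw [one_mul, ← h3]; linarith
      _ ≤ _ := mul_le_mul_of_nonneg_right h5 h6.le
  exact lt_of_mul_lt_mul_right h7 h6.le

theorem mul_le_add_mul_add {p p' q q' : ℝ} (hp : 0 ≤ p) (hp' : 0 ≤ p') (hq : 0 ≤ q) (hq' : 0 ≤ q') :
    p * q ≤ (p + p') * (q + q') :=
  mul_le_mul (by linarith) (by linarith) hq (by linarith)

theorem phaseLow_nonneg (c h s t : ℝ) : 0 ≤ phaseLow c h s t := by rw [phaseLow]; positivity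

theorem phaseHigh_nonneg (s t : ℝ) : 0 ≤ phaseHigh s t := by rw [phaseHigh]; positivity

theorem phaseCS_nonneg (c h s t : ℝ) : 0 ≤ phaseCS c h s t := by rw [phaseCS]; positivity

section phases

variable {c h s t : ℝ}

theorem le_phaseLow_mul_phaseHigh (hh : 0 < h) (hs : s ≠ 0) :
    1 ≤ phaseLow c h s t * phaseHigh s t * h ^ 2 := by
  rw [phaseLow, phaseHigh]
  calc 1 = (s / h) ^ 2 * (1 / s) ^ 2 * h ^ 2 := by field_simp
    _ ≤ _ := mul_le_mul_of_nonneg_right (mul_le_add_mul_add (by positivity) (by positivity)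
      (by positivity) (by positivity)) (by positivity)

theorem le_phaseLow_mul_phaseCS (hh : 0 < h) (hs : s ≠ 0) :
    1 ≤ phaseLow c h s t * phaseCS c h s t * h ^ 2 := by
  rw [phaseLow, phaseCS]
  calc 1 = (s / h) ^ 2 * (1 / s) ^ 2 * h ^ 2 := by field_simp
    _ ≤ _ := mul_le_mul_of_nonneg_right (mul_le_add_mul_add (by positivity) (by positivity)
      (by positivity) (by positivity)) (by positivity)

theorem le_phaseHigh_mul_phaseCS (hc : 0 < c) (hh : 0 < h) (ht : t ≠ 0) :
    1 / c ^ 2 ≤ phaseHigh s t * phaseCS c h s t * h ^ 2 := by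
  rw [phaseHigh, phaseCS, add_comm ((1 / s) ^ 2) ((1 / t) ^ 2), add_comm ((1 / s) ^ 2)]
  calc 1 / c ^ 2 = (1 / t) ^ 2 * (t / (c * h)) ^ 2 * h ^ 2 := by field_simp
    _ ≤ _ := mul_le_mul_of_nonneg_right (mul_le_add_mul_add (by positivity) (by positivity)
      (by positivity) (by positivity)) (by positivity)

theorem phaseCS_swap (hc : 0 < c) : phaseCS c⁻¹ (c * h) t s = (1 / t) ^ 2 + (s / h) ^ 2 := by
  rw [phaseCS, inv_mul_cancel_left₀ hc.ne']

theorem le_phaseLow_mul_phaseCS_swap (hc : 0 < c) (hh : 0 < h) (ht : t ≠ 0) :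
    1 / c ^ 2 ≤ phaseLow c h s t * phaseCS c⁻¹ (c * h) t s * h ^ 2 := by
  rw [phaseLow, phaseCS_swap hc, add_comm ((s / h) ^ 2)]
  calc 1 / c ^ 2 = (t / (c * h)) ^ 2 * (1 / t) ^ 2 * h ^ 2 := by field_simp
    _ ≤ _ := mul_le_mul_of_nonneg_right (mul_le_add_mul_add (by positivity) (by positivity)
      (by positivity) (by positivity)) (by positivity)

theorem le_phaseHigh_mul_phaseCS_swap (hc : 0 < c) (hh : 0 < h) (hs : s ≠ 0) :
    1 ≤ phaseHigh s t * phaseCS c⁻¹ (c * h) t s * h ^ 2 := by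
  rw [phaseHigh, phaseCS_swap hc, add_comm ((1 / t) ^ 2) ((s / h) ^ 2)]
  calc 1 = (1 / s) ^ 2 * (s / h) ^ 2 * h ^ 2 := by field_simp
    _ ≤ _ := mul_le_mul_of_nonneg_right (mul_le_add_mul_add (by positivity) (by positivity)
      (by positivity) (by positivity)) (by positivity)

theorem le_phaseCS_mul_phaseCS_swap (hc : 0 < c) (hh : 0 < h) (hs : s ≠ 0) :
    1 ≤ phaseCS c h s t * phaseCS c⁻¹ (c * h) t s * h ^ 2 := by
  rw [phaseCS, phaseCS_swap hc, add_comm ((1 / t) ^ 2) ((s / h) ^ 2)]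
  calc 1 = (1 / s) ^ 2 * (s / h) ^ 2 * h ^ 2 := by field_simp
    _ ≤ _ := mul_le_mul_of_nonneg_right (mul_le_add_mul_add (by positivity) (by positivity)
      (by positivity) (by positivity)) (by positivity)

end phases

/-- Outside its own region `lowSym` is smaller than any power of `h`. -/
theorem exists_norm_lowSym_far_le {ρ : ℝ} (hρ : |ρ| < 1) (a₁ a₂ c lam θ : ℝ) (N₀ w : ℕ) :
    ∃ K : ℝ, 0 < K ∧ ∀ h s t, 0 < h → h ≤ 1 → 1 < phaseLow c h s t ^ 4 * (1 * h) →
      ‖lowSym ρ a₁ a₂ c lam θ N₀ h s t‖ ≤ K * h ^ w := by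
  obtain ⟨C, δ, hC, hδ, hb⟩ := exists_norm_lowSym_le hρ a₁ a₂ c lam θ N₀
  obtain ⟨K, hK, hf⟩ := exists_exp_far_le hδ one_pos w
  refine ⟨C * K, by positivity, fun h s t hh hh1 hfar => (hb h s t hh hh1).trans ?_⟩
  rw [mul_assoc]
  exact mul_le_mul_of_nonneg_left (hf h _ hh (phaseLow_nonneg _ _ _ _) hfar) hC.le

/-- Outside its own region `highSym` is smaller than any power of `h`. -/
theorem exists_norm_highSym_far_le {ρ c lam θ : ℝ} (hρ : |ρ| < 1) (hc : 0 < c) (hlam : 0 < lam)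
    (hθ : 0 < θ) (N₀ w : ℕ) : ∃ K : ℝ, 0 < K ∧ ∀ h s t, 0 < h → h ≤ 1 → |s| ≤ Real.pi →
      |t| ≤ Real.pi → s ≠ 0 → t ≠ 0 → 1 < phaseHigh s t ^ 4 * (1 * h) →
      ‖(highSym ρ c lam θ N₀ h s t : ℂ)‖ ≤ K * h ^ w := by
  obtain ⟨C, δ, hC, hδ, hb⟩ := highSym_le hρ hc hlam hθ N₀
  obtain ⟨K, hK, hf⟩ := exists_exp_far_le hδ one_pos w
  refine ⟨C * K, by positivity, fun h s t hh hh1 hs ht hs0 ht0 hfar => ?_⟩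
  rw [Complex.norm_real, Real.norm_eq_abs, mul_assoc]
  refine (hb h s t hh hs ht hs0 ht0).trans (mul_le_mul_of_nonneg_left ?_ hC.le)
  exact (mul_le_of_le_one_left (Real.exp_pos _).le (pow_le_one₀ hh.le hh1)).trans
    (hf h _ hh (phaseHigh_nonneg _ _) hfar)

/-- Outside its own region `csSym` is smaller than any power of `h`. The factor `b` relates the mesh width `h` of `x` to the mesh width `b * h` of the direction in
which the angle is away from zero. -/
theorem exists_norm_csSym_far_le (a c : ℝ) {lam b : ℝ} (hlam : 0 < lam) (hb : 0 < b) (N₀ w : ℕ) :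
    ∃ K : ℝ, 0 < K ∧ ∀ (N : ℕ) (h s t : ℝ), 0 < h → b * h ≤ 1 → |s| ≤ Real.pi → s ≠ 0 →
      1 < phaseCS c (b * h) s t ^ 4 * (b * h) →
      ‖csSym a c lam N₀ N (b * h) s t‖ ≤ K * h ^ w := by
  obtain ⟨C, δ, hC, hδ, hb'⟩ := norm_csSym_le a (c := c) hlam N₀
  obtain ⟨K, hK, hf⟩ := exists_exp_far_le hδ hb w
  refine ⟨C * K, by positivity, fun N h s t hh hh1 hs hs0 hfar => ?_⟩
  have hbh : 0 < b * h := by positivity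
  rw [mul_assoc]
  refine (hb' N (b * h) s t hbh hs hs0).trans (mul_le_mul_of_nonneg_left ?_ hC.le)
  exact (mul_le_of_le_one_left (Real.exp_pos _).le (pow_le_one₀ hbh.le hh1)).trans
    (hf h _ hh (phaseCS_nonneg _ _ _ _) hfar)

theorem meshWidth_div (c lam : ℝ) (N : ℕ) : meshWidth (lam / c) N = c * meshWidth lam N := by
  rw [meshWidth, meshWidth, div_mul_eq_mul_div, one_div_div, mul_one_div]

/-- A mesh width below which the regions of the approximations are disjoint. -/
theorem exists_small_mesh {c : ℝ} (hc : 0 < c) : ∃ κ m h₀ : ℝ, 0 < κ ∧ κ ≤ 1 ∧ κ ≤ 1 / c ^ 2 ∧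
    0 < m ∧ m ≤ 1 ∧ m ≤ c ∧ 0 < h₀ ∧ ∀ h, 0 < h → h ≤ h₀ →
      h ≤ 1 ∧ c * h ≤ 1 ∧ h ^ 6 < κ ^ 4 * (m * m) := by
  have hκ : 0 < min 1 (1 / c ^ 2) := lt_min one_pos (by positivity)
  have hm : 0 < min 1 c := lt_min one_pos hc
  obtain ⟨q, hq⟩ : ∃ q, q = min 1 (1 / c ^ 2) ^ 4 * (min 1 c * min 1 c) := ⟨_, rfl⟩
  have hq0 : 0 < q := by rw [hq]; positivity
  refine ⟨min 1 (1 / c ^ 2), min 1 c, min (min 1 (1 / c)) (q / 2), hκ, min_le_left _ _,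
    min_le_right _ _, hm, min_le_left _ _, min_le_right _ _,
    lt_min (lt_min one_pos (by positivity)) (by positivity), fun h hh hle => ?_⟩
  have h1 : h ≤ 1 := hle.trans ((min_le_left _ _).trans (min_le_left _ _))
  have h2 : h ≤ 1 / c := hle.trans ((min_le_left _ _).trans (min_le_right _ _))
  refine ⟨h1, ?_, ?_⟩
  · rw [le_div_iff₀ hc] at h2; linarith
  · rw [← hq]
    have h3 : h ^ 6 ≤ h ^ 1 := pow_le_pow_of_le_one hh.le h1 (by norm_num)
    have h4 := hle.trans (min_le_right _ _)
    linarith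

theorem exp_neg_mul_le {δ δ' P : ℝ} (hP : 0 ≤ P) (h : δ ≤ δ') :
    Real.exp (-(δ' * P)) ≤ Real.exp (-(δ * P)) :=
  Real.exp_le_exp.2 (neg_le_neg (mul_le_mul_of_nonneg_right h hP))

section combine

variable {ρ a₁ a₂ c lam θ : ℝ}

/-- The error of the approximation of the symbol for `θ ≠ 1/2`. In the region of one approximation the
other one is negligible, and outside both regions everything is. -/
theorem exists_symbol_error_mcs (hρ : |ρ| < 1) (hc : 0 < c) (hlam : 0 < lam)
    (hθ : max (1 / 4) ((1 + |ρ|) / 6) < θ) (hθ2 : θ ≠ 1 / 2) (N₀ : ℕ) :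
    ∃ δ : ℝ, 0 < δ ∧ ∀ w : ℕ, ∃ (K : ℝ) (N₁ : ℕ), 0 < K ∧ ∀ N ≥ N₁, ∀ h, h = meshWidth lam N →
      ∀ s t : ℝ, s ≠ 0 → t ≠ 0 → |s| ≤ Real.pi → |t| ≤ Real.pi →
      ‖mainSym ρ a₁ a₂ c lam θ h N₀ N s t - lowSym ρ a₁ a₂ c lam θ N₀ h s t
        - (highSym ρ c lam θ N₀ h s t : ℂ)‖ ≤
      K * (h ^ 3 * Real.exp (-(δ * phaseLow c h s t)) +
        h ^ (2 * N₀ + 1) * Real.exp (-(δ * phaseHigh s t)) + h ^ w) := by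
  have hθ0 : 0 < θ := lt_trans (by norm_num) (lt_of_le_of_lt (le_max_left _ _) hθ)
  obtain ⟨CL, δL, hCL, hδL, hL⟩ := mainSym_sub_lowSym_le (a₁ := a₁) (a₂ := a₂) hρ hc hlam hθ0.le N₀
  obtain ⟨CH, δH, hCH, hδH, hH⟩ := mainSym_sub_highSym_le (a₁ := a₁) (a₂ := a₂) hρ hc hlam hθ0 N₀
  refine ⟨min δL δH, lt_min hδL hδH, fun w => ?_⟩
  obtain ⟨KL, hKL, farL⟩ := exists_norm_lowSym_far_le hρ a₁ a₂ c lam θ N₀ w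
  obtain ⟨KH, hKH, farH⟩ := exists_norm_highSym_far_le hρ hc hlam hθ0 N₀ w
  obtain ⟨KM, N₂, hKM, hM⟩ := mainSym_intermediate_le (a₁ := a₁) (a₂ := a₂) hρ hc hlam hθ N₀ w
  obtain ⟨κ, m, h₀, hκ, hκ1, hκc, hm, hm1, hmc, hh₀, hsmall⟩ := exists_small_mesh hc
  obtain ⟨N₁, hN₁⟩ := exists_meshWidth_le hlam hh₀ N₀
  obtain ⟨K, hKdef⟩ : ∃ K, K = CL + CH + KL + KH + KM := ⟨_, rfl⟩
  refine ⟨K, max N₁ N₂, by rw [hKdef]; positivity, fun N hN h hhN s t hs0 ht0 hs ht => ?_⟩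
  obtain ⟨hN0, hNN, hle⟩ := hN₁ N ((le_max_left _ _).trans hN)
  have hh : 0 < h := hhN ▸ meshWidth_pos hlam hN0
  rw [← hhN] at hle
  obtain ⟨hh1, -, hh6⟩ := hsmall h hh hle
  have hLx := hL (N, s, t)
  have hHx := hH (N, s, t)
  have hMx := hM N ((le_max_right _ _).trans hN) s t hs0 ht0 hs ht
  simp only [region, Set.mem_ofPred_eq, ← hhN] at hLx hHx hMx
  have farL' := farL h s t hh hh1
  have farH' := farH h s t hh hh1 hs ht hs0 ht0
  have hLH := hκ1.trans (le_phaseLow_mul_phaseHigh (c := c) (t := t) hh hs0)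
  have eL := exp_neg_mul_le (phaseLow_nonneg c h s t) (min_le_left δL δH)
  have eH := exp_neg_mul_le (phaseHigh_nonneg s t) (min_le_right δL δH)
  have hh3 : 0 < h ^ 3 := by positivity
  have hhN0 : 0 < h ^ (2 * N₀ + 1) := by positivity
  obtain ⟨BL, hBL⟩ : ∃ B, B = h ^ 3 * Real.exp (-(min δL δH * phaseLow c h s t)) := ⟨_, rfl⟩
  obtain ⟨BH, hBH⟩ : ∃ B, B = h ^ (2 * N₀ + 1) * Real.exp (-(min δL δH * phaseHigh s t)) := ⟨_, rfl⟩
  have hBL0 : 0 ≤ BL := by rw [hBL]; positivity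
  have hBH0 : 0 ≤ BH := by rw [hBH]; positivity
  have eL' := mul_le_mul_of_nonneg_left eL hh3.le
  have eH' := mul_le_mul_of_nonneg_left eH hhN0.le
  rw [← hBL] at eL' ⊢
  rw [← hBH] at eH' ⊢
  have eL'' := mul_le_mul_of_nonneg_left eL' hCL.le
  have eH'' := mul_le_mul_of_nonneg_left eH' hCH.le
  obtain ⟨hw, hhw⟩ : ∃ x, x = h ^ w := ⟨_, rfl⟩
  have hw0 : 0 ≤ hw := by rw [hhw]; positivity
  rw [← hhw] at farL' farH' hMx ⊢
  -- the constant dominates each of the contributions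
  have hK1 {x y z : ℝ} (hx : 0 ≤ x) (hy : 0 ≤ y) (hz : 0 ≤ z) :
      CL * x + CH * y + (KL + KH + KM) * z ≤ K * (x + y + z) := by
    rw [hKdef]
    have : 0 ≤ (CH + KL + KH + KM) * x + (CL + KL + KH + KM) * y + (CL + CH) * z := by positivity
    linarith
  refine le_trans ?_ (hK1 hBL0 hBH0 hw0)
  have p1 := mul_nonneg hCL.le hBL0
  have p2 := mul_nonneg hCH.le hBH0
  have p3 := mul_nonneg hKL.le hw0
  have p4 := mul_nonneg hKH.le hw0
  have p5 := mul_nonneg hKM.le hw0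
  generalize mainSym ρ a₁ a₂ c lam θ h N₀ N s t = M at *
  generalize lowSym ρ a₁ a₂ c lam θ N₀ h s t = L at *
  generalize (highSym ρ c lam θ N₀ h s t : ℂ) = H at *
  by_cases cL : phaseLow c h s t ^ 4 * (1 * h) ≤ 1
  · have q1 := hLx ⟨hN0, hNN, hh1, hs0, ht0, hs, ht, by rwa [one_mul] at cL⟩
    have q2 := farH' (far_of_near hh hm hκ hm1 hm1 hh6 hLH cL)
    have := norm_sub_le (M - L) H
    linarith
  by_cases cH : phaseHigh s t ^ 4 * (1 * h) ≤ 1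
  · have q1 := hHx ⟨hN0, hNN, hh1, hs0, ht0, hs, ht, by rwa [one_mul] at cH⟩
    have q2 := farL' (not_le.1 cL)
    have := norm_sub_le (M - H) L
    rw [sub_right_comm] at this
    linarith
  have q1 := farL' (not_le.1 cL)
  have q2 := farH' (not_le.1 cH)
  have q3 := hMx (by simpa using cL) (by simpa using cH) (fun h => absurd h hθ2)
  have := norm_sub_le (M - L) H
  have := norm_sub_le M L
  linarith

/-- The error of the approximation of the symbol for `θ = 1/2`, with four mutually disjoint regions. -/
theorem exists_symbol_error_cs (hρ : |ρ| < 1) (hc : 0 < c) (hlam : 0 < lam)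
    (hθ : max (1 / 4) ((1 + |ρ|) / 6) < (1 / 2 : ℝ)) (N₀ : ℕ) :
    ∃ δ : ℝ, 0 < δ ∧ ∀ w : ℕ, ∃ (K : ℝ) (N₁ : ℕ), 0 < K ∧ ∀ N ≥ N₁, ∀ h, h = meshWidth lam N →
      ∀ s t : ℝ, s ≠ 0 → t ≠ 0 → |s| ≤ Real.pi → |t| ≤ Real.pi →
      ‖mainSym ρ a₁ a₂ c lam (1 / 2) h N₀ N s t - lowSym ρ a₁ a₂ c lam (1 / 2) N₀ h s t
        - (highSym ρ c lam (1 / 2) N₀ h s t : ℂ) - csSym a₂ c lam N₀ N h s t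
        - csSym a₁ c⁻¹ (lam / c) N₀ N (c * h) t s‖ ≤
      K * (h ^ 3 * Real.exp (-(δ * phaseLow c h s t)) +
        h ^ (2 * N₀ + 1) * Real.exp (-(δ * phaseHigh s t)) +
        h ^ (2 * N₀ + 1) * (Real.exp (-(δ * phaseCS c h s t)) +
          Real.exp (-(δ * phaseCS c⁻¹ (c * h) t s))) + h ^ w) := by
  have hθ0 : (0 : ℝ) < 1 / 2 := by norm_num
  obtain ⟨CL, δL, hCL, hδL, hL⟩ := mainSym_sub_lowSym_le (a₁ := a₁) (a₂ := a₂) hρ hc hlam hθ0.le N₀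
  obtain ⟨CH, δH, hCH, hδH, hH⟩ := mainSym_sub_highSym_le (a₁ := a₁) (a₂ := a₂) hρ hc hlam hθ0 N₀
  obtain ⟨CX, δX, hCX, hδX, hX⟩ := mainSym_sub_csSym_le (a₁ := a₁) (a₂ := a₂) hρ hc hlam N₀
  obtain ⟨CY', δY, hCY', hδY, hY⟩ := mainSym_sub_csSym_le (a₁ := a₂) (a₂ := a₁) hρ (inv_pos.2 hc)
    (div_pos hlam hc) N₀
  obtain ⟨CY, hCYd⟩ : ∃ CY, CY = CY' * c ^ (2 * N₀ + 1) := ⟨_, rfl⟩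
  have hCY : 0 < CY := by rw [hCYd]; positivity
  obtain ⟨δ, hδdef⟩ : ∃ δ, δ = min (min δL δH) (min δX δY) := ⟨_, rfl⟩
  refine ⟨δ, by rw [hδdef]; exact lt_min (lt_min hδL hδH) (lt_min hδX hδY), fun w => ?_⟩
  obtain ⟨KL, hKL, farL⟩ := exists_norm_lowSym_far_le hρ a₁ a₂ c lam (1 / 2) N₀ w
  obtain ⟨KH, hKH, farH⟩ := exists_norm_highSym_far_le hρ hc hlam hθ0 N₀ w
  obtain ⟨KX, hKX, farX⟩ := exists_norm_csSym_far_le a₂ c hlam one_pos N₀ w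
  obtain ⟨KY, hKY, farY⟩ := exists_norm_csSym_far_le a₁ c⁻¹ (div_pos hlam hc) hc N₀ w
  obtain ⟨KM, N₂, hKM, hM⟩ := mainSym_intermediate_le (a₁ := a₁) (a₂ := a₂) hρ hc hlam hθ N₀ w
  obtain ⟨κ, m, h₀, hκ, hκ1, hκc, hm, hm1, hmc, hh₀, hsmall⟩ := exists_small_mesh hc
  obtain ⟨N₁, hN₁⟩ := exists_meshWidth_le hlam hh₀ N₀
  obtain ⟨C, hCdef⟩ : ∃ C, C = CL + CH + CX + CY := ⟨_, rfl⟩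
  obtain ⟨K', hK'def⟩ : ∃ K', K' = KL + KH + KX + KY + KM := ⟨_, rfl⟩
  have hC : 0 < C := by rw [hCdef]; positivity
  have hK' : 0 < K' := by rw [hK'def]; positivity
  refine ⟨C + K', max N₁ N₂, by positivity, fun N hN h hhN s t hs0 ht0 hs ht => ?_⟩
  obtain ⟨hN0, hNN, hle⟩ := hN₁ N ((le_max_left _ _).trans hN)
  have hh : 0 < h := hhN ▸ meshWidth_pos hlam hN0
  rw [← hhN] at hle
  obtain ⟨hh1, hch1, hh6⟩ := hsmall h hh hle
  have hLx := hL (N, s, t)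
  have hHx := hH (N, s, t)
  have hXx := hX (N, s, t)
  have hYx := hY (N, t, s)
  have hMx := hM N ((le_max_right _ _).trans hN) s t hs0 ht0 hs ht
  simp only [region, Set.mem_ofPred_eq, meshWidth_div, ← hhN] at hLx hHx hXx hYx hMx
  rw [mainSym_swap hc.ne', mul_pow c h, mul_assoc (c ^ (2 * N₀ + 1)), ← mul_assoc CY', ← hCYd] at hYx
  have farL' := farL h s t hh hh1
  have farH' := farH h s t hh hh1 hs ht hs0 ht0
  have farX' := farX N h s t hh (by rwa [one_mul]) hs hs0
  have farY' := farY N h t s hh hch1 ht ht0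
  have hLH := hκ1.trans (le_phaseLow_mul_phaseHigh (c := c) (t := t) hh hs0)
  have hLX := hκ1.trans (le_phaseLow_mul_phaseCS (c := c) (t := t) hh hs0)
  have hLY := hκc.trans (le_phaseLow_mul_phaseCS_swap (s := s) hc hh ht0)
  have hHX := hκc.trans (le_phaseHigh_mul_phaseCS (s := s) hc hh ht0)
  have hHY := hκ1.trans (le_phaseHigh_mul_phaseCS_swap (t := t) hc hh hs0)
  have hXY := hκ1.trans (le_phaseCS_mul_phaseCS_swap (t := t) hc hh hs0)
  have nL := phaseLow_nonneg c h s t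
  have nH := phaseHigh_nonneg s t
  have nX := phaseCS_nonneg c h s t
  have nY := phaseCS_nonneg c⁻¹ (c * h) t s
  have eL := exp_neg_mul_le nL (show δ ≤ δL by
    rw [hδdef]; exact (min_le_left _ _).trans (min_le_left _ _))
  have eH := exp_neg_mul_le nH (show δ ≤ δH by
    rw [hδdef]; exact (min_le_left _ _).trans (min_le_right _ _))
  have eX := exp_neg_mul_le nX (show δ ≤ δX by
    rw [hδdef]; exact (min_le_right _ _).trans (min_le_left _ _))
  have eY := exp_neg_mul_le nY (show δ ≤ δY by
    rw [hδdef]; exact (min_le_right _ _).trans (min_le_right _ _))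
  have hh3 : 0 < h ^ 3 := by positivity
  have hhN0 : 0 < h ^ (2 * N₀ + 1) := by positivity
  rw [mul_add (h ^ (2 * N₀ + 1))]
  obtain ⟨BL, hBL⟩ : ∃ B, B = h ^ 3 * Real.exp (-(δ * phaseLow c h s t)) := ⟨_, rfl⟩
  obtain ⟨BH, hBH⟩ : ∃ B, B = h ^ (2 * N₀ + 1) * Real.exp (-(δ * phaseHigh s t)) := ⟨_, rfl⟩
  obtain ⟨BX, hBX⟩ : ∃ B, B = h ^ (2 * N₀ + 1) * Real.exp (-(δ * phaseCS c h s t)) := ⟨_, rfl⟩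
  obtain ⟨BY, hBY⟩ : ∃ B, B = h ^ (2 * N₀ + 1) * Real.exp (-(δ * phaseCS c⁻¹ (c * h) t s)) :=
    ⟨_, rfl⟩
  have hBL0 : 0 ≤ BL := by rw [hBL]; positivity
  have hBH0 : 0 ≤ BH := by rw [hBH]; positivity
  have hBX0 : 0 ≤ BX := by rw [hBX]; positivity
  have hBY0 : 0 ≤ BY := by rw [hBY]; positivity
  have eL' := mul_le_mul_of_nonneg_left eL hh3.le
  have eH' := mul_le_mul_of_nonneg_left eH hhN0.le
  have eX' := mul_le_mul_of_nonneg_left eX hhN0.le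
  have eY' := mul_le_mul_of_nonneg_left eY hhN0.le
  rw [← hBL] at eL' ⊢
  rw [← hBH] at eH' ⊢
  rw [← hBX] at eX' ⊢
  rw [← hBY] at eY' ⊢
  have eL'' := mul_le_mul_of_nonneg_left eL' hCL.le
  have eH'' := mul_le_mul_of_nonneg_left eH' hCH.le
  have eX'' := mul_le_mul_of_nonneg_left eX' hCX.le
  have eY'' := mul_le_mul_of_nonneg_left eY' hCY.le
  obtain ⟨hw, hhw⟩ : ∃ x, x = h ^ w := ⟨_, rfl⟩
  have hw0 : 0 ≤ hw := by rw [hhw]; positivity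
  rw [← hhw] at farL' farH' farX' farY' hMx ⊢
  have p1 : CL * BL ≤ C * BL := mul_le_mul_of_nonneg_right (by rw [hCdef]; linarith) hBL0
  have p2 : CH * BH ≤ C * BH := mul_le_mul_of_nonneg_right (by rw [hCdef]; linarith) hBH0
  have p3 : CX * BX ≤ C * BX := mul_le_mul_of_nonneg_right (by rw [hCdef]; linarith) hBX0
  have p4 : CY * BY ≤ C * BY := mul_le_mul_of_nonneg_right (by rw [hCdef]; linarith) hBY0
  have n1 := mul_nonneg hC.le hBL0
  have n2 := mul_nonneg hC.le hBH0
  have n3 := mul_nonneg hC.le hBX0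
  have n4 := mul_nonneg hC.le hBY0
  have r1 := mul_nonneg hKL.le hw0
  have r2 := mul_nonneg hKH.le hw0
  have r3 := mul_nonneg hKX.le hw0
  have r4 := mul_nonneg hKY.le hw0
  have r5 := mul_nonneg hKM.le hw0
  have rsum : K' * hw = KL * hw + KH * hw + KX * hw + KY * hw + KM * hw := by rw [hK'def]; ring
  have hfin : C * (BL + BH + (BX + BY)) + K' * hw ≤ (C + K') * (BL + BH + (BX + BY) + hw) := by
    have : 0 ≤ K' * (BL + BH + (BX + BY)) + C * hw := by positivity
    linarith
  refine le_trans ?_ hfin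
  rw [mul_add C, mul_add C, mul_add C, rsum]
  simp only [one_mul] at farX'
  generalize mainSym ρ a₁ a₂ c lam (1 / 2) h N₀ N s t = M at *
  generalize lowSym ρ a₁ a₂ c lam (1 / 2) N₀ h s t = L at *
  generalize (highSym ρ c lam (1 / 2) N₀ h s t : ℂ) = H at *
  generalize csSym a₂ c lam N₀ N h s t = X at *
  generalize csSym a₁ c⁻¹ (lam / c) N₀ N (c * h) t s = Y at *
  generalize phaseLow c h s t = PL at *
  generalize phaseHigh s t = PH at *
  generalize phaseCS c h s t = PX at *
  generalize phaseCS c⁻¹ (c * h) t s = PY at *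
  by_cases cL : PL ^ 4 * (1 * h) ≤ 1
  · have q1 := hLx ⟨hN0, hNN, hh1, hs0, ht0, hs, ht, by rwa [one_mul] at cL⟩
    have q2 := farH' (far_of_near hh hm hκ hm1 hm1 hh6 hLH cL)
    have q3 := farX' (by simpa using far_of_near hh hm hκ hm1 hm1 hh6 hLX cL)
    have q4 := farY' (far_of_near hh hm hκ hm1 hmc hh6 hLY cL)
    have t1 := norm_sub_le (M - L) H
    have t2 := norm_sub_le (M - L - H) X
    have t3 := norm_sub_le (M - L - H - X) Y
    linarith
  by_cases cH : PH ^ 4 * (1 * h) ≤ 1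
  · have q1 := hHx ⟨hN0, hNN, hh1, hs0, ht0, hs, ht, by rwa [one_mul] at cH⟩
    have q2 := farL' (not_le.1 cL)
    have q3 := farX' (by simpa using far_of_near hh hm hκ hm1 hm1 hh6 hHX cH)
    have q4 := farY' (far_of_near hh hm hκ hm1 hmc hh6 hHY cH)
    have t1 := norm_sub_le (M - H) L
    rw [sub_right_comm] at t1
    have t2 := norm_sub_le (M - L - H) X
    have t3 := norm_sub_le (M - L - H - X) Y
    linarith
  by_cases cX : PX ^ 4 * (1 * h) ≤ 1
  · have q1 := hXx ⟨hN0, hNN, hh1, hs0, ht0, hs, ht, by rwa [one_mul] at cX⟩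
    have q2 := farL' (not_le.1 cL)
    have q3 := farH' (not_le.1 cH)
    have q4 := farY' (far_of_near hh hm hκ hm1 hmc hh6 hXY cX)
    have t1 := norm_sub_le (M - X) L
    have t2 := norm_sub_le (M - X - L) H
    have t3 := norm_sub_le (M - X - L - H) Y
    rw [show M - X - L - H - Y = M - L - H - X - Y by ring] at t3
    linarith
  by_cases cY : PY ^ 4 * (c * h) ≤ 1
  · have q1 := hYx ⟨hN0, hNN, hch1, ht0, hs0, ht, hs, cY⟩
    have q2 := farL' (not_le.1 cL)
    have q3 := farH' (not_le.1 cH)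
    have q4 := farX' (by simpa using cX)
    have t1 := norm_sub_le (M - Y) L
    have t2 := norm_sub_le (M - Y - L) H
    have t3 := norm_sub_le (M - Y - L - H) X
    rw [show M - Y - L - H - X = M - L - H - X - Y by ring] at t3
    linarith
  have q1 := farL' (not_le.1 cL)
  have q2 := farH' (not_le.1 cH)
  have q3 := farX' (by simpa using cX)
  have q4 := farY' (not_le.1 cY)
  have q5 := hMx (by simpa using cL) (by simpa using cH)
    (fun _ => ⟨by simpa using cX, not_le.1 cY⟩)
  have t0 := norm_sub_le M L
  have t1 := norm_sub_le (M - L) H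
  have t2 := norm_sub_le (M - L - H) X
  have t3 := norm_sub_le (M - L - H - X) Y
  linarith

end combine

/-! ### The remainder -/

theorem envLow_eq (δ c h s t : ℝ) : envLow δ c h s t = Real.exp (-(δ * phaseLow c h s t)) := by
  rw [envLow, phaseLow, neg_mul]

theorem envHigh_eq (δ s t : ℝ) : envHigh δ s t = Real.exp (-(δ * phaseHigh s t)) := by
  rw [envHigh, phaseHigh, neg_mul, one_div_pow, one_div_pow]

theorem envCS_eq {c : ℝ} (hc : 0 < c) (δ h s t : ℝ) : envCS δ c h s t =
    Real.exp (-(δ * phaseCS c h s t)) + Real.exp (-(δ * phaseCS c⁻¹ (c * h) t s)) := by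
  rw [envCS, phaseCS_swap hc, phaseCS, neg_mul, neg_mul, one_div_pow, one_div_pow,
    add_comm (1 / t ^ 2)]

theorem exp_neg_mul_le_one {δ P : ℝ} (hδ : 0 < δ) (hP : 0 ≤ P) : Real.exp (-(δ * P)) ≤ 1 :=
  Real.exp_le_one_iff.2 (by have := mul_nonneg hδ.le hP; linarith)

theorem mem_box_of_abs_lt {s t : ℝ} (hs : |s| < Real.pi) (ht : |t| < Real.pi) : (s, t) ∈ box :=
  ⟨⟨(abs_lt.1 hs).1, (abs_lt.1 hs).2.le⟩, ⟨(abs_lt.1 ht).1, (abs_lt.1 ht).2.le⟩⟩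

/-- The numerical solution after `N` steps. -/
def numGrid (ρ a₁ a₂ c lam θ : ℝ) (N₀ N : ℕ) : Grid :=
  gridOf (meshWidth lam N) (c * meshWidth lam N)
    (mainSym ρ a₁ a₂ c lam θ (meshWidth lam N) N₀ N)

section remainder

variable {ρ a₁ a₂ c lam θ : ℝ}

/-- The Fourier representation of the remainder for `θ ≠ 1/2`: the error of the symbol, plus the aliasing
error of the low-wavenumber part. -/
theorem exists_hasFourierBound_mcs (hρ : |ρ| < 1) (hc : 0 < c) (hlam : 0 < lam)
    (hθ : max (1 / 4) ((1 + |ρ|) / 6) < θ) (hθ2 : θ ≠ 1 / 2) (N₀ : ℕ) :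
    ∃ δ : ℝ, 0 < δ ∧ ∀ w : ℕ, ∃ (K : ℝ) (N₁ : ℕ), 0 < K ∧ ∀ N ≥ N₁, ∀ h : ℝ, h = meshWidth lam N →
      HasFourierBound h (c * h)
        (totalError ρ a₁ a₂ c h (numGrid ρ a₁ a₂ c lam θ N₀ N)
          - approxMCS ρ a₁ a₂ c lam θ N₀ h)
        (fun s t => K * (h ^ 3 * envLow δ c h s t + h ^ (2 * N₀ + 1) * envHigh δ s t
          + h ^ w)) := by
  have hθ0 : 0 < θ := lt_trans (by norm_num) (lt_of_le_of_lt (le_max_left _ _) hθ)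
  obtain ⟨δ, hδ, hw⟩ := exists_symbol_error_mcs (a₁ := a₁) (a₂ := a₂) hρ hc hlam hθ hθ2 N₀
  refine ⟨δ, hδ, fun w => ?_⟩
  obtain ⟨K, N₂, hK, hE⟩ := hw w
  obtain ⟨KL, hKL, hfold⟩ := exists_low_fold hρ hc a₁ a₂ lam θ N₀ w
  obtain ⟨N₁, hN₁⟩ := exists_meshWidth_le hlam one_pos N₀
  refine ⟨K + KL, max N₁ N₂, by positivity, fun N hN h hhN => ?_⟩
  obtain ⟨hN0, hNN, hle⟩ := hN₁ N ((le_max_left _ _).trans hN)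
  have hh : 0 < h := hhN ▸ meshWidth_pos hlam hN0
  rw [← hhN] at hle
  obtain ⟨EL, hEL, hELle, hELeq⟩ := hfold h hh hle
  have hM := isSymbol_mainSym (a₁ := a₁) (a₂ := a₂) hρ hc hlam hθ0.le hh N₀ N
  have hH := isSymbol_highSym hρ hc hlam hθ0 hh N₀
  have hgrid : totalError ρ a₁ a₂ c h (numGrid ρ a₁ a₂ c lam θ N₀ N)
      - approxMCS ρ a₁ a₂ c lam θ N₀ h = gridOf h (c * h) (fun s t =>
        mainSym ρ a₁ a₂ c lam θ h N₀ N s t - EL s t - (highSym ρ c lam θ N₀ h s t : ℂ)) := by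
    rw [gridOf_sub (hM.sub hEL) hH, gridOf_sub hM hEL]
    ext j k
    simp only [Pi.sub_apply, totalError, approxMCS, numGrid, ← hhN]
    rw [gridOf_highSym hρ hc hlam hθ0 hh, ← hELeq]
    ring
  rw [hgrid]
  refine hasFourierBound_gridOf ((hM.sub hEL).sub hH) (fun s t hs0 ht0 hs ht => ?_) (fun s t => ?_)
    (fun s t => ?_) _ _
  · have h1 := hE N ((le_max_right _ _).trans hN) h hhN s t hs0 ht0 hs.le ht.le
    have h2 := hELle (s, t) (mem_box_of_abs_lt hs ht)
    simp only at h2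
    have h3 := norm_sub_le (mainSym ρ a₁ a₂ c lam θ h N₀ N s t - lowSym ρ a₁ a₂ c lam θ N₀ h s t
        - (highSym ρ c lam θ N₀ h s t : ℂ)) (EL s t - lowSym ρ a₁ a₂ c lam θ N₀ h s t)
    rw [envLow_eq, envHigh_eq]
    rw [show mainSym ρ a₁ a₂ c lam θ h N₀ N s t - lowSym ρ a₁ a₂ c lam θ N₀ h s t
        - (highSym ρ c lam θ N₀ h s t : ℂ) - (EL s t - lowSym ρ a₁ a₂ c lam θ N₀ h s t) =
        mainSym ρ a₁ a₂ c lam θ h N₀ N s t - EL s t - (highSym ρ c lam θ N₀ h s t : ℂ) by ring] at h3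
    have h4 : 0 ≤ KL * (h ^ 3 * Real.exp (-(δ * phaseLow c h s t)) +
      h ^ (2 * N₀ + 1) * Real.exp (-(δ * phaseHigh s t))) := by positivity
    linarith
  · simp only [envLow, envHigh, neg_div, neg_sq]
  · simp only [envLow, envHigh]; positivity

/-- The Fourier representation of the remainder for `θ = 1/2`. -/
theorem exists_hasFourierBound_cs (hρ : |ρ| < 1) (hc : 0 < c) (hlam : 0 < lam)
    (hθ : max (1 / 4) ((1 + |ρ|) / 6) < (1 / 2 : ℝ)) (N₀ : ℕ) :
    ∃ δ : ℝ, 0 < δ ∧ ∀ w : ℕ, ∃ (K : ℝ) (N₁ : ℕ), 0 < K ∧ ∀ N ≥ N₁, ∀ h : ℝ, h = meshWidth lam N →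
      HasFourierBound h (c * h)
        (totalError ρ a₁ a₂ c h (numGrid ρ a₁ a₂ c lam (1 / 2) N₀ N)
          - (approxMCS ρ a₁ a₂ c lam (1 / 2) N₀ h + extraCS a₁ a₂ c lam N₀ N h))
        (fun s t => K * (h ^ 3 * envLow δ c h s t + h ^ (2 * N₀ + 1) * envHigh δ s t
          + h ^ (2 * N₀ + 1) * envCS δ c h s t + h ^ w)) := by
  have hθ0 : (0 : ℝ) < 1 / 2 := by norm_num
  obtain ⟨δ, hδ, hw⟩ := exists_symbol_error_cs (a₁ := a₁) (a₂ := a₂) hρ hc hlam hθ N₀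
  refine ⟨δ, hδ, fun w => ?_⟩
  obtain ⟨K, N₂, hK, hE⟩ := hw w
  obtain ⟨KL, hKL, hfold⟩ := exists_low_fold hρ hc a₁ a₂ lam (1 / 2) N₀ w
  obtain ⟨KX, hKX, hfoldX⟩ := exists_cs_fold a₂ hc hlam N₀ w
  obtain ⟨KY, hKY, hfoldY⟩ := exists_cs_fold_swap a₁ hc hlam N₀ w
  obtain ⟨N₁, hN₁⟩ := exists_meshWidth_le hlam (lt_min one_pos (one_div_pos.2 hc)) N₀
  refine ⟨K + (KL + KX + KY), max N₁ N₂, by positivity, fun N hN h hhN => ?_⟩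
  obtain ⟨hN0, hNN, hle⟩ := hN₁ N ((le_max_left _ _).trans hN)
  have hh : 0 < h := hhN ▸ meshWidth_pos hlam hN0
  rw [← hhN] at hle
  have hh1 : h ≤ 1 := hle.trans (min_le_left _ _)
  have hch : c * h ≤ 1 := by
    have := hle.trans (min_le_right _ _)
    rw [le_div_iff₀ hc] at this
    linarith
  obtain ⟨EL, hEL, hELle, hELeq⟩ := hfold h hh hh1
  obtain ⟨EX, hEX, hEXle, hEXeq⟩ := hfoldX N hNN h hh hh1
  obtain ⟨EY, hEY, hEYle, hEYeq⟩ := hfoldY N hNN h hh hch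
  have hM := isSymbol_mainSym (a₁ := a₁) (a₂ := a₂) hρ hc hlam hθ0.le hh N₀ N
  have hH := isSymbol_highSym hρ hc hlam hθ0 hh N₀
  have hgrid : totalError ρ a₁ a₂ c h (numGrid ρ a₁ a₂ c lam (1 / 2) N₀ N)
      - (approxMCS ρ a₁ a₂ c lam (1 / 2) N₀ h + extraCS a₁ a₂ c lam N₀ N h) =
        gridOf h (c * h) (fun s t => mainSym ρ a₁ a₂ c lam (1 / 2) h N₀ N s t - EL s t
          - (highSym ρ c lam (1 / 2) N₀ h s t : ℂ) - EX s t - EY s t) := by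
    rw [gridOf_sub (((hM.sub hEL).sub hH).sub hEX) hEY, gridOf_sub ((hM.sub hEL).sub hH) hEX,
      gridOf_sub (hM.sub hEL) hH, gridOf_sub hM hEL]
    ext j k
    simp only [Pi.sub_apply, Pi.add_apply, totalError, approxMCS, extraCS, numGrid, ← hhN]
    rw [gridOf_highSym hρ hc hlam hθ0 hh, ← hELeq, hEXeq, hEYeq]
    ring
  rw [hgrid]
  refine hasFourierBound_gridOf ((((hM.sub hEL).sub hH).sub hEX).sub hEY)
    (fun s t hs0 ht0 hs ht => ?_) (fun s t => ?_) (fun s t => ?_) _ _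
  · have h1 := hE N ((le_max_right _ _).trans hN) h hhN s t hs0 ht0 hs.le ht.le
    have h2 := hELle (s, t) (mem_box_of_abs_lt hs ht)
    have h2X := hEXle (s, t) (mem_box_of_abs_lt hs ht) hs0
    have h2Y := hEYle (s, t) (mem_box_of_abs_lt hs ht) ht0
    simp only at h2 h2X h2Y
    rw [envLow_eq, envHigh_eq, envCS_eq hc]
    have h4 : 0 ≤ (KL + KX + KY) * (h ^ 3 * Real.exp (-(δ * phaseLow c h s t)) +
      h ^ (2 * N₀ + 1) * Real.exp (-(δ * phaseHigh s t)) + h ^ (2 * N₀ + 1) *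
        (Real.exp (-(δ * phaseCS c h s t)) + Real.exp (-(δ * phaseCS c⁻¹ (c * h) t s)))) := by
      positivity
    generalize mainSym ρ a₁ a₂ c lam (1 / 2) h N₀ N s t = M at *
    generalize lowSym ρ a₁ a₂ c lam (1 / 2) N₀ h s t = L at *
    generalize (highSym ρ c lam (1 / 2) N₀ h s t : ℂ) = H at *
    generalize csSym a₂ c lam N₀ N h s t = X at *
    generalize csSym a₁ c⁻¹ (lam / c) N₀ N (c * h) t s = Y at *
    have t1 := norm_sub_le (M - L - H - X - Y) (EL s t - L)
    have t2 := norm_sub_le (M - L - H - X - Y - (EL s t - L)) (EX s t - X)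
    have t3 := norm_sub_le (M - L - H - X - Y - (EL s t - L) - (EX s t - X)) (EY s t - Y)
    rw [show M - L - H - X - Y - (EL s t - L) - (EX s t - X) - (EY s t - Y) =
      M - EL s t - H - EX s t - EY s t by ring] at t3
    linarith
  · simp only [envLow, envHigh, envCS, neg_div, neg_sq]
  · simp only [envLow, envHigh, envCS]; positivity

theorem integral_exp_neg_phaseLow_le {δ h : ℝ} (hδ : 0 < δ) (hc : 0 < c) (hh : 0 < h) :
    ∫ p : ℝ × ℝ, Real.exp (-(δ * phaseLow c h p.1 p.2)) ∂boxMeasure ≤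
      c * h ^ 2 * (Real.pi / δ) := by
  rw [boxMeasure_eq]
  have hI := integrable_exp_neg_phaseLow hδ hc hh
  refine (setIntegral_le_integral hI (Eventually.of_forall fun p => (Real.exp_pos _).le)).trans
    (le_of_eq ?_)
  have e (p : ℝ × ℝ) : Real.exp (-(δ * phaseLow c h p.1 p.2)) =
      Real.exp (-(δ / h ^ 2) * p.1 ^ 2) * Real.exp (-(δ / (c * h) ^ 2) * p.2 ^ 2) := by
    rw [← Real.exp_add, phaseLow]
    congr 1
    field_simp
    ring
  simp only [e]
  rw [Measure.volume_eq_prod, integral_prod_mul (fun x : ℝ => Real.exp (-(δ / h ^ 2) * x ^ 2))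
    (fun y : ℝ => Real.exp (-(δ / (c * h) ^ 2) * y ^ 2)), integral_gaussian, integral_gaussian,
    ← Real.sqrt_mul (by have := Real.pi_pos; positivity)]
  have hp := Real.pi_pos
  rw [show Real.pi / (δ / h ^ 2) * (Real.pi / (δ / (c * h) ^ 2)) =
    (c * h ^ 2 * (Real.pi / δ)) ^ 2 by field_simp, Real.sqrt_sq (by positivity)]

/-- The uniform bound on the remainder that follows from the bound on its symbol: dividing by `h₁ h₂`
costs two powers of `h`, which the integral of the low-wavenumber Gaussian gives back. The term
`h ^ 5` is the case `w = 5` of the bound on the symbol, and contributes `h ^ 3`. -/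
theorem abs_le_of_hasFourierBound {δ h K : ℝ} {r : Grid} {B : ℝ → ℝ → ℝ} {N₀ : ℕ} (hδ : 0 < δ)
    (hc : 0 < c) (hh : 0 < h) (hK : 0 < K) (hr : HasFourierBound h (c * h) r B)
    (hB : ∀ s t, B s t ≤
      K * (h ^ 3 * Real.exp (-(δ * phaseLow c h s t)) + 3 * h ^ (2 * N₀ + 1) + h ^ 5)) (j k : ℤ) :
    |r j k| ≤ K * (1 / (4 * Real.pi ^ 2 * c)) * (c * (Real.pi / δ) + 16 * Real.pi ^ 2) *
      (h ^ 3 + h ^ (2 * (N₀ : ℤ) - 1)) := by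
  have hp := Real.pi_pos
  obtain ⟨E, hEm, hEr, hEB⟩ := hr
  have hEle (s t : ℝ) (hs0 : s ≠ 0) (ht0 : t ≠ 0) (hs : |s| ≤ Real.pi) (ht : |t| ≤ Real.pi) :=
    (hEB s t (abs_pos.2 hs0) hs (abs_pos.2 ht0) ht).trans (hB s t)
  have hE : IsSymbol E := ⟨hEm, K * (h ^ 3 * 1 + 3 * h ^ (2 * N₀ + 1) + h ^ 5),
    fun s t hs0 ht0 hs ht => (hEle s t hs0 ht0 hs ht).trans (mul_le_mul_of_nonneg_left
      (add_le_add_left (add_le_add_left (mul_le_mul_of_nonneg_left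
        (exp_neg_mul_le_one hδ (phaseLow_nonneg _ _ _ _)) (by positivity)) _) _) hK.le)⟩
  have h1 : |r j k| ≤ 1 / (4 * Real.pi ^ 2 * h * (c * h)) * ∫ p, ‖E p.1 p.2‖ ∂boxMeasure := by
    have := abs_gridOf_le hE hh (mul_pos hc hh) j k
    rwa [gridOf, ← hEr, Complex.ofReal_re] at this
  have hI : Integrable (fun p : ℝ × ℝ => Real.exp (-(δ * phaseLow c h p.1 p.2))) boxMeasure := by
    rw [boxMeasure_eq]
    exact (integrable_exp_neg_phaseLow hδ hc hh).integrableOn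
  have hvol : boxMeasure.real Set.univ = 4 * Real.pi ^ 2 := by
    rw [boxMeasure, ← Set.univ_prod_univ, measureReal_prod_prod]
    simp only [measureReal_restrict_apply MeasurableSet.univ, Set.univ_inter, Real.volume_real_Ioc]
    rw [max_eq_left (by linarith)]
    ring
  have h2 : ∫ p, ‖E p.1 p.2‖ ∂boxMeasure ≤ K * (h ^ 3 * (c * h ^ 2 * (Real.pi / δ)) +
      (3 * h ^ (2 * N₀ + 1) + h ^ 5) * (4 * Real.pi ^ 2)) := by
    calc _ ≤ ∫ p : ℝ × ℝ, K * (h ^ 3 * Real.exp (-(δ * phaseLow c h p.1 p.2)) +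
          (3 * h ^ (2 * N₀ + 1) + h ^ 5)) ∂boxMeasure := by
          refine integral_mono_ae hE.integrable.norm
            (((hI.const_mul _).add (integrable_const _)).const_mul K) ?_
          filter_upwards [ae_boxMeasure] with p hp
          rw [← add_assoc]
          exact hEle p.1 p.2 hp.1 hp.2.1 hp.2.2.1 hp.2.2.2
      _ = K * (h ^ 3 * (∫ p : ℝ × ℝ, Real.exp (-(δ * phaseLow c h p.1 p.2)) ∂boxMeasure) +
          (3 * h ^ (2 * N₀ + 1) + h ^ 5) * (4 * Real.pi ^ 2)) := by
          rw [integral_const_mul, integral_add (hI.const_mul _) (integrable_const _),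
            integral_const_mul, integral_const, hvol, smul_eq_mul, mul_comm (4 * Real.pi ^ 2)]
      _ ≤ _ := mul_le_mul_of_nonneg_left (add_le_add_left (mul_le_mul_of_nonneg_left
          (integral_exp_neg_phaseLow_le hδ hc hh) (by positivity)) _) hK.le
  have e1 : h ^ (2 * N₀ + 1) = h ^ (2 * (N₀ : ℤ) - 1) * h ^ 2 := by
    rw [← zpow_natCast h (2 * N₀ + 1), ← zpow_natCast h 2, ← zpow_add₀ hh.ne']
    congr 1
    push_cast
    ring
  have h3 := h1.trans (mul_le_mul_of_nonneg_left h2 (by positivity))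
  rw [e1] at h3
  obtain ⟨z, hz⟩ : ∃ z, z = h ^ (2 * (N₀ : ℤ) - 1) := ⟨_, rfl⟩
  have hz0 : 0 < z := hz ▸ zpow_pos hh _
  rw [← hz] at h3 ⊢
  refine h3.trans ?_
  calc _ = K * (1 / (4 * Real.pi ^ 2 * c)) * (c * (Real.pi / δ) * h ^ 3 +
        12 * Real.pi ^ 2 * z + 4 * Real.pi ^ 2 * h ^ 3) := by field_simp; ring
    _ ≤ _ := by
        rw [mul_assoc (K * (1 / (4 * Real.pi ^ 2 * c)))]
        refine mul_le_mul_of_nonneg_left ?_ (by positivity)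
        have q1 : 0 ≤ c * (Real.pi / δ) * z := by positivity
        have q2 : 0 ≤ Real.pi ^ 2 * z := by positivity
        have q3 : 0 ≤ Real.pi ^ 2 * h ^ 3 := by positivity
        linarith

theorem exists_abs_remainder_mcs_le (hρ : |ρ| < 1) (hc : 0 < c) (hlam : 0 < lam)
    (hθ : max (1 / 4) ((1 + |ρ|) / 6) < θ) (hθ2 : θ ≠ 1 / 2) (N₀ : ℕ) :
    ∃ (K : ℝ) (N₁ : ℕ), 0 < K ∧ ∀ N ≥ N₁, ∀ h : ℝ, h = meshWidth lam N → ∀ j k : ℤ,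
      |totalError ρ a₁ a₂ c h (numGrid ρ a₁ a₂ c lam θ N₀ N) j k
        - approxMCS ρ a₁ a₂ c lam θ N₀ h j k| ≤ K * (h ^ 3 + h ^ (2 * (N₀ : ℤ) - 1)) := by
  obtain ⟨δ, hδ, H⟩ := exists_hasFourierBound_mcs (a₁ := a₁) (a₂ := a₂) hρ hc hlam hθ hθ2 N₀
  obtain ⟨K, N₂, hK, hF⟩ := H 5
  obtain ⟨N₁, hN₁⟩ := exists_meshWidth_le hlam one_pos N₀
  refine ⟨K * (1 / (4 * Real.pi ^ 2 * c)) * (c * (Real.pi / δ) + 16 * Real.pi ^ 2), max N₁ N₂,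
    by have := Real.pi_pos; positivity, fun N hN h hhN j k => ?_⟩
  obtain ⟨hN0, hNN, hle⟩ := hN₁ N ((le_max_left _ _).trans hN)
  have hh : 0 < h := hhN ▸ meshWidth_pos hlam hN0
  refine abs_le_of_hasFourierBound hδ hc hh hK (hF N ((le_max_right _ _).trans hN) h hhN)
    (fun s t => mul_le_mul_of_nonneg_left ?_ hK.le) j k
  rw [envLow_eq, envHigh_eq]
  have h1 := mul_le_of_le_one_right (show 0 ≤ h ^ (2 * N₀ + 1) by positivity)
    (exp_neg_mul_le_one hδ (phaseHigh_nonneg s t))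
  have h2 : 0 ≤ h ^ (2 * N₀ + 1) := by positivity
  linarith

theorem exists_abs_remainder_cs_le (hρ : |ρ| < 1) (hc : 0 < c) (hlam : 0 < lam)
    (hθ : max (1 / 4) ((1 + |ρ|) / 6) < (1 / 2 : ℝ)) (N₀ : ℕ) :
    ∃ (K : ℝ) (N₁ : ℕ), 0 < K ∧ ∀ N ≥ N₁, ∀ h : ℝ, h = meshWidth lam N → ∀ j k : ℤ,
      |totalError ρ a₁ a₂ c h (numGrid ρ a₁ a₂ c lam (1 / 2) N₀ N) j k
        - (approxMCS ρ a₁ a₂ c lam (1 / 2) N₀ h j k + extraCS a₁ a₂ c lam N₀ N h j k)| ≤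
        K * (h ^ 3 + h ^ (2 * (N₀ : ℤ) - 1)) := by
  obtain ⟨δ, hδ, H⟩ := exists_hasFourierBound_cs (a₁ := a₁) (a₂ := a₂) hρ hc hlam hθ N₀
  obtain ⟨K, N₂, hK, hF⟩ := H 5
  obtain ⟨N₁, hN₁⟩ := exists_meshWidth_le hlam one_pos N₀
  refine ⟨K * (1 / (4 * Real.pi ^ 2 * c)) * (c * (Real.pi / δ) + 16 * Real.pi ^ 2), max N₁ N₂,
    by have := Real.pi_pos; positivity, fun N hN h hhN j k => ?_⟩
  obtain ⟨hN0, hNN, hle⟩ := hN₁ N ((le_max_left _ _).trans hN)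
  have hh : 0 < h := hhN ▸ meshWidth_pos hlam hN0
  refine abs_le_of_hasFourierBound hδ hc hh hK (hF N ((le_max_right _ _).trans hN) h hhN)
    (fun s t => mul_le_mul_of_nonneg_left ?_ hK.le) j k
  rw [envLow_eq, envHigh_eq, envCS_eq hc]
  have h2 : 0 ≤ h ^ (2 * N₀ + 1) := by positivity
  have h1 := mul_le_of_le_one_right h2 (exp_neg_mul_le_one hδ (phaseHigh_nonneg s t))
  have h3 := mul_le_of_le_one_right h2 (exp_neg_mul_le_one hδ (phaseCS_nonneg c h s t))
  have h4 := mul_le_of_le_one_right h2 (exp_neg_mul_le_one hδ (phaseCS_nonneg c⁻¹ (c * h) t s))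
  linarith

/-- The order of convergence: all coefficients of the leading-order terms are bounded uniformly on the
grid, and each power of `h` in front of them is at most the claimed one. -/
theorem exists_abs_totalError_le (hρ : |ρ| < 1) (hc : 0 < c) (hlam : 0 < lam)
    (hθ : max (1 / 4) ((1 + |ρ|) / 6) < θ) (N₀ : ℕ) :
    ∃ (K : ℝ) (N₁ : ℕ), ∀ N ≥ N₁, ∀ h : ℝ, h = meshWidth lam N → ∀ j k : ℤ,
      |totalError ρ a₁ a₂ c h (numGrid ρ a₁ a₂ c lam θ N₀ N) j k| ≤
        K * h ^ min (2 : ℤ) (2 * (N₀ : ℤ) - 2) := by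
  have hθ0 : 0 < θ := lt_trans (by norm_num) (lt_of_le_of_lt (le_max_left _ _) hθ)
  obtain ⟨CL, hCL, hL⟩ := exists_abs_Clow_le hρ a₁ a₂ c lam θ N₀
  obtain ⟨CH, hCH, hH⟩ := exists_abs_Chigh_le hρ hc hlam hθ0 N₀
  obtain ⟨CX, hCX, hX⟩ := exists_abs_CcsX_le a₂ hlam N₀
  obtain ⟨CY, hCY, hY⟩ := exists_abs_CcsY_le a₁ hc hlam N₀
  obtain ⟨K, N₂, hK, hR⟩ : ∃ (K : ℝ) (N₁ : ℕ), 0 < K ∧ ∀ N ≥ N₁, ∀ h : ℝ, h = meshWidth lam N →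
      ∀ j k : ℤ, ∃ e : ℝ, |e| ≤ |extraCS a₁ a₂ c lam N₀ N h j k| ∧
      |totalError ρ a₁ a₂ c h (numGrid ρ a₁ a₂ c lam θ N₀ N) j k
        - (approxMCS ρ a₁ a₂ c lam θ N₀ h j k + e)| ≤ K * (h ^ 3 + h ^ (2 * (N₀ : ℤ) - 1)) := by
    by_cases hθ2 : θ = 1 / 2
    · subst hθ2
      obtain ⟨K, N₁, hK, H⟩ := exists_abs_remainder_cs_le (a₁ := a₁) (a₂ := a₂) hρ hc hlam hθ N₀
      exact ⟨K, N₁, hK, fun N hN h hh j k => ⟨_, le_rfl, H N hN h hh j k⟩⟩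
    · obtain ⟨K, N₁, hK, H⟩ :=
        exists_abs_remainder_mcs_le (a₁ := a₁) (a₂ := a₂) hρ hc hlam hθ hθ2 N₀
      refine ⟨K, N₁, hK, fun N hN h hh j k => ⟨0, by rw [abs_zero]; positivity, ?_⟩⟩
      rw [add_zero]
      exact H N hN h hh j k
  obtain ⟨N₁, hN₁⟩ := exists_meshWidth_le hlam one_pos N₀
  refine ⟨2 * K + CL + CH + (CX + CY), max N₁ N₂, fun N hN h hhN j k => ?_⟩
  obtain ⟨hN0, hNN, hle⟩ := hN₁ N ((le_max_left _ _).trans hN)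
  have hh : 0 < h := hhN ▸ meshWidth_pos hlam hN0
  rw [← hhN] at hle
  obtain ⟨e, he, hr⟩ := hR N ((le_max_right _ _).trans hN) h hhN j k
  obtain ⟨m, hm⟩ : ∃ m, m = h ^ min (2 : ℤ) (2 * (N₀ : ℤ) - 2) := ⟨_, rfl⟩
  have le_m {n : ℤ} (hn : min (2 : ℤ) (2 * (N₀ : ℤ) - 2) ≤ n) : h ^ n ≤ m := by
    rw [hm]; exact zpow_le_zpow_right_of_le_one₀ hh hle hn
  have m3 : h ^ 3 ≤ m := by
    have := le_m (n := 3) ((min_le_left _ _).trans (by norm_num))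
    exact_mod_cast this
  have m2 : h ^ 2 ≤ m := by
    have := le_m (n := 2) (min_le_left _ _)
    exact_mod_cast this
  have mh : h ^ (2 * (N₀ : ℤ) - 2) ≤ m := le_m (min_le_right _ _)
  have mx : h ^ (2 * (N₀ : ℤ) - 1) ≤ m := le_m ((min_le_right _ _).trans (by omega))
  have m0 : 0 < m := hm ▸ zpow_pos hh _
  rw [← hm]
  have b1 : |approxMCS ρ a₁ a₂ c lam θ N₀ h j k| ≤ m * CL + m * CH := by
    rw [approxMCS]
    refine (abs_add_le _ _).trans (add_le_add ?_ ?_)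
    · rw [abs_mul, abs_of_pos (by positivity : 0 < h ^ 2)]
      exact mul_le_mul m2 (hL _ _) (abs_nonneg _) m0.le
    · rw [abs_mul, abs_of_pos (zpow_pos hh _)]
      exact mul_le_mul mh (hH _ _) (abs_nonneg _) m0.le
  have b2 : |extraCS a₁ a₂ c lam N₀ N h j k| ≤ m * (CX + CY) := by
    rw [extraCS, abs_mul, abs_mul, abs_of_pos (zpow_pos hh _), abs_zpow, abs_neg, abs_one, one_zpow,
      mul_one]
    exact mul_le_mul mx ((abs_add_le _ _).trans (add_le_add (hX _ _) (hY _ _))) (abs_nonneg _) m0.le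
  have b3 := mul_le_mul_of_nonneg_left (add_le_add m3 mx) hK.le
  have b4 := abs_sub_abs_le_abs_sub (totalError ρ a₁ a₂ c h (numGrid ρ a₁ a₂ c lam θ N₀ N) j k)
    (approxMCS ρ a₁ a₂ c lam θ N₀ h j k + e)
  have b5 := abs_add_le (approxMCS ρ a₁ a₂ c lam θ N₀ h j k) e
  linarith

end remainder

end

end RannacherMCS

open RannacherMCS
theorem mainTheorem1 (ρ a₁ a₂ c lam θ : ℝ) (hρ : |ρ| < 1) (hc : 0 < c) (hlam : 0 < lam)
    (hθ : max (1 / 4) ((1 + |ρ|) / 6) < θ) (N₀ : ℕ) :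
    IsModelSolution ρ a₁ a₂ (exactSolution ρ a₁ a₂) ∧
    ∃ U : ℕ → Grid,
      (∀ N : ℕ, 0 < N →
        IsNumericalSolution ρ a₁ a₂ θ (meshWidth lam N) (c * meshWidth lam N) (1 / N) N₀ N (U N) ∧
        ∀ W : Grid,
          IsNumericalSolution ρ a₁ a₂ θ (meshWidth lam N) (c * meshWidth lam N) (1 / N) N₀ N W →
            W = U N) ∧
      (θ ≠ 1 / 2 →
        (∃ δ : ℝ, 0 < δ ∧ ∀ w : ℕ, ∃ (K : ℝ) (N₁ : ℕ), ∀ N ≥ N₁, ∀ h : ℝ, h = meshWidth lam N →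
          HasFourierBound h (c * h)
            (totalError ρ a₁ a₂ c h (U N) - approxMCS ρ a₁ a₂ c lam θ N₀ h)
            (fun s t => K * (h ^ 3 * envLow δ c h s t + h ^ (2 * N₀ + 1) * envHigh δ s t
              + h ^ w))) ∧
        (∃ (K : ℝ) (N₁ : ℕ), ∀ N ≥ N₁, ∀ h : ℝ, h = meshWidth lam N → ∀ j k : ℤ,
          |totalError ρ a₁ a₂ c h (U N) j k - approxMCS ρ a₁ a₂ c lam θ N₀ h j k|
            ≤ K * (h ^ 3 + h ^ (2 * (N₀ : ℤ) - 1)))) ∧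
      (θ = 1 / 2 →
        (∃ δ : ℝ, 0 < δ ∧ ∀ w : ℕ, ∃ (K : ℝ) (N₁ : ℕ), ∀ N ≥ N₁, ∀ h : ℝ, h = meshWidth lam N →
          HasFourierBound h (c * h)
            (totalError ρ a₁ a₂ c h (U N)
              - (approxMCS ρ a₁ a₂ c lam θ N₀ h + extraCS a₁ a₂ c lam N₀ N h))
            (fun s t => K * (h ^ 3 * envLow δ c h s t + h ^ (2 * N₀ + 1) * envHigh δ s t
              + h ^ (2 * N₀ + 1) * envCS δ c h s t + h ^ w))) ∧
        (∃ (K : ℝ) (N₁ : ℕ), ∀ N ≥ N₁, ∀ h : ℝ, h = meshWidth lam N → ∀ j k : ℤ,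
          |totalError ρ a₁ a₂ c h (U N) j k
              - (approxMCS ρ a₁ a₂ c lam θ N₀ h j k + extraCS a₁ a₂ c lam N₀ N h j k)|
            ≤ K * (h ^ 3 + h ^ (2 * (N₀ : ℤ) - 1)))) ∧
      (∃ (K : ℝ) (N₁ : ℕ), ∀ N ≥ N₁, ∀ h : ℝ, h = meshWidth lam N → ∀ j k : ℤ,
        |totalError ρ a₁ a₂ c h (U N) j k| ≤ K * h ^ min (2 : ℤ) (2 * (N₀ : ℤ) - 2)) := by
  have hθ0 : 0 < θ := lt_trans (by norm_num) (lt_of_le_of_lt (le_max_left _ _) hθ)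
  refine ⟨isModelSolution_exactSolution hρ a₁ a₂, numGrid ρ a₁ a₂ c lam θ N₀, fun N hN => ?_,
    fun hθ2 => ⟨?_, ?_⟩, fun hθ2 => ⟨?_, ?_⟩, exists_abs_totalError_le hρ hc hlam hθ N₀⟩
  · have e : (1 / N : ℝ) = lam * meshWidth lam N := by
      rw [meshWidth]
      have : (N : ℝ) ≠ 0 := by exact_mod_cast hN.ne'
      field_simp
    rw [e]
    exact isNumericalSolution_gridOf hρ hc hlam hθ0.le (meshWidth_pos hlam hN) N₀ N
  · obtain ⟨δ, hδ, H⟩ := exists_hasFourierBound_mcs (a₁ := a₁) (a₂ := a₂) hρ hc hlam hθ hθ2 N₀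
    refine ⟨δ, hδ, fun w => ?_⟩
    obtain ⟨K, N₁, -, hF⟩ := H w
    exact ⟨K, N₁, hF⟩
  · obtain ⟨K, N₁, -, H⟩ :=
      exists_abs_remainder_mcs_le (a₁ := a₁) (a₂ := a₂) hρ hc hlam hθ hθ2 N₀
    exact ⟨K, N₁, H⟩
  · subst hθ2
    obtain ⟨δ, hδ, H⟩ := exists_hasFourierBound_cs (a₁ := a₁) (a₂ := a₂) hρ hc hlam hθ N₀
    refine ⟨δ, hδ, fun w => ?_⟩
    obtain ⟨K, N₁, -, hF⟩ := H w
    exact ⟨K, N₁, hF⟩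
  · subst hθ2
    obtain ⟨K, N₁, -, H⟩ := exists_abs_remainder_cs_le (a₁ := a₁) (a₂ := a₂) hρ hc hlam hθ N₀
    exact ⟨K, N₁, H⟩
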